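/- Let $n\ge 2$ and let $\overline M$ be a compact smooth manifold of dimension $n+1$ with boundary $\partial M$ and interior $M$. Let $g$ be a smooth Riemannian metric on $M$ that is conformally compact of order $C^1$: there is a smooth function $t:\overline M\to[0,\infty)$ with $t>0$ on $M$, $t=0$ and $dt\neq 0$ on $\partial M$, such that $t^2g$ extends to a Riemannian metric on $\overline M$ of class $C^1$ up to the boundary. Fix any such $t$, and assume that $\mathrm{Ric}_g\ge -n\,g$ on $M$. Let $N$ be a complete (smooth, finite-dimensional) Riemannian manifold without boundary and of nonpositive sectional curvature. Let $\Sigma$ be a connected component of $\partial M$, let $t_0>0$, and for $0<s\le t_0$ let $$E_s=\{p\in \mathcal E:\ 0<t(p)<s\},$$ where $\mathcal E$ is the connected component of $\{p\in\overline M: t(p)<t_0\}$ that contains $\Sigma$ (for small $t_0$, $E_{t_0}$ is the end of $M$ at $\Sigma$). Let $f:E_{t_0}\to N$ be a smooth harmonic map of finite total energy, $\int_{E_{t_0}}|\nabla f|^2\,dv_g<\infty$. Then $$\int_{E_s}|\nabla f|^2\,dv_g=O(s^n)\qquad\text{as } s\to 0^+,$$ that is, there are $C$ and $\delta>0$ with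 $\int_{E_s}|\nabla f|^2\,dv_g\le C s^n$ for all $0<s<\delta$. -/

import Mathlib

open Set Filter MeasureTheory
open scoped Manifold ContDiff Topology ENNReal Bundle

noncomputable section

namespace EnergyDecay

/-! ### Riemannian geometry in coordinates

`ℝ^d` is `EuclideanSpace ℝ (Fin d)`; a metric in coordinates is a matrix valued function `G`. -/

section Coordinates

variable {d : ℕ}

/-- The `i`-th partial derivative of a real function on `ℝ^d`. -/
def pd (i : Fin d) (u : EuclideanSpace ℝ (Fin d) → ℝ) (y : EuclideanSpace ℝ (Fin d)) : ℝ :=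
  fderiv ℝ u y (EuclideanSpace.single i 1)

/-- Christoffel symbols
`Γ^k_{ij} = ½ ∑_l G^{kl} (∂_i G_{jl} + ∂_j G_{il} - ∂_l G_{ij})`. -/
def christoffel (G : EuclideanSpace ℝ (Fin d) → Matrix (Fin d) (Fin d) ℝ) (k i j : Fin d)
    (y : EuclideanSpace ℝ (Fin d)) : ℝ :=
  (1 / 2 : ℝ) * ∑ l, (G y)⁻¹ k l *
    (pd i (fun z => G z j l) y + pd j (fun z => G z i l) y - pd l (fun z => G z i j) y)

/-- Components of the curvature tensor, with the convention
`R(∂_i, ∂_j) ∂_k = ∇_i ∇_j ∂_k - ∇_j ∇_i ∂_k = ∑_l (riemann G l k i j) ∂_l`, that is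
`∂_i Γ^l_{jk} - ∂_j Γ^l_{ik} + ∑_m (Γ^l_{im} Γ^m_{jk} - Γ^l_{jm} Γ^m_{ik})`. -/
def riemann (G : EuclideanSpace ℝ (Fin d) → Matrix (Fin d) (Fin d) ℝ) (l k i j : Fin d)
    (y : EuclideanSpace ℝ (Fin d)) : ℝ :=
  pd i (christoffel G l j k) y - pd j (christoffel G l i k) y +
    ∑ m, (christoffel G l i m y * christoffel G m j k y -
      christoffel G l j m y * christoffel G m i k y)

/-- The Ricci tensor `Ric(v, w) = trace (u ↦ R(u, v) w)`, in components
`Ric_{jk} = ∑_i R^i_{kij}`. -/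
def ricci (G : EuclideanSpace ℝ (Fin d) → Matrix (Fin d) (Fin d) ℝ) (j k : Fin d)
    (y : EuclideanSpace ℝ (Fin d)) : ℝ :=
  ∑ i, riemann G i k i j y

/-- `⟨R(u, v) v, u⟩`, which is the sectional curvature of the plane spanned by `u` and `v` times
`|u|² |v|² - ⟨u, v⟩²`. -/
def sectionalForm (G : EuclideanSpace ℝ (Fin d) → Matrix (Fin d) (Fin d) ℝ)
    (y u v : EuclideanSpace ℝ (Fin d)) : ℝ :=
  ∑ i, ∑ j, ∑ k, ∑ l, ∑ p, G y l p * riemann G l k i j y * u i * v j * v k * u p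

/-- The `γ`-th component of the tension field of a map `u` between open subsets of `ℝ^d` (metric
`G`) and `ℝ^m` (metric `H`):
`∑_{ij} G^{ij} (∂_i ∂_j u^γ - ∑_k Γ^k_{ij} ∂_k u^γ + ∑_{αβ} Γ^γ_{αβ}(u) ∂_i u^α ∂_j u^β)`. -/
def tension {m : ℕ} (G : EuclideanSpace ℝ (Fin d) → Matrix (Fin d) (Fin d) ℝ)
    (H : EuclideanSpace ℝ (Fin m) → Matrix (Fin m) (Fin m) ℝ)
    (u : EuclideanSpace ℝ (Fin d) → EuclideanSpace ℝ (Fin m)) (γ : Fin m)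
    (y : EuclideanSpace ℝ (Fin d)) : ℝ :=
  ∑ i, ∑ j, (G y)⁻¹ i j *
    (pd i (pd j (fun z => u z γ)) y - ∑ k, christoffel G k i j y * pd k (fun z => u z γ) y +
      ∑ α, ∑ β, christoffel H γ α β (u y) * pd i (fun z => u z α) y * pd j (fun z => u z β) y)

end Coordinates

/-! ### Manifolds

A field of bilinear forms on a manifold is given as `g x v w` for `v w : T_x M`. -/

section Manifold

variable {d : ℕ} {X : Type*} [TopologicalSpace X]
  (I : ModelWithCorners ℝ (EuclideanSpace ℝ (Fin d)) X)
  {M : Type*} [TopologicalSpace M] [ChartedSpace X M]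

/-- The coordinate vector field `∂_i` of the chart `φ`, at the point with coordinates `y`. -/
def coordVec (φ : OpenPartialHomeomorph M X) (i : Fin d) (y : EuclideanSpace ℝ (Fin d)) :
    TangentSpace I ((φ.extend I).symm y) :=
  mfderivWithin 𝓘(ℝ, EuclideanSpace ℝ (Fin d)) I (φ.extend I).symm (range I) y
    (EuclideanSpace.single i (1 : ℝ) : EuclideanSpace ℝ (Fin d))

/-- The components `g(∂_i, ∂_j)` of `g` in the chart `φ`, as a function of the coordinates. -/
def metricCoeff (g : ∀ x : M, TangentSpace I x → TangentSpace I x → ℝ)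
    (φ : OpenPartialHomeomorph M X) (y : EuclideanSpace ℝ (Fin d)) : Matrix (Fin d) (Fin d) ℝ :=
  Matrix.of fun i j => g ((φ.extend I).symm y) (coordVec I φ i y) (coordVec I φ j y)

/-- The coordinates, in the chart `φ`, of the interior points of the manifold. -/
def interiorCoords (φ : OpenPartialHomeomorph M X) : Set (EuclideanSpace ℝ (Fin d)) :=
  {y ∈ (φ.extend I).target | (φ.extend I).symm y ∈ I.interior M}

/-- `Ric ≥ c g` in the interior of `M`, in all smooth charts. -/
def RicciBoundedBelow (g : ∀ x : M, TangentSpace I x → TangentSpace I x → ℝ) (c : ℝ) : Prop :=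
  ∀ φ ∈ IsManifold.maximalAtlas I ∞ M, ∀ y ∈ interiorCoords I φ,
    ∀ v : EuclideanSpace ℝ (Fin d),
      c * ∑ i, ∑ j, metricCoeff I g φ y i j * v i * v j ≤
        ∑ i, ∑ j, ricci (metricCoeff I g φ) i j y * v i * v j

/-- All sectional curvatures of `g` are `≤ 0` in the interior of `M`, in all smooth charts. -/
def NonpositivelyCurved (g : ∀ x : M, TangentSpace I x → TangentSpace I x → ℝ) : Prop :=
  ∀ φ ∈ IsManifold.maximalAtlas I ∞ M, ∀ y ∈ interiorCoords I φ,
    ∀ u v : EuclideanSpace ℝ (Fin d), sectionalForm (metricCoeff I g φ) y u v ≤ 0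

/-- The Riemannian measure of the interior part of one chart domain:
the image under the inverse chart of `√(det G) dy`. -/
def chartVolume [MeasurableSpace M] (g : ∀ x : M, TangentSpace I x → TangentSpace I x → ℝ)
    (φ : OpenPartialHomeomorph M X) : Measure M :=
  ((volume.restrict (interiorCoords I φ)).withDensity
    fun y => ENNReal.ofReal (√(metricCoeff I g φ y).det)).map (φ.extend I).symm

/-- The Riemannian measure of the interior of `M`: the least measure that dominates the Riemannian
measure of each chart domain. (Those agree on overlaps, so on each chart domain it is the
Riemannian measure of that chart.) The boundary has measure zero. -/
def riemannianVolume [MeasurableSpace M]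
    (g : ∀ x : M, TangentSpace I x → TangentSpace I x → ℝ) : Measure M :=
  ⨆ φ ∈ IsManifold.maximalAtlas I ∞ M, chartVolume I g φ

/-- `g` restricts to a smooth Riemannian metric on the open set `U`. -/
structure IsSmoothMetricOn (g : ∀ x : M, TangentSpace I x →L[ℝ] TangentSpace I x →L[ℝ] ℝ)
    (U : Set M) [IsManifold I 1 M] : Prop where
  symm : ∀ x ∈ U, ∀ v w : TangentSpace I x, g x v w = g x w v
  pos : ∀ x ∈ U, ∀ v : TangentSpace I x, v ≠ 0 → 0 < g x v v
  smooth : ContMDiffOn I (I.prod 𝓘(ℝ, EuclideanSpace ℝ (Fin d) →L[ℝ]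
      EuclideanSpace ℝ (Fin d) →L[ℝ] ℝ)) ∞
    (fun x => Bundle.TotalSpace.mk' (EuclideanSpace ℝ (Fin d) →L[ℝ]
      EuclideanSpace ℝ (Fin d) →L[ℝ] ℝ) x (g x)) U

/-- A smooth boundary defining function: positive in the interior and vanishing to first order on
the boundary. -/
structure IsDefiningFunction (t : M → ℝ) : Prop where
  smooth : ContMDiff I 𝓘(ℝ, ℝ) ∞ t
  pos : ∀ x ∈ I.interior M, 0 < t x
  zero : ∀ x ∈ I.boundary M, t x = 0
  mfderiv_ne_zero : ∀ x ∈ I.boundary M, mfderiv I 𝓘(ℝ, ℝ) t x ≠ 0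

/-- `t² g` extends from the interior of `M` to a Riemannian metric on `M` which is of class `C^k`
up to the boundary. -/
def HasConformalExtension (k : ℕ∞ω) [IsManifold I 1 M]
    (g : ∀ x : M, TangentSpace I x →L[ℝ] TangentSpace I x →L[ℝ] ℝ) (t : M → ℝ) : Prop :=
  ∃ gbar : Bundle.ContMDiffRiemannianMetric I k (EuclideanSpace ℝ (Fin d))
      (fun x : M => TangentSpace I x),
    ∀ x ∈ I.interior M, ∀ v w : TangentSpace I x, gbar.inner x v w = t x ^ 2 * g x v w

/-- The neighbourhood `{0 < t < s}` of infinity in the end which belongs to the boundary component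
of `x₀`; here the end is cut off at `t = t₀`, so that it is the connected component of
`{0 ≤ t < t₀}` at `x₀`, with the boundary removed. -/
def endRegion (t : M → ℝ) (t₀ : ℝ) (x₀ : M) (s : ℝ) : Set M :=
  {p ∈ connectedComponentIn {q | t q < t₀} x₀ | 0 < t p ∧ t p < s}

end Manifold

/-! ### Harmonic maps -/

section Maps

variable {d m : ℕ} {X Y : Type*} [TopologicalSpace X] [TopologicalSpace Y]
  (I : ModelWithCorners ℝ (EuclideanSpace ℝ (Fin d)) X)
  (J : ModelWithCorners ℝ (EuclideanSpace ℝ (Fin m)) Y)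
  {M : Type*} [TopologicalSpace M] [ChartedSpace X M]
  {N : Type*} [TopologicalSpace N] [ChartedSpace Y N]

/-- `|∇f|²` at `p`, the trace of `f^* h` with respect to `g`: `∑_{ij} g^{ij} h(df(e_i), df(e_j))`
for a basis `e_i` of the tangent space at `p`, `g^{ij}` being the inverse matrix of
`g(e_i, e_j)`. -/
def energyDensity (g : ∀ x : M, TangentSpace I x → TangentSpace I x → ℝ)
    (h : ∀ x : N, TangentSpace J x → TangentSpace J x → ℝ) (f : M → N) (p : M) : ℝ :=
  let e : Fin d → TangentSpace I p :=
    fun i => (EuclideanSpace.single i (1 : ℝ) : EuclideanSpace ℝ (Fin d))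
  let A : Matrix (Fin d) (Fin d) ℝ := Matrix.of fun i j => g p (e i) (e j)
  ∑ i, ∑ j, A⁻¹ i j * h (f p) (mfderiv I J f p (e i)) (mfderiv I J f p (e j))

/-- The energy `∫_U |∇f|²` of `f` on `U`. -/
def energy [MeasurableSpace M] (g : ∀ x : M, TangentSpace I x → TangentSpace I x → ℝ)
    (h : ∀ x : N, TangentSpace J x → TangentSpace J x → ℝ) (f : M → N) (U : Set M) : ℝ≥0∞ :=
  ∫⁻ p in U, ENNReal.ofReal (energyDensity I J g h f p) ∂(riemannianVolume I g)

/-- `f` is a smooth harmonic map on the open set `U`: its tension field vanishes, in all smooth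
charts. -/
structure IsHarmonicOn (g : ∀ x : M, TangentSpace I x → TangentSpace I x → ℝ)
    (h : ∀ x : N, TangentSpace J x → TangentSpace J x → ℝ) (f : M → N) (U : Set M) : Prop where
  smooth : ContMDiffOn I J ∞ f U
  tension_eq_zero : ∀ φ ∈ IsManifold.maximalAtlas I ∞ M, ∀ ψ ∈ IsManifold.maximalAtlas J ∞ N,
    ∀ y ∈ (φ.extend I).target, (φ.extend I).symm y ∈ U → f ((φ.extend I).symm y) ∈ ψ.source →
      ∀ γ : Fin m, tension (metricCoeff I g φ) (metricCoeff J h ψ)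
        (fun z => ψ.extend J (f ((φ.extend I).symm z))) γ y = 0

end Maps

end EnergyDecay

end

/-!
The estimate is local: by compactness of `∂M` and a positive lower bound of `t` away from `∂M`, it
is enough to bound the energy of `{t < s}` near each boundary point (`exists_nhds_energy_le`). In a
boundary chart the height `y 0` is comparable to `t`, and the metric is `(y 0)⁻²` times a metric
which is nondegenerate and `C¹` up to the boundary; the structure `AHMetric` records the bounds which
follow from this (`exists_ahMetric_chart`). In particular the Laplacian, in divergence form, is
`(y 0)^(1 - n)` times an operator which is uniformly elliptic with bounded first derivatives, and
`√(det g)` is comparable to `(y 0)^(-n - 1)`. Let `e` be the energy density of `f`.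

*Bochner.* As `Ric ≥ -n` and the target is nonpositively curved, `Δ e ≥ -2 n e`
(`laplacian_energyDensity_ge`). This is computed at the centre of charts which are normal to first
order on both sides (`exists_normal_chart`, `bochner_of_normal`).

*Small gradient.* On a ball whose radius is comparable to its height, rescaled to unit size, `Δ` is
uniformly elliptic, so the mean value inequality (`exists_mean_value`) bounds `e` at the centre by the
energy of the ball, up to a constant (`AHMetric.exists_pointwise_le`). As the total energy is finite,
`e → 0` at the boundary (`AHMetric.hasSmallGradient`).

*Boundary limit.* `e → 0` alone does not control `f`, since the boundary is at infinite distance. But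
moving such a ball towards the boundary and averaging the lengths of the paths of its points, the
finite energy and `2 ≤ n` make the average small (`lintegral_path_le`). Joining two points by going
down, across and up again shows that `f` is Cauchy at the boundary; the target is complete, so
`f → P` for a single point `P` near the given boundary point (`HasSmallGradient.exists_limit`).

*Decay.* In a chart of the target at `P` let `u` be the coordinate expression of `f`. The harmonic
map equation gives `|Δ u| ≤ C |∇u|²`, while `Δ |u - P|² ≥ |∇u|²` near `P`. Hence
`±(u^γ - P^γ) + κ |u - P|²` is a subsolution for large `κ`. It tends to zero at the boundary, and
comparison with a barrier of size `(y 0)^n` (`exists_barrier`, `exists_boundary_decay`) gives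
`|u - P| ≤ C (y 0)^n`. Now `Δ |u - P|²` bounds `e`, so the Caccioppoli type inequality
`exists_integral_divOp_le`, applied to `|u - P|² = O((y 0)^(2 n))`, and the mean value inequality give
`e ≤ C (y 0)^(2 n)`. So `e √(det g) ≤ C (y 0)^(n - 1)` (`AHMetric.exists_energy_decay`), whose
integral over `{y 0 < s}` is `O(s^n)`.
-/

noncomputable section

namespace EnergyDecay

open ENNReal (ofReal ofReal_mul ofReal_add ofReal_le_ofReal toReal_pos ofReal_pow)
open EuclideanSpace (single proj dist_eq basisFun)
open Finset (mul_sum sum_comm sum_add_distrib sum_mul sum_sub_distrib sum_nonneg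
  single_le_sum sum_le_sum sum_eq_zero sum_neg_distrib sum_ite_eq' sum_const_zero)
open IsManifold (maximalAtlas chart_mem_maximalAtlas)
open Matrix (mul_nonsing_inv mulVec_mulVec mulVec one_mulVec transpose_nonsing_inv of_apply
  transpose_apply det_mul)
open Metric (closedBall mem_closedBall_self ball closedBall_subset_closedBall)
open PiLp (norm_single)
open Real (norm_eq_abs sqrt_nonneg norm_of_nonneg)
open WithLp (toLp ofLp)

variable {n d m : ℕ}

/-- The model space `ℝ^d`. -/
local notation "𝔼" d:max => EuclideanSpace ℝ (Fin d)

/-- Square matrices of size `d`. -/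
local notation "𝕄" d:max => Matrix (Fin d) (Fin d) ℝ

/-- The model space `ℝ^(n + 1)` of the manifold with boundary. -/
local notation "𝕍" => EuclideanSpace ℝ (Fin (n + 1))

/-- The half space of dimension `n + 1`, as a model with corners. -/
local notation "𝓗" => 𝓡∂ (n + 1)

/-- The maximal smooth atlas. -/
local notation "𝒜" I:max M:max => maximalAtlas I ∞ M

/-- The inverse of the extended chart `φ.extend I`. -/
local notation:max φ:max "⁻[" I "]" => PartialEquiv.symm (OpenPartialHomeomorph.extend φ I)

/-- Fields of bilinear forms on the tangent spaces of a manifold. -/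
abbrev Forms {X : Type*} [TopologicalSpace X] (I : ModelWithCorners ℝ (𝔼 d) X) (M : Type*)
    [TopologicalSpace M] [ChartedSpace X M] :=
  ∀ x : M, TangentSpace I x →L[ℝ] TangentSpace I x →L[ℝ] ℝ

/-- A field of bundled bilinear forms, as a field of functions of two tangent vectors. -/
local notation:max "↟" g:max => fun x v w => g x v w

/-! ### Calculus of partial derivatives -/

lemma sum_ext {ι A : Type*} [Fintype ι] [AddCommMonoid A] {f g : ι → A} (h : ∀ i, f i = g i) :
    ∑ i, f i = ∑ i, g i :=
  Fintype.sum_congr _ _ h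

lemma pd_add {f g : 𝔼 d → ℝ} {y : 𝔼 d} (i : Fin d) (hf : DifferentiableAt ℝ f y)
    (hg : DifferentiableAt ℝ g y) : pd i (fun z => f z + g z) y = pd i f y + pd i g y := by
  simp [pd, fderiv_fun_add hf hg]

lemma pd_sub {f g : 𝔼 d → ℝ} {y : 𝔼 d} (i : Fin d) (hf : DifferentiableAt ℝ f y)
    (hg : DifferentiableAt ℝ g y) : pd i (fun z => f z - g z) y = pd i f y - pd i g y := by
  simp [pd, fderiv_fun_sub hf hg]

lemma pd_mul {f g : 𝔼 d → ℝ} {y : 𝔼 d} (i : Fin d)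
    (hf : DifferentiableAt ℝ f y) (hg : DifferentiableAt ℝ g y) :
    pd i (fun z => f z * g z) y = pd i f y * g y + f y * pd i g y := by
  simp [pd, fderiv_fun_mul hf hg]; ring

lemma pd_const_mul {f : 𝔼 d → ℝ} {y : 𝔼 d} (i : Fin d) (c : ℝ) (hf : DifferentiableAt ℝ f y) :
    pd i (fun z => c * f z) y = c * pd i f y := by
  simp [pd, fderiv_const_mul hf]

lemma pd_const {y : 𝔼 d} (i : Fin d) (c : ℝ) : pd i (fun _ => c) y = 0 := by simp [pd]

lemma pd_sum {ι : Type*} (s : Finset ι) {f : ι → 𝔼 d → ℝ}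
    {y : 𝔼 d} (i : Fin d) (hf : ∀ a ∈ s, DifferentiableAt ℝ (f a) y) :
    pd i (fun z => ∑ a ∈ s, f a z) y = ∑ a ∈ s, pd i (f a) y := by
  simp [pd, fderiv_fun_sum hf]

lemma pd_congr {f g : 𝔼 d → ℝ} {y : 𝔼 d} (i : Fin d) (h : f =ᶠ[𝓝 y] g) : pd i f y = pd i g y := by
  simp [pd, h.fderiv_eq]

lemma pd_eventuallyEq {f g : 𝔼 d → ℝ} {y : 𝔼 d}
    (i : Fin d) (h : f =ᶠ[𝓝 y] g) : pd i f =ᶠ[𝓝 y] pd i g :=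
  h.eventuallyEq_nhds.mono fun _ hz => pd_congr i hz

lemma pd_comp_real {φ : ℝ → ℝ} {u : 𝔼 d → ℝ} {y : 𝔼 d} (i : Fin d) {φ' : ℝ}
    (hφ : HasDerivAt φ φ' (u y)) (hu : DifferentiableAt ℝ u y) :
    pd i (fun z => φ (u z)) y = φ' * pd i u y := by
  have := (hφ.comp_hasFDerivAt y hu.hasFDerivAt).fderiv
  simp only [pd]
  rw [show (fun z => φ (u z)) = φ ∘ u from rfl, this]
  simp

lemma euclidean_eq_sum (v : 𝔼 d) : v = ∑ i, v i • single i (1 : ℝ) := by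
  ext j
  simp [Pi.single_apply]

lemma fderiv_eq_sum_pd (f : 𝔼 d → ℝ) (y v : 𝔼 d) : fderiv ℝ f y v = ∑ i, v i * pd i f y := by
  conv_lhs => rw [euclidean_eq_sum v]
  simp [pd]

lemma pd_coord (i k : Fin d) (y : 𝔼 d) : pd i (fun z => z k) y = if k = i then 1 else 0 := by
  have : (fun z : 𝔼 d => z k) = (proj k : 𝔼 d →L[ℝ] ℝ) := rfl
  rw [pd, this, ContinuousLinearMap.fderiv]
  simp [Pi.single_apply]

lemma fderiv_coord {u : 𝔼 d → 𝔼 m} {y : 𝔼 d} (hu : DifferentiableAt ℝ u y) (i : Fin d) (α : Fin m) :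
    fderiv ℝ u y (single i 1) α = pd i (u · α) y := by
  have h := ((proj α : 𝔼 m →L[ℝ] ℝ).hasFDerivAt.comp y
    hu.hasFDerivAt).fderiv
  have h2 : (u · α) = (proj α : 𝔼 m →L[ℝ] ℝ) ∘ u := rfl
  rw [pd, h2, h]
  simp

lemma pd_comp {F : 𝔼 m → ℝ} {u : 𝔼 d → 𝔼 m} {y : 𝔼 d} (i : Fin d) (hF : DifferentiableAt ℝ F (u y))
    (hu : DifferentiableAt ℝ u y) :
    pd i (fun z => F (u z)) y = ∑ α, pd α F (u y) * pd i (u · α) y := by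
  have h := (hF.hasFDerivAt.comp y hu.hasFDerivAt).fderiv
  rw [pd, show (fun z => F (u z)) = F ∘ u from rfl, h]
  simp only [ContinuousLinearMap.comp_apply]
  rw [fderiv_eq_sum_pd]
  refine sum_ext fun α => ?_
  rw [fderiv_coord hu, mul_comm]

lemma contDiffAt_pd {k : ℕ∞ω} {l : ℕ∞ω} {f : 𝔼 d → ℝ} {y : 𝔼 d} (i : Fin d)
    (hf : ContDiffAt ℝ l f y) (hk : k + 1 ≤ l) : ContDiffAt ℝ k (pd i f) y :=
  (hf.fderiv_right hk).clm_apply contDiffAt_const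

lemma differentiableAt_pd {f : 𝔼 d → ℝ} {y : 𝔼 d}
    (i : Fin d) (hf : ContDiffAt ℝ 2 f y) : DifferentiableAt ℝ (pd i f) y :=
  ContDiffAt.differentiableAt (n := 1) (contDiffAt_pd i hf (by norm_num)) (by simp)

lemma pd_comm {f : 𝔼 d → ℝ} {y : 𝔼 d} (i j : Fin d)
    (hf : ContDiffAt ℝ 2 f y) : pd i (pd j f) y = pd j (pd i f) y := by
  have hs : IsSymmSndFDerivAt ℝ f y := hf.isSymmSndFDerivAt (by simp)
  have hd : DifferentiableAt ℝ (fderiv ℝ f) y :=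
    (hf.fderiv_right (m := 1) (by norm_num)).differentiableAt (by simp)
  have key : ∀ i j : Fin d, pd i (pd j f) y =
      fderiv ℝ (fderiv ℝ f) y (single i 1) (single j 1) := by
    intro i j
    have := (hd.hasFDerivAt.clm_apply
      (hasFDerivAt_const (single j (1 : ℝ)) y)).fderiv
    rw [pd, show pd j f = fun z => fderiv ℝ f z (single j 1) from rfl, this]
    simp
  rw [key, key]
  exact hs.eq _ _

/-! ### Smooth dependence of determinants and inverse matrices -/

section MatrixCalculus

variable {E : Type*} [NormedAddCommGroup E] [NormedSpace ℝ E]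

lemma contDiffWithinAt_det {k : ℕ∞ω} {G : E → 𝕄 d} {s : Set E} {y : E}
    (hG : ∀ i j, ContDiffWithinAt ℝ k (G · i j) s y) :
    ContDiffWithinAt ℝ k (fun z => (G z).det) s y := by
  simp only [Matrix.det_apply]
  refine ContDiffWithinAt.sum fun σ _ => ContDiffWithinAt.const_smul _ ?_
  exact contDiffWithinAt_prod fun i _ => hG _ _

lemma contDiffWithinAt_inv_apply {k : ℕ∞ω} {G : E → 𝕄 d} {s : Set E} {y : E}
    (hG : ∀ i j, ContDiffWithinAt ℝ k (G · i j) s y) (h0 : (G y).det ≠ 0)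
    (i j : Fin d) : ContDiffWithinAt ℝ k (fun z => (G z)⁻¹ i j) s y := by
  simp only [Matrix.inv_def, Matrix.smul_apply, Ring.inverse_eq_inv', smul_eq_mul,
    Matrix.adjugate_apply]
  refine ((contDiffWithinAt_det hG).inv h0).mul (contDiffWithinAt_det fun a b => ?_)
  by_cases h : a = j
  · subst h
    simp only [Matrix.updateRow_self]
    exact contDiffWithinAt_const
  · simp only [Matrix.updateRow_ne h]
    exact hG a b

lemma contDiffAt_det {k : ℕ∞ω} {G : E → 𝕄 d} {y : E} (hG : ∀ i j, ContDiffAt ℝ k (G · i j) y) :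
    ContDiffAt ℝ k (fun z => (G z).det) y :=
  contDiffWithinAt_univ.1 (contDiffWithinAt_det fun i j => (hG i j).contDiffWithinAt)

lemma contDiffAt_inv_apply {k : ℕ∞ω} {G : E → 𝕄 d} {y : E} (hG : ∀ i j, ContDiffAt ℝ k (G · i j) y)
    (h0 : (G y).det ≠ 0) (i j : Fin d) : ContDiffAt ℝ k (fun z => (G z)⁻¹ i j) y :=
  contDiffWithinAt_univ.1
    (contDiffWithinAt_inv_apply (fun i j => (hG i j).contDiffWithinAt) h0 i j)

lemma contDiffAt_christoffel {k l : ℕ∞ω} {G : 𝔼 d → 𝕄 d} {y : 𝔼 d}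
    (hG : ∀ i j, ContDiffAt ℝ l (G · i j) y) (hk : k + 1 ≤ l) (h0 : (G y).det ≠ 0) (c i j : Fin d) :
    ContDiffAt ℝ k (christoffel G c i j) y := by
  have hkl : k ≤ l := le_trans le_self_add hk
  unfold christoffel
  refine contDiffAt_const.mul (ContDiffAt.sum fun e _ => ?_)
  refine (contDiffAt_inv_apply (fun i j => (hG i j).of_le hkl) h0 c e).mul ?_
  exact ((contDiffAt_pd i (hG _ _) hk).add (contDiffAt_pd j (hG _ _) hk)).sub
    (contDiffAt_pd e (hG _ _) hk)

lemma det_ne_zero_eventually {G : E → 𝕄 d} {y : E} (hG : ∀ i j, ContDiffAt ℝ 0 (G · i j) y)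
    (h0 : (G y).det ≠ 0) : ∀ᶠ z in 𝓝 y, (G z).det ≠ 0 :=
  (contDiffAt_det hG).continuousAt.eventually_ne h0

end MatrixCalculus

/-! ### The Bochner inequality in normal coordinates -/

lemma natCast_le_infty (n : ℕ) : (n : ℕ∞ω) ≤ (⊤ : ℕ∞) := WithTop.coe_le_coe.2 le_top

lemma pd_pd_mul {f g : 𝔼 d → ℝ} {y : 𝔼 d} (k l : Fin d) (hf : ContDiffAt ℝ 2 f y)
    (hg : ContDiffAt ℝ 2 g y) :
    pd k (pd l (fun z => f z * g z)) y = pd k (pd l f) y * g y + pd l f y * pd k g y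
    + (pd k f y * pd l g y + f y * pd k (pd l g) y) := by
  have hev : pd l (fun z => f z * g z) =ᶠ[𝓝 y] fun z => pd l f z * g z + f z * pd l g z := by
    filter_upwards [hf.eventually (by simp), hg.eventually (by simp)] with z hz hz'
    exact pd_mul l (hz.differentiableAt (by simp)) (hz'.differentiableAt (by simp))
  have hf1 : DifferentiableAt ℝ f y := hf.differentiableAt (by simp)
  have hg1 : DifferentiableAt ℝ g y := hg.differentiableAt (by simp)
  have hf2 : DifferentiableAt ℝ (pd l f) y := differentiableAt_pd l hf
  have hg2 : DifferentiableAt ℝ (pd l g) y := differentiableAt_pd l hg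
  rw [pd_congr k hev, pd_add k (hf2.fun_mul hg1) (hf1.fun_mul hg2), pd_mul k hf2 hg1, pd_mul k hf1 hg2]

lemma pd_pd_sum {ι : Type*} (s : Finset ι) {f : ι → 𝔼 d → ℝ}
    {y : 𝔼 d} (k l : Fin d) (hf : ∀ a ∈ s, ContDiffAt ℝ 2 (f a) y) :
    pd k (pd l (fun z => ∑ a ∈ s, f a z)) y = ∑ a ∈ s, pd k (pd l (f a)) y := by
  have hev : pd l (fun z => ∑ a ∈ s, f a z) =ᶠ[𝓝 y] fun z => ∑ a ∈ s, pd l (f a) z := by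
    have : ∀ᶠ z in 𝓝 y, ∀ a ∈ s, ContDiffAt ℝ 2 (f a) z :=
      (Finset.eventually_all s).2 fun a ha => (hf a ha).eventually (by simp)
    filter_upwards [this] with z hz
    exact pd_sum s l fun a ha => (hz a ha).differentiableAt (by simp)
  rw [pd_congr k hev, pd_sum s k fun a ha => differentiableAt_pd l (hf a ha)]

/-- At a point where `G = 1` and `∂G = 0`, also `∂G⁻¹ = 0` and `∂∂G⁻¹ = -∂∂G`. -/
lemma pd_inv_of_normal {G : 𝔼 d → 𝕄 d} {y : 𝔼 d} (hG : ∀ i j, ContDiffAt ℝ 2 (G · i j) y)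
    (h1 : G y = 1) (h' : ∀ i j k, pd k (G · i j) y = 0) (i j k l : Fin d) :
    pd k (fun z => (G z)⁻¹ i j) y = 0 ∧
    pd k (pd l (fun z => (G z)⁻¹ i j)) y = -pd k (pd l (G · i j)) y := by
  have h0 : (G y).det ≠ 0 := by simp [h1]
  have hW : ∀ a b, ContDiffAt ℝ 2 (fun z => (G z)⁻¹ a b) y := fun a b =>
    contDiffAt_inv_apply hG h0 a b
  have hW1 : ∀ a b, DifferentiableAt ℝ (fun z => (G z)⁻¹ a b) y := fun a b =>
    (hW a b).differentiableAt (by simp)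
  have hG1 : ∀ a b, DifferentiableAt ℝ (G · a b) y := fun a b => (hG a b).differentiableAt (by simp)
  have hev : ∀ b, (fun z => ∑ a, (G z)⁻¹ i a * G z a b) =ᶠ[𝓝 y]
      fun _ => (1 : 𝕄 d) i b := by
    intro b
    filter_upwards [det_ne_zero_eventually (fun i j => (hG i j).of_le (by simp)) h0] with z hz
    rw [← Matrix.mul_apply, Matrix.nonsing_inv_mul _ (isUnit_iff_ne_zero.2 hz)]
  have first : ∀ k b, pd k (fun z => (G z)⁻¹ i b) y = 0 := by
    intro k b
    have h2 := pd_congr k (hev b)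
    rw [pd_const, pd_sum _ _ (fun a _ => (hW1 i a).fun_mul (hG1 a b))] at h2
    simp only [pd_mul _ (hW1 _ _) (hG1 _ _), h', h1, Matrix.one_apply, mul_ite, mul_one,
      mul_zero, add_zero, sum_ite_eq', Finset.mem_univ, if_true] at h2
    exact h2
  refine ⟨first k j, ?_⟩
  have h2 := pd_congr k (pd_eventuallyEq l (hev j))
  rw [pd_pd_sum _ _ _ (fun a _ => (hW i a).mul (hG a j))] at h2
  have hz : pd k (pd l fun _ => (1 : 𝕄 d) i j) y = 0 := by
    rw [show pd l (fun _ : 𝔼 d => (1 : 𝕄 d) i j)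
      = fun _ => 0 from funext fun z => pd_const l _, pd_const]
  rw [hz] at h2
  have hterm : ∀ a, pd k (pd l (fun z => (G z)⁻¹ i a * G z a j)) y =
      pd k (pd l (fun z => (G z)⁻¹ i a)) y * (1 : 𝕄 d) a j
        + (1 : 𝕄 d) i a * pd k (pd l (G · a j)) y := by
    intro a
    rw [pd_pd_mul k l (hW i a) (hG a j), h', h', first, first, h1]
    simp
  simp only [hterm, sum_add_distrib, Matrix.one_apply, mul_ite, mul_one, mul_zero,
    ite_mul, one_mul, zero_mul, Finset.sum_ite_eq, sum_ite_eq', Finset.mem_univ,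
    if_true] at h2
  linarith

lemma christoffel_of_normal {G : 𝔼 d → 𝕄 d} {y : 𝔼 d} (hG : ∀ i j, ContDiffAt ℝ 2 (G · i j) y)
    (h1 : G y = 1) (h' : ∀ i j k, pd k (G · i j) y = 0) (k i j a : Fin d) :
    christoffel G k i j y = 0 ∧ pd a (christoffel G k i j) y =
    (1 / 2 : ℝ) * (pd a (pd i (G · j k)) y + pd a (pd j (G · i k)) y
    - pd a (pd k (G · i j)) y) := by
  have h0 : (G y).det ≠ 0 := by simp [h1]
  refine ⟨by simp [christoffel, h'], ?_⟩
  have hW1 : ∀ a b, DifferentiableAt ℝ (fun z => (G z)⁻¹ a b) y := fun a b =>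
    (contDiffAt_inv_apply hG h0 a b).differentiableAt (by simp)
  have hp : ∀ a b c, DifferentiableAt ℝ (pd c (G · a b)) y := fun a b c =>
    differentiableAt_pd c (hG a b)
  have hb : ∀ l, DifferentiableAt ℝ (fun z => pd i (G · j l) z
      + pd j (G · i l) z - pd l (G · i j) z) y := fun l =>
    ((hp _ _ _).fun_add (hp _ _ _)).fun_sub (hp _ _ _)
  unfold christoffel
  rw [pd_const_mul _ _ (DifferentiableAt.fun_sum fun l _ => (hW1 k l).fun_mul (hb l)),
    pd_sum _ _ (fun l _ => (hW1 k l).fun_mul (hb l))]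
  have hterm : ∀ l, pd a (fun z => (G z)⁻¹ k l * (pd i (G · j l) z
      + pd j (G · i l) z - pd l (G · i j) z)) y
      = (1 : 𝕄 d) k l * (pd a (pd i (G · j l)) y
        + pd a (pd j (G · i l)) y - pd a (pd l (G · i j)) y) := by
    intro l
    rw [pd_mul _ (hW1 k l) (hb l), pd_sub _ ((hp _ _ _).fun_add (hp _ _ _)) (hp _ _ _),
      pd_add _ (hp _ _ _) (hp _ _ _)]
    simp [h1, h']
  simp only [hterm, Matrix.one_apply, ite_mul, one_mul, zero_mul, Finset.sum_ite_eq,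
    Finset.mem_univ, if_true]

lemma riemann_of_normal {G : 𝔼 d → 𝕄 d} {y : 𝔼 d} (hG : ∀ i j, ContDiffAt ℝ 2 (G · i j) y)
    (h1 : G y = 1) (h' : ∀ i j k, pd k (G · i j) y = 0) (l k i j : Fin d) :
    riemann G l k i j y = (1 / 2 : ℝ) * (pd i (pd k (G · j l)) y - pd i (pd l (G · j k)) y
    - pd j (pd k (G · i l)) y + pd j (pd l (G · i k)) y) := by
  have h := fun k i j a => christoffel_of_normal hG h1 h' k i j a
  rw [riemann, (h l j k i).2, (h l i k j).2, pd_comm j i (hG k l)]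
  simp only [(h _ _ _ i).1, mul_zero, sub_zero, sum_const_zero, add_zero]
  ring

/-- The energy density `∑ G^{ij} H_{αβ}(u) ∂_i u^α ∂_j u^β` of a map between coordinate domains. -/
def coordEnergy (G : 𝔼 d → 𝕄 d) (H : 𝔼 m → 𝕄 m) (u : 𝔼 d → 𝔼 m) (z : 𝔼 d) : ℝ :=
  ∑ i, ∑ j, (G z)⁻¹ i j * ∑ α, ∑ β, H (u z) α β * (pd i (u · α) z * pd j (u · β) z)

lemma sum_one_mul (f : Fin d → Fin d → ℝ) : ∑ i, ∑ j, (1 : 𝕄 d) i j * f i j = ∑ i, f i i := by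
  simp [Matrix.one_apply]

lemma contDiffAt_coord {k : ℕ∞ω} {u : 𝔼 d → 𝔼 m} {y : 𝔼 d} (hu : ContDiffAt ℝ k u y) (α : Fin m) :
    ContDiffAt ℝ k (u · α) y :=
  (proj α : 𝔼 m →L[ℝ] ℝ).contDiff.contDiffAt.comp y hu

lemma pd_pd_comp_of_pd_eq_zero {F : 𝔼 m → ℝ} {u : 𝔼 d → 𝔼 m} {y : 𝔼 d} (k : Fin d)
    (hF : ContDiffAt ℝ 2 F (u y)) (hu : ContDiffAt ℝ 2 u y) (h0 : ∀ α, pd α F (u y) = 0) :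
    pd k (pd k (fun z => F (u z))) y =
    ∑ α, ∑ β, pd β (pd α F) (u y) * (pd k (u · β) y * pd k (u · α) y) := by
  have hev : pd k (fun z => F (u z)) =ᶠ[𝓝 y]
      fun z => ∑ α, pd α F (u z) * pd k (u · α) z := by
    filter_upwards [hu.eventually (by simp),
      hu.continuousAt.eventually (hF.eventually (by simp))] with z hz hz'
    exact pd_comp k (hz'.differentiableAt (by simp)) (hz.differentiableAt (by simp))
  have hu1 : DifferentiableAt ℝ u y := hu.differentiableAt (by simp)
  have hF1 : ∀ α, DifferentiableAt ℝ (pd α F) (u y) := fun α => differentiableAt_pd α hF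
  have hF2 : ∀ α, DifferentiableAt ℝ (fun z => pd α F (u z)) y := fun α => (hF1 α).comp y hu1
  have hu2 : ∀ α, DifferentiableAt ℝ (pd k (u · α)) y := fun α =>
    differentiableAt_pd k (contDiffAt_coord hu α)
  rw [pd_congr k hev, pd_sum _ _ fun α _ => (hF2 α).fun_mul (hu2 α)]
  refine sum_ext fun α => ?_
  rw [pd_mul k (hF2 α) (hu2 α), h0, zero_mul, add_zero, pd_comp k (hF1 α) hu1, sum_mul]
  exact sum_ext fun β => by ring

/-- The Laplacian of the energy density in normal coordinates, before the use of the equation. -/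
lemma laplacian_coordEnergy_of_normal {G : 𝔼 d → 𝕄 d} {H : 𝔼 m → 𝕄 m} {u : 𝔼 d → 𝔼 m} {y : 𝔼 d}
    (hG : ∀ i j, ContDiffAt ℝ ∞ (G · i j) y) (hH : ∀ i j, ContDiffAt ℝ ∞ (H · i j) (u y))
    (hu : ContDiffAt ℝ ∞ u y) (hG1 : G y = 1) (hG' : ∀ i j k, pd k (G · i j) y = 0)
    (hH1 : H (u y) = 1) (hH' : ∀ i j k, pd k (H · i j) (u y) = 0) (k : Fin d) :
    pd k (pd k (coordEnergy G H u)) y = -(∑ i, ∑ j, ∑ α, pd k (pd k (G · i j)) y *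
    (pd i (u · α) y * pd j (u · α) y)) + ∑ i, ((∑ α, ∑ β, (∑ γ, ∑ δ, pd δ (pd γ (H · α β)) (u y) *
    (pd k (u · δ) y * pd k (u · γ) y)) * (pd i (u · α) y * pd i (u · β) y))
    + 2 * ∑ α, (pd k (pd k (pd i (u · α))) y * pd i (u · α) y + pd k (pd i (u · α)) y ^ 2)) := by
  have e2 : (2 : ℕ∞ω) ≤ (⊤ : ℕ∞) := natCast_le_infty 2
  have hW : ∀ i j, ContDiffAt ℝ 2 (fun z => (G z)⁻¹ i j) y := fun i j =>
    contDiffAt_inv_apply (fun i j => (hG i j).of_le e2) (by simp [hG1]) i j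
  have hp : ∀ i α, ContDiffAt ℝ 2 (pd i (u · α)) y := fun i α =>
    contDiffAt_pd i (contDiffAt_coord hu α) (natCast_le_infty 3)
  have hh : ∀ α β, ContDiffAt ℝ 2 (fun z => H (u z) α β) y := fun α β =>
    ((hH α β).of_le e2).comp y (hu.of_le e2)
  have hpp : ∀ i j α β, ContDiffAt ℝ 2
      (fun z => pd i (u · α) z * pd j (u · β) z) y :=
    fun i j α β => (hp i α).mul (hp j β)
  have hK : ∀ i j, ContDiffAt ℝ 2 (fun z => ∑ α, ∑ β, H (u z) α β *
      (pd i (u · α) z * pd j (u · β) z)) y := fun i j =>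
    ContDiffAt.sum fun α _ => ContDiffAt.sum fun β _ => (hh α β).mul (hpp i j α β)
  have hinv := fun i j => pd_inv_of_normal (fun i j => (hG i j).of_le e2) hG1 hG' i j k k
  unfold coordEnergy
  rw [pd_pd_sum _ _ _ (fun i _ => ContDiffAt.sum fun j _ => (hW i j).mul (hK i j))]
  simp only [fun i => pd_pd_sum Finset.univ k k (fun j _ => (hW i j).mul (hK i j))]
  have hterm : ∀ i j, pd k (pd k (fun z => (G z)⁻¹ i j * ∑ α, ∑ β, H (u z) α β *
      (pd i (u · α) z * pd j (u · β) z))) y =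
      -(∑ α, pd k (pd k (G · i j)) y * (pd i (u · α) y * pd j (u · α) y))
      + (1 : 𝕄 d) i j * pd k (pd k (fun z => ∑ α, ∑ β, H (u z) α β *
      (pd i (u · α) z * pd j (u · β) z))) y := by
    intro i j
    rw [pd_pd_mul k k (hW i j) (hK i j), (hinv i j).1, (hinv i j).2, hG1, hH1, sum_one_mul]
    simp [mul_sum]
  simp only [hterm, sum_add_distrib, sum_neg_distrib]
  rw [sum_one_mul, add_right_inj]
  rw [← sum_add_distrib]
  refine sum_ext fun i => ?_
  rw [pd_pd_sum _ _ _ (fun α _ => ContDiffAt.sum fun β _ => (hh α β).mul (hpp i i α β))]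
  simp only [fun α => pd_pd_sum Finset.univ k k (fun β _ => (hh α β).mul (hpp i i α β))]
  have hh0 : ∀ α β, pd k (fun z => H (u z) α β) y = 0 := by
    intro α β
    rw [pd_comp k ((hH α β).differentiableAt (by simp)) (hu.differentiableAt (by simp))]
    simp [hH']
  have hterm2 : ∀ α β, pd k (pd k (fun z => H (u z) α β * (pd i (u · α) z * pd i (u · β) z))) y =
      (∑ γ, ∑ δ, pd δ (pd γ (H · α β)) (u y) * (pd k (u · δ) y * pd k (u · γ) y)) *
            (pd i (u · α) y * pd i (u · β) y)
      + (1 : 𝕄 m) α β * pd k (pd k (fun z => pd i (u · α) z * pd i (u · β) z)) y := by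
    intro α β
    rw [pd_pd_mul k k (hh α β) (hpp i i α β), hh0, hH1,
      pd_pd_comp_of_pd_eq_zero k ((hH α β).of_le e2) (hu.of_le e2) (hH' α β)]
    ring
  simp only [hterm2, sum_add_distrib]
  rw [sum_one_mul, add_right_inj, ← sum_add_distrib, mul_sum]
  refine sum_ext fun α => ?_
  rw [pd_pd_mul k k (hp i α) (hp i α)]
  ring

/-- The derivative of the harmonic map equation at a point, in normal coordinates. -/
lemma pd_tension_of_normal {G : 𝔼 d → 𝕄 d} {H : 𝔼 m → 𝕄 m} {u : 𝔼 d → 𝔼 m} {y : 𝔼 d}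
    (hG : ∀ i j, ContDiffAt ℝ ∞ (G · i j) y) (hH : ∀ i j, ContDiffAt ℝ ∞ (H · i j) (u y))
    (hu : ContDiffAt ℝ ∞ u y) (hG1 : G y = 1) (hG' : ∀ i j k, pd k (G · i j) y = 0)
    (hH1 : H (u y) = 1) (hH' : ∀ i j k, pd k (H · i j) (u y) = 0) (a : Fin d) (γ : Fin m) :
    pd a (tension G H u γ) y = ∑ i, (pd i (pd i (pd a (u · γ))) y
    - ∑ k, pd a (christoffel G k i i) y * pd k (u · γ) y
    + ∑ α, ∑ β, (∑ δ, pd δ (christoffel H γ α β) (u y) * pd a (u · δ) y) *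
    (pd i (u · α) y * pd i (u · β) y)) := by
  have e2 : (2 : ℕ∞ω) ≤ (⊤ : ℕ∞) := natCast_le_infty 2
  have e21 : (1 : ℕ∞ω) + 1 ≤ (⊤ : ℕ∞) := natCast_le_infty 2
  have e3 : (2 : ℕ∞ω) + 1 ≤ (⊤ : ℕ∞) := natCast_le_infty 3
  have hG2 := fun i j => (hG i j).of_le e2
  have hH2 := fun i j => (hH i j).of_le e2
  have hu1 : DifferentiableAt ℝ u y := hu.differentiableAt (by simp)
  have hW : ∀ i j, DifferentiableAt ℝ (fun z => (G z)⁻¹ i j) y := fun i j =>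
    (contDiffAt_inv_apply hG2 (by simp [hG1]) i j).differentiableAt (by simp)
  have hp2 : ∀ i α, ContDiffAt ℝ 2 (pd i (u · α)) y := fun i α =>
    contDiffAt_pd i (contDiffAt_coord hu α) e3
  have hp : ∀ i α, DifferentiableAt ℝ (pd i (u · α)) y := fun i α =>
    (hp2 i α).differentiableAt (by simp)
  have hpp : ∀ i j α, DifferentiableAt ℝ (pd i (pd j (u · α))) y := fun i j α =>
    differentiableAt_pd i (hp2 j α)
  have hΓ : ∀ k i j, DifferentiableAt ℝ (christoffel G k i j) y := fun k i j =>
    (contDiffAt_christoffel (k := 1) hG e21 (by simp [hG1]) k i j).differentiableAt (by simp)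
  have hΓH : ∀ k i j, DifferentiableAt ℝ (christoffel H k i j) (u y) := fun k i j =>
    (contDiffAt_christoffel (k := 1) hH e21 (by simp [hH1]) k i j).differentiableAt (by simp)
  have hΓHu : ∀ k i j, DifferentiableAt ℝ (fun z => christoffel H k i j (u z)) y := fun k i j =>
    (hΓH k i j).comp y hu1
  have hΓ0 := fun k i j => (christoffel_of_normal hG2 hG1 hG' k i j a).1
  have hΓH0 := fun k i j l => (christoffel_of_normal hH2 hH1 hH' k i j l).1
  have d1 : ∀ i j, DifferentiableAt ℝ (fun z => ∑ k, christoffel G k i j z *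
      pd k (u · γ) z) y := fun i j =>
    DifferentiableAt.fun_sum fun k _ => (hΓ k i j).fun_mul (hp k γ)
  have d2' : ∀ i j α β, DifferentiableAt ℝ (fun z => christoffel H γ α β (u z) *
      pd i (u · α) z * pd j (u · β) z) y := fun i j α β =>
    ((hΓHu γ α β).fun_mul (hp i α)).fun_mul (hp j β)
  have d2 : ∀ i j, DifferentiableAt ℝ (fun z => ∑ α, ∑ β, christoffel H γ α β (u z) *
      pd i (u · α) z * pd j (u · β) z) y := fun i j =>
    DifferentiableAt.fun_sum fun α _ => DifferentiableAt.fun_sum fun β _ => d2' i j α β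
  have d3 : ∀ i j, DifferentiableAt ℝ (fun z => pd i (pd j (u · γ)) z
      - (∑ k, christoffel G k i j z * pd k (u · γ) z) + ∑ α, ∑ β,
      christoffel H γ α β (u z) * pd i (u · α) z * pd j (u · β) z) y :=
    fun i j => ((hpp i j γ).fun_sub (d1 i j)).fun_add (d2 i j)
  unfold tension
  rw [pd_sum _ _ (fun i _ => DifferentiableAt.fun_sum fun j _ => (hW i j).fun_mul (d3 i j))]
  simp only [fun i => pd_sum Finset.univ a (fun j _ => (hW i j).fun_mul (d3 i j))]
  simp only [pd_mul a (hW _ _) (d3 _ _), (pd_inv_of_normal hG2 hG1 hG' _ _ a a).1, zero_mul,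
    zero_add, hG1, inv_one]
  rw [sum_one_mul]
  refine sum_ext fun i => ?_
  rw [pd_add a ((hpp i i γ).fun_sub (d1 i i)) (d2 i i), pd_sub a (hpp i i γ) (d1 i i),
    pd_sum _ _ (fun k _ => (hΓ k i i).fun_mul (hp k γ)),
    pd_sum _ _ (fun α _ => DifferentiableAt.fun_sum fun β _ => d2' i i α β)]
  simp only [fun α => pd_sum Finset.univ a (fun β _ => d2' i i α β),
    fun α β => pd_mul a ((hΓHu γ α β).fun_mul (hp i α)) (hp i β),
    fun α β => pd_mul a (hΓHu γ α β) (hp i α), pd_mul a (hΓ _ _ _) (hp _ _), hΓ0, zero_mul,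
    add_zero, fun α β => hΓH0 γ α β γ, pd_comp a (hΓH _ _ _) hu1]
  congr 1
  · congr 1
    rw [pd_comm a i (hp2 i γ)]
    refine pd_congr i ?_
    filter_upwards [((contDiffAt_coord hu γ).of_le e2).eventually (by simp)] with z hz
    exact pd_comm a i hz
  · refine sum_ext fun α => sum_ext fun β => by ring


lemma sum_sum_sum_sum_perm {n : ℕ} {f g : Fin n → Fin n → Fin n → Fin n → ℝ}
    (e : (Fin n × Fin n × Fin n × Fin n) ≃ (Fin n × Fin n × Fin n × Fin n))
    (h : ∀ x, f x.1 x.2.1 x.2.2.1 x.2.2.2 = g (e x).1 (e x).2.1 (e x).2.2.1 (e x).2.2.2) :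
    ∑ a, ∑ b, ∑ c, ∑ l, f a b c l = ∑ a, ∑ b, ∑ c, ∑ l, g a b c l := by
  have key : ∀ f : Fin n → Fin n → Fin n → Fin n → ℝ, ∑ a, ∑ b, ∑ c, ∑ l, f a b c l =
      ∑ x : Fin n × Fin n × Fin n × Fin n, f x.1 x.2.1 x.2.2.1 x.2.2.2 := by
    intro f
    simp only [Fintype.sum_prod_type]
  rw [key, key]
  exact Fintype.sum_equiv e _ _ h

/-- The contribution of the curvature of the target to the Bochner formula: `h γ δ α β` stands for
`∂_γ ∂_δ H_{αβ}`, and the left side is `-⟨R(a, b) b, a⟩` in normal coordinates. -/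
lemma sectional_contraction {n : ℕ} (h : Fin n → Fin n → Fin n → Fin n → ℝ)
    (h12 : ∀ a b c l, h a b c l = h b a c l) (h34 : ∀ a b c l, h a b c l = h a b l c)
    (a b : Fin n → ℝ) :
    2 * ∑ i, ∑ j, ∑ k, ∑ l, (1 / 2 : ℝ) * (h i k j l - h i l j k - h j k i l + h j l i k)
    * a i * b j * b k * a l =
    2 * (∑ γ, ∑ α, ∑ β, ∑ δ, (1 / 2 : ℝ) * (h δ α β γ + h δ β α γ - h δ γ α β) * a δ
    * (b α * b β) * a γ) - ∑ α, ∑ β, ∑ γ, ∑ δ, h δ γ α β * (b δ * b γ) * (a α * a β) := by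
  -- every term equals `B x y z w = ∑ h i j k l x_i y_j z_k w_l` with two `a`s and two `b`s
  set B : ℝ := ∑ i, ∑ j, ∑ k, ∑ l, h i j k l * a i * b j * b k * a l with hB
  set C : ℝ := ∑ i, ∑ j, ∑ k, ∑ l, h i j k l * a i * a j * b k * b l with hC
  set D : ℝ := ∑ i, ∑ j, ∑ k, ∑ l, h i j k l * b i * b j * a k * a l with hD
  have t1 : ∑ i, ∑ j, ∑ k, ∑ l, h i k j l * a i * b j * b k * a l = B :=
    sum_sum_sum_sum_perm ⟨fun x => (x.1, x.2.2.1, x.2.1, x.2.2.2),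
      fun x => (x.1, x.2.2.1, x.2.1, x.2.2.2), fun _ => rfl, fun _ => rfl⟩ fun x => by
      dsimp; ring
  have t2 : ∑ i, ∑ j, ∑ k, ∑ l, h i l j k * a i * b j * b k * a l = C :=
    sum_sum_sum_sum_perm ⟨fun x => (x.1, x.2.2.2, x.2.1, x.2.2.1),
      fun x => (x.1, x.2.2.1, x.2.2.2, x.2.1), fun _ => rfl, fun _ => rfl⟩ fun x => by
      dsimp; ring
  have t3 : ∑ i, ∑ j, ∑ k, ∑ l, h j k i l * a i * b j * b k * a l = D :=
    sum_sum_sum_sum_perm ⟨fun x => (x.2.1, x.2.2.1, x.1, x.2.2.2),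
      fun x => (x.2.2.1, x.1, x.2.1, x.2.2.2), fun _ => rfl, fun _ => rfl⟩ fun x => by
      dsimp; ring
  have t4 : ∑ i, ∑ j, ∑ k, ∑ l, h j l i k * a i * b j * b k * a l = B :=
    sum_sum_sum_sum_perm ⟨fun x => (x.2.2.2, x.2.1, x.2.2.1, x.1),
      fun x => (x.2.2.2, x.2.1, x.2.2.1, x.1), fun _ => rfl, fun _ => rfl⟩ fun x => by
      dsimp; rw [h12, h34]; ring
  have t5 : ∑ γ, ∑ α, ∑ β, ∑ δ, h δ α β γ * a δ * (b α * b β) * a γ = B :=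
    sum_sum_sum_sum_perm ⟨fun x => (x.2.2.2, x.2.1, x.2.2.1, x.1),
      fun x => (x.2.2.2, x.2.1, x.2.2.1, x.1), fun _ => rfl, fun _ => rfl⟩ fun x => by
      dsimp; ring
  have t6 : ∑ γ, ∑ α, ∑ β, ∑ δ, h δ β α γ * a δ * (b α * b β) * a γ = B :=
    sum_sum_sum_sum_perm ⟨fun x => (x.2.2.2, x.2.2.1, x.2.1, x.1),
      fun x => (x.2.2.2, x.2.2.1, x.2.1, x.1), fun _ => rfl, fun _ => rfl⟩ fun x => by
      dsimp; ring
  have t7 : ∑ γ, ∑ α, ∑ β, ∑ δ, h δ γ α β * a δ * (b α * b β) * a γ = C :=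
    sum_sum_sum_sum_perm ⟨fun x => (x.2.2.2, x.1, x.2.1, x.2.2.1),
      fun x => (x.2.1, x.2.2.1, x.2.2.2, x.1), fun _ => rfl, fun _ => rfl⟩ fun x => by
      dsimp; ring
  have t8 : ∑ α, ∑ β, ∑ γ, ∑ δ, h δ γ α β * (b δ * b γ) * (a α * a β) = D :=
    sum_sum_sum_sum_perm ⟨fun x => (x.2.2.2, x.2.2.1, x.1, x.2.1),
      fun x => (x.2.2.1, x.2.2.2, x.2.1, x.1), fun _ => rfl, fun _ => rfl⟩ fun x => by
      dsimp; ring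
  have l1 : ∑ i, ∑ j, ∑ k, ∑ l, (1 / 2 : ℝ) * (h i k j l - h i l j k - h j k i l + h j l i k)
        * a i * b j * b k * a l = (1 / 2 : ℝ) * (B - C - D + B) := by
    conv_rhs => rw [← t2, ← t3]
    nth_rewrite 1 [← t1]
    rw [← t4]
    simp only [mul_sum, ← sum_add_distrib, ← sum_sub_distrib]
    refine sum_ext fun i => sum_ext fun j => sum_ext fun k => sum_ext fun l => by ring
  have l2 : ∑ γ, ∑ α, ∑ β, ∑ δ, (1 / 2 : ℝ) * (h δ α β γ + h δ β α γ - h δ γ α β) * a δ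
        * (b α * b β) * a γ = (1 / 2 : ℝ) * (B + B - C) := by
    conv_rhs => rw [← t7]
    nth_rewrite 1 [← t5]
    rw [← t6]
    simp only [mul_sum, ← sum_add_distrib, ← sum_sub_distrib]
    refine sum_ext fun i => sum_ext fun j => sum_ext fun k => sum_ext fun l => by ring
  rw [l1, l2, t8]
  ring

/-- The contribution of the Ricci curvature of the domain to the Bochner formula; `g k l i j` stands
for `∂_k ∂_l G_{ij}`. -/
lemma ricci_contraction {n : ℕ} (g : Fin n → Fin n → Fin n → Fin n → ℝ)
    (h12 : ∀ a b c l, g a b c l = g b a c l) (h34 : ∀ a b c l, g a b c l = g a b l c)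
    (p : Fin n → ℝ) :
    2 * ∑ j, ∑ k, (∑ i, (1 / 2 : ℝ) * (g i k j i - g i i j k - g j k i i + g j i i k)) * p j * p k
    = 2 * ∑ j, ∑ i, (∑ k, (1 / 2 : ℝ) * (g j i i k + g j i i k - g j k i i) * p k) * p j
    - ∑ i, ∑ j, ∑ k, g i i j k * (p j * p k) := by
  have s1 : ∑ j, ∑ k, ∑ i, g i k j i * p j * p k = ∑ j, ∑ k, ∑ i, g j i i k * p j * p k := by
    rw [sum_comm]
    refine sum_ext fun i => sum_ext fun j => sum_ext fun k => ?_
    rw [h12, h34]; ring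
  have s2 : ∑ i, ∑ j, ∑ k, g i i j k * (p j * p k) = ∑ j, ∑ k, ∑ i, g i i j k * (p j * p k) := by
    rw [sum_comm]
    exact sum_ext fun i => sum_comm
  have s3 : ∑ j, ∑ i, (∑ k, (1 / 2 : ℝ) * (g j i i k + g j i i k - g j k i i) * p k) * p j =
      ∑ j, ∑ k, ∑ i, ((1 / 2 : ℝ) * (g j i i k + g j i i k - g j k i i) * p k) * p j := by
    refine sum_ext fun i => ?_
    rw [sum_comm]
    exact sum_ext fun j => by rw [sum_mul]
  have s4 : ∑ j, ∑ k, (∑ i, (1 / 2 : ℝ) * (g i k j i - g i i j k - g j k i i + g j i i k))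
      * p j * p k = (1 / 2 : ℝ) * (∑ j, ∑ k, ∑ i, g i k j i * p j * p k) +
      ∑ j, ∑ k, ∑ i, (1 / 2 : ℝ) * (- g i i j k - g j k i i + g j i i k) * p j * p k := by
    simp only [mul_sum, sum_mul, ← sum_add_distrib]
    refine sum_ext fun i => sum_ext fun j => sum_ext fun k => by ring
  rw [s4, s1, s2, s3]
  simp only [mul_sum, ← sum_add_distrib, ← sum_sub_distrib]
  refine sum_ext fun i => sum_ext fun j => sum_ext fun k => by ring

/-- **Bochner inequality** for a harmonic map into a nonpositively curved manifold, at a point where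
the coordinates are normal to first order: `Δ e ≥ 2 c e` if `Ric ≥ c`. The terms dropped are the
squared Hessian of the map and minus the sectional curvatures of the target. -/
theorem bochner_of_normal {G : 𝔼 d → 𝕄 d} {H : 𝔼 m → 𝕄 m} {u : 𝔼 d → 𝔼 m} {y : 𝔼 d}
    (hG : ∀ i j, ContDiffAt ℝ ∞ (G · i j) y) (hH : ∀ i j, ContDiffAt ℝ ∞ (H · i j) (u y))
    (hu : ContDiffAt ℝ ∞ u y) (hGs : ∀ᶠ z in 𝓝 y, ∀ i j, G z i j = G z j i)
    (hHs : ∀ᶠ z in 𝓝 (u y), ∀ i j, H z i j = H z j i) (hG1 : G y = 1)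
    (hG' : ∀ i j k, pd k (G · i j) y = 0) (hH1 : H (u y) = 1)
    (hH' : ∀ i j k, pd k (H · i j) (u y) = 0) (htens : ∀ γ, ∀ᶠ z in 𝓝 y, tension G H u γ z = 0)
    {c : ℝ}
    (hRic : ∀ v : 𝔼 d, c * ∑ i, ∑ j, G y i j * v i * v j ≤ ∑ i, ∑ j, ricci G i j y * v i * v j)
    (hN : ∀ v w : 𝔼 m, sectionalForm H (u y) v w ≤ 0) :
    2 * c * coordEnergy G H u y ≤ ∑ k, pd k (pd k (coordEnergy G H u)) y := by
  have e2 : (2 : ℕ∞ω) ≤ (⊤ : ℕ∞) := natCast_le_infty 2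
  have hG2 := fun i j => (hG i j).of_le e2
  have hH2 := fun i j => (hH i j).of_le e2
  -- second derivatives of the metrics, and first, third (contracted) and second ones of the map
  set g : Fin d → Fin d → Fin d → Fin d → ℝ := fun k l i j => pd k (pd l (G · i j)) y with hg
  set h : Fin m → Fin m → Fin m → Fin m → ℝ := fun k l i j => pd k (pd l (H · i j)) (u y) with hh
  set P : Fin d → Fin m → ℝ := fun i α => pd i (u · α) y with hP
  set T : Fin d → Fin d → Fin m → ℝ := fun k i α => pd k (pd k (pd i (u · α))) y with hT
  set q : Fin d → Fin d → Fin m → ℝ := fun k i α => pd k (pd i (u · α)) y with hq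
  have g12 : ∀ a b i j, g a b i j = g b a i j := fun a b i j => pd_comm a b (hG2 i j)
  have h12 : ∀ a b i j, h a b i j = h b a i j := fun a b i j => pd_comm a b (hH2 i j)
  have g34 : ∀ a b i j, g a b i j = g a b j i := fun a b i j =>
    pd_congr a (pd_eventuallyEq b (hGs.mono fun z hz => hz i j))
  have h34 : ∀ a b i j, h a b i j = h a b j i := fun a b i j =>
    pd_congr a (pd_eventuallyEq b (hHs.mono fun z hz => hz i j))
  have hE : coordEnergy G H u y = ∑ α, ∑ i, P i α * P i α := by
    rw [coordEnergy, hG1, hH1, inv_one, sum_one_mul]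
    simp only [sum_one_mul]
    exact sum_comm
  have hR : ∀ α, c * ∑ i, P i α * P i α ≤ ∑ j, ∑ k,
      (∑ i, (1 / 2 : ℝ) * (g i k j i - g i i j k - g j k i i + g j i i k)) * P j α * P k α := by
    intro α
    have h1 := hRic (toLp 2 fun i => P i α)
    simp only [ricci, riemann_of_normal hG2 hG1 hG', hG1, mul_assoc] at h1
    rw [sum_one_mul] at h1
    simpa only [mul_assoc] using h1
  have hS : ∀ a b : Fin m → ℝ, ∑ i, ∑ j, ∑ k, ∑ l, (1 / 2 : ℝ) *
      (h i k j l - h i l j k - h j k i l + h j l i k) * a i * b j * b k * a l ≤ 0 := by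
    intro a b
    have h1 := hN (toLp 2 a) (toLp 2 b)
    simp only [sectionalForm, riemann_of_normal hH2 hH1 hH', hH1, mul_assoc] at h1
    simp only [sum_one_mul] at h1
    simpa only [mul_assoc] using h1
  have hten : ∀ a γ, ∑ i, (T i a γ - ∑ k, (1 / 2 : ℝ) * (g a i i k + g a i i k - g a k i i) * P k γ
      + ∑ α, ∑ β, (∑ δ, (1 / 2 : ℝ) * (h δ α β γ + h δ β α γ - h δ γ α β) * P a δ)
        * (P i α * P i β)) = 0 := by
    intro a γ
    have h1 := pd_tension_of_normal hG hH hu hG1 hG' hH1 hH' a γ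
    rw [pd_congr a (htens γ), pd_const] at h1
    simp only [(christoffel_of_normal hG2 hG1 hG' _ _ _ _).2,
      (christoffel_of_normal hH2 hH1 hH' _ _ _ _).2] at h1
    exact h1.symm
  have hten2 : ∑ a, ∑ γ, (∑ i, T i a γ * P a γ) = ∑ γ, (∑ a, ∑ i, (∑ k, (1 / 2 : ℝ) *
      (g a i i k + g a i i k - g a k i i) * P k γ) * P a γ) - ∑ a, ∑ i, ∑ γ, ∑ α, ∑ β, ∑ δ,
      (1 / 2 : ℝ) * (h δ α β γ + h δ β α γ - h δ γ α β) * P a δ * (P i α * P i β) * P a γ := by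
    have h1 : ∑ a, ∑ γ, (∑ i, (T i a γ - ∑ k, (1 / 2 : ℝ) *
      (g a i i k + g a i i k - g a k i i) * P k γ
      + ∑ α, ∑ β, (∑ δ, (1 / 2 : ℝ) * (h δ α β γ + h δ β α γ - h δ γ α β) * P a δ)
        * (P i α * P i β))) * P a γ = 0 := by
      simp only [hten, zero_mul, sum_const_zero]
    simp only [sum_add_distrib, sum_sub_distrib, add_mul, sub_mul] at h1
    have r1 : ∑ γ, (∑ a, ∑ i, (∑ k, (1 / 2 : ℝ) *
      (g a i i k + g a i i k - g a k i i) * P k γ) * P a γ) = ∑ a, ∑ γ, (∑ i, ∑ k, (1 / 2 : ℝ) *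
      (g a i i k + g a i i k - g a k i i) * P k γ) * P a γ := by
      rw [sum_comm]
      simp only [sum_mul]
    have r2 : ∑ a, ∑ i, ∑ γ, ∑ α, ∑ β, ∑ δ,
      (1 / 2 : ℝ) * (h δ α β γ + h δ β α γ - h δ γ α β) * P a δ * (P i α * P i β) * P a γ =
      ∑ a, ∑ γ, (∑ i, ∑ α, ∑ β, (∑ δ, (1 / 2 : ℝ) * (h δ α β γ + h δ β α γ - h δ γ α β) * P a δ)
        * (P i α * P i β)) * P a γ := by
      refine sum_ext fun a => ?_
      rw [sum_comm]
      simp only [sum_mul]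
    rw [r1, r2]
    simp only [sum_mul] at h1 ⊢
    linarith
  have hL : ∑ k, pd k (pd k (coordEnergy G H u)) y =
      - ∑ α, (∑ k, ∑ i, ∑ j, g k k i j * (P i α * P j α))
      + ∑ i, ∑ k, (∑ α, ∑ β, ∑ γ, ∑ δ, h δ γ α β * (P k δ * P k γ) * (P i α * P i β))
      + 2 * (∑ a, ∑ γ, ∑ i, T i a γ * P a γ) + 2 * ∑ i, ∑ k, ∑ α, q k i α ^ 2 := by
    simp only [laplacian_coordEnergy_of_normal hG hH hu hG1 hG' hH1 hH', sum_add_distrib,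
      sum_neg_distrib]
    have r1 : ∑ α, (∑ k, ∑ i, ∑ j, g k k i j * (P i α * P j α)) =
        ∑ k, ∑ i, ∑ j, ∑ α, g k k i j * (P i α * P j α) := by
      rw [sum_comm]
      refine sum_ext fun a => ?_
      rw [sum_comm]
      exact sum_ext fun a => sum_comm
    have r2 : ∑ i, ∑ k, (∑ α, ∑ β, ∑ γ, ∑ δ, h δ γ α β * (P k δ * P k γ) * (P i α * P i β)) =
      ∑ k, ∑ i, (∑ α, ∑ β, (∑ γ, ∑ δ, h δ γ α β * (P k δ * P k γ)) * (P i α * P i β)) := by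
      rw [sum_comm]
      simp only [sum_mul]
    have r3 : ∑ a, ∑ γ, ∑ i, T i a γ * P a γ = ∑ k, ∑ i, ∑ α, T k i α * P i α := by
      conv_rhs => rw [sum_comm]
      exact sum_ext fun a => sum_comm
    have r4 : ∑ i, ∑ k, ∑ α, q k i α ^ 2 = ∑ k, ∑ i, ∑ α, q k i α ^ 2 := sum_comm
    rw [r1, r2, r3, r4]
    simp only [← mul_sum, sum_add_distrib]
    ring
  have hric : ∀ α, _ := fun α => ricci_contraction g g12 g34 (P · α)
  have hsec : ∀ i k, _ := fun i k => sectional_contraction h h12 h34 (P i) (P k)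
  have A1 : 2 * c * coordEnergy G H u y ≤ ∑ α, (2 * ∑ j, ∑ i, (∑ k, (1 / 2 : ℝ) *
      (g j i i k + g j i i k - g j k i i) * P k α) * P j α
        - ∑ i, ∑ j, ∑ k, g i i j k * (P j α * P k α)) := by
    rw [hE, mul_sum]
    refine sum_le_sum fun α _ => ?_
    rw [← hric α]
    have := hR α
    linarith
  have A2 : 0 ≤ ∑ i, ∑ k, (∑ α, ∑ β, ∑ γ, ∑ δ, h δ γ α β * (P k δ * P k γ) * (P i α * P i β)
      - 2 * (∑ γ, ∑ α, ∑ β, ∑ δ, (1 / 2 : ℝ) * (h δ α β γ + h δ β α γ - h δ γ α β) * P i δ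
        * (P k α * P k β) * P i γ)) := by
    refine sum_nonneg fun i _ => sum_nonneg fun k _ => ?_
    have h1 := hsec i k
    have h2 := hS (P i) (P k)
    linarith
  have A3 : 0 ≤ ∑ i, ∑ k, ∑ α, q k i α ^ 2 :=
    sum_nonneg fun i _ => sum_nonneg fun k _ => sum_nonneg fun α _ => sq_nonneg _
  rw [hL, hten2]
  simp only [sum_sub_distrib, ← mul_sum] at A1 A2
  linarith

/-! ### The Laplacian in divergence form -/

/-- Jacobi's formula for the derivative of a determinant. -/
lemma pd_det {G : 𝔼 d → 𝕄 d} {y : 𝔼 d} (hG : ∀ i j, DifferentiableAt ℝ (G · i j) y)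
    (h0 : (G y).det ≠ 0) (k : Fin d) :
    pd k (fun z => (G z).det) y = (G y).det * ∑ i, ∑ j, (G y)⁻¹ i j * pd k (G · j i) y := by
  have hprod : ∀ σ : Equiv.Perm (Fin d), HasFDerivAt (fun z => ∏ i, G z (σ i) i)
      (∑ i, (∏ j ∈ Finset.univ.erase i, G y (σ j) j) • fderiv ℝ (fun z => G z (σ i) i) y) y :=
    fun σ => HasFDerivAt.finsetProd fun i _ => (hG (σ i) i).hasFDerivAt
  have hdet : HasFDerivAt (fun z => (G z).det) (∑ σ : Equiv.Perm (Fin d),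
      ((Equiv.Perm.sign σ : ℤ) : ℝ) • ∑ i, (∏ j ∈ Finset.univ.erase i, G y (σ j) j) •
        fderiv ℝ (fun z => G z (σ i) i) y) y := by
    simp only [Matrix.det_apply']
    exact HasFDerivAt.fun_sum fun σ _ => (hprod σ).const_mul _
  have hinv : ∀ i j, (G y).det * (G y)⁻¹ i j = (G y).adjugate i j := by
    intro i j
    rw [Matrix.inv_def, Ring.inverse_eq_inv', Matrix.smul_apply, smul_eq_mul,
      mul_inv_cancel_left₀ h0]
  rw [pd, hdet.fderiv, mul_sum]
  have hcol : ∀ i, (G y).det * ∑ j, (G y)⁻¹ i j * pd k (G · j i) y =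
      ((G y).updateCol i fun j => pd k (G · j i) y).det := by
    intro i
    rw [← Matrix.cramer_apply, Matrix.cramer_eq_adjugate_mulVec, mul_sum]
    simp only [← mul_assoc, hinv]
    rfl
  rw [sum_ext fun i => hcol i]
  simp only [Matrix.det_apply']
  rw [sum_comm]
  simp only [sum_apply, smul_apply, smul_eq_mul, mul_sum]
  refine sum_ext fun σ => sum_ext fun i => ?_
  rw [← Finset.mul_prod_erase _ _ (Finset.mem_univ i), Matrix.updateCol_self, mul_comm (pd _ _ _)]
  congr 2
  refine Finset.prod_congr rfl fun j hj => ?_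
  rw [Matrix.updateCol_ne (Finset.ne_of_mem_erase hj)]

lemma pd_inv_apply {G : 𝔼 d → 𝕄 d} {y : 𝔼 d} (hG : ∀ i j, ContDiffAt ℝ 1 (G · i j) y)
    (h0 : (G y).det ≠ 0) (k i j : Fin d) :
    pd k (fun z => (G z)⁻¹ i j) y = -∑ a, ∑ b, (G y)⁻¹ i a * pd k (G · a b) y * (G y)⁻¹ b j := by
  have hW1 : ∀ a b, DifferentiableAt ℝ (fun z => (G z)⁻¹ a b) y := fun a b =>
    (contDiffAt_inv_apply hG h0 a b).differentiableAt (by simp)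
  have hG1 : ∀ a b, DifferentiableAt ℝ (G · a b) y := fun a b => (hG a b).differentiableAt (by simp)
  have hev : ∀ b, (fun z => ∑ a, (G z)⁻¹ i a * G z a b) =ᶠ[𝓝 y]
      fun _ => (1 : 𝕄 d) i b := by
    intro b
    filter_upwards [det_ne_zero_eventually (fun i j => (hG i j).of_le (by simp)) h0] with z hz
    rw [← Matrix.mul_apply, Matrix.nonsing_inv_mul _ (isUnit_iff_ne_zero.2 hz)]
  have h2 : ∀ b, ∑ a, pd k (fun z => (G z)⁻¹ i a) y * G y a b =
      -∑ a, (G y)⁻¹ i a * pd k (G · a b) y := by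
    intro b
    have h2 := pd_congr k (hev b)
    rw [pd_const, pd_sum _ _ (fun a _ => (hW1 i a).fun_mul (hG1 a b))] at h2
    simp only [pd_mul _ (hW1 _ _) (hG1 _ _), sum_add_distrib] at h2
    linarith
  have hone : ∀ a, ∑ b, G y a b * (G y)⁻¹ b j = (1 : 𝕄 d) a j := by
    intro a
    rw [← Matrix.mul_apply, mul_nonsing_inv _ (isUnit_iff_ne_zero.2 h0)]
  calc pd k (fun z => (G z)⁻¹ i j) y
      = ∑ a, pd k (fun z => (G z)⁻¹ i a) y * ∑ b, G y a b * (G y)⁻¹ b j := by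
        simp only [hone]
        simp [Matrix.one_apply]
    _ = ∑ b, (∑ a, pd k (fun z => (G z)⁻¹ i a) y * G y a b) * (G y)⁻¹ b j := by
        simp only [mul_sum, sum_mul]
        rw [sum_comm]
        exact sum_ext fun _ => sum_ext fun _ => by ring
    _ = _ := by
        simp only [h2, neg_mul, sum_neg_distrib, sum_mul]
        rw [sum_comm]

/-- The Laplace-Beltrami operator `∑ G^{ij} (∂_i ∂_j v - ∑ Γ^k_{ij} ∂_k v)`. -/
def laplacian (G : 𝔼 d → 𝕄 d) (v : 𝔼 d → ℝ) (y : 𝔼 d) : ℝ :=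
  ∑ i, ∑ j, (G y)⁻¹ i j * (pd i (pd j v) y - ∑ k, christoffel G k i j y * pd k v y)

/-- The operator `∑ ∂_i (A_{ij} ∂_j v)`. -/
def divOp (A : 𝔼 d → 𝕄 d) (v : 𝔼 d → ℝ) (y : 𝔼 d) : ℝ :=
  ∑ i, pd i (fun z => ∑ j, A z i j * pd j v z) y

/-- The coefficient matrix `√(det G) G⁻¹` of the Laplace-Beltrami operator in divergence form. -/
def volInv (G : 𝔼 d → 𝕄 d) (y : 𝔼 d) : 𝕄 d :=
  √(G y).det • (G y)⁻¹

lemma divOp_eq {A : 𝔼 d → 𝕄 d} {v : 𝔼 d → ℝ} {y : 𝔼 d} (hA : ∀ i j, DifferentiableAt ℝ (A · i j) y)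
    (hv : ContDiffAt ℝ 2 v y) : divOp A v y = ∑ i, ∑ j, A y i j * pd i (pd j v) y
    + ∑ j, (∑ i, pd i (A · i j) y) * pd j v y := by
  have hv1 : ∀ j, DifferentiableAt ℝ (pd j v) y := fun j => differentiableAt_pd j hv
  unfold divOp
  simp only [fun i => pd_sum Finset.univ i (fun j _ => (hA i j).fun_mul (hv1 j)),
    pd_mul _ (hA _ _) (hv1 _), sum_add_distrib]
  rw [add_comm, add_right_inj, sum_comm]
  simp only [sum_mul]

/-- The Laplacian in divergence form: `√(det G)` times it is `divOp` with the matrix `√(det G) G⁻¹`. -/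
lemma divOp_volInv_eq {G : 𝔼 d → 𝕄 d} {v : 𝔼 d → ℝ} {y : 𝔼 d}
    (hG : ∀ i j, ContDiffAt ℝ 1 (G · i j) y) (hGs : ∀ᶠ z in 𝓝 y, ∀ i j, G z i j = G z j i)
    (h0 : 0 < (G y).det) (hv : ContDiffAt ℝ 2 v y) :
    divOp (volInv G) v y = √(G y).det * laplacian G v y := by
  have hG1 : ∀ a b, DifferentiableAt ℝ (G · a b) y := fun a b => (hG a b).differentiableAt (by simp)
  have hW1 : ∀ a b, DifferentiableAt ℝ (fun z => (G z)⁻¹ a b) y := fun a b =>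
    (contDiffAt_inv_apply hG h0.ne' a b).differentiableAt (by simp)
  have hdet : DifferentiableAt ℝ (fun z => (G z).det) y :=
    (contDiffAt_det hG).differentiableAt (by simp)
  have hsq : DifferentiableAt ℝ (fun z => √(G z).det) y := hdet.sqrt h0.ne'
  have hA : ∀ i j, DifferentiableAt ℝ (fun z => volInv G z i j) y := fun i j => by
    simp only [volInv, Matrix.smul_apply, smul_eq_mul]
    exact hsq.fun_mul (hW1 i j)
  have hWs : ∀ i j, (G y)⁻¹ i j = (G y)⁻¹ j i := by
    have : (G y).transpose = G y := by ext i j; exact hGs.self_of_nhds j i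
    intro i j
    conv_lhs => rw [← this, ← transpose_nonsing_inv]
    rfl
  set g : Fin d → Fin d → Fin d → ℝ := fun k i j => pd k (G · i j) y with hg
  set W : Fin d → Fin d → ℝ := fun i j => (G y)⁻¹ i j with hW
  have gs : ∀ k i j, g k i j = g k j i := fun k i j => pd_congr k (hGs.mono fun z hz => hz i j)
  have hs : ∀ k, pd k (fun z => √(G z).det) y = √(G y).det * ((1 / 2) * ∑ i, ∑ j, W i j * g k j i) := by
    intro k
    rw [pd_comp_real k (Real.hasDerivAt_sqrt h0.ne') hdet, pd_det hG1 h0.ne' k]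
    have h1 : √(G y).det * √(G y).det = (G y).det := Real.mul_self_sqrt h0.le
    have h2 : √(G y).det ≠ 0 := (Real.sqrt_pos.2 h0).ne'
    have h3 : ∀ s D X : ℝ, s * s = D → s ≠ 0 → 1 / (2 * s) * (D * X) = s * ((1 / 2) * X) := by
      rintro s D X rfl h
      field_simp
    exact h3 _ _ _ h1 h2
  -- `∂_i (√G G^{ij}) = -√G ∑ G^{kl} Γ^j_{kl}`
  have key : ∀ j, ∑ i, pd i (fun z => volInv G z i j) y =
      -(√(G y).det * ∑ k, ∑ l, W k l * christoffel G j k l y) := by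
    intro j
    have e1 : ∀ i, pd i (fun z => volInv G z i j) y = √(G y).det *
        ((1 / 2) * (∑ a, ∑ b, W a b * g i b a) * W i j - ∑ a, ∑ b, W i a * g i a b * W b j) := by
      intro i
      simp only [volInv, Matrix.smul_apply, smul_eq_mul]
      rw [pd_mul i hsq (hW1 i j), hs, pd_inv_apply hG h0.ne']
      ring
    simp only [e1]
    rw [← mul_sum, ← mul_neg]
    congr 1
    have e2 : ∑ k, ∑ l, W k l * christoffel G j k l y =
        ∑ k, ∑ l, ∑ b, (1 / 2 : ℝ) * (W k l * W j b * (g k l b + g l k b - g b k l)) := by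
      refine sum_ext fun k => sum_ext fun l => ?_
      simp only [christoffel, mul_sum]
      refine sum_ext fun b => ?_
      simp only [hW, hg]
      ring
    have e3 : ∑ i, ∑ a, ∑ b, W i a * g i a b * W b j = ∑ k, ∑ l, ∑ b, W k l * W j b * g k l b := by
      refine sum_ext fun k => sum_ext fun l => sum_ext fun b => ?_
      rw [show W b j = W j b from hWs b j]; ring
    have e4 : ∑ k, ∑ l, ∑ b, W k l * W j b * g l k b = ∑ k, ∑ l, ∑ b, W k l * W j b * g k l b := by
      rw [sum_comm]
      refine sum_ext fun k => sum_ext fun l => sum_ext fun b => ?_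
      rw [show W k l = W l k from hWs k l]
    have e5 : ∑ i, (1 / 2) * (∑ a, ∑ b, W a b * g i b a) * W i j =
        (1 / 2) * ∑ k, ∑ l, ∑ b, W k l * W j b * g b k l := by
      simp only [mul_sum, sum_mul]
      rw [sum_comm]
      refine sum_ext fun k => ?_
      rw [sum_comm]
      refine sum_ext fun l => sum_ext fun b => ?_
      rw [show W b j = W j b from hWs b j, gs b l k]; ring
    have e6 : ∑ k, ∑ l, ∑ b, (1 / 2 : ℝ) * (W k l * W j b * (g k l b + g l k b - g b k l)) =
        (1 / 2) * (∑ k, ∑ l, ∑ b, W k l * W j b * g k l b) +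
        (1 / 2) * (∑ k, ∑ l, ∑ b, W k l * W j b * g l k b) -
        (1 / 2) * (∑ k, ∑ l, ∑ b, W k l * W j b * g b k l) := by
      simp only [mul_sum, ← sum_add_distrib, ← sum_sub_distrib]
      refine sum_ext fun k => sum_ext fun l => sum_ext fun b => by ring
    rw [sum_sub_distrib, e5, e3, e2, e6, e4]
    ring
  rw [divOp_eq hA hv]
  simp only [key]
  simp only [laplacian, mul_sub, sum_sub_distrib, mul_sum, volInv, Matrix.smul_apply, smul_eq_mul]
  rw [sub_eq_add_neg]
  congr 1
  · exact sum_ext fun i => sum_ext fun j => by ring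
  · simp only [neg_mul, sum_neg_distrib, sum_mul, neg_inj]
    rw [sum_comm]
    refine sum_ext fun i => ?_
    rw [sum_comm]
    refine sum_ext fun j => sum_ext fun k => by simp only [hW]; ring

/-! ### Integration by parts against compactly supported functions -/

lemma continuous_mul_of_tsupport_subset {X : Type*} [TopologicalSpace X] {f g : X → ℝ} {U : Set X}
    (hU : IsOpen U) (hf : ContinuousOn f U) (hg : Continuous g) (hgU : tsupport g ⊆ U) :
    Continuous fun x => f x * g x := by
  rw [continuous_iff_continuousAt]
  intro x
  by_cases hx : x ∈ U
  · exact (hf.continuousAt (hU.mem_nhds hx)).mul hg.continuousAt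
  · have : (fun x => f x * g x) =ᶠ[𝓝 x] fun _ => 0 := by
      have h1 : (tsupport g)ᶜ ∈ 𝓝 x :=
        (isClosed_tsupport g).isOpen_compl.mem_nhds fun h => hx (hgU h)
      filter_upwards [h1] with z hz
      rw [image_eq_zero_of_notMem_tsupport hz, mul_zero]
    exact continuousAt_const.congr this.symm

lemma integrable_mul_of_tsupport_subset {f g : 𝔼 d → ℝ} {U : Set (𝔼 d)} (hU : IsOpen U)
    (hf : ContinuousOn f U) (hg : Continuous g) (hgU : tsupport g ⊆ U) (hc : HasCompactSupport g) :
    Integrable fun x => f x * g x :=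
  (continuous_mul_of_tsupport_subset hU hf hg hgU).integrable_of_hasCompactSupport hc.mul_left

lemma continuousOn_pd {f : 𝔼 d → ℝ} {U : Set (𝔼 d)}
    (hU : IsOpen U) (hf : ContDiffOn ℝ 1 f U) (i : Fin d) : ContinuousOn (pd i f) U := fun x hx =>
  (contDiffAt_pd (k := 0) i (hf.contDiffAt (hU.mem_nhds hx)) (by norm_num)).continuousAt
    |>.continuousWithinAt

lemma contDiff_pd {k : ℕ∞ω} {l : ℕ∞ω} {f : 𝔼 d → ℝ} (i : Fin d)
    (hf : ContDiff ℝ l f) (hk : k + 1 ≤ l) : ContDiff ℝ k (pd i f) :=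
  contDiff_iff_contDiffAt.2 fun _ => contDiffAt_pd i hf.contDiffAt hk

lemma tsupport_pd_subset (f : 𝔼 d → ℝ) (i : Fin d) : tsupport (pd i f) ⊆ tsupport f := by
  refine closure_minimal (fun x hx => ?_) (isClosed_tsupport f)
  by_contra h
  refine hx ?_
  rw [pd, fderiv_of_notMem_tsupport ℝ h]
  simp

lemma hasCompactSupport_pd {f : 𝔼 d → ℝ} (hf : HasCompactSupport f)
    (i : Fin d) : HasCompactSupport (pd i f) :=
  hf.of_isClosed_subset (isClosed_tsupport _) (tsupport_pd_subset f i)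

lemma integral_pd_mul {f g : 𝔼 d → ℝ} {U : Set (𝔼 d)} (hU : IsOpen U) (hf : ContDiffOn ℝ 1 f U)
    (hg : ContDiff ℝ 1 g) (hgU : tsupport g ⊆ U) (hc : HasCompactSupport g) (i : Fin d) :
    ∫ x, pd i f x * g x = -∫ x, f x * pd i g x := by
  have hpg : Continuous (pd i g) := (contDiff_pd (k := 0) i hg (by norm_num)).continuous
  have h := integral_mul_fderiv_eq_neg_fderiv_mul_of_integrable (μ := (volume : Measure
    (𝔼 d))) (f := f) (g := g) (v := single i (1 : ℝ))
    (integrable_mul_of_tsupport_subset hU (continuousOn_pd hU hf i) hg.continuous hgU hc)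
    (integrable_mul_of_tsupport_subset hU hf.continuousOn hpg
      ((tsupport_pd_subset g i).trans hgU) (hasCompactSupport_pd hc i))
    (integrable_mul_of_tsupport_subset hU hf.continuousOn hg.continuous hgU hc)
    (fun x hx => (hf.contDiffAt (hU.mem_nhds (hgU hx))).differentiableAt (by simp))
    (fun x _ => hg.contDiffAt.differentiableAt (by simp))
  simp only [pd]
  rw [h, neg_neg]

/-! ### Elliptic matrices and compactly supported test functions -/

section TestFunctions

lemma norm_sq_eq_sum (z : 𝔼 d) : ‖z‖ ^ 2 = ∑ i, z i ^ 2 := by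
  rw [EuclideanSpace.norm_sq_eq]
  simp

lemma abs_coord_le (z : 𝔼 d) (i : Fin d) : |z i| ≤ ‖z‖ := by simpa using PiLp.norm_apply_le z i

lemma abs_sum_mul_le {f g : Fin d → ℝ} {a b : ℝ} (hf : ∀ i, |f i| ≤ a) (hg : ∀ i, |g i| ≤ b) :
    |∑ i, f i * g i| ≤ d * (a * b) := by
  calc |∑ i, f i * g i| ≤ ∑ i, |f i * g i| := Finset.abs_sum_le_sum_abs _ _
    _ ≤ ∑ _i : Fin d, a * b := sum_le_sum fun i _ => by
        rw [abs_mul]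
        exact mul_le_mul (hf i) (hg i) (abs_nonneg _) ((abs_nonneg _).trans (hf i))
    _ = d * (a * b) := by simp

/-- Quantitative ellipticity of a symmetric matrix: `lam |ξ|² ≤ ⟨A ξ, ξ⟩` and entries bounded by
`Lam`. -/
structure IsEllipticMatrix (A : 𝕄 d) (lam Lam : ℝ) : Prop where
  symm : ∀ i j, A i j = A j i
  lower : ∀ ξ : Fin d → ℝ, lam * ∑ i, ξ i ^ 2 ≤ ∑ i, ∑ j, A i j * ξ i * ξ j
  upper : ∀ i j, |A i j| ≤ Lam

lemma sum_sq_mulVec_le {A : 𝕄 d} {Lam : ℝ} (hA : ∀ i j, |A i j| ≤ Lam)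
    (w : Fin d → ℝ) : ∑ i, (A.mulVec w i) ^ 2 ≤ (d * Lam) ^ 2 * ∑ i, w i ^ 2 := by
  have h : ∀ i, (A.mulVec w i) ^ 2 ≤ d * Lam ^ 2 * ∑ j, w j ^ 2 := by
    intro i
    calc (A.mulVec w i) ^ 2 = (∑ j, A i j * w j) ^ 2 := rfl
      _ ≤ (∑ j, A i j ^ 2) * ∑ j, w j ^ 2 := Finset.sum_mul_sq_le_sq_mul_sq _ _ _
      _ ≤ (∑ _j : Fin d, Lam ^ 2) * ∑ j, w j ^ 2 := by
          refine mul_le_mul_of_nonneg_right (sum_le_sum fun j _ => ?_)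
            (sum_nonneg fun j _ => sq_nonneg _)
          exact sq_le_sq' (by linarith [neg_abs_le (A i j), hA i j]) ((le_abs_self _).trans (hA i j))
      _ = d * Lam ^ 2 * ∑ j, w j ^ 2 := by simp
  calc ∑ i, (A.mulVec w i) ^ 2 ≤ ∑ _i : Fin d, d * Lam ^ 2 * ∑ j, w j ^ 2 :=
        sum_le_sum fun i _ => h i
    _ = (d * Lam) ^ 2 * ∑ i, w i ^ 2 := by simp; ring

lemma IsEllipticMatrix.det_ne_zero {A : 𝕄 d} {lam Lam : ℝ}
    (hA : IsEllipticMatrix A lam Lam) (hlam : 0 < lam) : A.det ≠ 0 := by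
  intro h
  obtain ⟨v, hv, hv0⟩ := Matrix.exists_mulVec_eq_zero_iff.2 h
  have h1 := hA.lower v
  have h2 : ∑ i, ∑ j, A i j * v i * v j = ∑ i, v i * A.mulVec v i := by
    refine sum_ext fun i => ?_
    rw [mulVec, dotProduct, mul_sum]
    exact sum_ext fun j => by ring
  rw [h2, hv0] at h1
  simp only [Pi.zero_apply, mul_zero, sum_const_zero] at h1
  have h3 : 0 ≤ ∑ i, v i ^ 2 := sum_nonneg fun i _ => sq_nonneg _
  have h4 : ∑ i, v i ^ 2 = 0 := by nlinarith
  rw [Finset.sum_eq_zero_iff_of_nonneg fun i _ => sq_nonneg _] at h4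
  exact hv (funext fun i => by simpa using h4 i (Finset.mem_univ i))

lemma IsEllipticMatrix.sum_inv {A : 𝕄 d} {lam Lam : ℝ} (hA : IsEllipticMatrix A lam Lam)
    (hlam : 0 < lam) (z : Fin d → ℝ) : ∃ w : Fin d → ℝ, A.mulVec w = z ∧ A⁻¹.mulVec z = w ∧
    ∑ i, ∑ j, A⁻¹ i j * z i * z j = ∑ i, w i * z i ∧ lam * ∑ i, w i ^ 2 ≤ ∑ i, w i * z i := by
  have hu : IsUnit A.det := isUnit_iff_ne_zero.2 (hA.det_ne_zero hlam)
  refine ⟨A⁻¹.mulVec z, ?_, rfl, ?_, ?_⟩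
  · rw [mulVec_mulVec, mul_nonsing_inv _ hu, one_mulVec]
  · refine sum_ext fun i => ?_
    rw [mulVec, dotProduct, sum_mul]
    exact sum_ext fun j => by ring
  · set w := A⁻¹.mulVec z with hw
    have hz : A.mulVec w = z := by rw [hw, mulVec_mulVec, mul_nonsing_inv _ hu, one_mulVec]
    refine (hA.lower w).trans (le_of_eq ?_)
    refine sum_ext fun i => ?_
    rw [← hz, mulVec, dotProduct, mul_sum]
    exact sum_ext fun j => by ring

lemma IsEllipticMatrix.inv_lower {A : 𝕄 d} {lam Lam : ℝ}
    (hA : IsEllipticMatrix A lam Lam) (hlam : 0 < lam) (z : Fin d → ℝ) :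
    lam * ∑ i, z i ^ 2 ≤ (d * Lam) ^ 2 * ∑ i, ∑ j, A⁻¹ i j * z i * z j := by
  obtain ⟨w, hw, -, h1, h2⟩ := hA.sum_inv hlam z
  rw [h1]
  calc lam * ∑ i, z i ^ 2 ≤ lam * ((d * Lam) ^ 2 * ∑ i, w i ^ 2) := by
        rw [← hw]
        exact mul_le_mul_of_nonneg_left (sum_sq_mulVec_le hA.upper w) hlam.le
    _ = (d * Lam) ^ 2 * (lam * ∑ i, w i ^ 2) := by ring
    _ ≤ _ := mul_le_mul_of_nonneg_left h2 (sq_nonneg _)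

lemma IsEllipticMatrix.abs_inv_le {A : 𝕄 d} {lam Lam : ℝ}
    (hA : IsEllipticMatrix A lam Lam) (hlam : 0 < lam) (i j : Fin d) : |A⁻¹ i j| ≤ 1 / lam := by
  obtain ⟨w, -, hw, -, h2⟩ := hA.sum_inv hlam (Pi.single j 1)
  have h3 : w i = A⁻¹ i j := by rw [← hw]; simp
  have h4 : ∑ i, w i * (Pi.single j (1 : ℝ) : Fin d → ℝ) i = w j := by simp [Pi.single_apply]
  rw [h4] at h2
  have h5 : ∀ k, w k ^ 2 ≤ ∑ i, w i ^ 2 := fun k =>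
    single_le_sum (f := fun i => w i ^ 2) (fun i _ => sq_nonneg _) (Finset.mem_univ k)
  rw [← h3]
  set s := √(∑ i, w i ^ 2) with hs
  have hs0 : 0 ≤ s := sqrt_nonneg _
  have hss : s ^ 2 = ∑ i, w i ^ 2 := Real.sq_sqrt (sum_nonneg fun i _ => sq_nonneg _)
  have h6 : ∀ k, |w k| ≤ s := fun k => Real.abs_le_sqrt (h5 k)
  rw [← hss] at h2
  have h7 : lam * s ^ 2 ≤ s := h2.trans ((le_abs_self _).trans (h6 j))
  have h8 : s ≤ 1 / lam := by
    rw [le_div_iff₀ hlam]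
    rcases hs0.eq_or_lt with h | h
    · rw [← h]; simp
    · nlinarith
  exact (h6 i).trans h8

/-- Powers of the positive part are differentiable, from the square on. -/
lemma hasDerivAt_max_zero_pow (k : ℕ) (x : ℝ) :
    HasDerivAt (fun x : ℝ => max x 0 ^ (k + 2)) ((k + 2 : ℝ) * max x 0 ^ (k + 1)) x := by
  rcases lt_trichotomy x 0 with h | h | h
  · have h1 : (fun x : ℝ => max x 0 ^ (k + 2)) =ᶠ[𝓝 x] fun _ => 0 := by
      filter_upwards [gt_mem_nhds h] with z hz
      rw [max_eq_right hz.le]; simp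
    rw [max_eq_right h.le]
    simpa using (hasDerivAt_const x (0 : ℝ)).congr_of_eventuallyEq h1
  · subst h
    rw [hasDerivAt_iff_isLittleO]
    simp only [max_self, sub_zero]
    have : (fun x : ℝ => max x 0 ^ (k + 2)) =O[𝓝 0] fun x => x ^ (k + 2) := by
      refine Asymptotics.IsBigO.of_bound 1 (Eventually.of_forall fun x => ?_)
      rw [one_mul, norm_pow, norm_pow]
      refine pow_le_pow_left₀ (norm_nonneg _) ?_ _
      rw [norm_eq_abs, norm_eq_abs, abs_of_nonneg (le_max_right _ _)]
      exact max_le (le_abs_self x) (abs_nonneg x)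
    have h2 : (fun x : ℝ => x ^ (k + 2)) =o[𝓝 0] fun x => x ^ 1 :=
      Asymptotics.isLittleO_pow_pow (by omega)
    simpa using this.trans_isLittleO h2
  · have h1 : (fun x : ℝ => max x 0 ^ (k + 2)) =ᶠ[𝓝 x] fun x => x ^ (k + 2) := by
      filter_upwards [lt_mem_nhds h] with z hz
      rw [max_eq_left hz.le]
    rw [max_eq_left h.le]
    have := (hasDerivAt_pow (k + 2) x).congr_of_eventuallyEq h1
    simpa using this

lemma contDiff_max_zero_pow_three : ContDiff ℝ 2 (fun x : ℝ => max x 0 ^ 3) := by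
  have h1 : deriv (fun x : ℝ => max x 0 ^ 3) = fun x => 3 * max x 0 ^ 2 := by
    funext x
    have := (hasDerivAt_max_zero_pow 1 x).deriv
    norm_num at this
    exact this
  have h2 : deriv (fun x : ℝ => max x 0 ^ 2) = fun x => 2 * max x 0 := by
    funext x
    have := (hasDerivAt_max_zero_pow 0 x).deriv
    norm_num at this
    exact this
  have c1 : ContDiff ℝ 1 (fun x : ℝ => max x 0 ^ 2) := by
    rw [contDiff_one_iff_deriv, h2]
    refine ⟨fun x => ?_, by fun_prop⟩
    have := (hasDerivAt_max_zero_pow 0 x).differentiableAt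
    simpa using this
  rw [show (2 : ℕ∞ω) = 1 + 1 by norm_num, contDiff_succ_iff_deriv, h1]
  refine ⟨fun x => ?_, by simp, contDiff_const.mul c1⟩
  exact (hasDerivAt_max_zero_pow 1 x).differentiableAt

/-- The quadratic form of a matrix. -/
def quadForm (P : 𝕄 d) (z : 𝔼 d) : ℝ := ∑ a, ∑ b, P a b * z a * z b

/-- The test function `(1 - ⟨P z, z⟩)₊³`, which is of class `C²`. -/
def testFun (P : 𝕄 d) (z : 𝔼 d) : ℝ := max (1 - quadForm P z) 0 ^ 3

lemma contDiff_quadForm (P : 𝕄 d) {k : ℕ∞ω} : ContDiff ℝ k (quadForm P) := by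
  unfold quadForm
  fun_prop

lemma contDiff_testFun (P : 𝕄 d) : ContDiff ℝ 2 (testFun P) :=
  contDiff_max_zero_pow_three.comp (contDiff_const.sub (contDiff_quadForm P))

lemma pd_quadForm {P : 𝕄 d} (hP : ∀ i j, P i j = P j i) (i : Fin d)
    (z : 𝔼 d) : pd i (quadForm P) z = 2 * ∑ b, P i b * z b := by
  have hd : ∀ a, DifferentiableAt ℝ (fun z : 𝔼 d => z a) z := fun a => by fun_prop
  unfold quadForm
  rw [pd_sum _ _ fun a _ => DifferentiableAt.fun_sum fun b _ =>
    ((hd a).const_mul (P a b)).fun_mul (hd b)]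
  simp only [fun a => pd_sum Finset.univ i (fun b (_ : b ∈ Finset.univ) =>
    ((hd a).const_mul (P a b)).fun_mul (hd b)), fun a b => pd_mul i ((hd a).const_mul (P a b)) (hd b),
    fun a b => pd_const_mul i (P a b) (hd a), pd_coord, mul_ite, mul_one, mul_zero, ite_mul, zero_mul,
    sum_add_distrib, sum_ite_eq', Finset.mem_univ, if_true]
  rw [sum_comm]
  simp only [sum_ite_eq', Finset.mem_univ, if_true]
  rw [two_mul]
  congr 1
  exact sum_ext fun b => by rw [hP b i]

lemma pd_testFun {P : 𝕄 d} (hP : ∀ i j, P i j = P j i) (i : Fin d) (z : 𝔼 d) :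
    pd i (testFun P) z = -6 * (max (1 - quadForm P z) 0 ^ 2 * ∑ b, P i b * z b) := by
  have h1 := pd_comp_real (φ := fun x => max x 0 ^ 3) i
    (hasDerivAt_max_zero_pow 1 (1 - quadForm P z))
    (u := fun z => 1 - quadForm P z) (y := z)
    ((contDiff_const.sub (contDiff_quadForm (k := 1) P)).differentiable (by simp) z)
  have h2 : pd i (fun z => 1 - quadForm P z) z = - (2 * ∑ b, P i b * z b) := by
    rw [pd_sub i (by fun_prop) ((contDiff_quadForm (k := 1) P).differentiable (by simp) z),
      pd_const, pd_quadForm hP, zero_sub]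
  unfold testFun
  rw [h1, h2]
  push_cast
  ring

lemma pd_pd_testFun {P : 𝕄 d} (hP : ∀ i j, P i j = P j i) (i j : Fin d) (z : 𝔼 d) :
    pd j (pd i (testFun P)) z = 24 * (max (1 - quadForm P z) 0 * (∑ b, P i b * z b) *
    ∑ b, P j b * z b) - 6 * (max (1 - quadForm P z) 0 ^ 2 * P i j) := by
  have hq : DifferentiableAt ℝ (fun z => 1 - quadForm P z) z :=
    (contDiff_const.sub (contDiff_quadForm (k := 1) P)).differentiable (by simp) z
  have h1 := pd_comp_real (φ := fun x => max x 0 ^ 2) j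
    (hasDerivAt_max_zero_pow 0 (1 - quadForm P z))
    (u := fun z => 1 - quadForm P z) (y := z) hq
  have h2 : pd j (fun z => 1 - quadForm P z) z = - (2 * ∑ b, P j b * z b) := by
    rw [pd_sub j (by fun_prop) ((contDiff_quadForm (k := 1) P).differentiable (by simp) z),
      pd_const, pd_quadForm hP, zero_sub]
  have hd : ∀ a, DifferentiableAt ℝ (fun z : 𝔼 d => z a) z := fun a => by fun_prop
  have h3 : DifferentiableAt ℝ (fun z => max (1 - quadForm P z) 0 ^ 2) z :=
    DifferentiableAt.comp (g := fun x : ℝ => max x 0 ^ 2) z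
      (hasDerivAt_max_zero_pow 0 (1 - quadForm P z)).differentiableAt hq
  have h4 : DifferentiableAt ℝ (fun z : 𝔼 d => ∑ b, P i b * z b) z := by fun_prop
  have h5 : pd j (fun z : 𝔼 d => ∑ b, P i b * z b) z = P i j := by
    rw [pd_sum _ _ fun b _ => (hd b).const_mul (P i b)]
    simp [pd_const_mul _ _ (hd _), pd_coord]
  rw [show pd i (testFun P) = fun z => -6 * (max (1 - quadForm P z) 0 ^ 2 * ∑ b, P i b * z b) from
    funext (pd_testFun hP i), pd_const_mul _ _ (h3.fun_mul h4), pd_mul j h3 h4, h1, h2, h5]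
  push_cast
  ring

lemma testFun_nonneg (P : 𝕄 d) (z : 𝔼 d) : 0 ≤ testFun P z := pow_nonneg (le_max_right _ _) _

/-- The hypotheses on the matrix `P` of a test function: symmetric, `P ≥ 1`, entries bounded
by `B`. -/
structure IsTestMatrix (P : 𝕄 d) (B : ℝ) : Prop where
  symm : ∀ i j, P i j = P j i
  lower : ∀ z : 𝔼 d, ‖z‖ ^ 2 ≤ quadForm P z
  upper : ∀ i j, |P i j| ≤ B

variable {P : 𝕄 d} {B : ℝ}

lemma IsTestMatrix.max_le_one (hP : IsTestMatrix P B) (z : 𝔼 d) : max (1 - quadForm P z) 0 ≤ 1 :=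
  max_le (by linarith [hP.lower z, sq_nonneg ‖z‖]) zero_le_one

lemma IsTestMatrix.max_eq_zero (hP : IsTestMatrix P B) {z : 𝔼 d}
    (hz : 1 ≤ ‖z‖) : max (1 - quadForm P z) 0 = 0 :=
  max_eq_right (by nlinarith [hP.lower z])

lemma IsTestMatrix.testFun_le_one (hP : IsTestMatrix P B) (z : 𝔼 d) : testFun P z ≤ 1 :=
  pow_le_one₀ (le_max_right _ _) (hP.max_le_one z)

lemma IsTestMatrix.tsupport_subset (hP : IsTestMatrix P B) :
    tsupport (testFun P) ⊆ closedBall 0 1 := by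
  refine closure_minimal (fun z hz => ?_) Metric.isClosed_closedBall
  by_contra h
  refine hz ?_
  rw [mem_closedBall_zero_iff, not_le] at h
  simp [testFun, hP.max_eq_zero h.le]

lemma IsTestMatrix.hasCompactSupport (hP : IsTestMatrix P B) : HasCompactSupport (testFun P) :=
  (isCompact_closedBall 0 1).of_isClosed_subset (isClosed_tsupport _) hP.tsupport_subset

lemma IsTestMatrix.abs_pd_le (hP : IsTestMatrix P B) (i : Fin d) (z : 𝔼 d) :
    |pd i (testFun P) z| ≤ 6 * (d * B) := by
  have hB : 0 ≤ B := (abs_nonneg _).trans (hP.upper i i)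
  rw [pd_testFun hP.symm]
  rcases le_total 1 ‖z‖ with hz | hz
  · rw [hP.max_eq_zero hz]; simp; positivity
  · have h1 : |∑ b, P i b * z b| ≤ d * (B * 1) :=
      abs_sum_mul_le (hP.upper i) fun b => (abs_coord_le z b).trans hz
    have h2 : max (1 - quadForm P z) 0 ^ 2 ≤ 1 := pow_le_one₀ (le_max_right _ _) (hP.max_le_one z)
    rw [abs_mul, abs_mul, abs_of_nonneg (pow_nonneg (le_max_right (1 - quadForm P z) 0) 2)]
    norm_num
    calc max (1 - quadForm P z) 0 ^ 2 * |∑ b, P i b * z b| ≤ 1 * (d * (B * 1)) :=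
          mul_le_mul h2 h1 (abs_nonneg _) zero_le_one
      _ = d * B := by ring

lemma IsTestMatrix.abs_pd_pd_le (hP : IsTestMatrix P B) (i j : Fin d) (z : 𝔼 d) :
    |pd j (pd i (testFun P)) z| ≤ 24 * (d * B) ^ 2 + 6 * B := by
  have hB : 0 ≤ B := (abs_nonneg _).trans (hP.upper i i)
  rw [pd_pd_testFun hP.symm]
  rcases le_total 1 ‖z‖ with hz | hz
  · rw [hP.max_eq_zero hz]; simp; positivity
  · have h1 : ∀ i, |∑ b, P i b * z b| ≤ d * B := fun i => by
      simpa using abs_sum_mul_le (hP.upper i) fun b => (abs_coord_le z b).trans hz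
    have h3 := hP.max_le_one z
    have h4 : 0 ≤ max (1 - quadForm P z) 0 := le_max_right _ _
    have h2 : max (1 - quadForm P z) 0 ^ 2 ≤ 1 := pow_le_one₀ h4 h3
    have e1 : |max (1 - quadForm P z) 0 * (∑ b, P i b * z b) * ∑ b, P j b * z b| ≤
        1 * (d * B) * (d * B) := by
      rw [abs_mul, abs_mul, abs_of_nonneg h4]
      gcongr
      · exact h1 i
      · exact h1 j
    have e2 : |max (1 - quadForm P z) 0 ^ 2 * P i j| ≤ 1 * B := by
      rw [abs_mul, abs_of_nonneg (pow_nonneg h4 2)]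
      gcongr
      exact hP.upper i j
    calc _ ≤ |24 * (max (1 - quadForm P z) 0 * (∑ b, P i b * z b) * ∑ b, P j b * z b)| +
          |6 * (max (1 - quadForm P z) 0 ^ 2 * P i j)| := abs_sub _ _
      _ ≤ 24 * (1 * (d * B) * (d * B)) + 6 * (1 * B) := by
          rw [abs_mul, abs_mul (6 : ℝ)]
          norm_num
          norm_num at e1 e2
          linarith
      _ = _ := by ring

end TestFunctions

/-! ### The derivative of the mean values in the radius -/

section EllipticEstimates

/-- `A` is a `C¹` field of elliptic matrices on `U`, with first derivatives bounded by `eps`. -/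
structure EllipticOn (A : 𝔼 d → 𝕄 d) (U : Set (𝔼 d)) (lam Lam eps : ℝ) : Prop where
  contDiffOn : ∀ i j, ContDiffOn ℝ 1 (A · i j) U
  elliptic : ∀ y ∈ U, IsEllipticMatrix (A y) lam Lam
  deriv_le : ∀ y ∈ U, ∀ i j k, |pd k (A · i j) y| ≤ eps

lemma contDiffOn_pd {k l : ℕ∞ω} {f : 𝔼 d → ℝ}
    {U : Set (𝔼 d)} (hU : IsOpen U) (hf : ContDiffOn ℝ l f U) (i : Fin d)
    (hk : k + 1 ≤ l) : ContDiffOn ℝ k (pd i f) U := fun x hx =>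
  (contDiffAt_pd i (hf.contDiffAt (hU.mem_nhds hx)) hk).contDiffWithinAt

lemma contDiff_mul_of_tsupport_subset {f g : 𝔼 d → ℝ} {k : ℕ∞ω}
    {U : Set (𝔼 d)} (hU : IsOpen U) (hf : ContDiffOn ℝ k f U)
    (hg : ContDiff ℝ k g) (hgU : tsupport g ⊆ U) : ContDiff ℝ k fun x => f x * g x := by
  rw [contDiff_iff_contDiffAt]
  intro x
  by_cases hx : x ∈ U
  · exact (hf.contDiffAt (hU.mem_nhds hx)).mul hg.contDiffAt
  · have : (fun x => f x * g x) =ᶠ[𝓝 x] fun _ => 0 := by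
      have h1 : (tsupport g)ᶜ ∈ 𝓝 x :=
        (isClosed_tsupport g).isOpen_compl.mem_nhds fun h => hx (hgU h)
      filter_upwards [h1] with z hz
      rw [image_eq_zero_of_notMem_tsupport hz, mul_zero]
    exact contDiffAt_const.congr_of_eventuallyEq this

/-- The operator `divOp A` is formally self-adjoint. -/
lemma integral_divOp_mul {A : 𝔼 d → 𝕄 d} {v ψ : 𝔼 d → ℝ} {U : Set (𝔼 d)} (hU : IsOpen U)
    (hA : ∀ i j, ContDiffOn ℝ 1 (A · i j) U) (hAs : ∀ y ∈ U, ∀ i j, A y i j = A y j i)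
    (hv : ContDiffOn ℝ 2 v U) (hψ : ContDiff ℝ 2 ψ) (hψU : tsupport ψ ⊆ U)
    (hc : HasCompactSupport ψ) : ∫ x, divOp A v x * ψ x = ∫ x, v x * divOp A ψ x := by
  have hv1 : ContDiffOn ℝ 1 v U := hv.of_le (by norm_num)
  have hψ1 : ContDiff ℝ 1 ψ := hψ.of_le (by norm_num)
  have hF : ∀ i, ContDiffOn ℝ 1 (fun z => ∑ j, A z i j * pd j v z) U := fun i =>
    ContDiffOn.sum fun j _ => (hA i j).mul (contDiffOn_pd hU hv j (by norm_num))
  have hpψ : ∀ j, ContDiff ℝ 1 (pd j ψ) := fun j => contDiff_pd j hψ (by norm_num)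
  have hpψU : ∀ j, tsupport (pd j ψ) ⊆ U := fun j => (tsupport_pd_subset ψ j).trans hψU
  have hH : ∀ i, ContDiff ℝ 1 (fun z => ∑ j, A z i j * pd j ψ z) := fun i =>
    ContDiff.sum fun j _ => contDiff_mul_of_tsupport_subset hU (hA i j) (hpψ j) (hpψU j)
  have hHsub : ∀ i, tsupport (fun z => ∑ j, A z i j * pd j ψ z) ⊆ tsupport ψ := by
    intro i
    refine closure_minimal (fun x hx => ?_) (isClosed_tsupport ψ)
    by_contra h
    refine hx (sum_eq_zero fun j _ => ?_)
    rw [image_eq_zero_of_notMem_tsupport fun h' => h (tsupport_pd_subset ψ j h'), mul_zero]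
  have hHc : ∀ i, HasCompactSupport (fun z => ∑ j, A z i j * pd j ψ z) := fun i =>
    hc.of_isClosed_subset (isClosed_tsupport _) (hHsub i)
  have L : ∫ x, divOp A v x * ψ x = -∫ x, ∑ i, (∑ j, A x i j * pd j v x) * pd i ψ x := by
    have h1 : ∀ x, divOp A v x * ψ x = ∑ i, pd i (fun z => ∑ j, A z i j * pd j v z) x * ψ x :=
      fun x => by rw [divOp, sum_mul]
    simp only [h1]
    rw [integral_finsetSum _ fun i _ => integrable_mul_of_tsupport_subset hU
        (continuousOn_pd hU (hF i) i) hψ.continuous hψU hc,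
      integral_finsetSum _ fun i _ => integrable_mul_of_tsupport_subset hU
        (hF i).continuousOn (hpψ i).continuous (hpψU i) (hasCompactSupport_pd hc i),
      ← sum_neg_distrib]
    exact sum_ext fun i => integral_pd_mul hU (hF i) hψ1 hψU hc i
  have R : ∫ x, v x * divOp A ψ x = -∫ x, ∑ i, pd i v x * (∑ j, A x i j * pd j ψ x) := by
    have h1 : ∀ x, v x * divOp A ψ x = ∑ i, v x * pd i (fun z => ∑ j, A z i j * pd j ψ z) x :=
      fun x => by rw [divOp, mul_sum]
    simp only [h1]
    rw [integral_finsetSum _ fun i _ => integrable_mul_of_tsupport_subset hU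
        hv1.continuousOn (contDiff_pd (k := 0) i (hH i) (by norm_num)).continuous
        ((tsupport_pd_subset _ i).trans ((hHsub i).trans hψU)) (hasCompactSupport_pd (hHc i) i),
      integral_finsetSum _ fun i _ => integrable_mul_of_tsupport_subset hU
        (continuousOn_pd hU hv1 i) (hH i).continuous ((hHsub i).trans hψU) (hHc i),
      ← sum_neg_distrib]
    refine sum_ext fun i => ?_
    rw [integral_pd_mul hU hv1 (hH i) ((hHsub i).trans hψU) (hHc i) i, neg_neg]
  rw [L, R]
  congr 1
  refine integral_congr_ae (Eventually.of_forall fun x => ?_)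
  by_cases hx : x ∈ U
  · simp only [sum_mul, mul_sum]
    rw [sum_comm]
    refine sum_ext fun i => sum_ext fun j => ?_
    rw [hAs x hx i j]; ring
  · have h0 : ∀ j, pd j ψ x = 0 := fun j =>
      image_eq_zero_of_notMem_tsupport fun h' => hx (hpψU j h')
    simp [h0]

lemma abs_sum_sum_mul_le {f g : Fin d → Fin d → ℝ} {a b : ℝ} (hf : ∀ i j, |f i j| ≤ a)
    (hg : ∀ i j, |g i j| ≤ b) : |∑ i, ∑ j, f i j * g i j| ≤ d ^ 2 * (a * b) := by
  calc |∑ i, ∑ j, f i j * g i j| ≤ ∑ i, |∑ j, f i j * g i j| := Finset.abs_sum_le_sum_abs _ _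
    _ ≤ ∑ _i : Fin d, d * (a * b) := sum_le_sum fun i _ => abs_sum_mul_le (hf i) (hg i)
    _ = d ^ 2 * (a * b) := by simp; ring

lemma abs_sub_le_of_pd_le {f : 𝔼 d → ℝ} {s : Set (𝔼 d)} {eps : ℝ} (hs : Convex ℝ s)
    (hf : ∀ x ∈ s, DifferentiableAt ℝ f x) (h : ∀ x ∈ s, ∀ k, |pd k f x| ≤ eps) {x y : 𝔼 d}
    (hx : x ∈ s) (hy : y ∈ s) : |f y - f x| ≤ d * eps * ‖y - x‖ := by
  refine hs.norm_image_sub_le_of_norm_fderiv_le (𝕜 := ℝ) hf (fun z hz => ?_) hx hy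
  rcases Nat.eq_zero_or_pos d with hd | hd
  · subst hd
    refine ContinuousLinearMap.opNorm_le_bound _ (by simp) fun v => ?_
    rw [fderiv_eq_sum_pd]; simp
  · have he : 0 ≤ eps := (abs_nonneg _).trans (h z hz ⟨0, hd⟩)
    refine ContinuousLinearMap.opNorm_le_bound _ (by positivity) fun v => ?_
    rw [fderiv_eq_sum_pd, norm_eq_abs]
    refine (abs_sum_mul_le (fun i => abs_coord_le v i) (h z hz)).trans (le_of_eq (by ring))

variable {A : 𝔼 d → 𝕄 d} {U : Set (𝔼 d)} {lam Lam eps : ℝ}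

lemma divOp_testFun_sub_le (hA : EllipticOn A U lam Lam eps) (hU : IsOpen U)
    (hball : closedBall 0 1 ⊆ U) {P : 𝕄 d} {B : ℝ} (hP : IsTestMatrix P B) {x : 𝔼 d}
    (hx : x ∈ closedBall 0 1) : |divOp A (testFun P) x - divOp (fun _ => A 0) (testFun P) x| ≤
    (d ^ 3 * (24 * (d * B) ^ 2 + 6 * B) + d ^ 2 * (6 * (d * B))) * eps := by
  have hd1 : ∀ z ∈ U, ∀ i j, DifferentiableAt ℝ (A · i j) z := fun z hz i j =>
    ((hA.contDiffOn i j).contDiffAt (hU.mem_nhds hz)).differentiableAt (by simp)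
  rw [divOp_eq (hd1 x (hball hx)) (contDiff_testFun P).contDiffAt,
    divOp_eq (A := fun _ => A 0) (fun i j => differentiableAt_const _) (contDiff_testFun P).contDiffAt]
  simp only [pd_const, sum_const_zero, zero_mul, add_zero]
  have e1 : ∑ i, ∑ j, A x i j * pd i (pd j (testFun P)) x
      + ∑ j, (∑ i, pd i (A · i j) x) * pd j (testFun P) x -
      ∑ i, ∑ j, A 0 i j * pd i (pd j (testFun P)) x =
      ∑ i, ∑ j, (A x i j - A 0 i j) * pd i (pd j (testFun P)) x
      + ∑ j, ∑ i, pd i (A · i j) x * pd j (testFun P) x := by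
    simp only [sub_mul, sum_sub_distrib, sum_mul]; ring
  rw [e1]
  have h1 : ∀ i j, |A x i j - A 0 i j| ≤ d * eps := by
    intro i j
    have h := abs_sub_le_of_pd_le (f := fun z => A z i j) (eps := eps)
      (convex_closedBall (0 : 𝔼 d) 1) (fun z hz => hd1 z (hball hz) i j)
      (fun z hz k => hA.deriv_le z (hball hz) i j k)
      (mem_closedBall_self zero_le_one) hx
    have he : 0 ≤ eps := (abs_nonneg _).trans (hA.deriv_le x (hball hx) i i i)
    refine h.trans ?_
    rw [sub_zero]
    have : ‖x‖ ≤ 1 := mem_closedBall_zero_iff.1 hx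
    exact mul_le_of_le_one_right (by positivity) this
  calc _ ≤ |∑ i, ∑ j, (A x i j - A 0 i j) * pd i (pd j (testFun P)) x| +
        |∑ j, ∑ i, pd i (A · i j) x * pd j (testFun P) x| := abs_add_le _ _
    _ ≤ d ^ 2 * (d * eps * (24 * (d * B) ^ 2 + 6 * B)) + d ^ 2 * (eps * (6 * (d * B))) :=
        add_le_add (abs_sum_sum_mul_le h1 fun i j => hP.abs_pd_pd_le j i x)
          (abs_sum_sum_mul_le (fun j i => hA.deriv_le x (hball hx) i j i)
            fun j _ => hP.abs_pd_le j x)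
    _ = _ := by ring

/-- The weight `χ` of the mean values, which satisfies `A(0) ∇(testFun P) = -χ z` if
`P = μ A(0)⁻¹`. -/
def meanWeight (P : 𝕄 d) (mu : ℝ) (z : 𝔼 d) : ℝ := 6 * mu * max (1 - quadForm P z) 0 ^ 2

lemma continuous_meanWeight (P : 𝕄 d) (mu : ℝ) : Continuous (meanWeight P mu) := by
  have := (contDiff_quadForm P (k := 0)).continuous
  unfold meanWeight
  fun_prop

/-- A lower bound for the derivative of the mean values in the radius, at radius one. -/
lemma integral_meanWeight_ge (hA : EllipticOn A U lam Lam eps) (hU : IsOpen U) (hlam : 0 < lam)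
    (heps : 0 ≤ eps) (hball : closedBall 0 1 ⊆ U) {mu B : ℝ} (hP : IsTestMatrix (mu • (A 0)⁻¹) B)
    {v : 𝔼 d → ℝ} (hv : ContDiffOn ℝ 2 v U) {S : ℝ} (hv0 : ∀ x ∈ closedBall 0 1, 0 ≤ v x)
    (hvS : ∀ x ∈ closedBall 0 1, v x ≤ S) (hdiv : ∀ x ∈ closedBall 0 1, -(eps * S) ≤ divOp A v x) :
    -((1 + (d ^ 3 * (24 * (d * B) ^ 2 + 6 * B) + d ^ 2 * (6 * (d * B)))) * (eps * S) *
    volume.real (closedBall (0 : 𝔼 d) 1)) ≤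
    ∫ z, meanWeight (mu • (A 0)⁻¹) mu z * fderiv ℝ v z z := by
  set P := mu • (A 0)⁻¹ with hPdef
  set ψ := testFun P with hψ
  set K := d ^ 3 * (24 * (d * B) ^ 2 + 6 * B) + d ^ 2 * (6 * (d * B)) with hK
  set D : Set (𝔼 d) := closedBall 0 1 with hD
  have h0U : (0 : 𝔼 d) ∈ U := hball (mem_closedBall_self zero_le_one)
  have hψ2 : ContDiff ℝ 2 ψ := contDiff_testFun P
  have hψU : tsupport ψ ⊆ U := hP.tsupport_subset.trans hball
  have hψc : HasCompactSupport ψ := hP.hasCompactSupport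
  have hv1 : ContDiffOn ℝ 1 v U := hv.of_le (by norm_num)
  have hS : 0 ≤ S := (hv0 0 (mem_closedBall_self zero_le_one)).trans
    (hvS 0 (mem_closedBall_self zero_le_one))
  -- `A(0) ∇ψ = -χ z`
  have hAψ : ∀ z i, ∑ j, A 0 i j * pd j ψ z = -(meanWeight P mu z * z i) := by
    intro z i
    have hAP : ∀ b, ∑ j, A 0 i j * P j b = mu * (1 : 𝕄 d) i b := by
      intro b
      rw [← mul_nonsing_inv (A 0)
        (isUnit_iff_ne_zero.2 ((hA.elliptic 0 h0U).det_ne_zero hlam)), Matrix.mul_apply,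
        mul_sum]
      refine sum_ext fun j => ?_
      simp only [hPdef, Matrix.smul_apply, smul_eq_mul]; ring
    have e1 : ∑ j, A 0 i j * pd j ψ z =
        -6 * max (1 - quadForm P z) 0 ^ 2 * ∑ b, (∑ j, A 0 i j * P j b) * z b := by
      simp only [hψ, pd_testFun hP.symm, sum_mul, mul_sum]
      rw [sum_comm]
      exact sum_ext fun _ => sum_ext fun _ => by ring
    rw [e1]
    simp only [hAP, Matrix.one_apply, mul_ite, mul_one, mul_zero, ite_mul, zero_mul,
      Finset.sum_ite_eq, Finset.mem_univ, if_true, meanWeight]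
    ring
  have hconst : ∫ z, meanWeight P mu z * fderiv ℝ v z z = ∫ x, v x * divOp (fun _ => A 0) ψ x := by
    have hpψ : ∀ j, ContDiff ℝ 1 (pd j ψ) := fun j => contDiff_pd j hψ2 (by norm_num)
    have hH : ∀ i, ContDiff ℝ 1 (fun z => ∑ j, A 0 i j * pd j ψ z) := fun i =>
      ContDiff.sum fun j _ => contDiff_const.mul (hpψ j)
    have hHsub : ∀ i, tsupport (fun z => ∑ j, A 0 i j * pd j ψ z) ⊆ tsupport ψ := by
      intro i
      refine closure_minimal (fun x hx => ?_) (isClosed_tsupport ψ)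
      by_contra h
      refine hx (sum_eq_zero fun j _ => ?_)
      rw [image_eq_zero_of_notMem_tsupport fun h' => h (tsupport_pd_subset ψ j h'), mul_zero]
    have hHc : ∀ i, HasCompactSupport (fun z => ∑ j, A 0 i j * pd j ψ z) := fun i =>
      hψc.of_isClosed_subset (isClosed_tsupport _) (hHsub i)
    have h1 : ∀ x, v x * divOp (fun _ => A 0) ψ x =
        ∑ i, v x * pd i (fun z => ∑ j, A 0 i j * pd j ψ z) x := fun x => by
      rw [divOp, mul_sum]
    have h2 : ∀ x, meanWeight P mu x * fderiv ℝ v x x =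
        -∑ i, pd i v x * ∑ j, A 0 i j * pd j ψ x := fun x => by
      rw [fderiv_eq_sum_pd, mul_sum, ← sum_neg_distrib]
      refine sum_ext fun i => ?_
      rw [hAψ]; ring
    simp only [h1, h2]
    rw [integral_neg, integral_finsetSum _ fun i _ => integrable_mul_of_tsupport_subset hU
        (continuousOn_pd hU hv1 i) (hH i).continuous ((hHsub i).trans hψU) (hHc i),
      integral_finsetSum _ fun i _ => integrable_mul_of_tsupport_subset hU
        hv1.continuousOn (contDiff_pd (k := 0) i (hH i) (by norm_num)).continuous
        ((tsupport_pd_subset _ i).trans ((hHsub i).trans hψU)) (hasCompactSupport_pd (hHc i) i),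
      ← sum_neg_distrib]
    refine sum_ext fun i => ?_
    rw [integral_pd_mul hU hv1 (hH i) ((hHsub i).trans hψU) (hHc i) i, neg_neg]
  have hsupp0 : ∀ x ∉ D, ∀ A' : 𝔼 d → 𝕄 d, divOp A' ψ x = 0 := by
    intro x hx A'
    refine sum_eq_zero fun i _ => ?_
    have : (fun z => ∑ j, A' z i j * pd j ψ z) =ᶠ[𝓝 x] fun _ => 0 := by
      have h1 : Dᶜ ∈ 𝓝 x := Metric.isClosed_closedBall.isOpen_compl.mem_nhds hx
      filter_upwards [h1] with z hz
      refine sum_eq_zero fun j _ => ?_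
      rw [image_eq_zero_of_notMem_tsupport
        fun h' => hz (hP.tsupport_subset (tsupport_pd_subset ψ j h')), mul_zero]
    rw [pd_congr i this, pd_const]
  have hself := integral_divOp_mul hU hA.contDiffOn (fun y hy => (hA.elliptic y hy).symm) hv hψ2
    hψU hψc
  have hdivint : ∀ A' : 𝔼 d → 𝕄 d,
      (∀ i j, ContDiffOn ℝ 1 (A' · i j) U) → Integrable fun x => v x * divOp A' ψ x := by
    intro A' hA'
    have hH : ∀ i, ContDiff ℝ 1 (fun z => ∑ j, A' z i j * pd j ψ z) := fun i =>
      ContDiff.sum fun j _ => contDiff_mul_of_tsupport_subset hU (hA' i j)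
        (contDiff_pd j hψ2 (by norm_num)) ((tsupport_pd_subset ψ j).trans hψU)
    have hcont : Continuous (divOp A' ψ) := by
      unfold divOp
      exact continuous_finsetSum _ fun i _ =>
        (contDiff_pd (k := 0) i (hH i) (by norm_num)).continuous
    have hts : tsupport (divOp A' ψ) ⊆ D :=
      closure_minimal (fun x hx => by by_contra h; exact hx (hsupp0 x h A'))
        Metric.isClosed_closedBall
    exact integrable_mul_of_tsupport_subset hU hv1.continuousOn hcont (hts.trans hball)
      ((isCompact_closedBall 0 1).of_isClosed_subset (isClosed_tsupport _) hts)
  have hint1 := hdivint A hA.contDiffOn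
  have hint2 := hdivint (fun _ => A 0) fun i j => contDiffOn_const
  have hF : ∀ i, ContDiffOn ℝ 1 (fun z => ∑ j, A z i j * pd j v z) U := fun i =>
    ContDiffOn.sum fun j _ => (hA.contDiffOn i j).mul (contDiffOn_pd hU hv j (by norm_num))
  have hdivv : ContinuousOn (divOp A v) U := by
    unfold divOp
    exact continuousOn_finsetSum _ fun i _ => continuousOn_pd hU (hF i) i
  have hint3 : Integrable fun x => divOp A v x * ψ x :=
    integrable_mul_of_tsupport_subset hU hdivv hψ2.continuous hψU hψc
  have hfin : volume D ≠ ⊤ := (isCompact_closedBall _ _).measure_lt_top.ne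
  have hind : ∀ c : ℝ, ∫ x, D.indicator (fun _ => c) x = c * volume.real D := by
    intro c
    rw [integral_indicator Metric.isClosed_closedBall.measurableSet, setIntegral_const,
      smul_eq_mul, mul_comm]
  have hindint : ∀ c : ℝ, Integrable (D.indicator fun _ => c) := fun c =>
    (integrable_indicator_iff Metric.isClosed_closedBall.measurableSet).2
      (integrableOn_const (hs := hfin))
  have b1 : -(eps * S) * volume.real D ≤ ∫ x, divOp A v x * ψ x := by
    rw [← hind]
    refine integral_mono (hindint _) hint3 fun x => ?_
    by_cases hx : x ∈ D
    · rw [indicator_of_mem hx]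
      have h1 := hdiv x hx
      have h2 : 0 ≤ ψ x := testFun_nonneg P x
      have h3 : ψ x ≤ 1 := hP.testFun_le_one x
      have h4 : 0 ≤ eps * S := by positivity
      show -(eps * S) ≤ divOp A v x * ψ x
      nlinarith
    · rw [indicator_of_notMem hx]
      show 0 ≤ divOp A v x * ψ x
      have hψx : ψ x = 0 := image_eq_zero_of_notMem_tsupport fun h' => hx (hP.tsupport_subset h')
      rw [hψx, mul_zero]
  have b2 : ∫ x, (v x * divOp A ψ x - v x * divOp (fun _ => A 0) ψ x) ≤
      S * (K * eps) * volume.real D := by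
    rw [← hind]
    refine integral_mono (hint1.sub hint2) (hindint _) fun x => ?_
    by_cases hx : x ∈ D
    · rw [indicator_of_mem hx]
      have h1 := divOp_testFun_sub_le hA hU hball hP hx
      rw [← mul_sub]
      calc v x * (divOp A ψ x - divOp (fun _ => A 0) ψ x)
          ≤ v x * (K * eps) := mul_le_mul_of_nonneg_left ((le_abs_self _).trans h1) (hv0 x hx)
        _ ≤ S * (K * eps) := mul_le_mul_of_nonneg_right (hvS x hx) ((abs_nonneg _).trans h1)
    · rw [indicator_of_notMem hx]
      show v x * divOp A ψ x - v x * divOp (fun _ => A 0) ψ x ≤ 0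
      rw [hsupp0 x hx, hsupp0 x hx]; simp
  rw [integral_sub hint1 hint2] at b2
  rw [hconst]
  nlinarith [b1, b2, hself]

end EllipticEstimates

/-! ### The mean value inequality -/

section MeanValue

variable {A : 𝔼 d → 𝕄 d} {U : Set (𝔼 d)} {lam Lam eps : ℝ}

lemma fderiv_comp_affine {f : 𝔼 d → ℝ} {c z : 𝔼 d} {s : ℝ} (hf : DifferentiableAt ℝ f (c + s • z))
    (w : 𝔼 d) : fderiv ℝ (fun z => f (c + s • z)) z w = s * fderiv ℝ f (c + s • z) w := by
  have h1 : HasFDerivAt (fun z : 𝔼 d => c + s • z)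
      (s • ContinuousLinearMap.id ℝ (𝔼 d)) z :=
    ((hasFDerivAt_id z).const_smul s).const_add c
  have h2 := (hf.hasFDerivAt.comp z h1).fderiv
  rw [show (fun z => f (c + s • z)) = f ∘ fun z => c + s • z from rfl, h2]
  simp

lemma pd_comp_affine {f : 𝔼 d → ℝ} {c z : 𝔼 d} {s : ℝ} (hf : DifferentiableAt ℝ f (c + s • z))
    (i : Fin d) : pd i (fun z => f (c + s • z)) z = s * pd i f (c + s • z) :=
  fderiv_comp_affine hf _

lemma continuous_affine (c : 𝔼 d) (s : ℝ) : Continuous fun z : 𝔼 d => c + s • z := by fun_prop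

lemma contDiffOn_comp_affine {f : 𝔼 d → ℝ} {k : ℕ∞ω} (hf : ContDiffOn ℝ k f U) (c : 𝔼 d) (s : ℝ) :
    ContDiffOn ℝ k (fun z => f (c + s • z)) ((fun z => c + s • z) ⁻¹' U) :=
  hf.comp (by fun_prop) (fun _ hz => hz)

lemma EllipticOn.comp_affine (hA : EllipticOn A U lam Lam eps) (hU : IsOpen U)
    (c : 𝔼 d) {s : ℝ} (hs : 0 ≤ s) :
    EllipticOn (fun z => A (c + s • z)) ((fun z => c + s • z) ⁻¹' U) lam Lam (s * eps) where
  contDiffOn i j := contDiffOn_comp_affine (hA.contDiffOn i j) c s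
  elliptic y hy := hA.elliptic _ hy
  deriv_le y hy i j k := by
    have hd : DifferentiableAt ℝ (A · i j) (c + s • y) :=
      ((hA.contDiffOn i j).contDiffAt (hU.mem_nhds hy)).differentiableAt (by simp)
    rw [pd_comp_affine (f := fun z => A z i j) hd, abs_mul, abs_of_nonneg hs]
    exact mul_le_mul_of_nonneg_left (hA.deriv_le _ hy i j k) hs

lemma divOp_comp_affine (hA : ∀ i j, ContDiffOn ℝ 1 (A · i j) U) (hU : IsOpen U) {v : 𝔼 d → ℝ}
    (hv : ContDiffOn ℝ 2 v U) {c z : 𝔼 d} {s : ℝ} (hz : c + s • z ∈ U) :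
    divOp (fun z => A (c + s • z)) (fun z => v (c + s • z)) z = s ^ 2 * divOp A v (c + s • z) := by
  have hF : ∀ i, ContDiffOn ℝ 1 (fun z => ∑ j, A z i j * pd j v z) U := fun i =>
    ContDiffOn.sum fun j _ => (hA i j).mul (contDiffOn_pd hU hv j (by norm_num))
  unfold divOp
  rw [mul_sum]
  refine sum_ext fun i => ?_
  have hev : (fun z => ∑ j, A (c + s • z) i j * pd j (fun z => v (c + s • z)) z) =ᶠ[𝓝 z]
      fun z => s * (fun y => ∑ j, A y i j * pd j v y) (c + s • z) := by
    have h1 : (fun z => c + s • z) ⁻¹' U ∈ 𝓝 z := (hU.preimage (continuous_affine c s)).mem_nhds hz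
    filter_upwards [h1] with x hx
    rw [mul_sum]
    refine sum_ext fun j => ?_
    rw [pd_comp_affine ((hv.contDiffAt (hU.mem_nhds hx)).differentiableAt (by simp))]
    ring
  have hd : DifferentiableAt ℝ (fun y => ∑ j, A y i j * pd j v y) (c + s • z) :=
    ((hF i).contDiffAt (hU.mem_nhds hz)).differentiableAt (by simp)
  have hd' : DifferentiableAt ℝ (fun z => (fun y => ∑ j, A y i j * pd j v y) (c + s • z)) z :=
    DifferentiableAt.comp (g := fun y => ∑ j, A y i j * pd j v y) z hd (by fun_prop)
  rw [pd_congr i hev, pd_const_mul i s hd', pd_comp_affine hd]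
  ring

lemma IsEllipticMatrix.isTestMatrix_inv {A : 𝕄 d} (hA : IsEllipticMatrix A lam Lam)
    (hlam : 0 < lam) :
    IsTestMatrix (((d * Lam) ^ 2 / lam) • A⁻¹) ((d * Lam) ^ 2 / lam * (1 / lam)) where
  symm i j := by
    have : A.transpose = A := by ext i j; exact hA.symm j i
    have h2 : A⁻¹ i j = A⁻¹ j i := by
      conv_lhs => rw [← this, ← transpose_nonsing_inv]
      rfl
    simp [h2]
  lower z := by
    have h := hA.inv_lower hlam z
    rw [norm_sq_eq_sum]
    have h2 : quadForm (((d * Lam) ^ 2 / lam) • A⁻¹) z =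
        ((d * Lam) ^ 2 * ∑ i, ∑ j, A⁻¹ i j * z i * z j) / lam := by
      simp only [quadForm, Matrix.smul_apply, smul_eq_mul, mul_sum, Finset.sum_div]
      exact sum_ext fun _ => sum_ext fun _ => by ring
    rw [h2, le_div_iff₀ hlam]
    linarith
  upper i j := by
    rw [Matrix.smul_apply, smul_eq_mul, abs_mul, abs_of_nonneg (by positivity)]
    exact mul_le_mul_of_nonneg_left (hA.abs_inv_le hlam i j) (by positivity)

lemma exists_integral_meanWeight_ge (d : ℕ) {mu B : ℝ} (hmu : 0 < mu) (hB : 0 ≤ B) :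
    ∃ κ : ℝ, 0 < κ ∧ ∀ P : 𝕄 d, IsTestMatrix P B →
    κ ≤ ∫ z in closedBall (0 : 𝔼 d) 1, meanWeight P mu z := by
  set N : ℝ := d ^ 2 * B + 1 with hN
  have hN1 : 1 ≤ N := by rw [hN]; nlinarith [sq_nonneg (d : ℝ), mul_nonneg (sq_nonneg (d : ℝ)) hB]
  set r : ℝ := 1 / (2 * N) with hr
  have hr0 : 0 < r := by positivity
  have hr1 : r ≤ 1 := by rw [hr, div_le_one (by positivity)]; linarith
  refine ⟨3 / 2 * mu * volume.real (closedBall (0 : 𝔼 d) r), ?_, ?_⟩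
  · have : 0 < volume.real (closedBall (0 : 𝔼 d) r) :=
      toReal_pos (Metric.measure_closedBall_pos _ _ hr0).ne'
        (isCompact_closedBall _ _).measure_lt_top.ne
    positivity
  · intro P hP
    have hint : IntegrableOn (meanWeight P mu)
        (closedBall (0 : 𝔼 d) 1) :=
      (continuous_meanWeight P mu).continuousOn.integrableOn_compact (isCompact_closedBall _ _)
    have hsub : closedBall (0 : 𝔼 d) r ⊆ closedBall 0 1 := closedBall_subset_closedBall hr1
    have hnn : ∀ z, 0 ≤ meanWeight P mu z := fun z => by unfold meanWeight; positivity
    calc _ = ∫ z in closedBall (0 : 𝔼 d) r, (3 / 2 * mu : ℝ) := by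
          rw [setIntegral_const, smul_eq_mul, mul_comm]
      _ ≤ ∫ z in closedBall (0 : 𝔼 d) r, meanWeight P mu z := by
          refine setIntegral_mono_on (integrableOn_const
            (hs := (isCompact_closedBall _ _).measure_lt_top.ne)) (hint.mono_set hsub)
            Metric.isClosed_closedBall.measurableSet fun z hz => ?_
          have hz' : ‖z‖ ≤ r := mem_closedBall_zero_iff.1 hz
          have hq : quadForm P z ≤ 1 / 2 := by
            have h1 : |quadForm P z| ≤ d ^ 2 * (B * (r * r)) := by
              unfold quadForm
              simp only [mul_assoc]
              refine abs_sum_sum_mul_le hP.upper fun i j => ?_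
              rw [abs_mul]
              exact mul_le_mul ((abs_coord_le z i).trans hz') ((abs_coord_le z j).trans hz')
                (abs_nonneg _) hr0.le
            have h2 : d ^ 2 * (B * (r * r)) ≤ N * (r * r) := by
              rw [← mul_assoc]
              exact mul_le_mul_of_nonneg_right (by rw [hN]; linarith) (by positivity)
            have h3 : N * (r * r) = r / 2 := by rw [hr]; field_simp
            linarith [le_abs_self (quadForm P z)]
          have h4 : 1 / 2 ≤ max (1 - quadForm P z) 0 := le_max_of_le_left (by linarith)
          have h5 : (1 / 2 : ℝ) ^ 2 ≤ max (1 - quadForm P z) 0 ^ 2 :=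
            pow_le_pow_left₀ (by norm_num) h4 2
          unfold meanWeight
          nlinarith
      _ ≤ _ := setIntegral_mono_set hint (ae_of_all _ hnn) (LE.le.eventuallyLE hsub)

lemma setIntegral_comp_affine (v : 𝔼 d → ℝ) (c : 𝔼 d) {s : ℝ} (hs : 0 < s) (t : ℝ) (ht : 0 ≤ t) :
    ∫ z in closedBall (0 : 𝔼 d) t, v (c + s • z) =
    (s ^ d)⁻¹ * ∫ y in closedBall c (s * t), v y := by
  have h1 := Measure.setIntegral_comp_smul_of_pos (volume : Measure (𝔼 d))
    (fun x => v (c + x)) (closedBall (0 : 𝔼 d) t) hs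
  rw [h1, finrank_euclideanSpace_fin, smul_eq_mul, smul_closedBall _ _ ht, smul_zero,
    norm_of_nonneg hs.le]
  congr 1
  have h2 := (measurePreserving_add_left (volume : Measure (𝔼 d))
    c).setIntegral_preimage_emb (measurableEmbedding_addLeft c) v (closedBall c (s * t))
  rw [← h2]
  congr 2
  ext x
  simp [dist_eq_norm]

/-- A mean value inequality on a small ball, with an error term which is small compared to the
supremum if the radius `ρ` is small compared to `R`. -/
lemma exists_mean_value_with_error (hd : 0 < d) (hlam : 0 < lam) (hLam : 0 < Lam) :
    ∃ C : ℝ, 0 < C ∧ ∀ (A : 𝔼 d → 𝕄 d) (U : Set (𝔼 d)) (y : 𝔼 d) (ρ R S : ℝ)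
    (v : 𝔼 d → ℝ), IsOpen U → 0 < ρ → ρ ≤ R →
    closedBall y ρ ⊆ U → EllipticOn A U lam Lam (Lam / R) → ContDiffOn ℝ 2 v U →
    (∀ x ∈ closedBall y ρ, 0 ≤ v x) → (∀ x ∈ closedBall y ρ, v x ≤ S) →
    (∀ x ∈ closedBall y ρ, -(Lam / R ^ 2 * v x) ≤ divOp A v x) →
    v y ≤ C * ((ρ ^ d)⁻¹ * ∫ x in closedBall y ρ, v x) + C * (ρ / R * S) := by
  have hd' : (0 : ℝ) < d := by exact_mod_cast hd
  -- `mu` makes `P = mu A(y)⁻¹ ≥ 1`, so that the test function is supported in the unit ball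
  set mu : ℝ := (d * Lam) ^ 2 / lam with hmu
  set B : ℝ := mu * (1 / lam) with hB
  have hmu0 : 0 < mu := by positivity
  have hB0 : 0 < B := by positivity
  obtain ⟨κ, hκ, hκ'⟩ := exists_integral_meanWeight_ge d hmu0 hB0.le
  set C1 : ℝ := (1 + (d ^ 3 * (24 * (d * B) ^ 2 + 6 * B) + d ^ 2 * (6 * (d * B)))) * Lam *
      volume.real (closedBall (0 : 𝔼 d) 1) with hC1
  have hC10 : 0 ≤ C1 := by positivity
  refine ⟨(6 * mu + C1) / κ, by positivity, ?_⟩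
  intro A U y ρ R S v hU hρ hρR hball hA hv hv0 hvS hdiv
  have hR : 0 < R := hρ.trans_le hρR
  have hyU : y ∈ U := hball (mem_closedBall_self hρ.le)
  set P := mu • (A y)⁻¹ with hP
  have hPt : IsTestMatrix P B := (hA.elliptic y hyU).isTestMatrix_inv hlam
  set χ := meanWeight P mu with hχ
  have hS : 0 ≤ S := (hv0 y (mem_closedBall_self hρ.le)).trans
    (hvS y (mem_closedBall_self hρ.le))
  set D : Set (𝔼 d) := closedBall 0 1 with hD
  have hmem : ∀ s, 0 ≤ s → s ≤ ρ → ∀ z ∈ D, y + s • z ∈ closedBall y ρ := by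
    intro s hs hsρ z hz
    rw [mem_closedBall_iff_norm, add_sub_cancel_left, norm_smul, norm_of_nonneg hs]
    have : ‖z‖ ≤ 1 := mem_closedBall_zero_iff.1 hz
    nlinarith
  have hv1 : ContDiffOn ℝ 1 v U := hv.of_le (by norm_num)
  have hvd : ∀ x ∈ U, DifferentiableAt ℝ v x := fun x hx =>
    (hv.contDiffAt (hU.mem_nhds hx)).differentiableAt (by simp)
  have hfd : ContinuousOn (fderiv ℝ v) U := hv1.continuousOn_fderiv_of_isOpen hU le_rfl
  -- the derivative of the mean values in the radius
  have hJ : ∀ s, 0 < s → s ≤ ρ → -(C1 * S / R) ≤ ∫ z in D, χ z * fderiv ℝ v (y + s • z) z := by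
    intro s hs hsρ
    have hball' : closedBall (0 : 𝔼 d) 1 ⊆ (fun z => y + s • z) ⁻¹' U :=
      fun z hz => hball (hmem s hs.le hsρ z hz)
    have h := integral_meanWeight_ge (hA.comp_affine hU y hs.le)
      (hU.preimage (continuous_affine y s)) hlam (by positivity) hball' (mu := mu) (B := B)
      (by simpa using hPt) (contDiffOn_comp_affine hv y s) (S := S)
      (fun x hx => hv0 _ (hmem s hs.le hsρ x hx)) (fun x hx => hvS _ (hmem s hs.le hsρ x hx))
      (fun x hx => by
        rw [divOp_comp_affine hA.contDiffOn hU hv (hball' hx)]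
        have h1 := hdiv _ (hmem s hs.le hsρ x hx)
        have h2 := hvS _ (hmem s hs.le hsρ x hx)
        have h3 : s * (Lam / R) * S - s ^ 2 * (Lam / R ^ 2 * S) = s * Lam * S / R ^ 2 * (R - s) := by
          field_simp
        have h4 : 0 ≤ s * Lam * S / R ^ 2 * (R - s) := mul_nonneg (by positivity) (by linarith)
        have h5 : s ^ 2 * (Lam / R ^ 2 * v (y + s • x)) ≤ s ^ 2 * (Lam / R ^ 2 * S) := by gcongr
        nlinarith [mul_le_mul_of_nonneg_left h1 (sq_nonneg s)])
    simp only [smul_zero, add_zero] at h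
    have e1 : ∫ z, meanWeight (mu • (A y)⁻¹) mu z * fderiv ℝ (fun z => v (y + s • z)) z z =
        s * ∫ z in D, χ z * fderiv ℝ v (y + s • z) z := by
      rw [← integral_const_mul, ← setIntegral_eq_integral_of_forall_compl_eq_zero (s := D)]
      · refine setIntegral_congr_fun Metric.isClosed_closedBall.measurableSet fun z hz => ?_
        show χ z * _ = _
        rw [fderiv_comp_affine (hvd _ (hball' hz))]
        ring
      · intro z hz
        have : 1 ≤ ‖z‖ := by
          by_contra h'
          exact hz (mem_closedBall_zero_iff.2 (not_le.1 h').le)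
        rw [meanWeight, hPt.max_eq_zero this]
        simp
    rw [e1] at h
    have h6 : s * -(C1 * S / R) ≤ s * ∫ z in D, χ z * fderiv ℝ v (y + s • z) z := by
      refine le_trans (le_of_eq ?_) h
      rw [hC1]
      ring
    exact le_of_mul_le_mul_left h6 hs
  -- the fundamental theorem of calculus along rays, and Fubini
  have hcont : ContinuousOn (fun p : ℝ × 𝔼 d =>
      χ p.2 * fderiv ℝ v (y + p.1 • p.2) p.2) (Icc 0 ρ ×ˢ D) := by
    refine ((continuous_meanWeight P mu).comp continuous_snd).continuousOn.mul ?_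
    refine ContinuousOn.clm_apply (hfd.comp (by fun_prop) ?_) continuousOn_snd
    rintro ⟨s, z⟩ ⟨hs, hz⟩
    exact hball (hmem s hs.1 hs.2 z hz)
  have hprod : Integrable (Function.uncurry fun (s : ℝ) (z : 𝔼 d) => χ z * fderiv ℝ v (y + s • z) z)
      ((volume.restrict (Set.uIoc 0 ρ)).prod (volume.restrict D)) := by
    rw [Measure.prod_restrict]
    have h1 : IntegrableOn (fun p : ℝ × 𝔼 d =>
      χ p.2 * fderiv ℝ v (y + p.1 • p.2) p.2) (Icc 0 ρ ×ˢ D) (volume.prod volume) :=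
      hcont.integrableOn_compact (isCompact_Icc.prod (isCompact_closedBall _ _))
    refine h1.mono_set (prod_mono ?_ Subset.rfl)
    rw [uIoc_of_le hρ.le]
    exact Ioc_subset_Icc_self
  have hswap := intervalIntegral_integral_swap hprod
  have hlow : -(C1 * S / R) * ρ ≤ ∫ s in (0 : ℝ)..ρ, ∫ z in D, χ z * fderiv ℝ v (y + s • z) z := by
    have h1 : ∫ s in (0 : ℝ)..ρ, -(C1 * S / R) = -(C1 * S / R) * ρ := by
      rw [intervalIntegral.integral_const]; simp; ring
    rw [← h1]
    refine intervalIntegral.integral_mono_on_of_le_Ioo hρ.le intervalIntegrable_const ?_ ?_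
    · rw [intervalIntegrable_iff]
      exact hprod.integral_prod_left
    · exact fun s hs => hJ s hs.1 hs.2.le
  have hray : ∀ z ∈ D, ∫ s in (0 : ℝ)..ρ, χ z * fderiv ℝ v (y + s • z) z =
      χ z * v (y + ρ • z) - χ z * v y := by
    intro z hz
    have h1 : ∀ s ∈ uIcc 0 ρ, HasDerivAt (fun s : ℝ => v (y + s • z))
        (fderiv ℝ v (y + s • z) z) s := by
      intro s hs
      rw [uIcc_of_le hρ.le] at hs
      have h2 := (hvd _ (hball (hmem s hs.1 hs.2 z hz))).hasFDerivAt
      have h3 : HasDerivAt (fun s : ℝ => y + s • z) z s := by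
        simpa using ((hasDerivAt_id s).smul_const z).const_add y
      exact h2.comp_hasDerivAt s h3
    have h4 : ContinuousOn (fun s : ℝ => fderiv ℝ v (y + s • z) z) (uIcc 0 ρ) := by
      refine ContinuousOn.clm_apply (hfd.comp (by fun_prop) ?_) continuousOn_const
      intro s hs
      rw [uIcc_of_le hρ.le] at hs
      exact hball (hmem s hs.1 hs.2 z hz)
    rw [intervalIntegral.integral_const_mul,
      intervalIntegral.integral_eq_sub_of_hasDerivAt h1 h4.intervalIntegrable]
    simp; ring
  have hχint : IntegrableOn χ D :=
    (continuous_meanWeight P mu).continuousOn.integrableOn_compact (isCompact_closedBall _ _)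
  have hvcont : ContinuousOn (fun z => v (y + ρ • z)) D :=
    hv1.continuousOn.comp (by fun_prop) fun z hz => hball (hmem ρ hρ.le le_rfl z hz)
  have hχv : IntegrableOn (fun z => χ z * v (y + ρ • z)) D :=
    ((continuous_meanWeight P mu).continuousOn.mul hvcont).integrableOn_compact
      (isCompact_closedBall _ _)
  have hmain : ∫ z in D, (χ z * v (y + ρ • z) - χ z * v y) =
      ∫ s in (0 : ℝ)..ρ, ∫ z in D, χ z * fderiv ℝ v (y + s • z) z := by
    rw [hswap]
    exact setIntegral_congr_fun Metric.isClosed_closedBall.measurableSet fun z hz =>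
      (hray z hz).symm
  rw [integral_sub hχv (hχint.mul_const _), integral_mul_const] at hmain
  have hup : ∫ z in D, χ z * v (y + ρ • z) ≤ 6 * mu * ((ρ ^ d)⁻¹ * ∫ x in closedBall y ρ, v x) := by
    have h1 := setIntegral_comp_affine v y hρ 1 zero_le_one
    rw [mul_one] at h1
    rw [← h1, ← integral_const_mul]
    refine setIntegral_mono_on hχv ((hvcont.integrableOn_compact
      (isCompact_closedBall _ _)).const_mul _) Metric.isClosed_closedBall.measurableSet ?_
    intro z hz
    have h2 : χ z ≤ 6 * mu := by
      rw [hχ, meanWeight]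
      exact mul_le_of_le_one_right (by positivity)
        (pow_le_one₀ (le_max_right _ _) (hPt.max_le_one z))
    exact mul_le_mul_of_nonneg_right h2 (hv0 _ (hmem ρ hρ.le le_rfl z hz))
  have hk := hκ' P hPt
  have hvy := hv0 y (mem_closedBall_self hρ.le)
  have h7 : κ * v y ≤ 6 * mu * ((ρ ^ d)⁻¹ * ∫ x in closedBall y ρ, v x) + C1 * (ρ / R * S) := by
    have h8 : κ * v y ≤ (∫ z in D, χ z) * v y := mul_le_mul_of_nonneg_right hk hvy
    have h9 : -(C1 * S / R) * ρ = -(C1 * (ρ / R * S)) := by ring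
    rw [h9] at hlow
    linarith
  have hI : 0 ≤ (ρ ^ d)⁻¹ * ∫ x in closedBall y ρ, v x := mul_nonneg (by positivity)
      (setIntegral_nonneg Metric.isClosed_closedBall.measurableSet fun x hx => hv0 x hx)
  have hE : 0 ≤ ρ / R * S := by positivity
  rw [← mul_add, div_mul_eq_mul_div, le_div_iff₀ hκ]
  nlinarith [mul_nonneg hmu0.le hE, mul_nonneg hC10 hI]

end MeanValue

/-! ### Absorption of the error term, and the Caccioppoli inequality -/

section Estimates

variable {lam Lam : ℝ}

/-- The mean value inequality for nonnegative functions with `divOp A v ≥ -(Λ/R²) v`. -/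
lemma exists_mean_value (hd : 0 < d) (hlam : 0 < lam) (hLam : 0 < Lam) :
    ∃ C : ℝ, 0 < C ∧ ∀ (A : 𝔼 d → 𝕄 d) (U : Set (𝔼 d)) (c : 𝔼 d) (R : ℝ)
    (v : 𝔼 d → ℝ), IsOpen U → 0 < R →
    closedBall c R ⊆ U → EllipticOn A U lam Lam (Lam / R) → ContDiffOn ℝ 2 v U →
    (∀ x ∈ closedBall c R, 0 ≤ v x) → (∀ x ∈ closedBall c R, -(Lam / R ^ 2 * v x) ≤ divOp A v x) →
    R ^ d * v c ≤ C * ∫ x in closedBall c R, v x := by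
  obtain ⟨C, hC, hmv⟩ := exists_mean_value_with_error hd hlam hLam
  -- `θ` is chosen so that the error term can be absorbed
  set θ : ℝ := min (1 / 2) (1 / (2 * C * 2 ^ d)) with hθ
  have hθ0 : 0 < θ := by positivity
  have hθ1 : θ ≤ 1 / 2 := min_le_left _ _
  have hθ2 : C * (θ * 2 ^ d) ≤ 1 / 2 := by
    have : θ ≤ 1 / (2 * C * 2 ^ d) := min_le_right _ _
    rw [le_div_iff₀ (by positivity)] at this
    linarith
  refine ⟨2 * C * (θ ^ d)⁻¹, by positivity, ?_⟩
  intro A U c R v hU hR hball hA hv hv0 hdiv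
  have hvc : ContinuousOn v (closedBall c R) := hv.continuousOn.mono hball
  have hcm : c ∈ closedBall c R := mem_closedBall_self hR.le
  have hI : 0 ≤ ∫ x in closedBall c R, v x :=
    setIntegral_nonneg Metric.isClosed_closedBall.measurableSet fun x hx => hv0 x hx
  -- if `y` maximizes this function, `v ≤ 2^d v(y)` on the ball of radius `(R - |y - c|) / 2`
  obtain ⟨y, hy, hmax⟩ := (isCompact_closedBall c R).exists_isMaxOn ⟨c, hcm⟩
    (f := fun y => (R - dist y c) ^ d * v y) (ContinuousOn.mul (by fun_prop) hvc)
  have hmax' : ∀ x ∈ closedBall c R, (R - dist x c) ^ d * v x ≤ (R - dist y c) ^ d * v y :=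
    fun x hx => hmax hx
  have hyR : dist y c ≤ R := hy
  set δ : ℝ := R - dist y c with hδ
  have hc := hmax' c hcm
  rw [dist_self, sub_zero] at hc
  refine hc.trans ?_
  rcases (sub_nonneg.2 hyR).eq_or_lt with h0 | hδ0
  · rw [hδ, ← h0, zero_pow hd.ne', zero_mul]
    positivity
  have hρ : 0 < θ * δ := mul_pos hθ0 hδ0
  have hδR : δ ≤ R := by rw [hδ]; linarith [dist_nonneg (x := y) (y := c)]
  have hρδ : θ * δ ≤ δ / 2 := by nlinarith
  have hdist : ∀ x ∈ closedBall y (θ * δ), δ / 2 ≤ R - dist x c := by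
    intro x hx
    have h1 : dist x y ≤ θ * δ := hx
    have := dist_triangle x y c
    rw [hδ] at hρδ h1 ⊢
    linarith
  have hsub : closedBall y (θ * δ) ⊆ closedBall c R := by
    intro x hx
    have := hdist x hx
    rw [Metric.mem_closedBall]
    linarith
  have hvS : ∀ x ∈ closedBall y (θ * δ), v x ≤ 2 ^ d * v y := by
    intro x hx
    have h1 : (δ / 2) ^ d * v x ≤ δ ^ d * v y :=
      (mul_le_mul_of_nonneg_right (pow_le_pow_left₀ (by positivity) (hdist x hx) d)
        (hv0 x (hsub hx))).trans (hmax' x (hsub hx))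
    have h2 : δ ^ d * v x ≤ δ ^ d * (2 ^ d * v y) := by
      rw [div_pow, div_mul_eq_mul_div, div_le_iff₀ (by positivity)] at h1
      linarith
    exact le_of_mul_le_mul_left h2 (by positivity)
  have h := hmv A U y (θ * δ) R (2 ^ d * v y) v hU hρ (by linarith) (hsub.trans hball) hA hv
    (fun x hx => hv0 x (hsub hx)) hvS (fun x hx => hdiv x (hsub hx))
  have hvy := hv0 y hy
  have h1 : C * (θ * δ / R * (2 ^ d * v y)) ≤ 1 / 2 * v y := by
    have h2 : δ / R ≤ 1 := (div_le_one hR).2 hδR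
    have h3 : C * (θ * δ / R * (2 ^ d * v y)) = C * (θ * 2 ^ d) * v y * (δ / R) := by ring
    rw [h3]
    calc _ ≤ C * (θ * 2 ^ d) * v y := mul_le_of_le_one_right (by positivity) h2
      _ ≤ _ := mul_le_mul_of_nonneg_right hθ2 hvy
  have hint : ∫ x in closedBall y (θ * δ), v x ≤ ∫ x in closedBall c R, v x := by
    refine setIntegral_mono_set (hvc.integrableOn_compact (isCompact_closedBall _ _)) ?_
      (LE.le.eventuallyLE hsub)
    filter_upwards [ae_restrict_mem Metric.isClosed_closedBall.measurableSet] with x hx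
      using hv0 x hx
  have h4 : v y ≤ 2 * (C * (((θ * δ) ^ d)⁻¹ * ∫ x in closedBall c R, v x)) := by
    have h5 : C * (((θ * δ) ^ d)⁻¹ * ∫ x in closedBall y (θ * δ), v x) ≤
      C * (((θ * δ) ^ d)⁻¹ * ∫ x in closedBall c R, v x) := by gcongr
    linarith
  calc δ ^ d * v y ≤ δ ^ d * (2 * (C * (((θ * δ) ^ d)⁻¹ * ∫ x in closedBall c R, v x))) := by gcongr
    _ = _ := by
        have hδd : δ ^ d ≠ 0 := by positivity
        rw [mul_pow, mul_inv]
        calc _ = δ ^ d * (δ ^ d)⁻¹ * (2 * C * (θ ^ d)⁻¹ * ∫ x in closedBall c R, v x) := by ring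
          _ = _ := by rw [mul_inv_cancel₀ hδd, one_mul]

lemma isTestMatrix_one : IsTestMatrix (1 : 𝕄 d) 1 where
  symm i j := by rw [Matrix.one_apply, Matrix.one_apply]; simp [eq_comm]
  lower z := by
    rw [norm_sq_eq_sum]
    simp [quadForm, Matrix.one_apply, pow_two]
  upper i j := by
    rw [Matrix.one_apply]
    split_ifs <;> simp

lemma quadForm_one (z : 𝔼 d) : quadForm (1 : 𝕄 d) z = ‖z‖ ^ 2 := by
  rw [norm_sq_eq_sum]
  simp [quadForm, Matrix.one_apply, pow_two]

lemma EllipticOn.abs_divOp_testFun_le {A : 𝔼 d → 𝕄 d} {U : Set (𝔼 d)} {eps : ℝ}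
    (hA : EllipticOn A U lam Lam eps) (hU : IsOpen U) {P : 𝕄 d} {B : ℝ} (hP : IsTestMatrix P B)
    {x : 𝔼 d} (hx : x ∈ U) : |divOp A (testFun P) x| ≤
    d ^ 2 * (Lam * (24 * (d * B) ^ 2 + 6 * B)) + d ^ 2 * (eps * (6 * (d * B))) := by
  rw [divOp_eq (fun i j => ((hA.contDiffOn i j).contDiffAt (hU.mem_nhds hx)).differentiableAt
    (by simp)) (contDiff_testFun P).contDiffAt]
  simp only [sum_mul]
  exact (abs_add_le _ _).trans (add_le_add
    (abs_sum_sum_mul_le (hA.elliptic x hx).upper fun i j => hP.abs_pd_pd_le j i x)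
    (abs_sum_sum_mul_le (fun j i => hA.deriv_le x hx i j i) fun j _ => hP.abs_pd_le j x))

/-- The total mass of `divOp A w` is controlled by the size of `w` on a ball of twice the
radius, if it is nonnegative there. -/
lemma exists_integral_divOp_le (d : ℕ) (hLam : 0 < Lam) : ∃ C : ℝ, 0 < C ∧ ∀ (A : 𝔼 d → 𝕄 d)
    (U : Set (𝔼 d)) (c : 𝔼 d) (R S : ℝ) (w : 𝔼 d → ℝ), IsOpen U → 0 < R →
    closedBall c R ⊆ U → EllipticOn A U lam Lam (Lam / R) → ContDiffOn ℝ 2 w U →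
    (∀ x ∈ closedBall c R, |w x| ≤ S) → (∀ x ∈ closedBall c R, 0 ≤ divOp A w x) →
    R ^ 2 * ∫ x in closedBall c (R / 2), divOp A w x ≤ C * (R ^ d * S) := by
  set K : ℝ := d ^ 2 * (Lam * (24 * (d * 1) ^ 2 + 6 * 1)) + d ^ 2 * (Lam * (6 * (d * 1))) with hK
  have hK0 : 0 ≤ K := by positivity
  set D : Set (𝔼 d) := closedBall 0 1 with hD
  refine ⟨64 / 27 * (K * volume.real D) + 1, by positivity, ?_⟩
  intro A U c R S w hU hR hball hA hw hwS hdiv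
  -- rescaling to the unit ball
  set A' : 𝔼 d → 𝕄 d := fun z => A (c + R • z) with hA'
  set w' : 𝔼 d → ℝ := fun z => w (c + R • z) with hw'
  set U' := (fun z => c + R • z) ⁻¹' U with hU'
  have hU'o : IsOpen U' := hU.preimage (continuous_affine c R)
  have hEll : EllipticOn A' U' lam Lam Lam := by
    have := hA.comp_affine hU c hR.le
    rwa [mul_div_cancel₀ _ hR.ne'] at this
  have hmem : ∀ z ∈ D, c + R • z ∈ closedBall c R := by
    intro z hz
    rw [mem_closedBall_iff_norm, add_sub_cancel_left, norm_smul, norm_of_nonneg hR.le]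
    have : ‖z‖ ≤ 1 := mem_closedBall_zero_iff.1 hz
    nlinarith
  have hDU : D ⊆ U' := fun z hz => hball (hmem z hz)
  have hw2 : ContDiffOn ℝ 2 w' U' := contDiffOn_comp_affine hw c R
  have hscale : ∀ z ∈ D, divOp A' w' z = R ^ 2 * divOp A w (c + R • z) := fun z hz =>
    divOp_comp_affine hA.contDiffOn hU hw (hDU hz)
  set ψ := testFun (1 : 𝕄 d) with hψ
  have hP := isTestMatrix_one (d := d)
  have hψU : tsupport ψ ⊆ U' := hP.tsupport_subset.trans hDU
  have hψ2 : ContDiff ℝ 2 ψ := contDiff_testFun 1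
  have hself := integral_divOp_mul hU'o hEll.contDiffOn (fun y hy => (hEll.elliptic y hy).symm) hw2
    hψ2 hψU hP.hasCompactSupport
  have hdc : ContinuousOn (divOp A' w') U' := by
    have h1 : ∀ i, ContDiffOn ℝ 1 (fun z => ∑ j, A' z i j * pd j w' z) U' := fun i =>
      ContDiffOn.sum fun j _ => (hEll.contDiffOn i j).mul (contDiffOn_pd hU'o hw2 j (by norm_num))
    unfold divOp
    exact continuousOn_finsetSum _ fun i _ => continuousOn_pd hU'o (h1 i) i
  have hcb : ∀ z, z ∉ D → ψ z = 0 := fun z hz =>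
    image_eq_zero_of_notMem_tsupport fun h => hz (hP.tsupport_subset h)
  -- the upper bound
  have hup : ∫ x, w' x * divOp A' ψ x ≤ S * K * volume.real D := by
    have hz : ∀ z, z ∉ D → w' z * divOp A' ψ z = 0 := by
      intro z hz
      have hzt : z ∉ tsupport ψ := fun h => hz (hP.tsupport_subset h)
      have hz0 : divOp A' ψ z = 0 := by
        unfold divOp
        refine sum_eq_zero fun i _ => ?_
        have : (fun z => ∑ j, A' z i j * pd j ψ z) =ᶠ[𝓝 z] fun _ => 0 := by
          filter_upwards [(isClosed_tsupport ψ).isOpen_compl.mem_nhds hzt] with x hx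
          refine sum_eq_zero fun j _ => ?_
          rw [image_eq_zero_of_notMem_tsupport fun h' => hx (tsupport_pd_subset ψ j h'), mul_zero]
        rw [pd_congr i this, pd_const]
      rw [hz0, mul_zero]
    rw [← setIntegral_eq_integral_of_forall_compl_eq_zero (s := D) hz]
    refine (le_abs_self _).trans ?_
    rw [← norm_eq_abs]
    refine norm_setIntegral_le_of_norm_le_const (isCompact_closedBall _ _).measure_lt_top
      fun x hx => ?_
    rw [norm_eq_abs, abs_mul]
    exact mul_le_mul (hwS _ (hmem x hx)) (hEll.abs_divOp_testFun_le hU'o hP (hDU hx))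
      (abs_nonneg _) ((abs_nonneg _).trans (hwS _ (hmem x hx)))
  -- the lower bound
  have hlow : 27 / 64 * ∫ z in closedBall (0 : 𝔼 d) (1 / 2),
      divOp A' w' z ≤ ∫ x, divOp A' w' x * ψ x := by
    have hsub : closedBall (0 : 𝔼 d) (1 / 2) ⊆ D := closedBall_subset_closedBall (by norm_num)
    have hfull := setIntegral_eq_integral_of_forall_compl_eq_zero (μ := volume) (s := D)
      (f := fun x => divOp A' w' x * ψ x) fun z hz => by simp only [hcb z hz, mul_zero]
    rw [← hfull, ← integral_const_mul]
    have hi : IntegrableOn (fun x => divOp A' w' x * ψ x) D :=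
      ((hdc.mono hDU).mul hψ2.continuous.continuousOn).integrableOn_compact
        (isCompact_closedBall _ _)
    have hnn : ∀ z ∈ D, 0 ≤ divOp A' w' z := fun z hz => by
      rw [hscale z hz]
      exact mul_nonneg (by positivity) (hdiv _ (hmem z hz))
    refine le_trans ?_ (setIntegral_mono_set hi ?_ (LE.le.eventuallyLE hsub))
    · refine setIntegral_mono_on (((hdc.mono (hsub.trans hDU)).integrableOn_compact
        (isCompact_closedBall _ _)).const_mul _) (hi.mono_set hsub)
        Metric.isClosed_closedBall.measurableSet fun z hz => ?_
      rw [mul_comm]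
      refine mul_le_mul_of_nonneg_left ?_ (hnn z (hsub hz))
      have h1 : ‖z‖ ≤ 1 / 2 := mem_closedBall_zero_iff.1 hz
      have h2 : 3 / 4 ≤ max (1 - ‖z‖ ^ 2) 0 := le_max_of_le_left (by nlinarith [norm_nonneg z])
      rw [hψ, testFun, quadForm_one]
      calc (27 / 64 : ℝ) = (3 / 4) ^ 3 := by norm_num
        _ ≤ _ := pow_le_pow_left₀ (by norm_num) h2 3
    · filter_upwards [ae_restrict_mem Metric.isClosed_closedBall.measurableSet] with x hx
        using mul_nonneg (hnn x hx) (testFun_nonneg _ _)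
  have heq : ∫ z in closedBall (0 : 𝔼 d) (1 / 2), divOp A' w' z =
      R ^ 2 * ((R ^ d)⁻¹ * ∫ x in closedBall c (R / 2), divOp A w x) := by
    have h1 := setIntegral_comp_affine (divOp A w) c hR (1 / 2) (by norm_num)
    rw [show R * (1 / 2) = R / 2 by ring] at h1
    rw [← h1, ← integral_const_mul]
    exact setIntegral_congr_fun Metric.isClosed_closedBall.measurableSet fun z hz =>
      hscale z (closedBall_subset_closedBall (by norm_num) hz)
  rw [heq, hself] at hlow
  have hS : 0 ≤ S := (abs_nonneg _).trans (hwS c (mem_closedBall_self hR.le))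
  have hRd : 0 < R ^ d := by positivity
  have h3 : R ^ 2 * ((R ^ d)⁻¹ * ∫ x in closedBall c (R / 2), divOp A w x) ≤
      64 / 27 * (S * K * volume.real D) := by linarith
  calc R ^ 2 * ∫ x in closedBall c (R / 2), divOp A w x =
        R ^ d * (R ^ 2 * ((R ^ d)⁻¹ * ∫ x in closedBall c (R / 2), divOp A w x)) := by
        field_simp
    _ ≤ R ^ d * (64 / 27 * (S * K * volume.real D)) := by gcongr
    _ ≤ _ := by nlinarith [mul_nonneg hRd.le hS]

end Estimates

lemma deriv_deriv_nonpos_of_isLocalMax {f : ℝ → ℝ} {x : ℝ} (h : IsLocalMax f x)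
    (hf : ContinuousAt f x) : deriv (deriv f) x ≤ 0 := by
  by_contra! hpos
  have h1 := isLocalMin_of_deriv_deriv_pos hpos h.deriv_eq_zero hf
  -- a point which is a local minimum and a local maximum
  have h2 : f =ᶠ[𝓝 x] fun _ => f x := by
    filter_upwards [h, h1] with z hz1 hz2
    exact le_antisymm hz1 hz2
  have h3 : deriv f =ᶠ[𝓝 x] fun _ => 0 := by
    filter_upwards [h2.eventuallyEq_nhds] with z hz
    rw [hz.deriv_eq, deriv_const]
  rw [h3.deriv_eq, deriv_const] at hpos
  exact lt_irrefl _ hpos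

lemma sum_pd_pd_nonpos_of_isLocalMax {v : 𝔼 d → ℝ} {y : 𝔼 d} (h : IsLocalMax v y)
    (hv : ContDiffAt ℝ 2 v y) (b : 𝔼 d) : ∑ i, ∑ j, b i * b j * pd i (pd j v) y ≤ 0 := by
  have hl : ∀ s : ℝ, HasDerivAt (fun s : ℝ => y + s • b) b s := fun s => by
    simpa using ((hasDerivAt_id s).smul_const b).const_add y
  have hc : Continuous fun s : ℝ => y + s • b := by fun_prop
  have ht : Tendsto (fun s : ℝ => y + s • b) (𝓝 0) (𝓝 y) := by simpa using hc.tendsto 0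
  have hdir : ∀ z w, fderiv ℝ v z w = ∑ j, w j * pd j v z := fun z w => fderiv_eq_sum_pd v z w
  have h1 : deriv (fun s : ℝ => v (y + s • b)) =ᶠ[𝓝 0] fun s => ∑ j, b j * pd j v (y + s • b) := by
    have h2 : ∀ᶠ z in 𝓝 y, DifferentiableAt ℝ v z :=
      (hv.eventually (by simp)).mono fun z hz => hz.differentiableAt (by simp)
    filter_upwards [ht.eventually h2] with s hs
    rw [← hdir]
    exact (hs.hasFDerivAt.comp_hasDerivAt s (hl s)).deriv
  have h3 : HasDerivAt (fun s : ℝ => ∑ j, b j * pd j v (y + s • b))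
      (∑ j, b j * ∑ i, b i * pd i (pd j v) y) 0 := by
    refine HasDerivAt.fun_sum fun j _ => HasDerivAt.const_mul _ ?_
    have h4 : DifferentiableAt ℝ (pd j v) (y + (0 : ℝ) • b) := by
      rw [zero_smul, add_zero]
      exact differentiableAt_pd j hv
    have h5 := h4.hasFDerivAt.comp_hasDerivAt (0 : ℝ) (hl 0)
    rw [fderiv_eq_sum_pd, zero_smul, add_zero] at h5
    exact h5
  have hmax : IsLocalMax (fun s : ℝ => v (y + s • b)) 0 := by
    have := ht.eventually h
    simpa [IsLocalMax, IsMaxFilter] using this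
  have hcont : ContinuousAt (fun s : ℝ => v (y + s • b)) 0 :=
    ContinuousAt.comp (g := v) (by simpa using hv.continuousAt) hc.continuousAt
  have h6 := deriv_deriv_nonpos_of_isLocalMax hmax hcont
  rw [h1.deriv_eq, h3.deriv] at h6
  refine le_trans (le_of_eq ?_) h6
  rw [sum_comm]
  refine sum_ext fun j => ?_
  rw [mul_sum]
  exact sum_ext fun i => by ring

open scoped MatrixOrder in
lemma IsEllipticMatrix.exists_eq_sum {A : 𝕄 d} {lam Lam : ℝ} (hA : IsEllipticMatrix A lam Lam)
    (hlam : 0 ≤ lam) : ∃ B : 𝕄 d, ∀ i j, A i j = ∑ k, B k i * B k j := by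
  have hs : A.PosSemidef := by
    refine Matrix.PosSemidef.of_dotProduct_mulVec_nonneg ?_ fun x => ?_
    · ext i j; simp [hA.symm i j]
    · have h1 := hA.lower x
      have h2 : star x ⬝ᵥ A.mulVec x = ∑ i, ∑ j, A i j * x i * x j := by
        simp only [dotProduct, mulVec, Pi.star_apply, star_trivial, mul_sum]
        exact sum_ext fun _ => sum_ext fun _ => by ring
      rw [h2]
      exact le_trans (by positivity) h1
  obtain ⟨B, hB⟩ := (CStarAlgebra.nonneg_iff_eq_star_mul_self).1 hs.nonneg
  refine ⟨B, fun i j => ?_⟩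
  rw [hB]
  simp [Matrix.mul_apply, Matrix.star_apply]

/-- At a local maximum the gradient vanishes and the Hessian is nonpositive; write the matrix as a
sum of squares. -/
lemma divOp_nonpos_of_isLocalMax {A : 𝔼 d → 𝕄 d} {v : 𝔼 d → ℝ} {y : 𝔼 d} {lam Lam : ℝ}
    (hA : ∀ i j, DifferentiableAt ℝ (A · i j) y) (hAe : IsEllipticMatrix (A y) lam Lam)
    (hlam : 0 ≤ lam) (hv : ContDiffAt ℝ 2 v y) (h : IsLocalMax v y) : divOp A v y ≤ 0 := by
  rw [divOp_eq hA hv]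
  have h0 : ∀ j, pd j v y = 0 := fun j => by rw [pd, h.fderiv_eq_zero]; rfl
  simp only [h0, mul_zero, sum_const_zero, add_zero]
  obtain ⟨B, hB⟩ := hAe.exists_eq_sum hlam
  have h1 : ∑ i, ∑ j, A y i j * pd i (pd j v) y =
      ∑ k, ∑ i, ∑ j, B k i * B k j * pd i (pd j v) y := by
    rw [sum_comm]
    simp only [hB, sum_mul]
    rw [sum_comm]
    refine Eq.trans ?_ sum_comm
    refine sum_ext fun i => ?_
    rw [sum_comm]
  rw [h1]
  exact Finset.sum_nonpos fun k _ => sum_pd_pd_nonpos_of_isLocalMax h hv (toLp 2 (B k))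

lemma divOp_sub {A : 𝔼 d → 𝕄 d} {v w : 𝔼 d → ℝ} {y : 𝔼 d}
    (hA : ∀ i j, DifferentiableAt ℝ (A · i j) y) (hv : ContDiffAt ℝ 2 v y)
    (hw : ContDiffAt ℝ 2 w y) :
    divOp A (fun z => v z - w z) y = divOp A v y - divOp A w y := by
  have h1 : ∀ j, pd j (fun z => v z - w z) =ᶠ[𝓝 y] fun z => pd j v z - pd j w z := fun j => by
    filter_upwards [hv.eventually (by simp), hw.eventually (by simp)] with z h1 h2
    exact pd_sub j (h1.differentiableAt (by simp)) (h2.differentiableAt (by simp))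
  have h2 : ∀ i j, pd i (pd j fun z => v z - w z) y = pd i (pd j v) y - pd i (pd j w) y :=
    fun i j => by
      rw [pd_congr i (h1 j), pd_sub]
      · exact differentiableAt_pd j hv
      · exact differentiableAt_pd j hw
  rw [divOp_eq hA hv, divOp_eq hA hw, divOp_eq hA (hv.sub hw)]
  simp only [h2, (h1 _).eq_of_nhds, mul_sub, sum_sub_distrib]
  ring

lemma divOp_const_mul {A : 𝔼 d → 𝕄 d} {v : 𝔼 d → ℝ} {y : 𝔼 d}
    (hA : ∀ i j, DifferentiableAt ℝ (A · i j) y) (hv : ContDiffAt ℝ 2 v y) (c : ℝ) :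
    divOp A (fun z => c * v z) y = c * divOp A v y := by
  have h1 : ∀ j, pd j (fun z => c * v z) =ᶠ[𝓝 y] fun z => c * pd j v z := fun j => by
    filter_upwards [hv.eventually (by simp)] with z h1
    exact pd_const_mul j c (h1.differentiableAt (by simp))
  have h2 : ∀ i j, pd i (pd j fun z => c * v z) y = c * pd i (pd j v) y := fun i j => by
      rw [pd_congr i (h1 j), pd_const_mul]
      exact differentiableAt_pd j hv
  rw [divOp_eq hA hv, divOp_eq hA (contDiffAt_const.mul hv)]
  simp only [h2, (h1 _).eq_of_nhds, mul_add, mul_sum]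
  congr 1
  · exact sum_ext fun _ => sum_ext fun _ => by ring
  · exact sum_ext fun _ => by ring

/-- The chain rule for the composition with a function of one variable. -/
lemma divOp_comp_real {A : 𝔼 d → 𝕄 d} {v : 𝔼 d → ℝ} {y : 𝔼 d}
    (hA : ∀ i j, DifferentiableAt ℝ (A · i j) y) (hv : ContDiffAt ℝ 2 v y) {φ φ' : ℝ → ℝ} {φ'' : ℝ}
    (hφ : ∀ x, HasDerivAt φ (φ' x) x) (hφ' : HasDerivAt φ' φ'' (v y)) (hφ2 : ContDiff ℝ 2 φ) :
    divOp A (fun z => φ (v z)) y =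
    φ'' * ∑ i, ∑ j, A y i j * pd i v y * pd j v y + φ' (v y) * divOp A v y := by
  have h1 : ∀ j, pd j (fun z => φ (v z)) =ᶠ[𝓝 y] fun z => φ' (v z) * pd j v z := fun j => by
    filter_upwards [hv.eventually (by simp)] with z h1
    exact pd_comp_real j (hφ _) (h1.differentiableAt (by simp))
  have hv1 : DifferentiableAt ℝ v y := hv.differentiableAt (by simp)
  have h2 : ∀ i j, pd i (pd j fun z => φ (v z)) y =
      φ'' * pd i v y * pd j v y + φ' (v y) * pd i (pd j v) y := fun i j => by
    rw [pd_congr i (h1 j), pd_mul (f := fun z => φ' (v z)), pd_comp_real i hφ' hv1]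
    · exact hφ'.differentiableAt.comp y hv1
    · exact differentiableAt_pd j hv
  rw [divOp_eq hA hv, divOp_eq hA (v := fun z => φ (v z)) (hφ2.contDiffAt.comp y hv)]
  simp only [h2, (h1 _).eq_of_nhds, mul_add, mul_sum, sum_add_distrib, add_assoc]
  congr 1
  · exact sum_ext fun _ => sum_ext fun _ => by ring
  congr 1
  · exact sum_ext fun _ => sum_ext fun _ => by ring
  · exact sum_ext fun _ => by ring

lemma divOp_smul {A : 𝔼 d → 𝕄 d} {v w : 𝔼 d → ℝ} {y : 𝔼 d}
    (hA : ∀ i j, DifferentiableAt ℝ (A · i j) y) (hw : DifferentiableAt ℝ w y)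
    (hv : ContDiffAt ℝ 2 v y) : divOp (fun z => w z • A z) v y =
    w y * divOp A v y + ∑ i, ∑ j, A y i j * pd i w y * pd j v y := by
  rw [divOp_eq hA hv, divOp_eq (fun i j => by
    simp only [Matrix.smul_apply, smul_eq_mul]; exact hw.fun_mul (hA i j)) hv]
  simp only [Matrix.smul_apply, smul_eq_mul, pd_mul _ hw (hA _ _), sum_add_distrib,
    mul_add, add_mul, mul_sum, sum_mul]
  have e1 : ∑ i, ∑ j, w y * A y i j * pd i (pd j v) y =
      ∑ i, ∑ j, w y * (A y i j * pd i (pd j v) y) :=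
    sum_ext fun _ => sum_ext fun _ => by ring
  have e2 : ∑ j, ∑ i, pd i w y * A y i j * pd j v y = ∑ i, ∑ j, A y i j * pd i w y * pd j v y := by
    rw [sum_comm]
    exact sum_ext fun _ => sum_ext fun _ => by ring
  have e3 : ∑ j, ∑ i, w y * pd i (A · i j) y * pd j v y =
      ∑ j, ∑ i, w y * (pd i (A · i j) y * pd j v y) :=
    sum_ext fun _ => sum_ext fun _ => by ring
  rw [e1, e2, e3]
  ring

/-! ### The barrier at the boundary -/

section Barrier

/-- The open half ball of radius `r` around `c`. -/
def halfBall (c : 𝕍) (r : ℝ) : Set 𝕍 := {y | 0 < y 0 ∧ dist y c < r}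

lemma isOpen_halfBall (c : 𝕍) (r : ℝ) : IsOpen (halfBall c r) := by
  have h1 : IsOpen {y : 𝕍 | 0 < y 0} := isOpen_lt continuous_const (by fun_prop)
  have h2 : IsOpen {y : 𝕍 | dist y c < r} := isOpen_lt (by fun_prop) continuous_const
  exact h1.inter h2

/-- The coefficient field of the Laplacian of a conformally compact metric: the singular factor
`(y 0)^(1 - n)` times a field which is regular up to the boundary. -/
def singularField (A : 𝕍 → 𝕄 (n + 1)) (y : 𝕍) : 𝕄 (n + 1) :=
  ((y 0) ^ (n - 1))⁻¹ • A y

/-- The function `r² - |y - c|²`. -/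
def bump (c : 𝕍) (r : ℝ) (y : 𝕍) : ℝ := r ^ 2 - ∑ i, (y i - c i) ^ 2

/-- The level sets of `tent c r` in the half ball shrink towards the boundary at the rim. -/
def tent (c : 𝕍) (r : ℝ) (y : 𝕍) : ℝ := y 0 * ((bump c r y) ^ 2)⁻¹

variable {c y : 𝔼 (n + 1)} {r : ℝ}

lemma bump_eq (c : 𝕍) (r : ℝ) (y : 𝕍) : bump c r y = r ^ 2 - dist y c ^ 2 := by
  rw [bump, dist_eq_norm, norm_sq_eq_sum]; rfl

lemma contDiff_bump (c : 𝕍) (r : ℝ) {k : ℕ∞ω} : ContDiff ℝ k (bump c r) := by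
  unfold bump
  fun_prop

lemma pd_bump (j : Fin (n + 1)) : pd j (bump c r) y = -2 * (y j - c j) := by
  have hd : ∀ i, DifferentiableAt ℝ (fun z : 𝕍 => z i - c i) y := fun i => by fun_prop
  have h1 : ∀ i, pd j (fun z : 𝕍 => z i - c i) y = if i = j then 1 else 0 := fun i => by
    rw [pd_sub (g := fun _ => c i) j (by fun_prop) (by fun_prop), pd_coord, pd_const, sub_zero]
  unfold bump
  rw [pd_sub (f := fun _ => r ^ 2) j (by fun_prop) (by fun_prop), pd_const,
    pd_sum _ _ fun i _ => by fun_prop]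
  have h2 : ∀ i, pd j (fun z : 𝕍 => (z i - c i) ^ 2) y =
      2 * (y i - c i) * if i = j then 1 else 0 := fun i => by
    have := pd_comp_real (φ := fun x => x ^ 2) (φ' := 2 * (y i - c i)) j
      (by simpa using hasDerivAt_pow 2 (y i - c i)) (hd i)
    rw [this, h1]
  simp [h2]

lemma contDiffAt_tent (hy : bump c r y ≠ 0) {k : ℕ∞ω} : ContDiffAt ℝ k (tent c r) y := by
  unfold tent
  refine ContDiffAt.mul (by fun_prop) (ContDiffAt.inv ?_ (pow_ne_zero 2 hy))
  exact (contDiff_bump c r).contDiffAt.pow 2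

lemma pd_bump_pow_inv (hy : bump c r y ≠ 0) (k : ℕ) (j : Fin (n + 1)) :
    pd j (fun z => ((bump c r z) ^ k)⁻¹) y = 2 * k * (y j - c j) * ((bump c r y) ^ (k + 1))⁻¹ := by
  have h := pd_comp_real (φ := fun x => (x ^ k)⁻¹) j
    (φ' := -(k * (bump c r y) ^ (k - 1)) / ((bump c r y) ^ k) ^ 2)
    ((hasDerivAt_pow k (bump c r y)).fun_inv (pow_ne_zero k hy))
    ((contDiff_bump c r (k := 1)).differentiable (by simp) y)
  rw [h, pd_bump]
  rcases k with _ | k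
  · simp
  · simp only [Nat.add_sub_cancel]
    field_simp
    ring

lemma pd_tent (hy : bump c r y ≠ 0) (j : Fin (n + 1)) :
    pd j (tent c r) y = (if 0 = j then 1 else 0) * ((bump c r y) ^ 2)⁻¹ +
    4 * (y 0 * (y j - c j) * ((bump c r y) ^ 3)⁻¹) := by
  have hd : ∀ k : ℕ, DifferentiableAt ℝ (fun z => ((bump c r z) ^ k)⁻¹) y := fun k =>
    (((contDiff_bump c r (k := 1)).differentiable (by simp) y).fun_pow k).fun_inv
      (pow_ne_zero k hy)
  unfold tent
  rw [pd_mul (f := fun z : 𝕍 => z 0) j (by fun_prop) (hd 2), pd_coord, pd_bump_pow_inv hy]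
  push_cast; ring

lemma pd_pd_tent (hy : bump c r y ≠ 0) (i j : Fin (n + 1)) : pd i (pd j (tent c r)) y =
    4 * ((if 0 = j then 1 else 0) * (y i - c i) + (if 0 = i then 1 else 0) * (y j - c j) +
    y 0 * (if j = i then 1 else 0)) * ((bump c r y) ^ 3)⁻¹ +
    24 * (y 0 * (y i - c i) * (y j - c j) * ((bump c r y) ^ 4)⁻¹) := by
  have hev : ∀ᶠ z in 𝓝 y, bump c r z ≠ 0 :=
    (contDiff_bump c r (k := 0)).continuous.continuousAt.eventually_ne hy
  have hd : ∀ k : ℕ, DifferentiableAt ℝ (fun z => ((bump c r z) ^ k)⁻¹) y := fun k =>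
    (((contDiff_bump c r (k := 1)).differentiable (by simp) y).fun_pow k).fun_inv
      (pow_ne_zero k hy)
  have hc : DifferentiableAt ℝ
      (fun z : 𝕍 => z 0 * (z j - c j)) y := by fun_prop
  rw [pd_congr i (hev.mono fun z hz => pd_tent hz j), pd_add i ((hd 2).const_mul _)
    ((hc.fun_mul (hd 3)).const_mul 4), pd_const_mul i _ (hd 2), pd_const_mul i _
    (hc.fun_mul (hd 3)), pd_mul i hc (hd 3), pd_bump_pow_inv hy, pd_bump_pow_inv hy,
    pd_mul (f := fun z : 𝕍 => z 0) i (by fun_prop) (by fun_prop),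
    pd_sub (g := fun _ => c j) i (by fun_prop) (by fun_prop), pd_coord, pd_coord, pd_const]
  push_cast; ring

/-- Real arithmetic: the error terms of the barrier are small compared to the leading term. -/
lemma barrier_arith {n : ℕ} {a0 e1 e2 X κ ρ x lam : ℝ} (hx : 0 < x) (ha : lam ≤ a0)
    (he1 : |e1| ≤ κ * (ρ * x)) (he2 : |e2| ≤ κ * (ρ * x)) (hX : |X| ≤ κ * (ρ * x)) (hκ : 0 ≤ κ)
    (hρ : 0 ≤ ρ) (hx1 : x ≤ 1) (hsmall : ((2 * n + 1) * (2 * n + 1) * κ) * ρ < (n + 1) * lam)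
    (hn : 1 ≤ n) : (n * (n - 1) * x ^ n - (n + 1) * n * x ^ (n + 1)) * (a0 + e1) +
    (n * x ^ n - (n + 1) * x ^ (n + 1)) * (-(n - 1) * (a0 + e2) + X) < 0 := by
  have hn' : (1 : ℝ) ≤ n := by exact_mod_cast hn
  have hxn : 0 < x ^ n := by positivity
  have hx2 : x ^ (n + 1) ≤ x ^ n := by rw [pow_succ]; exact mul_le_of_le_one_right hxn.le hx1
  have hx3 : 0 < x ^ (n + 1) := by positivity
  have hlead : (n * (n - 1) * x ^ n - (n + 1) * n * x ^ (n + 1)) * (a0 + e1) +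
      (n * x ^ n - (n + 1) * x ^ (n + 1)) * (-(n - 1) * (a0 + e2) + X) =
      -((n + 1) * a0 * x ^ (n + 1)) + (n * (n - 1) * x ^ n - (n + 1) * n * x ^ (n + 1)) * e1 +
      (n * x ^ n - (n + 1) * x ^ (n + 1)) * (-(n - 1) * e2 + X) := by ring
  rw [hlead]
  have hb1 : |n * (n - 1) * x ^ n - (n + 1) * n * x ^ (n + 1)| ≤ 2 * n ^ 2 * x ^ n := by
    rw [abs_le]
    constructor <;> nlinarith [mul_nonneg (sub_nonneg.2 hn') hxn.le,
      mul_nonneg (by positivity : (0 : ℝ) ≤ n) (sub_nonneg.2 hx2),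
      mul_nonneg (by positivity : (0 : ℝ) ≤ n ^ 2) (sub_nonneg.2 hx2),
      mul_nonneg (by positivity : (0 : ℝ) ≤ n) hxn.le,
      mul_nonneg (by positivity : (0 : ℝ) ≤ n) hx3.le,
      mul_nonneg (by positivity : (0 : ℝ) ≤ n ^ 2) hx3.le,
      mul_nonneg (by positivity : (0 : ℝ) ≤ (n : ℝ) * (n - 1)) hxn.le]
  have hb2 : |n * x ^ n - (n + 1) * x ^ (n + 1)| ≤ (2 * n + 1) * x ^ n := by
    rw [abs_le]
    constructor <;> nlinarith [mul_nonneg (by positivity : (0 : ℝ) ≤ n) hxn.le,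
      mul_nonneg (by positivity : (0 : ℝ) ≤ n) hx3.le,
      mul_nonneg (by positivity : (0 : ℝ) ≤ n) (sub_nonneg.2 hx2)]
  have hb3 : |-(n - 1) * e2 + X| ≤ n * (κ * (ρ * x)) := by
    calc _ ≤ |-(n - 1) * e2| + |X| := abs_add_le _ _
      _ ≤ (n - 1) * (κ * (ρ * x)) + κ * (ρ * x) := by
          rw [abs_mul, abs_neg, abs_of_nonneg (sub_nonneg.2 hn')]
          exact add_le_add (mul_le_mul_of_nonneg_left he2 (sub_nonneg.2 hn')) hX
      _ = _ := by ring
  have h1 : (n * (n - 1) * x ^ n - (n + 1) * n * x ^ (n + 1)) * e1 ≤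
      2 * n ^ 2 * x ^ n * (κ * (ρ * x)) :=
    (le_abs_self _).trans (by rw [abs_mul]; gcongr)
  have h2 : (n * x ^ n - (n + 1) * x ^ (n + 1)) * (-(n - 1) * e2 + X) ≤
      (2 * n + 1) * x ^ n * (n * (κ * (ρ * x))) :=
    (le_abs_self _).trans (by rw [abs_mul]; gcongr)
  have h3 : 2 * n ^ 2 * x ^ n * (κ * (ρ * x)) + (2 * n + 1) * x ^ n * (n * (κ * (ρ * x))) ≤
      (((2 * n + 1) * (2 * n + 1) * κ) * ρ) * x ^ (n + 1) := by
    have : 2 * (n : ℝ) ^ 2 * x ^ n * (κ * (ρ * x)) + (2 * n + 1) * x ^ n * (n * (κ * (ρ * x))) =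
      ((2 * n ^ 2 + (2 * n + 1) * n) * κ * ρ) * x ^ (n + 1) := by ring
    rw [this]
    refine mul_le_mul_of_nonneg_right ?_ hx3.le
    refine mul_le_mul_of_nonneg_right ?_ hρ
    refine mul_le_mul_of_nonneg_right ?_ hκ
    nlinarith
  have h4 : (((2 * n + 1) * (2 * n + 1) * κ) * ρ) * x ^ (n + 1) < (n + 1) * lam * x ^ (n + 1) :=
    mul_lt_mul_of_pos_right hsmall hx3
  have h5 : (n + 1) * lam * x ^ (n + 1) ≤ (n + 1) * a0 * x ^ (n + 1) := by gcongr
  linarith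

set_option maxHeartbeats 1000000 in
/-- The barrier: `tent ^ n - tent ^ (n + 1)` is a strict supersolution below the tent. -/
lemma exists_barrier (hn : 2 ≤ n) {lam Lam : ℝ} (hlam : 0 < lam) (hLam : 0 < Lam) :
    ∃ r₁ : ℝ, 0 < r₁ ∧ ∀ (A : 𝕍 → 𝕄 (n + 1)) (U : Set 𝕍) (c y : 𝕍) (r : ℝ), IsOpen U → y ∈ U →
    EllipticOn A U lam Lam Lam → 0 < r → r ≤ r₁ → 0 < y 0 → 0 < bump c r y →
    2 * y 0 ≤ (bump c r y) ^ 2 →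
    divOp (singularField A) (fun z => tent c r z ^ n - tent c r z ^ (n + 1)) y < 0 := by
  set κ : ℝ := 41 * (n + 1) ^ 2 * Lam with hκ
  have hκ0 : 0 < κ := by positivity
  set K : ℝ := (2 * n + 1) * (2 * n + 1) * κ with hK
  have hK0 : 0 < K := by positivity
  refine ⟨min 1 ((n + 1) * lam / (2 * K)), by positivity, ?_⟩
  intro A U c y r hU hyU hA hr hr1 hy0 hη hytent
  have hrone : r ≤ 1 := hr1.trans (min_le_left _ _)
  have hrK : K * r < (n + 1) * lam := by
    have h1 : r ≤ (n + 1) * lam / (2 * K) := hr1.trans (min_le_right _ _)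
    rw [le_div_iff₀ (by positivity)] at h1
    have : 0 < (n + 1) * lam := by positivity
    linarith
  set η := bump c r y with hηdef
  have hη1 : η ≤ r ^ 2 := by rw [hηdef, bump_eq]; linarith [sq_nonneg (dist y c)]
  have hr2 : r ^ 2 ≤ r := by nlinarith
  have hηr : η ≤ r := hη1.trans hr2
  have hη2 : η ^ 2 ≤ r := by nlinarith
  have hηone : η ≤ 1 := hηr.trans hrone
  have hdist : dist y c ≤ r := by
    have : 0 < r ^ 2 - dist y c ^ 2 := by rw [← bump_eq]; exact hη
    nlinarith [dist_nonneg (x := y) (y := c)]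
  have hcoord : ∀ j, |y j - c j| ≤ r := fun j =>
    (abs_coord_le (y - c) j).trans (by rwa [← dist_eq_norm])
  set x := tent c r y with hx
  have hxdef : x = y 0 * (η ^ 2)⁻¹ := rfl
  have hyx : y 0 = x * η ^ 2 := by rw [hxdef]; field_simp
  have hx0 : 0 < x := by rw [hxdef]; positivity
  have hx1 : x ≤ 1 / 2 := by rw [hxdef, ← div_eq_mul_inv, div_le_iff₀ (by positivity)]; linarith
  have hrx : 0 < r * x := by positivity
  have hd : ∀ i j, DifferentiableAt ℝ (A · i j) y := fun i j =>
    ((hA.contDiffOn i j).contDiffAt (hU.mem_nhds hyU)).differentiableAt (by simp)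
  have htent : ContDiffAt ℝ 2 (tent c r) y := contDiffAt_tent hη.ne'
  set δ : Fin (n + 1) → ℝ := fun j => if 0 = j then 1 else 0 with hδ
  have hδ1 : ∀ j, |δ j| ≤ 1 := fun j => by simp only [hδ]; split_ifs <;> simp
  set ε : Fin (n + 1) → ℝ := fun j => 4 * (y 0 * (y j - c j) * η⁻¹) with hε
  have hε1 : ∀ j, |ε j| ≤ 4 * (r * x) := by
    intro j
    have h1 : ε j = 4 * (x * η * (y j - c j)) := by simp only [hε]; rw [hyx]; field_simp
    rw [h1, abs_mul, abs_mul, abs_of_pos (by norm_num : (0 : ℝ) < 4), abs_of_pos (by positivity)]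
    have h2 : x * η * |y j - c j| ≤ x * 1 * r := by gcongr; exact hcoord j
    linarith
  have hrx1 : r * x ≤ 1 := by nlinarith
  have hgrad : ∀ j, pd j (tent c r) y = (η ^ 2)⁻¹ * (δ j + ε j) := by
    intro j
    rw [pd_tent hη.ne']
    simp only [hδ, hε]
    rw [← hηdef]
    field_simp
  have hAup := (hA.elliptic y hyU).upper
  set a := A y 0 0 with ha
  have halam : lam ≤ a := by
    have h := (hA.elliptic y hyU).lower (Pi.single 0 1)
    simpa [Pi.single_apply] using h
  -- the three error terms
  set e1 : ℝ := ∑ i, ∑ j, A y i j * (δ i * ε j + ε i * δ j + ε i * ε j) with he1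
  set e2 : ℝ := ∑ j, A y 0 j * ε j with he2
  set X : ℝ := y 0 * η ^ 2 * divOp A (tent c r) y with hX
  have hQ : ∑ i, ∑ j, A y i j * pd i (tent c r) y * pd j (tent c r) y = (η ^ 4)⁻¹ * (a + e1) := by
    have h1 : a = ∑ i, ∑ j, A y i j * (δ i * δ j) := by simp [hδ, ha]
    rw [h1, he1, ← sum_add_distrib, mul_sum]
    refine sum_ext fun i => ?_
    rw [← sum_add_distrib, mul_sum]
    refine sum_ext fun j => ?_
    rw [hgrad, hgrad]
    field_simp
    ring
  have hL : ∑ j, A y 0 j * pd j (tent c r) y = (η ^ 2)⁻¹ * (a + e2) := by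
    have h1 : a = ∑ j, A y 0 j * δ j := by simp [hδ, ha]
    rw [h1, he2, ← sum_add_distrib, mul_sum]
    refine sum_ext fun j => ?_
    rw [hgrad]
    ring
  have hb1 : |e1| ≤ κ * (r * x) := by
    have h := abs_sum_sum_mul_le (f := A y) hAup
      (g := fun i j => δ i * ε j + ε i * δ j + ε i * ε j) (b := 24 * (r * x)) fun i j => by
        have hm : ∀ {p q P Q : ℝ}, |p| ≤ P → |q| ≤ Q → |p * q| ≤ P * Q := fun hp hq => by
          rw [abs_mul]
          exact mul_le_mul hp hq (abs_nonneg _) ((abs_nonneg _).trans hp)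
        have h1 := hm (hδ1 i) (hε1 j)
        have h2 := hm (hε1 i) (hδ1 j)
        have h3 := hm (hε1 i) (hε1 j)
        have h4 := abs_add_le (δ i * ε j + ε i * δ j) (ε i * ε j)
        have h5 := abs_add_le (δ i * ε j) (ε i * δ j)
        nlinarith
    refine h.trans ?_
    push_cast
    rw [hκ]
    linarith [mul_pos (mul_pos (by positivity : (0 : ℝ) < (n + 1) ^ 2) hLam) hrx]
  have hb2 : |e2| ≤ κ * (r * x) := by
    refine (abs_sum_mul_le (hAup 0) hε1).trans ?_
    push_cast
    rw [hκ]
    have h1 : ((n : ℝ) + 1) * (Lam * (4 * (r * x))) ≤ (n + 1) ^ 2 * (Lam * (4 * (r * x))) := by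
      refine mul_le_mul_of_nonneg_right ?_ (by positivity)
      nlinarith [(Nat.cast_nonneg n : (0 : ℝ) ≤ n)]
    linarith [mul_pos (mul_pos (by positivity : (0 : ℝ) < (n + 1) ^ 2) hLam) hrx]
  have hbX : |X| ≤ κ * (r * x) := by
    have h1 : X = ∑ i, ∑ j, A y i j * (y 0 * η ^ 2 * pd i (pd j (tent c r)) y) +
        ∑ j, ∑ i, pd i (A · i j) y * (y 0 * η ^ 2 * pd j (tent c r) y) := by
      rw [hX, divOp_eq hd htent, mul_add, mul_sum, mul_sum]
      simp only [mul_sum, sum_mul]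
      congr 1 <;> exact sum_ext fun _ => sum_ext fun _ => by ring
    have h2 : ∀ j, |y 0 * η ^ 2 * pd j (tent c r) y| ≤ 5 * (r * x) := by
      intro j
      have h3 : y 0 * η ^ 2 * pd j (tent c r) y = x * η ^ 2 * (δ j + ε j) := by
        rw [hgrad, hyx]; field_simp
      rw [h3, abs_mul, abs_of_pos (by positivity)]
      have h4 : |δ j + ε j| ≤ 5 := by
        have := abs_add_le (δ j) (ε j)
        have := hδ1 j
        have := hε1 j
        linarith
      calc _ ≤ x * r * 5 := by gcongr
        _ = _ := by ring
    have h3 : ∀ i j, |y 0 * η ^ 2 * pd i (pd j (tent c r)) y| ≤ 36 * (r * x) := by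
      intro i j
      have h4 : y 0 * η ^ 2 * pd i (pd j (tent c r)) y =
          x * (4 * η * (δ j * (y i - c i) + δ i * (y j - c j) +
            y 0 * (if j = i then 1 else 0)) + 24 * y 0 * (y i - c i) * (y j - c j)) := by
        rw [pd_pd_tent hη.ne', ← hηdef]
        simp only [hδ]
        rw [hxdef]
        field_simp
      have hy0r : y 0 ≤ r := by nlinarith
      have hm : ∀ {p q P Q : ℝ}, |p| ≤ P → |q| ≤ Q → |p * q| ≤ P * Q := fun hp hq => by
        rw [abs_mul]
        exact mul_le_mul hp hq (abs_nonneg _) ((abs_nonneg _).trans hp)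
      have h5 : |y 0 * (if j = i then (1 : ℝ) else 0)| ≤ r * 1 :=
        hm (by rwa [abs_of_pos hy0]) (by split_ifs <;> simp)
      have h6 := hm (hδ1 j) (hcoord i)
      have h7 := hm (hδ1 i) (hcoord j)
      have h8 : |24 * y 0 * (y i - c i) * (y j - c j)| ≤ 24 * r * 1 * 1 :=
        hm (hm (by rw [abs_of_pos (by positivity)]; linarith) ((hcoord i).trans hrone))
          ((hcoord j).trans hrone)
      have h9 : |4 * η * (δ j * (y i - c i) + δ i * (y j - c j) +
            y 0 * (if j = i then 1 else 0))| ≤ 4 * (3 * r) := by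
        refine hm (by rw [abs_of_pos (by positivity)]; linarith) ?_
        have := abs_add_le (δ j * (y i - c i) + δ i * (y j - c j)) (y 0 * (if j = i then 1 else 0))
        have := abs_add_le (δ j * (y i - c i)) (δ i * (y j - c j))
        linarith
      rw [h4, abs_mul, abs_of_pos hx0]
      have h10 := abs_add_le (4 * η * (δ j * (y i - c i) + δ i * (y j - c j) +
            y 0 * (if j = i then 1 else 0))) (24 * y 0 * (y i - c i) * (y j - c j))
      calc _ ≤ x * (36 * r) := by gcongr; linarith
        _ = _ := by ring
    rw [h1]
    refine (abs_add_le _ _).trans ((add_le_add (abs_sum_sum_mul_le (f := A y) hAup h3)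
      (abs_sum_sum_mul_le (fun j i => hA.deriv_le y hyU i j i) fun j _ => h2 j)).trans ?_)
    push_cast
    rw [hκ]
    exact le_of_eq (by ring)
  have harith := barrier_arith (n := n) hx0 halam hb1 hb2 hbX hκ0.le hr.le (by linarith)
    (by rw [← hK]; exact hrK) (by omega)
  -- the chain rule
  have hn1 : ((n - 1 : ℕ) : ℝ) = n - 1 := by rw [Nat.cast_sub (by omega)]; simp
  have hφ : ∀ x : ℝ, HasDerivAt (fun x : ℝ => x ^ n - x ^ (n + 1))
      (n * x ^ (n - 1) - (n + 1) * x ^ n) x := fun x => by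
    simpa using (hasDerivAt_pow n x).fun_sub (hasDerivAt_pow (n + 1) x)
  have hφ' : HasDerivAt (fun x : ℝ => n * x ^ (n - 1) - (n + 1) * x ^ n)
      (n * ((n - 1) * x ^ (n - 2)) - (n + 1) * (n * x ^ (n - 1))) x := by
    have h := ((hasDerivAt_pow (n - 1) x).const_mul (n : ℝ)).fun_sub
      ((hasDerivAt_pow n x).const_mul (n + 1 : ℝ))
    rw [hn1, show n - 1 - 1 = n - 2 by omega] at h
    exact h
  have hΨ : ContDiffAt ℝ 2 (fun z => tent c r z ^ n - tent c r z ^ (n + 1)) y :=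
    (htent.pow n).sub (htent.pow (n + 1))
  have hw : DifferentiableAt ℝ (fun z : 𝕍 => ((z 0) ^ (n - 1))⁻¹) y :=
    DifferentiableAt.fun_inv (by fun_prop) (pow_ne_zero _ hy0.ne')
  have hpw : ∀ i, pd i (fun z : 𝕍 => ((z 0) ^ (n - 1))⁻¹) y = -((n - 1) * ((y 0) ^ n)⁻¹) * δ i := by
    intro i
    have h := pd_comp_real (φ := fun x => (x ^ (n - 1))⁻¹) i
      ((hasDerivAt_pow (n - 1) (y 0)).fun_inv (pow_ne_zero _ hy0.ne'))
      (u := fun z : 𝕍 => z 0) (y := y) (by fun_prop)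
    rw [h, pd_coord, hn1]
    simp only [hδ]
    congr 1
    obtain ⟨k, rfl⟩ : ∃ k, n = k + 2 := ⟨n - 2, by omega⟩
    simp only [show k + 2 - 1 = k + 1 by omega, show k + 1 - 1 = k by omega]
    field_simp
    ring
  have hfin : y 0 ^ 2 * y 0 ^ (n - 1) *
      divOp (singularField A) (fun z => tent c r z ^ n - tent c r z ^ (n + 1)) y =
      (n * (n - 1) * x ^ n - (n + 1) * n * x ^ (n + 1)) * (a + e1) +
      (n * x ^ n - (n + 1) * x ^ (n + 1)) * (-(n - 1) * (a + e2) + X) := by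
    have h1 : divOp (singularField A) (fun z => tent c r z ^ n - tent c r z ^ (n + 1)) y = _ :=
      divOp_smul (A := A) hd hw hΨ
    rw [h1, divOp_comp_real hd htent hφ hφ' (by fun_prop), hQ, ← hx]
    have h2 : ∑ i, ∑ j, A y i j * pd i (fun z : 𝕍 =>
        ((z 0) ^ (n - 1))⁻¹) y * pd j (fun z => tent c r z ^ n - tent c r z ^ (n + 1)) y =
        -((n - 1) * ((y 0) ^ n)⁻¹) * (n * x ^ (n - 1) - (n + 1) * x ^ n) *
          ((η ^ 2)⁻¹ * (a + e2)) := by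
      rw [← hL, mul_sum, Finset.sum_eq_single 0]
      · refine sum_ext fun j => ?_
        rw [hpw, pd_comp_real (φ := fun x => x ^ n - x ^ (n + 1)) j (hφ (tent c r y))
          (htent.differentiableAt (by simp)), ← hx]
        simp only [hδ, if_true]
        ring
      · intro i _ hi
        refine sum_eq_zero fun j _ => ?_
        rw [hpw]
        simp [hδ, Ne.symm hi]
      · simp
    rw [h2]
    have hD : divOp A (tent c r) y = X / (y 0 * η ^ 2) := by rw [hX]; field_simp
    rw [hD, hyx]
    obtain ⟨k, rfl⟩ : ∃ k, n = k + 2 := ⟨n - 2, by omega⟩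
    simp only [show k + 2 - 1 = k + 1 by omega, show k + 2 - 2 = k by omega]
    field_simp
    ring
  have hpos : 0 < y 0 ^ 2 * y 0 ^ (n - 1) := by positivity
  rw [← hfin] at harith
  exact not_le.1 fun h => harith.not_ge (mul_nonneg hpos.le h)

end Barrier

lemma IsEllipticMatrix.smul {d : ℕ} {A : 𝕄 d} {lam Lam w : ℝ} (hA : IsEllipticMatrix A lam Lam)
    (hw : 0 ≤ w) : IsEllipticMatrix (w • A) (w * lam) (w * Lam) where
  symm i j := by simp [hA.symm i j]
  lower ξ := by
    have h := mul_le_mul_of_nonneg_left (hA.lower ξ) hw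
    simp only [Matrix.smul_apply, smul_eq_mul, mul_assoc] at h ⊢
    simpa only [← mul_sum] using h
  upper i j := by
    rw [Matrix.smul_apply, smul_eq_mul, abs_mul, abs_of_nonneg hw]
    exact mul_le_mul_of_nonneg_left (hA.upper i j) hw

lemma differentiableAt_singularField {A : 𝕍 → 𝕄 (n + 1)} {y : 𝕍}
    (hA : ∀ i j, DifferentiableAt ℝ (A · i j) y) (hy : 0 < y 0) (i j : Fin (n + 1)) :
    DifferentiableAt ℝ (fun z => singularField A z i j) y := by
  simp only [singularField, Matrix.smul_apply, smul_eq_mul]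
  have hw : DifferentiableAt ℝ (fun z : 𝕍 => ((z 0) ^ (n - 1))⁻¹) y :=
    DifferentiableAt.fun_inv (by fun_prop) (pow_ne_zero _ hy.ne')
  exact hw.fun_mul (hA i j)

/-- A bounded subsolution with vanishing boundary values decays at the rate of the barrier. -/
lemma exists_boundary_decay (hn : 2 ≤ n) {lam Lam : ℝ} (hlam : 0 < lam) (hLam : 0 < Lam) :
    ∃ r₁ : ℝ, 0 < r₁ ∧ ∀ (A : 𝕍 → 𝕄 (n + 1)) (c : 𝕍) (r S : ℝ) (v : 𝕍 → ℝ), 0 < r → r ≤ r₁ → 0 < S →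
    EllipticOn A (halfBall c r) lam Lam Lam → ContDiffOn ℝ 2 v (halfBall c r) →
    (∀ y ∈ halfBall c r, 0 ≤ divOp (singularField A) v y) → (∀ y ∈ halfBall c r, v y ≤ S) →
    (∀ ε > 0, ∃ δ > 0, ∀ y ∈ halfBall c r, y 0 < δ → v y ≤ ε) →
    ∀ y ∈ halfBall c (r / 2), v y ≤ 2 ^ (n + 1) * (2 / r ^ 4) ^ n * S * y 0 ^ n := by
  obtain ⟨r₁, hr₁, hbar⟩ := exists_barrier hn hlam hLam
  refine ⟨r₁, hr₁, ?_⟩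
  intro A c r S v hr hrr hS hA hv hsub hvS hlim y hy
  have hU := isOpen_halfBall c r
  set K : ℝ := 2 ^ (n + 1) * S with hK
  have hK0 : 0 < K := by positivity
  set Ψ : 𝕍 → ℝ := fun z => tent c r z ^ n - tent c r z ^ (n + 1) with hΨ
  have hbc : Continuous (bump c r) := (contDiff_bump c r (k := 0)).continuous
  have hmem : ∀ z, 0 < z 0 → 0 < bump c r z → z ∈ halfBall c r := by
    intro z h0 hz
    rw [bump_eq] at hz
    exact ⟨h0, by nlinarith [dist_nonneg (x := z) (y := c)]⟩
  -- comparison below the tent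
  have hcomp : ∀ y₁, 0 < y₁ 0 → 0 < bump c r y₁ → 2 * y₁ 0 ≤ bump c r y₁ ^ 2 → v y₁ ≤ K * Ψ y₁ := by
    intro y₁ h0 hη ht
    by_contra! hlt
    set m : ℝ := v y₁ - K * Ψ y₁ with hm
    have hm0 : 0 < m := by rw [hm]; linarith
    obtain ⟨δ, hδ, hδv⟩ := hlim (m / 2) (by linarith)
    have htent : ∀ z, 0 < z 0 → 0 < bump c r z → 2 * z 0 ≤ bump c r z ^ 2 →
        0 < tent c r z ∧ tent c r z ≤ 1 / 2 := by
      intro z hz0 hzη hzt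
      refine ⟨by unfold tent; positivity, ?_⟩
      rw [tent, ← div_eq_mul_inv, div_le_iff₀ (by positivity)]
      linarith
    have hΨ0 : ∀ z, 0 < z 0 → 0 < bump c r z → 2 * z 0 ≤ bump c r z ^ 2 → 0 ≤ Ψ z := by
      intro z hz0 hzη hzt
      obtain ⟨h1, h2⟩ := htent z hz0 hzη hzt
      have : tent c r z ^ (n + 1) ≤ tent c r z ^ n := by
        rw [pow_succ]
        exact mul_le_of_le_one_right (by positivity) (by linarith)
      simp only [hΨ]
      linarith
    set T : Set 𝕍 := {z | δ / 2 ≤ z 0 ∧ 2 * z 0 ≤ bump c r z ^ 2 ∧ 0 ≤ bump c r z} with hT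
    have hTpos : ∀ z ∈ T, 0 < z 0 ∧ 0 < bump c r z := by
      rintro z ⟨h1, h2, h3⟩
      have h4 : 0 < z 0 := by linarith
      refine ⟨h4, h3.lt_of_ne' fun h => ?_⟩
      rw [h] at h2
      linarith
    have hTc : IsCompact T := by
      refine Metric.isCompact_of_isClosed_isBounded ?_ ?_
      · have h1 : IsClosed {z : 𝕍 | δ / 2 ≤ z 0} := isClosed_le continuous_const (by fun_prop)
        have h2 : IsClosed {z | 2 * z 0 ≤ bump c r z ^ 2} := isClosed_le (by fun_prop) (hbc.pow 2)
        have h3 : IsClosed {z | 0 ≤ bump c r z} := isClosed_le continuous_const hbc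
        exact h1.inter (h2.inter h3)
      · refine Metric.isBounded_closedBall.subset (s := T) (t := closedBall c r) ?_
        intro z hz
        exact (hmem z (hTpos z hz).1 (hTpos z hz).2).2.le
    have hy₁δ : δ ≤ y₁ 0 := by
      by_contra! h
      have h1 := hδv y₁ (hmem y₁ h0 hη) h
      have h2 := mul_nonneg hK0.le (hΨ0 y₁ h0 hη ht)
      rw [hm] at h1 hm0
      linarith
    have hΨd : ∀ z, 0 < bump c r z → ContDiffAt ℝ 2 Ψ z := fun z hz =>
      ((contDiffAt_tent hz.ne').pow n).sub ((contDiffAt_tent hz.ne').pow (n + 1))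
    have hvd : ∀ z ∈ T, ContDiffAt ℝ 2 v z := fun z hz =>
      hv.contDiffAt (hU.mem_nhds (hmem z (hTpos z hz).1 (hTpos z hz).2))
    have hfd : ∀ z ∈ T, ContDiffAt ℝ 2 (fun z => v z - K * Ψ z) z := fun z hz =>
      (hvd z hz).sub (contDiffAt_const.mul (hΨd z (hTpos z hz).2))
    obtain ⟨z, hz, hzmax⟩ := hTc.exists_isMaxOn ⟨y₁, by linarith, ht, hη.le⟩
      (f := fun z => v z - K * Ψ z) fun z hz => (hfd z hz).continuousAt.continuousWithinAt
    have hzm : m ≤ v z - K * Ψ z := hzmax (show y₁ ∈ T from ⟨by linarith, ht, hη.le⟩)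
    obtain ⟨hz0, hzη⟩ := hTpos z hz
    have hzU := hmem z hz0 hzη
    have hz1 : δ / 2 < z 0 := by
      refine hz.1.lt_of_ne fun h => ?_
      have h1 := hδv z hzU (by linarith)
      have h2 := mul_nonneg hK0.le (hΨ0 z hz0 hzη hz.2.1)
      linarith
    have hz2 : 2 * z 0 < bump c r z ^ 2 := by
      refine hz.2.1.lt_of_ne fun h => ?_
      have h1 : tent c r z = 1 / 2 := by rw [tent, ← h]; field_simp
      have h2 : K * Ψ z = S := by
        simp only [hΨ, h1, hK]
        rw [pow_succ, pow_succ, one_div, inv_pow]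
        field_simp
        ring
      have := hvS z hzU
      linarith
    have hloc : IsLocalMax (fun z => v z - K * Ψ z) z := by
      have h1 : ∀ᶠ w in 𝓝 z, δ / 2 < w 0 := (show Continuous fun w : 𝕍 => w 0 by
          fun_prop).continuousAt.eventually_const_lt hz1
      have h2 : ∀ᶠ w in 𝓝 z, 2 * w 0 < bump c r w ^ 2 :=
        ContinuousAt.eventually_lt (by fun_prop) (hbc.pow 2).continuousAt hz2
      have h3 : ∀ᶠ w in 𝓝 z, 0 < bump c r w := hbc.continuousAt.eventually_const_lt hzη
      filter_upwards [h1, h2, h3] with w hw1 hw2 hw3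
      exact hzmax (show w ∈ T from ⟨hw1.le, hw2.le, hw3.le⟩)
    have hd : ∀ i j, DifferentiableAt ℝ (fun z => singularField A z i j) z :=
      differentiableAt_singularField (fun i j =>
        ((hA.contDiffOn i j).contDiffAt (hU.mem_nhds hzU)).differentiableAt (by simp)) hz0
    have hw0 : 0 ≤ ((z 0) ^ (n - 1))⁻¹ := by positivity
    have h1 := divOp_nonpos_of_isLocalMax hd ((hA.elliptic z hzU).smul hw0)
      (mul_nonneg hw0 hlam.le) (hfd z hz) hloc
    rw [divOp_sub hd (hvd z hz) (contDiffAt_const.mul (hΨd z hzη)),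
      divOp_const_mul hd (hΨd z hzη)] at h1
    have h2 := hbar A (halfBall c r) c z r hU hzU hA hr hrr hz0 hzη hz.2.1
    have h3 := hsub z hzU
    nlinarith
  -- the bound in terms of the tent
  obtain ⟨hy0, hyd⟩ := hy
  have hη : r ^ 2 * (3 / 4) ≤ bump c r y := by
    rw [bump_eq]
    nlinarith [dist_nonneg (x := y) (y := c)]
  have hη0 : 0 < bump c r y := lt_of_lt_of_le (by positivity) hη
  have hyU := hmem y hy0 hη0
  have htpos : 0 < tent c r y := by unfold tent; positivity
  have h1 : v y ≤ K * tent c r y ^ n := by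
    rcases le_total (2 * y 0) (bump c r y ^ 2) with h | h
    · refine (hcomp y hy0 hη0 h).trans ?_
      simp only [hΨ]
      have : 0 < tent c r y ^ (n + 1) := by positivity
      nlinarith
    · have h2 : 1 / 2 ≤ tent c r y := by
        rw [tent, ← div_eq_mul_inv, le_div_iff₀ (by positivity)]; linarith
      have h3 : (1 / 2 : ℝ) ^ n ≤ tent c r y ^ n := pow_le_pow_left₀ (by norm_num) h2 n
      calc v y ≤ S := hvS y hyU
        _ ≤ 2 * S := by linarith
        _ = K * (1 / 2) ^ n := by rw [hK, pow_succ, one_div, inv_pow]; field_simp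
        _ ≤ _ := by gcongr
  have h2 : tent c r y ≤ 2 / r ^ 4 * y 0 := by
    rw [tent, mul_comm]
    refine mul_le_mul_of_nonneg_right ?_ hy0.le
    rw [inv_eq_one_div, div_le_div_iff₀ (by positivity) (by positivity)]
    have h3 : (r ^ 2 * (3 / 4)) ^ 2 ≤ bump c r y ^ 2 := pow_le_pow_left₀ (by positivity) hη 2
    have h4 : 0 < r ^ 4 := by positivity
    have h5 : (r ^ 2 * (3 / 4)) ^ 2 = r ^ 4 * (9 / 16) := by ring
    linarith
  calc v y ≤ K * tent c r y ^ n := h1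
    _ ≤ K * (2 / r ^ 4 * y 0) ^ n := by gcongr
    _ = _ := by rw [hK, mul_pow]; ring

/-! ### Estimates on balls of radius comparable to the height -/

section Whitney

variable {lam Lam : ℝ} {A : 𝔼 (n + 1) → 𝕄 (n + 1)} {c y : 𝔼 (n + 1)} {r s : ℝ}

/-- The part of the half ball where the height is comparable to `s`. -/
def slab (c : 𝕍) (r s : ℝ) : Set 𝕍 := {x ∈ halfBall c r | s / 4 < x 0 ∧ x 0 < 2 * s}

lemma isOpen_slab (c : 𝕍) (r s : ℝ) : IsOpen (slab c r s) := by
  have h1 : IsOpen {y : 𝕍 | s / 4 < y 0} := isOpen_lt continuous_const (by fun_prop)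
  have h2 : IsOpen {y : 𝕍 | y 0 < 2 * s} := isOpen_lt (by fun_prop) continuous_const
  exact (isOpen_halfBall c r).inter (h1.inter h2)

lemma height_lt (hc : c 0 = 0) (hy : y ∈ halfBall c r) : y 0 < r := by
  have h := abs_coord_le (y - c) 0
  rw [← dist_eq_norm] at h
  simp only [PiLp.sub_apply, hc, sub_zero] at h
  exact (le_abs_self _).trans_lt (h.trans_lt hy.2)

lemma abs_height_sub_le (x y : 𝕍) : |x 0 - y 0| ≤ dist x y := by
  have h := abs_coord_le (x - y) 0
  rwa [← dist_eq_norm] at h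

lemma closedBall_subset_slab (hc : c 0 = 0) (hy : y ∈ halfBall c (r / 2)) :
    closedBall y (y 0 / 2) ⊆ slab c r (y 0) := by
  intro x hx
  have h1 := abs_height_sub_le x y
  have h2 := height_lt hc hy
  have h3 : dist x y ≤ y 0 / 2 := hx
  have h4 := dist_triangle x y c
  have h5 := hy.1
  have h6 := hy.2
  rw [abs_le] at h1
  refine ⟨⟨by linarith, by linarith⟩, by linarith, by linarith⟩

/-- On a slab of height `s` the singular factor is comparable to a constant, so that, up to this
constant, the singular operator is uniformly elliptic at the scale `s`. -/
lemma EllipticOn.scaled_singularField (hA : EllipticOn A (halfBall c r) lam Lam Lam)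
    (hlam : 0 < lam) (hLam : 0 < Lam) (hs : 0 < s) (hs1 : s ≤ 1) {R : ℝ} (hR : 0 < R)
    (hRs : R ≤ s) :
    EllipticOn (fun x => s ^ (n - 1) • singularField A x) (slab c r s) (lam / 2 ^ n)
    ((n + 1) * 4 ^ n * Lam) ((n + 1) * 4 ^ n * Lam / R) := by
  set w : 𝕍 → ℝ := fun x => s ^ (n - 1) * ((x 0) ^ (n - 1))⁻¹ with hw
  have hAw : ∀ x i j, (s ^ (n - 1) • singularField A x) i j = w x * A x i j := by
    intro x i j
    simp only [singularField, Matrix.smul_apply, smul_eq_mul, hw]; ring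
  have hU := isOpen_halfBall c r
  have hwd : ∀ x ∈ slab c r s, ContDiffAt ℝ 1 w x := fun x hx =>
    contDiffAt_const.mul (ContDiffAt.inv (by fun_prop) (pow_ne_zero _ hx.1.1.ne'))
  have hw2 : ∀ x ∈ slab c r s, 1 / 2 ^ n ≤ w x ∧ w x ≤ 4 ^ n := by
    intro x hx
    have h0 := hx.1.1
    have hweq : w x = (s / x 0) ^ (n - 1) := by simp only [hw, div_pow]; rfl
    have h1 : 1 / 2 ≤ s / x 0 := by rw [div_le_div_iff₀ (by norm_num) h0]; linarith [hx.2.2]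
    have h2 : s / x 0 ≤ 4 := by rw [div_le_iff₀ h0]; linarith [hx.2.1]
    rw [hweq]
    constructor
    · calc (1 : ℝ) / 2 ^ n = (1 / 2) ^ n := by rw [div_pow, one_pow]
        _ ≤ (1 / 2) ^ (n - 1) := pow_le_pow_of_le_one (by norm_num) (by norm_num) (Nat.sub_le _ _)
        _ ≤ _ := pow_le_pow_left₀ (by norm_num) h1 _
    · calc _ ≤ (4 : ℝ) ^ (n - 1) := pow_le_pow_left₀ (by positivity) h2 _
        _ ≤ _ := pow_le_pow_right₀ (by norm_num) (Nat.sub_le _ _)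
  have hpw : ∀ x ∈ slab c r s, ∀ k, |pd k w x| ≤ n * 4 ^ n / s := by
    intro x hx k
    have h0 := hx.1.1
    have h := pd_comp_real (φ := fun x => (x ^ (n - 1))⁻¹) k
      ((hasDerivAt_pow (n - 1) (x 0)).fun_inv (pow_ne_zero _ h0.ne'))
      (u := fun z : 𝕍 => z 0) (y := x) (by fun_prop)
    have hd : DifferentiableAt ℝ (fun z : 𝕍 => ((z 0) ^ (n - 1))⁻¹) x :=
      DifferentiableAt.fun_inv (by fun_prop) (pow_ne_zero _ h0.ne')
    rw [hw, pd_const_mul k _ hd, h, pd_coord]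
    have hkey : s ^ (n - 1) * (-(((n - 1 : ℕ) : ℝ) * x 0 ^ (n - 1 - 1)) / (x 0 ^ (n - 1)) ^ 2 *
        (if 0 = k then 1 else 0)) = -(((n - 1 : ℕ) : ℝ) * (s / x 0) ^ (n - 1) * (1 / x 0) *
        (if 0 = k then 1 else 0)) := by
      rcases hn : n - 1 with _ | m
      · simp
      · rw [Nat.add_sub_cancel, div_pow]
        field_simp
        ring
    rw [hkey, abs_neg, abs_mul, abs_of_nonneg (by positivity)]
    have h2 : s / x 0 ≤ 4 := by rw [div_le_iff₀ h0]; linarith [hx.2.1]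
    have h3 : |(if 0 = k then (1 : ℝ) else 0)| ≤ 1 := by split_ifs <;> simp
    rcases Nat.eq_zero_or_pos n with hn | hn
    · subst hn; simp
    have h4 : 1 / x 0 ≤ 4 / s := by rw [div_le_div_iff₀ h0 hs]; linarith [hx.2.1]
    calc _ ≤ ((n - 1 : ℕ) : ℝ) * (s / x 0) ^ (n - 1) * (1 / x 0) :=
          mul_le_of_le_one_right (by positivity) h3
      _ ≤ n * 4 ^ (n - 1) * (4 / s) := by
          gcongr
          exact Nat.sub_le _ _
      _ = _ := by
          obtain ⟨m, rfl⟩ : ∃ m, n = m + 1 := ⟨n - 1, by omega⟩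
          simp only [Nat.add_sub_cancel]
          ring
  refine ⟨fun i j => ?_, fun x hx => ?_, fun x hx i j k => ?_⟩
  · simp only [hAw]
    intro x hx
    exact ((hwd x hx).mul ((hA.contDiffOn i j).contDiffAt (hU.mem_nhds hx.1))).contDiffWithinAt
  · obtain ⟨h1, h2⟩ := hw2 x hx
    have hwx : 0 ≤ w x := le_trans (by positivity) h1
    have h3 := (hA.elliptic x hx.1).smul hwx
    have h4 : s ^ (n - 1) • singularField A x = w x • A x := by ext i j; rw [hAw]; rfl
    rw [h4]
    refine ⟨h3.symm, fun ξ => le_trans ?_ (h3.lower ξ), fun i j => (h3.upper i j).trans ?_⟩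
    · refine mul_le_mul_of_nonneg_right ?_ (by positivity)
      rw [div_eq_mul_one_div, mul_comm]
      exact mul_le_mul_of_nonneg_right h1 hlam.le
    · refine mul_le_mul_of_nonneg_right ?_ hLam.le
      nlinarith [mul_nonneg (Nat.cast_nonneg n : (0 : ℝ) ≤ n) (by positivity : (0 : ℝ) ≤ 4 ^ n)]
  · simp only [hAw]
    have hAd : DifferentiableAt ℝ (A · i j) x :=
      ((hA.contDiffOn i j).contDiffAt (hU.mem_nhds hx.1)).differentiableAt (by simp)
    rw [pd_mul k ((hwd x hx).differentiableAt (by simp)) hAd]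
    have h1 : |pd k w x * A x i j| ≤ n * 4 ^ n / s * Lam := by
      rw [abs_mul]
      exact mul_le_mul (hpw x hx k) ((hA.elliptic x hx.1).upper i j) (abs_nonneg _)
        (by positivity)
    have h2 : |w x * pd k (A · i j) x| ≤ 4 ^ n * Lam := by
      rw [abs_mul, abs_of_nonneg (le_trans (by positivity) (hw2 x hx).1)]
      exact mul_le_mul (hw2 x hx).2 (hA.deriv_le x hx.1 i j k) (abs_nonneg _) (by positivity)
    have h3 : (4 : ℝ) ^ n * Lam ≤ 4 ^ n * Lam / s := by
      rw [le_div_iff₀ hs]; exact mul_le_of_le_one_right (by positivity) hs1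
    calc _ ≤ n * 4 ^ n / s * Lam + 4 ^ n * Lam / s :=
          (abs_add_le _ _).trans (add_le_add h1 (h2.trans h3))
      _ = (n + 1) * 4 ^ n * Lam / s := by ring
      _ ≤ _ := by gcongr

lemma divOp_scaled_singularField (hA : EllipticOn A (halfBall c r) lam Lam Lam) {v : 𝕍 → ℝ}
    (hv : ContDiffOn ℝ 2 v (halfBall c r)) (k : ℝ) {x : 𝕍} (hx : x ∈ halfBall c r) :
    divOp (fun x => k • singularField A x) v x = k * divOp (singularField A) v x := by
  have hU := isOpen_halfBall c r
  have h := divOp_smul (w := fun _ => k) (differentiableAt_singularField (fun i j =>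
    ((hA.contDiffOn i j).contDiffAt (hU.mem_nhds hx)).differentiableAt (by simp)) hx.1)
    (differentiableAt_const k) (hv.contDiffAt (hU.mem_nhds hx))
  rw [h]
  simp [pd_const]

/-- The mean value inequality on balls whose radius is comparable to the height. -/
lemma exists_whitney_mean_value (n : ℕ) (hlam : 0 < lam) (hLam : 0 < Lam) :
    ∃ C : ℝ, 0 < C ∧ ∀ (A : 𝔼 (n + 1) → 𝕄 (n + 1)) (c y : 𝔼 (n + 1)) (r : ℝ)
    (v : 𝔼 (n + 1) → ℝ), c 0 = 0 → r ≤ 1 →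
    EllipticOn A (halfBall c r) lam Lam Lam → ContDiffOn ℝ 2 v (halfBall c r) →
    (∀ x ∈ halfBall c r, 0 ≤ v x) →
    (∀ x ∈ halfBall c r, -(Lam * ((x 0) ^ (n + 1))⁻¹ * v x) ≤ divOp (singularField A) v x) →
    y ∈ halfBall c (r / 2) → y 0 ^ (n + 1) * v y ≤ C * ∫ x in closedBall y (y 0 / 4), v x := by
  set Lam1 : ℝ := (n + 1) * 4 ^ (n + 1) * Lam with hLam1
  have hL1 : 0 < Lam1 := by positivity
  obtain ⟨C, hC, h⟩ := exists_mean_value (d := n + 1) (Nat.succ_pos n)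
    (by positivity : 0 < lam / 2 ^ n) hL1
  refine ⟨C * 4 ^ (n + 1), by positivity, ?_⟩
  intro A c y r v hc hr1 hA hv hv0 hdiv hy
  have hy0 := hy.1
  have hys := height_lt hc hy
  set s := y 0 with hs
  have hsub : closedBall y (s / 4) ⊆ slab c r s :=
    (closedBall_subset_closedBall (by linarith)).trans (closedBall_subset_slab hc hy)
  have hE := hA.scaled_singularField hlam hLam hy0 (by linarith) (R := s / 4) (by positivity)
    (by linarith)
  have hE' : EllipticOn (fun x => s ^ (n - 1) • singularField A x) (slab c r s) (lam / 2 ^ n)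
      Lam1 (Lam1 / (s / 4)) := by
    have hle : (n + 1) * 4 ^ n * Lam ≤ Lam1 := by
      rw [hLam1, pow_succ]
      have : (0 : ℝ) < (n + 1) * 4 ^ n * Lam := by positivity
      nlinarith
    refine ⟨hE.contDiffOn, fun x hx => ?_, fun x hx i j k => (hE.deriv_le x hx i j k).trans ?_⟩
    · have h1 := hE.elliptic x hx
      exact ⟨h1.symm, h1.lower, fun i j => (h1.upper i j).trans hle⟩
    · gcongr
  have h1 := h _ (slab c r s) y (s / 4) v (isOpen_slab c r s) (by positivity) hsub hE'
    (hv.mono fun x hx => hx.1) (fun x hx => hv0 x (hsub hx).1) (fun x hx => by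
      have hx' := hsub hx
      rw [divOp_scaled_singularField hA hv _ hx'.1]
      have h2 := mul_le_mul_of_nonneg_left (hdiv x hx'.1) (by positivity : 0 ≤ s ^ (n - 1))
      refine le_trans (neg_le_neg ?_) (le_of_eq_of_le (mul_neg _ _).symm h2)
      have h3 : s ^ (n - 1) * ((x 0) ^ (n + 1))⁻¹ ≤ 4 ^ (n + 1) / s ^ 2 := by
        have hx0 := hx'.1.1
        rw [← div_eq_mul_inv, div_le_div_iff₀ (by positivity) (by positivity)]
        have h4 : s ^ (n + 1) ≤ (4 * x 0) ^ (n + 1) :=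
          pow_le_pow_left₀ hy0.le (by linarith [hx'.2.1]) _
        rcases n with _ | m
        · have hs1 : s ≤ 1 := by linarith
          simp only [zero_add, pow_one] at h4 ⊢
          simp only [zero_tsub, pow_zero, one_mul]
          nlinarith
        · calc _ = s ^ (m + 1 + 1) := by rw [Nat.add_sub_cancel]; ring
            _ ≤ _ := h4
            _ = _ := by rw [mul_pow]
      calc s ^ (n - 1) * (Lam * ((x 0) ^ (n + 1))⁻¹ * v x) =
            Lam * (s ^ (n - 1) * ((x 0) ^ (n + 1))⁻¹) * v x := by ring
        _ ≤ Lam * (4 ^ (n + 1) / s ^ 2) * v x := by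
            have := hv0 x hx'.1
            gcongr
        _ ≤ _ := by
            refine mul_le_mul_of_nonneg_right ?_ (hv0 x hx'.1)
            rw [hLam1, div_pow]
            have : (0 : ℝ) < 4 ^ (n + 1) * Lam / s ^ 2 := by positivity
            have e : (n + 1) * 4 ^ (n + 1) * Lam / (s ^ 2 / 4 ^ 2) =
              (16 * (n + 1)) * (4 ^ (n + 1) * Lam / s ^ 2) := by field_simp; ring
            rw [e]
            have hn : (0 : ℝ) ≤ n := Nat.cast_nonneg n
            calc _ = 1 * (4 ^ (n + 1) * Lam / s ^ 2) := by ring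
              _ ≤ _ := by gcongr; linarith)
  rw [div_pow, div_mul_eq_mul_div, div_le_iff₀ (by positivity)] at h1
  linarith

/-- The energy inequality on balls whose radius is comparable to the height. The powers of the
height cancel. -/
lemma exists_whitney_integral_le (hn : 2 ≤ n) (hlam : 0 < lam) (hLam : 0 < Lam) :
    ∃ C : ℝ, 0 < C ∧ ∀ (A : 𝕍 → 𝕄 (n + 1)) (c y : 𝕍) (r S : ℝ) (w : 𝕍 → ℝ), c 0 = 0 → r ≤ 1 →
    EllipticOn A (halfBall c r) lam Lam Lam → ContDiffOn ℝ 2 w (halfBall c r) →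
    (∀ x ∈ halfBall c r, 0 ≤ divOp (singularField A) w x) → y ∈ halfBall c (r / 2) →
    (∀ x ∈ closedBall y (y 0 / 2), |w x| ≤ S) →
    ∫ x in closedBall y (y 0 / 4), divOp (singularField A) w x ≤ C * S := by
  set Lam1 : ℝ := (n + 1) * 4 ^ n * Lam with hLam1
  have hL1 : 0 < Lam1 := by positivity
  obtain ⟨C, hC, h⟩ := exists_integral_divOp_le (lam := lam / 2 ^ n) (n + 1) hL1
  refine ⟨C, hC, ?_⟩
  intro A c y r S w hc hr1 hA hw hdiv hy hwS
  have hy0 := hy.1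
  have hys := height_lt hc hy
  set s := y 0 with hs
  have hsub : closedBall y (s / 2) ⊆ slab c r s := closedBall_subset_slab hc hy
  have hE := hA.scaled_singularField hlam hLam hy0 (by linarith) (R := s / 2) (by positivity)
    (by linarith)
  have h1 := h _ (slab c r s) y (s / 2) S w (isOpen_slab c r s) (by positivity) hsub hE
    (hw.mono fun x hx => hx.1) hwS (fun x hx => by
      rw [divOp_scaled_singularField hA hw _ (hsub hx).1]
      exact mul_nonneg (by positivity) (hdiv x (hsub hx).1))
  have h2 : ∫ x in closedBall y (s / 2 / 2), divOp (fun x => s ^ (n - 1) •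
      singularField A x) w x = s ^ (n - 1) *
      ∫ x in closedBall y (s / 4), divOp (singularField A) w x := by
    rw [← integral_const_mul, show s / 2 / 2 = s / 4 by ring]
    refine setIntegral_congr_fun Metric.isClosed_closedBall.measurableSet fun x hx => ?_
    exact divOp_scaled_singularField hA hw _
      (hsub (closedBall_subset_closedBall (by linarith) hx)).1
  rw [h2] at h1
  have hS : 0 ≤ S := (abs_nonneg _).trans (hwS y (mem_closedBall_self (by positivity)))
  have h3 : s ^ 2 * s ^ (n - 1) = s ^ (n + 1) := by rw [← pow_add]; congr 1; omega
  have h4 : (s / 2) ^ (n + 1) ≤ (s / 2) ^ 2 * s ^ (n - 1) := by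
    have h5 : (s / 2) ^ (n + 1) = (s / 2) ^ 2 * (s / 2) ^ (n - 1) := by
      rw [← pow_add]; congr 1; omega
    rw [h5]
    gcongr
    linarith
  have hpos : 0 < (s / 2) ^ 2 * s ^ (n - 1) := by positivity
  refine le_of_mul_le_mul_left ?_ hpos
  calc _ = (s / 2) ^ 2 * (s ^ (n - 1) *
        ∫ x in closedBall y (s / 4), divOp (singularField A) w x) := by ring
    _ ≤ C * ((s / 2) ^ (n + 1) * S) := h1
    _ ≤ C * ((s / 2) ^ 2 * s ^ (n - 1) * S) := by gcongr
    _ = _ := by ring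

end Whitney

/-! ### Averages of the lengths of paths -/

section Oscillation

variable {c p : 𝔼 (n + 1)} {r s m : ℝ}

/-- Multiplication of the height by `μ`. -/
def vscale (μ : ℝ) : 𝕍 →ₗ[ℝ] 𝕍 :=
  Matrix.toEuclideanLin (Matrix.diagonal fun i => if i = 0 then μ else 1)

lemma vscale_apply (μ : ℝ) (z : 𝕍) (i : Fin (n + 1)) :
    vscale μ z i = (if i = 0 then μ else 1) * z i := by
  simp [vscale, Matrix.mulVec_diagonal]

lemma vscale_zero_apply (μ : ℝ) (z : 𝕍) : vscale μ z 0 = μ * z 0 := by simp [vscale_apply]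

lemma vscale_eq (μ : ℝ) (z : 𝕍) : vscale μ z = z + ((μ - 1) * z 0) • single 0 1 := by
  ext i
  rw [vscale_apply]
  by_cases h : i = 0
  · subst h; simp; ring
  · simp [h]

lemma det_vscale (μ : ℝ) : LinearMap.det (vscale (n := n) μ) = μ := by
  rw [vscale, show Matrix.toEuclideanLin (𝕜 := ℝ) (m := Fin (n + 1)) (n := Fin (n + 1)) =
    Matrix.toLpLin 2 2 from rfl, Matrix.toLpLin_eq_toLin, LinearMap.det_toLin, Matrix.det_diagonal]
  simp

lemma dist_vscale_le (hc : c 0 = 0) {μ : ℝ} (h0 : 0 ≤ μ) (h1 : μ ≤ 1)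
    (z : 𝕍) : dist (vscale μ z) c ≤ dist z c := by
  rw [dist_eq, dist_eq]
  refine Real.sqrt_le_sqrt (sum_le_sum fun i _ => ?_)
  rw [vscale_apply]
  by_cases h : i = 0
  · subst h
    rw [if_pos rfl, hc, dist_zero_right, dist_zero_right, norm_eq_abs, norm_eq_abs,
      abs_mul, abs_of_nonneg h0]
    exact pow_le_pow_left₀ (by positivity) (mul_le_of_le_one_left (abs_nonneg _) h1) 2
  · simp [h]

lemma vscale_mem_halfBall (hc : c 0 = 0) {μ : ℝ} (h0 : 0 < μ) (h1 : μ ≤ 1)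
    {z : 𝕍} (hz : z ∈ halfBall c r) : vscale μ z ∈ halfBall c r :=
  ⟨by rw [vscale_zero_apply]; exact mul_pos h0 hz.1, (dist_vscale_le hc h0.le h1 z).trans_lt hz.2⟩

/-- The density of the energy when `φ / height` bounds the differential. -/
def weightedSq (φ : 𝕍 → ℝ≥0∞) (x : 𝕍) : ℝ≥0∞ := φ x ^ 2 * ofReal ((x 0) ^ (n - 1))⁻¹

/-- The part of the energy below the height `δ`. -/
def lowEnergy (φ : 𝕍 → ℝ≥0∞) (c : 𝕍) (r δ : ℝ) : ℝ≥0∞ :=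
  ∫⁻ x in halfBall c r ∩ {x | x 0 < δ}, weightedSq φ x

variable {φ : 𝔼 (n + 1) → ℝ≥0∞}

lemma measurable_height : Measurable fun x : 𝕍 => x 0 :=
  (show Continuous fun x : 𝕍 => x 0 by fun_prop).measurable

lemma measurable_weightedSq (hφ : Measurable φ) : Measurable (weightedSq φ) :=
  (hφ.pow_const 2).mul (measurable_height.pow_const _).inv.ennreal_ofReal

lemma measurableSet_low (c : 𝕍) (r δ : ℝ) : MeasurableSet (halfBall c r ∩ {x | x 0 < δ}) :=
  (isOpen_halfBall c r).measurableSet.inter (measurableSet_lt measurable_height measurable_const)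

lemma lowEnergy_mono {δ δ' : ℝ} (h : δ ≤ δ') : lowEnergy φ c r δ ≤ lowEnergy φ c r δ' :=
  lintegral_mono_set fun _ hx => ⟨hx.1, lt_of_lt_of_le hx.2 h⟩

/-- The energy below the height `δ` tends to zero, by absolute continuity of the integral. -/
lemma exists_lowEnergy_le (hfin : ∫⁻ x in halfBall c r, weightedSq φ x ≠ ⊤) {ε : ℝ≥0∞}
    (hε : 0 < ε) : ∃ δ : ℝ, 0 < δ ∧ lowEnergy φ c r δ ≤ ε := by
  set μ := (volume : Measure 𝕍).restrict (halfBall c r) with hμ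
  have hμfin : IsFiniteMeasure μ := by
    refine ⟨?_⟩
    rw [hμ, Measure.restrict_apply_univ]
    exact (measure_mono fun x hx => Metric.ball_subset_closedBall (show x ∈ ball c r from
      hx.2)).trans_lt (isCompact_closedBall c r).measure_lt_top
  have hs : Tendsto (fun k : ℕ => μ {x | x 0 < 1 / ((k : ℝ) + 1)}) atTop (𝓝 0) := by
    have h1 : μ (⋂ k : ℕ, {x | x 0 < 1 / ((k : ℝ) + 1)}) = 0 := by
      rw [hμ, Measure.restrict_apply' (isOpen_halfBall c r).measurableSet]
      convert measure_empty (μ := volume)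
      refine eq_empty_of_forall_notMem ?_
      rintro x ⟨hx, hx'⟩
      obtain ⟨k, hk⟩ := exists_nat_one_div_lt hx'.1
      have := mem_iInter.1 hx k
      exact absurd this (not_lt.2 hk.le)
    rw [← h1]
    refine tendsto_measure_iInter_atTop (fun k =>
      (measurableSet_lt measurable_height measurable_const).nullMeasurableSet) ?_
      ⟨0, measure_ne_top _ _⟩
    intro k l hkl x hx
    refine lt_of_lt_of_le (show x 0 < 1 / ((l : ℝ) + 1) from hx) ?_
    have : (k : ℝ) ≤ l := by exact_mod_cast hkl
    gcongr
  have ht := tendsto_setLIntegral_zero hfin hs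
  obtain ⟨k, hk⟩ := (ht.eventually (ge_mem_nhds hε)).exists
  refine ⟨1 / ((k : ℝ) + 1), by positivity, ?_⟩
  rwa [hμ, Measure.restrict_restrict (measurableSet_lt measurable_height measurable_const),
    inter_comm] at hk

lemma ofReal_mul_le_add (l : ℝ) {α : ℝ} (hα : 0 < α) (t : ℝ≥0∞) :
    ofReal l * t ≤ ofReal α * t ^ 2 + ofReal (l ^ 2 / α) := by
  rcases eq_or_ne t ⊤ with rfl | ht
  · rw [ENNReal.top_pow two_ne_zero, ENNReal.mul_top (a := ofReal α) (by simpa using hα)]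
    exact le_top.trans le_self_add
  · obtain ⟨x, hx, rfl⟩ : ∃ x : ℝ, 0 ≤ x ∧ t = ofReal x :=
      ⟨t.toReal, ENNReal.toReal_nonneg, (ENNReal.ofReal_toReal ht).symm⟩
    rw [← ofReal_pow hx, ← ENNReal.ofReal_mul' hx, ← ofReal_mul hα.le,
      ← ofReal_add (by positivity) (by positivity)]
    refine ofReal_le_ofReal ?_
    have h1 : 0 ≤ (α * x - l / 2) ^ 2 / α := by positivity
    have h2 : (α * x - l / 2) ^ 2 / α = α * x ^ 2 - l * x + l ^ 2 / α / 4 := by field_simp; ring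
    have h3 : 0 ≤ l ^ 2 / α := by positivity
    linarith

lemma height_of_mem_closedBall {z : 𝕍}
    (hz : z ∈ closedBall p (p 0 / 4)) : 3 / 4 * p 0 ≤ z 0 ∧ z 0 ≤ 5 / 4 * p 0 := by
  have h1 := abs_height_sub_le z p
  have h2 : dist z p ≤ p 0 / 4 := hz
  rw [abs_le] at h1
  constructor <;> linarith

lemma continuous_vscale : Continuous fun q : ℝ × 𝕍 => vscale q.1 q.2 := by
  simp only [vscale_eq]
  fun_prop

/-- The average, over a ball of radius comparable to its height, of the length of a path which
moves by rescaling the height and by a horizontal translation. The two terms come from the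
weighted inequality between the arithmetic and the geometric mean; that the second one does not
depend on the path needs `2 ≤ n`. -/
lemma lintegral_path_le (hn : 2 ≤ n) (hφ : Measurable φ) {μ : ℝ → ℝ} (hμc : Continuous μ)
    {w : ℝ → 𝕍} (hwc : Continuous w) (hμ : ∀ τ ∈ Icc (0 : ℝ) 1, 0 < μ τ ∧ μ τ ≤ m) (hm : m ≤ 1)
    (hw : ∀ τ, w τ 0 = 0) (hp : 0 < p 0) (l : ℝ) {K : ℝ} (hK : 0 < K)

    (hmem : ∀ z ∈ closedBall p (p 0 / 4), ∀ τ ∈ Icc (0 : ℝ) 1, vscale (μ τ) z + w τ ∈ halfBall c r) :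
    ∫⁻ z in closedBall p (p 0 / 4), ∫⁻ τ in Icc (0 : ℝ) 1, ofReal l * φ (vscale (μ τ) z + w τ) ≤
    ofReal (K * p 0 ^ (n + 1)) * lowEnergy φ c r (2 * m * p 0) +
    ofReal (l ^ 2 * 2 ^ (n - 1) / (K * p 0 ^ 2)) * volume (closedBall p (p 0 / 4)) := by
  set s := p 0 with hs
  set B := closedBall p (s / 4) with hB
  have hBm : MeasurableSet B := Metric.isClosed_closedBall.measurableSet
  set W := (halfBall c r ∩ {x | x 0 < 2 * m * s}).indicator (weightedSq φ) with hW
  have hWm : Measurable W := (measurable_weightedSq hφ).indicator (measurableSet_low c r _)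
  have hint : ∫⁻ x, W x = lowEnergy φ c r (2 * m * s) :=
    lintegral_indicator (measurableSet_low c r _) _
  -- the pointwise estimate
  have hpt : ∀ z ∈ B, ∀ τ ∈ Icc (0 : ℝ) 1, ofReal l * φ (vscale (μ τ) z + w τ) ≤
      ofReal (K * s ^ (n + 1)) * (ofReal (μ τ) * W (vscale (μ τ) z + w τ)) +
        ofReal (l ^ 2 * 2 ^ (n - 1) / (K * s ^ 2)) := by
    intro z hz τ hτ
    obtain ⟨hμ0, hμm⟩ := hμ τ hτ
    obtain ⟨hz1, hz2⟩ := height_of_mem_closedBall hz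
    set x := vscale (μ τ) z + w τ with hx
    have hx0 : x 0 = μ τ * z 0 := by rw [hx, PiLp.add_apply, vscale_zero_apply, hw, add_zero]
    have hz0 : 0 < z 0 := by linarith
    have hxpos : 0 < x 0 := by rw [hx0]; positivity
    have hxW : W x = weightedSq φ x := by
      have hlow : x 0 < 2 * m * s := by
        rw [hx0]
        have : 0 < m := hμ0.trans_le hμm
        calc μ τ * z 0 ≤ m * z 0 := by gcongr
          _ < m * (2 * s) := by gcongr; linarith
          _ = _ := by ring
      exact indicator_of_mem (show x ∈ halfBall c r ∩ {x | x 0 < 2 * m * s} from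
        ⟨hmem z hz τ hτ, hlow⟩) _
    set α : ℝ := K * s ^ (n + 1) * (μ τ * (x 0 ^ (n - 1))⁻¹) with hα
    have hα0 : 0 < α := by positivity
    refine (ofReal_mul_le_add l hα0 (φ x)).trans (add_le_add (le_of_eq ?_) ?_)
    · rw [hxW, weightedSq, hα, ofReal_mul (by positivity), ofReal_mul hμ0.le]
      ring
    · refine ofReal_le_ofReal ?_
      rw [div_le_div_iff₀ hα0 (by positivity)]
      have h1 : x 0 ^ (n - 1) ≤ 2 ^ (n - 1) * s ^ (n - 1) * μ τ := by
        rw [hx0]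
        calc (μ τ * z 0) ^ (n - 1) ≤ (μ τ * (2 * s)) ^ (n - 1) := by gcongr; linarith
          _ = 2 ^ (n - 1) * s ^ (n - 1) * μ τ ^ (n - 1) := by rw [mul_pow, mul_pow]; ring
          _ ≤ _ := by
            refine mul_le_mul_of_nonneg_left ?_ (by positivity)
            exact pow_le_of_le_one hμ0.le (hμm.trans hm) (by omega)
      have h2 : 1 ≤ 2 ^ (n - 1) * s ^ (n - 1) * μ τ * (x 0 ^ (n - 1))⁻¹ := by
        rw [← div_eq_mul_inv, le_div_iff₀ (by positivity), one_mul]; exact h1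
      have h3 : s ^ (n + 1) = s ^ 2 * s ^ (n - 1) := by rw [← pow_add]; congr 1; omega
      calc l ^ 2 * (K * s ^ 2) = l ^ 2 * (K * s ^ 2) * 1 := by ring
        _ ≤ l ^ 2 * (K * s ^ 2) * (2 ^ (n - 1) * s ^ (n - 1) * μ τ * (x 0 ^ (n - 1))⁻¹) := by gcongr
        _ = _ := by rw [hα, h3]; ring
  -- the change of variables
  have hcov : ∀ τ ∈ Icc (0 : ℝ) 1,
      ∫⁻ z in B, ofReal (μ τ) * W (vscale (μ τ) z + w τ) ≤ lowEnergy φ c r (2 * m * s) := by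
    intro τ hτ
    obtain ⟨hμ0, -⟩ := hμ τ hτ
    have hdet : LinearMap.det (vscale (n := n) (μ τ)) ≠ 0 := by rw [det_vscale]; exact hμ0.ne'
    have hvm : Measurable (vscale (n := n) (μ τ)) :=
      (LinearMap.continuous_of_finiteDimensional _).measurable
    have hWt : Measurable fun y => W (y + w τ) := hWm.comp (measurable_id.add_const _)
    have h1 : ∫⁻ z, W (vscale (μ τ) z + w τ) = ofReal (μ τ)⁻¹ * ∫⁻ x, W x := by
      have h2 := lintegral_map (μ := volume) hWt hvm
      rw [Measure.map_linearMap_addHaar_eq_smul_addHaar _ hdet, lintegral_smul_measure,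
        lintegral_add_right_eq_self W (w τ), det_vscale, abs_of_pos (inv_pos.2 hμ0)] at h2
      rw [← h2, smul_eq_mul]
    calc _ ≤ ∫⁻ z, ofReal (μ τ) * W (vscale (μ τ) z + w τ) := setLIntegral_le_lintegral _ _
      _ = lowEnergy φ c r (2 * m * s) := by
        rw [lintegral_const_mul (f := fun z => W (vscale (μ τ) z + w τ)) _ (hWt.comp hvm), h1, ← mul_assoc, ← ofReal_mul hμ0.le,
          mul_inv_cancel₀ hμ0.ne', ENNReal.ofReal_one, one_mul, hint]
  have hL : Continuous fun q : ℝ × 𝕍 => vscale (μ q.1) q.2 + w q.1 :=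
    (continuous_vscale.comp ((hμc.comp continuous_fst).prodMk continuous_snd)).add
      (hwc.comp continuous_fst)
  have hmeas : Measurable fun q : ℝ × 𝕍 => ofReal (μ q.1) * W (vscale (μ q.1) q.2 + w q.1) :=
    (hμc.measurable.comp measurable_fst).ennreal_ofReal.mul (hWm.comp hL.measurable)
  set F := lowEnergy φ c r (2 * m * s) with hF
  set D : ℝ≥0∞ := ofReal (l ^ 2 * 2 ^ (n - 1) / (K * s ^ 2)) with hD
  calc _ ≤ ∫⁻ z in B, ∫⁻ τ in Icc (0 : ℝ) 1, (ofReal (K * s ^ (n + 1)) *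
        (ofReal (μ τ) * W (vscale (μ τ) z + w τ)) + D) :=
        setLIntegral_mono' hBm fun z hz => setLIntegral_mono' measurableSet_Icc fun τ hτ =>
          hpt z hz τ hτ
    _ = ∫⁻ τ in Icc (0 : ℝ) 1, ∫⁻ z in B, (ofReal (K * s ^ (n + 1)) *
        (ofReal (μ τ) * W (vscale (μ τ) z + w τ)) + D) := by
        refine lintegral_lintegral_swap (Measurable.aemeasurable ?_)
        exact ((hmeas.comp measurable_swap).const_mul _).add_const _
    _ ≤ ∫⁻ _τ in Icc (0 : ℝ) 1, (ofReal (K * s ^ (n + 1)) * F + D * volume B) := by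
        refine setLIntegral_mono' measurableSet_Icc fun τ hτ => ?_
        have hmτ : Measurable fun z => ofReal (μ τ) * W (vscale (μ τ) z + w τ) :=
          hmeas.comp measurable_prodMk_left
        rw [lintegral_add_right _ measurable_const, lintegral_const_mul _ hmτ, setLIntegral_const]
        gcongr
        exact hcov τ hτ
    _ = _ := by simp

end Oscillation

/-! ### The limit at the boundary -/

section UniformLimit

variable {c p : 𝔼 (n + 1)} {r s m : ℝ} {φ : 𝔼 (n + 1) → ℝ≥0∞} {N : Type*}

/-- `φ` is an upper gradient of `f` along segments in the half ball, of finite energy, and small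
on the scale of the height near the boundary. -/
structure HasSmallGradient [PseudoEMetricSpace N] (f : 𝕍 → N) (φ : 𝕍 → ℝ≥0∞) (c : 𝕍) (r : ℝ) :
    Prop where
  measurable : Measurable φ
  edist_le : ∀ a ∈ halfBall c r, ∀ b ∈ halfBall c r, edist (f a) (f b) ≤
    ∫⁻ τ in Icc (0 : ℝ) 1, ofReal ‖b - a‖ * φ (a + τ • (b - a))
  finite : ∫⁻ x in halfBall c r, weightedSq φ x ≠ ⊤
  small : ∀ ε : ℝ, 0 < ε → ∃ δ : ℝ, 0 < δ ∧ ∀ y ∈ halfBall c r, y 0 < δ →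
    ofReal (y 0) * φ y ≤ ofReal ε

lemma convex_halfBall (c : 𝕍) (r : ℝ) : Convex ℝ (halfBall c r) := by
  have h1 : Convex ℝ {y : 𝕍 | 0 < y 0} := convex_halfSpace_gt (f := fun y : 𝕍 => y 0)
      ⟨fun _ _ => rfl, fun _ _ => rfl⟩ 0
  exact h1.inter (convex_ball c r)

lemma closedBall_subset_halfBall (hc : c 0 = 0) (hp : p ∈ halfBall c (r / 2)) :
    closedBall p (p 0 / 4) ⊆ halfBall c r := fun _ hx =>
  (closedBall_subset_slab hc hp (closedBall_subset_closedBall (by linarith [hp.1]) hx)).1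

variable [PseudoEMetricSpace N] {f : 𝔼 (n + 1) → N}

/-- The oscillation on balls of radius comparable to the height. -/
lemma HasSmallGradient.local_oscillation (hf : HasSmallGradient f φ c r) (hc : c 0 = 0) {ε : ℝ}
    (hε : 0 < ε) : ∃ δ : ℝ, 0 < δ ∧ ∀ p ∈ halfBall c (r / 2), p 0 < δ →
    ∀ z ∈ closedBall p (p 0 / 4), edist (f p) (f z) ≤ ofReal ε := by
  obtain ⟨δ, hδ, h⟩ := hf.small ε hε
  refine ⟨δ / 2, by positivity, fun p hp hpδ z hz => ?_⟩
  have hsub := closedBall_subset_halfBall hc hp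
  have hp0 := hp.1
  have hpB : p ∈ closedBall p (p 0 / 4) := mem_closedBall_self (by positivity)
  refine (hf.edist_le p (hsub hpB) z (hsub hz)).trans ?_
  calc _ ≤ ∫⁻ _τ in Icc (0 : ℝ) 1, ofReal ε := by
        refine setLIntegral_mono' measurableSet_Icc fun τ hτ => ?_
        have hx : p + τ • (z - p) ∈ closedBall p (p 0 / 4) :=
          (convex_closedBall p (p 0 / 4)).add_smul_sub_mem hpB hz hτ
        obtain ⟨h1, h2⟩ := height_of_mem_closedBall hx
        refine le_trans ?_ (h _ (hsub hx) (by linarith))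
        gcongr
        rw [← dist_eq_norm]
        have : dist z p ≤ p 0 / 4 := hz
        linarith
    _ = _ := by simp

lemma exists_le_of_setLIntegral_le {B : Set 𝕍} {T : 𝕍 → ℝ≥0∞} (hB0 : volume B ≠ 0)
    (hB : volume B ≠ ⊤) (hT : AEMeasurable T (volume.restrict B)) {C : ℝ≥0∞}
    (h : ∫⁻ z in B, T z ≤ C * volume B) : ∃ z ∈ B, T z ≤ C := by
  obtain ⟨z, hz, hz'⟩ := exists_le_setLAverage hB0 hB hT
  refine ⟨z, hz, hz'.trans ?_⟩
  rw [setLAverage_eq]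
  exact ENNReal.div_le_of_le_mul h

/-- The total cost of the paths of `lintegral_path_le` is eventually small. -/
lemma HasSmallGradient.exists_path_small (hf : HasSmallGradient f φ c r) (hn : 2 ≤ n) {L ε : ℝ}
    (hε : 0 < ε) : ∃ δ : ℝ, 0 < δ ∧ ∀ (p : 𝕍) (m l : ℝ) (μ : ℝ → ℝ)
    (w : ℝ → 𝕍), 0 < p 0 → m ≤ 1 → m * p 0 ≤ δ → l ^ 2 ≤ L * p 0 ^ 2 → Continuous μ → Continuous w →
    (∀ τ ∈ Icc (0 : ℝ) 1, 0 < μ τ ∧ μ τ ≤ m) → (∀ τ, w τ 0 = 0) →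
    (∀ z ∈ closedBall p (p 0 / 4), ∀ τ ∈ Icc (0 : ℝ) 1, vscale (μ τ) z + w τ ∈ halfBall c r) →
    ∫⁻ z in closedBall p (p 0 / 4), ∫⁻ τ in Icc (0 : ℝ) 1, ofReal l * φ (vscale (μ τ) z + w τ) ≤
    ofReal ε * volume (closedBall p (p 0 / 4)) := by
  -- the constant of the second term
  set K : ℝ := (|L| + 1) * 2 ^ (n - 1) * 2 / ε with hK
  have hK0 : 0 < K := by positivity
  set vol1 : ℝ := volume.real (closedBall (0 : 𝕍) 1) with hvol1
  have hvol10 : 0 < vol1 := toReal_pos (Metric.measure_closedBall_pos _ _ one_pos).ne'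
    (isCompact_closedBall _ _).measure_lt_top.ne
  have hball : ∀ (p : 𝕍), 0 < p 0 →
      volume (closedBall p (p 0 / 4)) = ofReal ((p 0 / 4) ^ (n + 1) * vol1) := by
    intro p hp
    rw [Measure.addHaar_closedBall' _ _ (by positivity), ofReal_mul (by positivity), hvol1,
      measureReal_def, ENNReal.ofReal_toReal (isCompact_closedBall _ _).measure_lt_top.ne,
      finrank_euclideanSpace_fin]
  obtain ⟨δ, hδ, hδF⟩ := exists_lowEnergy_le (c := c) (r := r) hf.finite
    (ε := ofReal (ε / 2 * vol1 / (K * 4 ^ (n + 1)))) (by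
      rw [ENNReal.ofReal_pos]; positivity)
  refine ⟨δ / 2, by positivity, ?_⟩
  intro p m l μ w hp hm hmp hl hμc hwc hμ hw hmem
  refine (lintegral_path_le hn hf.measurable hμc hwc hμ hm hw hp l hK0 hmem).trans ?_
  have h1 : lowEnergy φ c r (2 * m * p 0) ≤ ofReal (ε / 2 * vol1 / (K * 4 ^ (n + 1))) :=
    (lowEnergy_mono (by linarith)).trans hδF
  have h2 : ofReal (K * p 0 ^ (n + 1)) * lowEnergy φ c r (2 * m * p 0) ≤
      ofReal (ε / 2) * volume (closedBall p (p 0 / 4)) := by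
    rw [hball p hp, ← ofReal_mul (by positivity)]
    refine (mul_le_mul_right h1 _).trans ?_
    rw [← ofReal_mul (by positivity)]
    refine ofReal_le_ofReal (le_of_eq ?_)
    rw [div_pow]
    field_simp
  have h3 : ofReal (l ^ 2 * 2 ^ (n - 1) / (K * p 0 ^ 2)) ≤ ofReal (ε / 2) := by
    refine ofReal_le_ofReal ?_
    rw [div_le_div_iff₀ (by positivity) (by positivity)]
    have h4 : l ^ 2 ≤ (|L| + 1) * p 0 ^ 2 :=
      hl.trans (mul_le_mul_of_nonneg_right (by linarith [le_abs_self L]) (by positivity))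
    have h5 : ε * K = (|L| + 1) * 2 ^ (n - 1) * 2 := by rw [hK]; field_simp
    calc l ^ 2 * 2 ^ (n - 1) * 2 ≤ (|L| + 1) * p 0 ^ 2 * 2 ^ (n - 1) * 2 := by gcongr
      _ = ε * K * p 0 ^ 2 := by rw [h5]; ring
      _ = _ := by ring
  calc _ ≤ ofReal (ε / 2) * volume (closedBall p (p 0 / 4)) +
        ofReal (ε / 2) * volume (closedBall p (p 0 / 4)) := by
        gcongr
    _ = _ := by rw [← add_mul, ← ofReal_add (by positivity) (by positivity), add_halves]

lemma aemeasurable_path_cost (hφ : Measurable φ) {μ : ℝ → ℝ} (hμc : Continuous μ)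
    {w : ℝ → 𝕍} (hwc : Continuous w) (l : ℝ) :
    Measurable fun z => ∫⁻ τ in Icc (0 : ℝ) 1, ofReal l * φ (vscale (μ τ) z + w τ) := by
  have hL : Continuous fun q : 𝕍 × ℝ => vscale (μ q.2) q.1 + w q.2 :=
    (continuous_vscale.comp ((hμc.comp continuous_snd).prodMk continuous_fst)).add
      (hwc.comp continuous_snd)
  exact Measurable.lintegral_prod_right ((hφ.comp hL.measurable).const_mul _)

lemma volume_whitney_pos (hp : 0 < p 0) : volume (closedBall p (p 0 / 4)) ≠ 0 :=
  (Metric.measure_closedBall_pos _ _ (by positivity)).ne'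

/-- The edist along a vertical path is bounded by the cost of that path. -/
lemma HasSmallGradient.edist_vscale_le (hf : HasSmallGradient f φ c r) {lam : ℝ} {z w : 𝕍}
    (h0 : 0 < lam) (h1 : lam ≤ 1) (ha : vscale lam z + w ∈ halfBall c r) (hb : z + w ∈ halfBall c r)
    (hz0 : 0 ≤ z 0) {l : ℝ} (hzl : z 0 ≤ l) : edist (f (vscale lam z + w)) (f (z + w)) ≤
    ∫⁻ τ in Icc (0 : ℝ) 1, ofReal l * φ (vscale (lam + τ * (1 - lam)) z + w) := by
  refine (hf.edist_le _ ha _ hb).trans (setLIntegral_mono' measurableSet_Icc fun τ hτ => ?_)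
  have e1 : z + w - (vscale lam z + w) = ((1 - lam) * z 0) • single 0 (1 : ℝ) := by
    rw [vscale_eq]; module
  have e2 : vscale lam z + w + τ • (z + w - (vscale lam z + w)) =
      vscale (lam + τ * (1 - lam)) z + w := by
    rw [e1, vscale_eq, vscale_eq]; module
  rw [e2]
  gcongr
  rw [e1, norm_smul, norm_single, norm_one, mul_one, norm_eq_abs,
    abs_of_nonneg (mul_nonneg (by linarith) hz0)]
  nlinarith

/-- The oscillation over points of the same height: two vertical paths down to a much smaller
height, joined by a horizontal path there. -/
lemma HasSmallGradient.horizontal_oscillation (hf : HasSmallGradient f φ c r) (hn : 2 ≤ n)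
    (hc : c 0 = 0) {ε : ℝ} (hε : 0 < ε) : ∃ δ : ℝ, 0 < δ ∧ ∀ p ∈ halfBall c (r / 2),
    ∀ q ∈ halfBall c (r / 2), p 0 < δ → q 0 = p 0 → edist (f p) (f q) ≤ ofReal ε := by
  obtain ⟨δ₁, hδ₁, hloc⟩ := hf.local_oscillation hc (ε := ε / 5) (by positivity)
  obtain ⟨δ₂, hδ₂, hvert⟩ := hf.exists_path_small hn (L := 4) (ε := ε / 5) (by positivity)
  refine ⟨min δ₁ δ₂, by positivity, ?_⟩
  intro p hp q hq hpδ hqp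
  have hp0 := hp.1
  set s := p 0 with hs
  set h := q - p with hh
  have hh0 : h 0 = 0 := by rw [hh, PiLp.sub_apply, hqp]; exact sub_self _
  obtain ⟨δ₃, hδ₃, hhor⟩ := hf.exists_path_small hn (L := ‖h‖ ^ 2 / s ^ 2) (ε := ε / 5)
    (by positivity)
  -- the height at which the horizontal path runs
  set lam : ℝ := min 1 (δ₃ / s) with hlam
  have hlam0 : 0 < lam := by positivity
  have hlam1 : lam ≤ 1 := min_le_left _ _
  have hlams : lam * s ≤ δ₃ := by
    calc lam * s ≤ δ₃ / s * s := by gcongr; exact min_le_right _ _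
      _ = δ₃ := by field_simp
  set B := closedBall p (s / 4) with hB
  have hBp : B ⊆ halfBall c r := closedBall_subset_halfBall hc hp
  have hzq : ∀ z ∈ B, z + h ∈ closedBall q (q 0 / 4) := by
    intro z hz
    rw [mem_closedBall_iff_norm, hqp, hh, show z + (q - p) - q = z - p by abel]
    exact mem_closedBall_iff_norm.1 hz
  have hBq : ∀ z ∈ B, z + h ∈ halfBall c r := fun z hz =>
    closedBall_subset_halfBall hc hq (hzq z hz)
  have hμm : ∀ τ ∈ Icc (0 : ℝ) 1, 0 < lam + τ * (1 - lam) ∧ lam + τ * (1 - lam) ≤ 1 := by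
    intro τ hτ
    have h1 := mul_nonneg hτ.1 (sub_nonneg.2 hlam1)
    have h2 := mul_le_mul_of_nonneg_right hτ.2 (sub_nonneg.2 hlam1)
    exact ⟨by linarith, by linarith⟩
  have hvh : ∀ (μ : ℝ) (z : 𝕍), vscale μ (z + h) = vscale μ z + h := by
    intro μ z
    rw [vscale_eq, vscale_eq, PiLp.add_apply, hh0, add_zero]
    module
  have hmem0 : ∀ z ∈ B, ∀ μ : ℝ, 0 < μ → μ ≤ 1 → vscale μ z ∈ halfBall c r := fun z hz μ h0 h1 =>
    vscale_mem_halfBall hc h0 h1 (hBp hz)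
  have hmem1 : ∀ z ∈ B, ∀ μ : ℝ, 0 < μ → μ ≤ 1 → vscale μ z + h ∈ halfBall c r :=
    fun z hz μ h0 h1 => by
      rw [← hvh]
      exact vscale_mem_halfBall hc h0 h1 (hBq z hz)
  have hsδ : 1 * s ≤ δ₂ := by rw [one_mul]; exact hpδ.le.trans (min_le_right _ _)
  have hμc : Continuous fun τ : ℝ => lam + τ * (1 - lam) := by fun_prop
  have c1 := hvert p 1 (2 * s) (fun τ => lam + τ * (1 - lam)) (fun _ => 0) hp0 le_rfl hsδ
    (le_of_eq (by ring)) hμc continuous_const hμm (fun _ => rfl) fun z hz τ hτ => by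
      rw [add_zero]; exact hmem0 z hz _ (hμm τ hτ).1 (hμm τ hτ).2
  have c2 := hvert p 1 (2 * s) (fun τ => lam + τ * (1 - lam)) (fun _ => h) hp0 le_rfl hsδ
    (le_of_eq (by ring)) hμc continuous_const hμm (fun _ => hh0) fun z hz τ hτ =>
      hmem1 z hz _ (hμm τ hτ).1 (hμm τ hτ).2
  have hwc : Continuous fun τ : ℝ => τ • h := by fun_prop
  have hmem2 : ∀ z ∈ B, ∀ τ ∈ Icc (0 : ℝ) 1, vscale lam z + τ • h ∈ halfBall c r := by
    intro z hz τ hτ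
    have := (convex_halfBall c r).add_smul_sub_mem (hmem0 z hz lam hlam0 hlam1)
      (hmem1 z hz lam hlam0 hlam1) hτ
    rwa [add_sub_cancel_left] at this
  have c3 := hhor p lam ‖h‖ (fun _ => lam) (fun τ => τ • h) hp0 hlam1 hlams
    (le_of_eq (by rw [← hs]; field_simp)) continuous_const hwc (fun _ _ => ⟨hlam0, le_rfl⟩)
    (fun τ => by rw [PiLp.smul_apply, hh0, smul_zero]) hmem2
  have m1 := aemeasurable_path_cost hf.measurable hμc
    (continuous_const (y := (0 : 𝕍))) (2 * s)
  have m2 := aemeasurable_path_cost hf.measurable hμc (continuous_const (y := h)) (2 * s)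
  have m3 := aemeasurable_path_cost hf.measurable (continuous_const (y := lam)) hwc ‖h‖
  obtain ⟨z, hz, hT⟩ := exists_le_of_setLIntegral_le (volume_whitney_pos hp0)
    (isCompact_closedBall p (s / 4)).measure_lt_top.ne ((m1.add m2).add m3).aemeasurable
    (C := ofReal (ε / 5) + ofReal (ε / 5) + ofReal (ε / 5)) (by
      simp only [Pi.add_apply]
      rw [lintegral_add_right _ m3, lintegral_add_right _ m2, add_mul, add_mul]
      exact add_le_add (add_le_add c1 c2) c3)
  simp only [Pi.add_apply] at hT
  obtain ⟨hz1, hz2⟩ := height_of_mem_closedBall hz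
  have hz0 : 0 ≤ z 0 := by linarith
  have hzl : z 0 ≤ 2 * s := by linarith
  have e1 := hf.edist_vscale_le (w := 0) hlam0 hlam1 (by
    rw [add_zero]; exact hmem0 z hz lam hlam0 hlam1) (by rw [add_zero]; exact hBp hz) hz0 hzl
  have e2 := hf.edist_vscale_le (w := h) hlam0 hlam1 (hmem1 z hz lam hlam0 hlam1) (hBq z hz) hz0 hzl
  have e3 := hf.edist_le _ (hmem0 z hz lam hlam0 hlam1) _ (hmem1 z hz lam hlam0 hlam1)
  simp only [add_sub_cancel_left] at e3
  have e4 := hloc p hp (hpδ.trans_le (min_le_left _ _)) z hz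
  have e5 := hloc q hq (by rw [hqp]; exact hpδ.trans_le (min_le_left _ _)) _ (hzq z hz)
  rw [add_zero, add_zero, edist_comm] at e1
  calc edist (f p) (f q) ≤ edist (f p) (f z) + (edist (f z) (f (vscale lam z)) +
        edist (f (vscale lam z)) (f (vscale lam z + h)) +
        edist (f (vscale lam z + h)) (f (z + h))) + edist (f (z + h)) (f q) := by
        refine (edist_triangle _ (f (z + h)) _).trans (add_le_add_left ?_ _)
        refine (edist_triangle _ (f z) _).trans (add_le_add_right ?_ _)
        refine (edist_triangle _ (f (vscale lam z + h)) _).trans (add_le_add_left ?_ _)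
        exact edist_triangle _ _ _
    _ ≤ ofReal (ε / 5) + (ofReal (ε / 5) + ofReal (ε / 5) + ofReal (ε / 5)) + ofReal (ε / 5) := by
        refine add_le_add (add_le_add e4 (le_trans ?_ hT)) (by rw [edist_comm]; exact e5)
        calc _ ≤ _ := add_le_add (add_le_add e1 e3) e2
          _ = _ := add_right_comm _ _ _
    _ = ofReal ε := by
        rw [← ofReal_add (by positivity) (by positivity),
          ← ofReal_add (by positivity) (by positivity),
          ← ofReal_add (by positivity) (by positivity),
          ← ofReal_add (by positivity) (by positivity)]
        congr 1; ring

/-- The oscillation between a point and a point below it. A vertical path starts near the upper point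
and ends near the height of the lower one; local and horizontal oscillations bridge the gaps. -/
lemma HasSmallGradient.vertical_oscillation (hf : HasSmallGradient f φ c r) (hn : 2 ≤ n)
    (hc : c 0 = 0) {ε : ℝ} (hε : 0 < ε) : ∃ δ : ℝ, 0 < δ ∧ ∀ p ∈ halfBall c (r / 4),
    p 0 < δ → ∀ lam : ℝ, 0 < lam → lam ≤ 1 → edist (f p) (f (vscale lam p)) ≤ ofReal ε := by
  obtain ⟨δ₁, hδ₁, hloc⟩ := hf.local_oscillation hc (ε := ε / 4) (by positivity)
  obtain ⟨δ₂, hδ₂, hvert⟩ := hf.exists_path_small hn (L := 4) (ε := ε / 4) (by positivity)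
  obtain ⟨δ₃, hδ₃, hhor⟩ := hf.horizontal_oscillation hn hc (ε := ε / 4) (by positivity)
  refine ⟨min δ₁ (min δ₂ δ₃), by positivity, ?_⟩
  intro p hp hpδ lam hlam0 hlam1
  have hδ₁' := hpδ.trans_le (min_le_left _ _)
  have hδ₂' := hpδ.trans_le ((min_le_right _ _).trans (min_le_left _ _))
  have hδ₃' := hpδ.trans_le ((min_le_right _ _).trans (min_le_right _ _))
  have hp0 := hp.1
  have hpr := height_lt hc hp
  have hp2 : p ∈ halfBall c (r / 2) := ⟨hp0, by linarith [hp.2]⟩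
  set s := p 0 with hs
  set B := closedBall p (s / 4) with hB
  have hBp : B ⊆ halfBall c r := closedBall_subset_halfBall hc hp2
  have hμm : ∀ τ ∈ Icc (0 : ℝ) 1, 0 < lam + τ * (1 - lam) ∧ lam + τ * (1 - lam) ≤ 1 := by
    intro τ hτ
    have h1 := mul_nonneg hτ.1 (sub_nonneg.2 hlam1)
    have h2 := mul_le_mul_of_nonneg_right hτ.2 (sub_nonneg.2 hlam1)
    exact ⟨by linarith, by linarith⟩
  have hmem0 : ∀ z ∈ B, ∀ μ : ℝ, 0 < μ → μ ≤ 1 → vscale μ z ∈ halfBall c r := fun z hz μ h0 h1 =>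
    vscale_mem_halfBall hc h0 h1 (hBp hz)
  have hμc : Continuous fun τ : ℝ => lam + τ * (1 - lam) := by fun_prop
  have c1 := hvert p 1 (2 * s) (fun τ => lam + τ * (1 - lam)) (fun _ => 0) hp0 le_rfl
    (by rw [one_mul]; exact hδ₂'.le) (le_of_eq (by ring)) hμc continuous_const hμm
    (fun _ => rfl) fun z hz τ hτ => by rw [add_zero]; exact hmem0 z hz _ (hμm τ hτ).1 (hμm τ hτ).2
  have m1 := aemeasurable_path_cost hf.measurable hμc
    (continuous_const (y := (0 : 𝕍))) (2 * s)
  obtain ⟨z, hz, hT⟩ := exists_le_of_setLIntegral_le (volume_whitney_pos hp0)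
    (isCompact_closedBall p (s / 4)).measure_lt_top.ne m1.aemeasurable c1
  obtain ⟨hz1, hz2⟩ := height_of_mem_closedBall hz
  have e1 := hf.edist_vscale_le (w := 0) hlam0 hlam1 (by
    rw [add_zero]; exact hmem0 z hz lam hlam0 hlam1) (by rw [add_zero]; exact hBp hz)
    (by linarith : 0 ≤ z 0) (by linarith : z 0 ≤ 2 * s)
  rw [add_zero, add_zero] at e1
  have e2 := hloc p hp2 hδ₁' z hz
  -- the point at the height of `p` over `z`
  set z' := z + (s - z 0) • single 0 (1 : ℝ) with hz'
  have hz'0 : z' 0 = s := by simp [hz']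
  have hzd : dist z' z ≤ s / 4 := by
    rw [dist_eq_norm, hz', add_sub_cancel_left, norm_smul, norm_single, norm_one,
      mul_one, norm_eq_abs, abs_le]
    constructor <;> linarith
  have hz'2 : z' ∈ halfBall c (r / 2) := by
    refine ⟨by rw [hz'0]; exact hp0, ?_⟩
    have h1 := dist_triangle z' z c
    have h2 := dist_triangle z p c
    have h3 : dist z p ≤ s / 4 := hz
    have := hp.2
    linarith
  have hq2 : vscale lam z' ∈ halfBall c (r / 2) := vscale_mem_halfBall hc hlam0 hlam1 hz'2
  have hq0 : vscale lam z' 0 = lam * s := by rw [vscale_zero_apply, hz'0]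
  have hls : lam * s ≤ s := mul_le_of_le_one_left hp0.le hlam1
  have e3 := hloc (vscale lam z') hq2 (by rw [hq0]; linarith) (vscale lam z) (by
    rw [mem_closedBall_iff_norm, hq0]
    have : vscale lam z - vscale lam z' = (lam * (z 0 - s)) • single 0 (1 : ℝ) := by
      rw [← map_sub, hz', vscale_eq]
      simp
      module
    rw [this, norm_smul, norm_single, norm_one, mul_one, norm_eq_abs, abs_mul, abs_of_pos hlam0]
    have h1 : |z 0 - s| ≤ s / 4 := by rw [abs_le]; constructor <;> linarith
    calc lam * |z 0 - s| ≤ lam * (s / 4) := by gcongr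
      _ = _ := by ring)
  have e4 := hhor (vscale lam z') hq2 (vscale lam p) (vscale_mem_halfBall hc hlam0 hlam1 hp2)
    (by rw [hq0]; linarith) (by rw [hq0, vscale_zero_apply])
  calc edist (f p) (f (vscale lam p)) ≤ edist (f p) (f z) + edist (f z) (f (vscale lam z)) +
        edist (f (vscale lam z)) (f (vscale lam z')) +
        edist (f (vscale lam z')) (f (vscale lam p)) := by
        refine (edist_triangle _ (f (vscale lam z')) _).trans (add_le_add_left ?_ _)
        refine (edist_triangle _ (f (vscale lam z)) _).trans (add_le_add_left ?_ _)
        exact edist_triangle _ _ _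
    _ ≤ ofReal (ε / 4) + ofReal (ε / 4) + ofReal (ε / 4) + ofReal (ε / 4) := by
        refine add_le_add (add_le_add (add_le_add e2 ?_) ?_) e4
        · rw [edist_comm]; exact e1.trans hT
        · rw [edist_comm]; exact e3
    _ = ofReal ε := by
        rw [← ofReal_add (by positivity) (by positivity),
          ← ofReal_add (by positivity) (by positivity),
          ← ofReal_add (by positivity) (by positivity)]
        congr 1; ring

lemma HasSmallGradient.oscillation (hf : HasSmallGradient f φ c r) (hn : 2 ≤ n) (hc : c 0 = 0)
    {ε : ℝ} (hε : 0 < ε) : ∃ δ : ℝ, 0 < δ ∧ ∀ p ∈ halfBall c (r / 4),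
    ∀ q ∈ halfBall c (r / 4), p 0 < δ → q 0 < δ → edist (f p) (f q) ≤ ofReal ε := by
  obtain ⟨δ₁, hδ₁, hver⟩ := hf.vertical_oscillation hn hc (ε := ε / 2) (by positivity)
  obtain ⟨δ₂, hδ₂, hhor⟩ := hf.horizontal_oscillation hn hc (ε := ε / 2) (by positivity)
  refine ⟨min δ₁ δ₂, by positivity, ?_⟩
  have key : ∀ p ∈ halfBall c (r / 4), ∀ q ∈ halfBall c (r / 4), p 0 < min δ₁ δ₂ → q 0 ≤ p 0 →
      edist (f p) (f q) ≤ ofReal ε := by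
    intro p hp q hq hpδ hqp
    have hp0 := hp.1
    have hr := dist_nonneg.trans_lt hp.2
    have hsub : halfBall c (r / 4) ⊆ halfBall c (r / 2) := fun x hx => ⟨hx.1, by linarith [hx.2]⟩
    have h1 := hver p hp (hpδ.trans_le (min_le_left _ _)) (q 0 / p 0) (div_pos hq.1 hp0)
      ((div_le_one hp0).2 hqp)
    have h0 : vscale (q 0 / p 0) p 0 = q 0 := by rw [vscale_zero_apply]; field_simp
    have h2 := hhor _ (hsub (vscale_mem_halfBall hc (div_pos hq.1 hp0) ((div_le_one hp0).2 hqp) hp))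
      q (hsub hq) (by rw [h0]; exact hqp.trans_lt (hpδ.trans_le (min_le_right _ _))) h0.symm
    calc _ ≤ _ := edist_triangle _ _ _
      _ ≤ ofReal (ε / 2) + ofReal (ε / 2) := add_le_add h1 h2
      _ = _ := by rw [← ofReal_add (by positivity) (by positivity), add_halves]
  intro p hp q hq hpδ hqδ
  rcases le_total (q 0) (p 0) with h | h
  · exact key p hp q hq hpδ h
  · rw [edist_comm]; exact key q hq p hp hqδ h

/-- A map with small gradient extends continuously, by a constant, to the boundary. -/
lemma HasSmallGradient.exists_limit [CompleteSpace N] (hf : HasSmallGradient f φ c r) (hn : 2 ≤ n)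
    (hc : c 0 = 0) (hr : 0 < r) : ∃ P : N, ∀ ε : ℝ, 0 < ε → ∃ δ : ℝ, 0 < δ ∧
    ∀ y ∈ halfBall c (r / 4), y 0 < δ → edist (f y) P ≤ ofReal ε := by
  -- a sequence of points above `c` which tends to the boundary
  set a : ℕ → 𝕍 := fun k => c + (r / 8 * (1 / ((k : ℝ) + 1))) • single 0 (1 : ℝ) with ha
  have ha0 : ∀ k, a k 0 = r / 8 * (1 / ((k : ℝ) + 1)) := fun k => by simp [ha, hc]
  have ham : ∀ k, a k ∈ halfBall c (r / 4) := by
    intro k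
    refine ⟨by rw [ha0]; positivity, ?_⟩
    rw [dist_eq_norm, ha, add_sub_cancel_left, norm_smul, norm_single, norm_one,
      mul_one, norm_of_nonneg (by positivity)]
    have : 1 / ((k : ℝ) + 1) ≤ 1 := by
      rw [div_le_one (by positivity)]; linarith [(Nat.cast_nonneg k : (0 : ℝ) ≤ k)]
    nlinarith
  have halim : Tendsto (a · 0) atTop (𝓝 0) := by
    simp only [ha0]
    simpa using tendsto_one_div_add_atTop_nhds_zero_nat.const_mul (r / 8)
  have hsmall : ∀ δ : ℝ, 0 < δ → ∀ᶠ k in atTop, a k 0 < δ := fun δ hδ =>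
    halim.eventually (gt_mem_nhds hδ)
  have hcau : CauchySeq fun k => f (a k) := by
    rw [EMetric.cauchySeq_iff]
    intro ε hε
    obtain ⟨ε', hε', hle⟩ : ∃ ε' : ℝ, 0 < ε' ∧ ofReal ε' < ε := by
      obtain ⟨b, hb0, hb⟩ := ENNReal.lt_iff_exists_real_btwn.1 hε
      exact ⟨b, ENNReal.ofReal_pos.1 hb.1, hb.2⟩
    obtain ⟨δ, hδ, h⟩ := hf.oscillation hn hc hε'
    obtain ⟨k₀, hk₀⟩ := eventually_atTop.1 (hsmall δ hδ)
    exact ⟨k₀, fun k hk l hl => (h _ (ham k) _ (ham l) (hk₀ k hk) (hk₀ l hl)).trans_lt hle⟩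
  obtain ⟨P, hP⟩ := cauchySeq_tendsto_of_complete hcau
  refine ⟨P, fun ε hε => ?_⟩
  obtain ⟨δ, hδ, h⟩ := hf.oscillation hn hc hε
  refine ⟨δ, hδ, fun y hy hyδ => ?_⟩
  refine le_of_tendsto (tendsto_const_nhds.edist hP) ?_
  filter_upwards [hsmall δ hδ] with k hk
  exact h y hy _ (ham k) hyδ hk

end UniformLimit

/-! ### Harmonic maps in coordinates near the boundary -/

section LocalDecay

variable {lam Lam : ℝ}

/-- A smooth metric on the half ball which becomes nondegenerate and of class `C¹` up to the
boundary when it is multiplied by the square of the height, expressed by bounds for the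
coefficients of its Laplacian and for its volume density. -/
structure AHMetric (G : 𝕍 → 𝕄 (n + 1)) (c : 𝕍) (r lam Lam : ℝ) : Prop where
  contDiffOn : ∀ i j, ContDiffOn ℝ ∞ (G · i j) (halfBall c r)
  symm : ∀ y ∈ halfBall c r, ∀ i j, G y i j = G y j i
  det_pos : ∀ y ∈ halfBall c r, 0 < (G y).det
  field : EllipticOn (fun y => (y 0) ^ (n - 1) • volInv G y) (halfBall c r) lam Lam Lam
  le_det : ∀ y ∈ halfBall c r, lam * ((y 0) ^ (n + 1))⁻¹ ≤ √(G y).det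
  det_le : ∀ y ∈ halfBall c r, √(G y).det ≤ Lam * ((y 0) ^ (n + 1))⁻¹
  metric_le : ∀ y ∈ halfBall c r, ∀ ξ : Fin (n + 1) → ℝ,
    ∑ i, ∑ j, G y i j * ξ i * ξ j ≤ Lam * ((y 0) ^ 2)⁻¹ * ∑ i, ξ i ^ 2

variable {G : 𝔼 (n + 1) → 𝕄 (n + 1)} {c y : 𝔼 (n + 1)} {r : ℝ}

lemma halfBall_mono {r' : ℝ} (h : r' ≤ r) : halfBall c r' ⊆ halfBall c r := fun _ hx =>
  ⟨hx.1, hx.2.trans_le h⟩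

lemma EllipticOn.mono {d : ℕ} {A : 𝔼 d → 𝕄 d}
    {U V : Set (𝔼 d)} {eps Lam' eps' : ℝ} (hA : EllipticOn A U lam Lam eps)
    (hV : V ⊆ U) (h1 : Lam ≤ Lam') (h2 : eps ≤ eps') : EllipticOn A V lam Lam' eps' where
  contDiffOn i j := (hA.contDiffOn i j).mono hV
  elliptic y hy := ⟨(hA.elliptic y (hV hy)).symm, (hA.elliptic y (hV hy)).lower,
    fun i j => ((hA.elliptic y (hV hy)).upper i j).trans h1⟩
  deriv_le y hy i j k := (hA.deriv_le y (hV hy) i j k).trans h2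

lemma AHMetric.mono {r' : ℝ} (hG : AHMetric G c r lam Lam) (h : r' ≤ r) :
    AHMetric G c r' lam Lam where
  contDiffOn i j := (hG.contDiffOn i j).mono (halfBall_mono h)
  symm y hy := hG.symm y (halfBall_mono h hy)
  det_pos y hy := hG.det_pos y (halfBall_mono h hy)
  field := hG.field.mono (halfBall_mono h) le_rfl le_rfl
  le_det y hy := hG.le_det y (halfBall_mono h hy)
  det_le y hy := hG.det_le y (halfBall_mono h hy)
  metric_le y hy := hG.metric_le y (halfBall_mono h hy)

lemma divOp_congr {d : ℕ} {A B : 𝔼 d → 𝕄 d} {y : 𝔼 d} (h : A =ᶠ[𝓝 y] B) (v : 𝔼 d → ℝ) :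
    divOp A v y = divOp B v y := by
  unfold divOp
  refine sum_ext fun i => pd_congr i ?_
  filter_upwards [h] with z hz
  rw [hz]

lemma AHMetric.divOp_eq (hG : AHMetric G c r lam Lam) (hy : y ∈ halfBall c r) {v : 𝕍 → ℝ}
    (hv : ContDiffOn ℝ 2 v (halfBall c r)) :
    divOp (singularField fun y => (y 0) ^ (n - 1) • volInv G y) v y =
    √(G y).det * laplacian G v y := by
  have hU := (isOpen_halfBall c r).mem_nhds hy
  have h1 : (singularField fun y => (y 0) ^ (n - 1) • volInv G y) =ᶠ[𝓝 y] volInv G := by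
    filter_upwards [hU] with z hz
    rw [singularField, smul_smul, inv_mul_cancel₀ (pow_ne_zero _ hz.1.ne'), one_smul]
  rw [divOp_congr h1]
  refine divOp_volInv_eq (fun i j => ((hG.contDiffOn i j).contDiffAt hU).of_le ?_) ?_
    (hG.det_pos y hy) (hv.contDiffAt hU)
  · exact natCast_le_infty 1
  · filter_upwards [hU] with z hz using hG.symm z hz

/-- The squared length of the gradient. -/
def gradSq {d : ℕ} (G : 𝔼 d → 𝕄 d) (v : 𝔼 d → ℝ) (y : 𝔼 d) : ℝ :=
  ∑ i, ∑ j, (G y)⁻¹ i j * (pd i v y * pd j v y)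

lemma AHMetric.inv_symm (hG : AHMetric G c r lam Lam) (hy : y ∈ halfBall c r) (i j : Fin (n + 1)) :
    (G y)⁻¹ i j = (G y)⁻¹ j i := by
  have : (G y).transpose = G y := by ext i j; exact hG.symm y hy j i
  conv_lhs => rw [← this, ← transpose_nonsing_inv]
  rfl

lemma AHMetric.inv_nonneg (hG : AHMetric G c r lam Lam) (hlam : 0 < lam) (hy : y ∈ halfBall c r)
    (ξ : Fin (n + 1) → ℝ) : 0 ≤ ∑ i, ∑ j, (G y)⁻¹ i j * (ξ i * ξ j) := by
  have h := (hG.field.elliptic y hy).lower ξ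
  have h1 : ∑ i, ∑ j, ((y 0) ^ (n - 1) • volInv G y) i j * ξ i * ξ j =
      ((y 0) ^ (n - 1) * √(G y).det) * ∑ i, ∑ j, (G y)⁻¹ i j * (ξ i * ξ j) := by
    simp only [volInv, Matrix.smul_apply, smul_eq_mul, mul_sum]
    exact sum_ext fun _ => sum_ext fun _ => by ring
  rw [h1] at h
  have h2 : 0 < (y 0) ^ (n - 1) * √(G y).det :=
    mul_pos (pow_pos hy.1 _) (Real.sqrt_pos.2 (hG.det_pos y hy))
  have h3 : 0 ≤ lam * ∑ i, ξ i ^ 2 := by positivity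
  exact nonneg_of_mul_nonneg_right (h3.trans h) h2

/-- The pointwise bound of a subsolution, such as the energy density of a harmonic map, by its
integral over a ball whose radius is comparable to the height. -/
lemma AHMetric.exists_pointwise_le (hG : AHMetric G c r lam Lam) (hlam : 0 < lam) (hLam : 0 < Lam)
    (hc : c 0 = 0) (hr1 : r ≤ 1) {v : 𝕍 → ℝ} (hv : ContDiffOn ℝ 2 v (halfBall c r))
    (hv0 : ∀ x ∈ halfBall c r, 0 ≤ v x)
    (hlap : ∀ x ∈ halfBall c r, -(2 * n * v x) ≤ laplacian G v x) :
    ∃ C : ℝ, 0 < C ∧ ∀ y ∈ halfBall c (r / 2),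
    v y ≤ C * ∫ x in closedBall y (y 0 / 4), v x * √(G x).det := by
  set Lam' : ℝ := (2 * n + 1) * Lam with hLam'
  have hn0 : (0 : ℝ) ≤ n := Nat.cast_nonneg n
  have hLL : Lam ≤ Lam' := by rw [hLam']; nlinarith
  obtain ⟨C, hC, h⟩ := exists_whitney_mean_value n hlam (hLam.trans_le hLL)
  refine ⟨C * 2 ^ (n + 1) / lam, by positivity, fun y hy => ?_⟩
  have hy0 := hy.1
  have h1 := h _ c y r v hc hr1 (hG.field.mono Subset.rfl hLL hLL) hv hv0 (fun x hx => by
    rw [hG.divOp_eq hx hv]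
    have h2 := mul_le_mul_of_nonneg_left (hlap x hx) (sqrt_nonneg (G x).det)
    refine le_trans (neg_le_neg ?_) (le_of_eq_of_le (mul_neg _ _).symm h2)
    have h3 := hG.det_le x hx
    have h4 := hv0 x hx
    have hx0 := hx.1
    calc _ ≤ Lam * ((x 0) ^ (n + 1))⁻¹ * (2 * n * v x) := by gcongr
      _ = (2 * n) * (Lam * ((x 0) ^ (n + 1))⁻¹ * v x) := by ring
      _ ≤ (2 * n + 1) * (Lam * ((x 0) ^ (n + 1))⁻¹ * v x) := by gcongr; linarith
      _ = _ := by rw [hLam']; ring) hy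
  set B := closedBall y (y 0 / 4) with hB
  have hBU : B ⊆ halfBall c r := closedBall_subset_halfBall hc hy
  have hdetc : ContinuousOn (fun x => √(G x).det) (halfBall c r) := fun x hx =>
    (contDiffAt_det (k := 0) fun i j => ((hG.contDiffOn i j).contDiffAt
      ((isOpen_halfBall c r).mem_nhds hx)).of_le (natCast_le_infty 0)).continuousAt.sqrt
      |>.continuousWithinAt
  have h2 : ∫ x in B, v x ≤ (2 * y 0) ^ (n + 1) / lam * ∫ x in B, v x * √(G x).det := by
    rw [← integral_const_mul]
    refine setIntegral_mono_on ((hv.continuousOn.mono hBU).integrableOn_compact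
      (isCompact_closedBall _ _)) (((hv.continuousOn.mul hdetc).mono hBU).integrableOn_compact
      (isCompact_closedBall _ _) |>.const_mul _) Metric.isClosed_closedBall.measurableSet ?_
    intro x hx
    have hxU := hBU hx
    have hx0 := hxU.1
    obtain ⟨-, hx2⟩ := height_of_mem_closedBall hx
    have h3 := hG.le_det x hxU
    have h4 := hv0 x hxU
    have h5 : lam ≤ (2 * y 0) ^ (n + 1) * √(G x).det := by
      calc lam = (x 0) ^ (n + 1) * (lam * ((x 0) ^ (n + 1))⁻¹) := by field_simp
        _ ≤ (x 0) ^ (n + 1) * √(G x).det := by gcongr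
        _ ≤ _ := by gcongr; linarith
    calc v x = v x * (lam / lam) := by rw [div_self hlam.ne', mul_one]
      _ ≤ v x * ((2 * y 0) ^ (n + 1) * √(G x).det / lam) := by gcongr
      _ = _ := by ring
  have h6 : 0 < y 0 ^ (n + 1) := by positivity
  refine le_of_mul_le_mul_left ?_ h6
  calc _ ≤ C * ∫ x in B, v x := h1
    _ ≤ C * ((2 * y 0) ^ (n + 1) / lam * ∫ x in B, v x * √(G x).det) := by gcongr
    _ = _ := by rw [mul_pow]; ring

variable {H : 𝔼 m → 𝕄 m} {u : 𝔼 (n + 1) → 𝔼 m} {P : 𝔼 m}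

/-- The function `σ (u^γ - P^γ) + κ |u - P|²`. -/
def comparisonFun (u : 𝕍 → 𝔼 m) (P : 𝔼 m) (σ κ : ℝ) (γ : Fin m) (y : 𝕍) : ℝ :=
  σ * (u y γ - P γ) + κ * ∑ β, (u y β - P β) ^ 2

lemma contDiffAt_comparisonFun {k : ℕ∞ω} (hu : ContDiffAt ℝ k u y) (σ κ : ℝ) (γ : Fin m) :
    ContDiffAt ℝ k (comparisonFun u P σ κ γ) y := by
  have h := fun β => contDiffAt_coord hu β
  unfold comparisonFun
  exact (contDiffAt_const.mul ((h γ).sub contDiffAt_const)).add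
    (contDiffAt_const.mul (ContDiffAt.sum fun β _ => ((h β).sub contDiffAt_const).pow 2))

lemma pd_comparisonFun (hu : DifferentiableAt ℝ u y) (σ κ : ℝ) (γ : Fin m) (j : Fin (n + 1)) :
    pd j (comparisonFun u P σ κ γ) y = σ * pd j (u · γ) y +
    κ * ∑ β, 2 * (u y β - P β) * pd j (u · β) y := by
  have h : ∀ β, DifferentiableAt ℝ (u · β) y := fun β => by fun_prop
  have h1 : ∀ β, DifferentiableAt ℝ (fun z => u z β - P β) y := fun β => (h β).sub_const _
  have h2 : ∀ β, pd j (fun z => u z β - P β) y = pd j (u · β) y := fun β => by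
    rw [pd_sub (g := fun _ => P β) j (h β) (differentiableAt_const _), pd_const, sub_zero]
  have h3 : ∀ β, pd j (fun z => (u z β - P β) ^ 2) y =
      2 * (u y β - P β) * pd j (u · β) y := fun β => by
    rw [pd_comp_real (φ := fun x => x ^ 2) (φ' := 2 * (u y β - P β)) j
      (by simpa using hasDerivAt_pow 2 (u y β - P β)) (h1 β), h2]
  unfold comparisonFun
  rw [pd_add j ((h1 γ).const_mul σ) ((DifferentiableAt.fun_sum fun β _ =>
    (h1 β).fun_pow 2).const_mul κ), pd_const_mul j σ (h1 γ), h2,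
    pd_const_mul j κ (DifferentiableAt.fun_sum fun β _ => (h1 β).fun_pow 2),
    pd_sum _ _ fun β _ => (h1 β).fun_pow 2]
  simp only [h3]

/-- The Laplacian of the comparison function; `κ |u - P|²` contributes the positive term
`2 κ ∑ |∇u^β|²`. -/
lemma laplacian_comparisonFun (hu : ContDiffAt ℝ 2 u y) (σ κ : ℝ) (γ : Fin m) :
    laplacian G (comparisonFun u P σ κ γ) y = σ * laplacian G (u · γ) y +
    κ * ∑ β, 2 * (gradSq G (u · β) y + (u y β - P β) * laplacian G (u · β) y) := by
  have h0 := fun β => contDiffAt_coord hu β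
  have h : ∀ β, DifferentiableAt ℝ (u · β) y := fun β => (h0 β).differentiableAt (by simp)
  have h1 : ∀ β, DifferentiableAt ℝ (fun z => u z β - P β) y := fun β => (h β).sub_const _
  have hp : ∀ β j, DifferentiableAt ℝ (pd j fun z => u z β) y := fun β j =>
    differentiableAt_pd j (h0 β)
  have hev : ∀ j, pd j (comparisonFun u P σ κ γ) =ᶠ[𝓝 y] fun z => σ * pd j (u · γ) z +
      κ * ∑ β, 2 * ((u z β - P β) * pd j (u · β) z) := fun j => by
    filter_upwards [hu.eventually (by simp)] with z hz
    rw [pd_comparisonFun (hz.differentiableAt (by simp))]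
    simp only [mul_assoc]
  have h2 : ∀ β i, pd i (fun z => u z β - P β) y = pd i (u · β) y := fun β i => by
    rw [pd_sub (g := fun _ => P β) i (h β) (differentiableAt_const _), pd_const, sub_zero]
  have hpp : ∀ i j, pd i (pd j (comparisonFun u P σ κ γ)) y =
      σ * pd i (pd j fun z => u z γ) y + κ * ∑ β, 2 * (pd i (u · β) y *
        pd j (u · β) y + (u y β - P β) * pd i (pd j fun z => u z β) y) := by
    intro i j
    have hd : ∀ β, DifferentiableAt ℝ (fun z => (u z β - P β) * pd j (u · β) z) y :=
      fun β => (h1 β).fun_mul (hp β j)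
    rw [pd_congr i (hev j), pd_add i ((hp γ j).const_mul σ) ((DifferentiableAt.fun_sum fun β _ =>
      (hd β).const_mul 2).const_mul κ), pd_const_mul i σ (hp γ j), pd_const_mul i κ
      (DifferentiableAt.fun_sum fun β _ => (hd β).const_mul 2),
      pd_sum _ _ fun β _ => (hd β).const_mul 2]
    simp only [pd_const_mul i 2 (hd _), pd_mul i (h1 _) (hp _ j), h2]
  unfold laplacian gradSq
  simp only [hpp, pd_comparisonFun (hu.differentiableAt (by simp))]
  have e1 : ∀ β, (∑ i, ∑ j, (G y)⁻¹ i j * (pd i (u · β) y * pd j (u · β) y) +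
      (u y β - P β) * ∑ i, ∑ j, (G y)⁻¹ i j * (pd i (pd j fun z => u z β) y -
        ∑ k, christoffel G k i j y * pd k (u · β) y)) =
      ∑ i, ∑ j, (G y)⁻¹ i j * (pd i (u · β) y * pd j (u · β) y +
        (u y β - P β) * (pd i (pd j fun z => u z β) y -
        ∑ k, christoffel G k i j y * pd k (u · β) y)) := by
    intro β
    simp only [mul_add, sum_add_distrib, mul_sum]
    congr 1
    exact sum_ext fun _ => sum_ext fun _ => by ring
  simp only [e1]
  rw [mul_sum, mul_sum]
  have e2 : ∑ β, κ * (2 * ∑ i, ∑ j, (G y)⁻¹ i j * (pd i (u · β) y *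
      pd j (u · β) y + (u y β - P β) * (pd i (pd j fun z => u z β) y -
        ∑ k, christoffel G k i j y * pd k (u · β) y))) =
      ∑ i, ∑ j, (G y)⁻¹ i j * ∑ β, κ * (2 * (pd i (u · β) y *
      pd j (u · β) y + (u y β - P β) * (pd i (pd j fun z => u z β) y -
        ∑ k, christoffel G k i j y * pd k (u · β) y))) := by
    simp only [mul_sum (s := (Finset.univ : Finset (Fin m))),
      mul_sum (s := (Finset.univ : Finset (Fin (n + 1)))) (a := (2 : ℝ)),
      mul_sum (s := (Finset.univ : Finset (Fin (n + 1)))) (a := κ)]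
    rw [sum_comm]
    refine sum_ext fun i => ?_
    rw [sum_comm]
    refine sum_ext fun j => sum_ext fun β => ?_
    ring
  rw [e2, ← sum_add_distrib]
  refine sum_ext fun i => ?_
  rw [mul_sum, ← sum_add_distrib]
  refine sum_ext fun j => ?_
  have e3 : ∑ k, christoffel G k i j y * (σ * pd k (u · γ) y +
      κ * ∑ β, 2 * (u y β - P β) * pd k (u · β) y) =
      σ * ∑ k, christoffel G k i j y * pd k (u · γ) y +
      ∑ β, κ * (2 * ((u y β - P β) * ∑ k, christoffel G k i j y * pd k (u · β) y)) := by
    simp only [mul_add, sum_add_distrib, mul_sum]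
    congr 1
    · exact sum_ext fun _ => by ring
    · rw [sum_comm]
      exact sum_ext fun _ => sum_ext fun _ => by ring
  rw [e3]
  have e4 : ∑ β, κ * (2 * (pd i (u · β) y *
      pd j (u · β) y + (u y β - P β) * (pd i (pd j fun z => u z β) y -
        ∑ k, christoffel G k i j y * pd k (u · β) y))) =
      κ * ∑ β, 2 * (pd i (u · β) y * pd j (u · β) y +
        (u y β - P β) * pd i (pd j fun z => u z β) y) -
      ∑ β, κ * (2 * ((u y β - P β) * ∑ k, christoffel G k i j y * pd k (u · β) y)) := by
    rw [mul_sum, ← sum_sub_distrib]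
    exact sum_ext fun _ => by ring
  rw [e4]
  ring

end LocalDecay

/-! ### Decay of the energy density in coordinates -/

section LocalDecay

variable {lam Lam : ℝ} {G : 𝔼 (n + 1) → 𝕄 (n + 1)} {c y : 𝔼 (n + 1)} {r : ℝ} {H : 𝔼 m → 𝕄 m}
  {u : 𝔼 (n + 1) → 𝔼 m} {P : 𝔼 m}

/-- The inner product `⟨∇u^α, ∇u^β⟩`. -/
def crossEnergy {d : ℕ} (G : 𝔼 d → 𝕄 d) (u : 𝔼 d → 𝔼 m) (y : 𝔼 d) (α β : Fin m) : ℝ :=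
  ∑ i, ∑ j, (G y)⁻¹ i j * (pd i (u · α) y * pd j (u · β) y)

lemma sum_gradSq_nonneg (hG : AHMetric G c r lam Lam) (hlam : 0 < lam) (hy : y ∈ halfBall c r)
    (v : 𝕍 → ℝ) : 0 ≤ gradSq G v y :=
  hG.inv_nonneg hlam hy _

lemma AHMetric.abs_crossEnergy_le (hG : AHMetric G c r lam Lam) (hlam : 0 < lam)
    (hy : y ∈ halfBall c r) (α β : Fin m) : |crossEnergy G u y α β| ≤ ∑ γ, gradSq G (u · γ) y := by
  set ξ : Fin (n + 1) → ℝ := fun i => pd i (u · α) y with hξ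
  set η : Fin (n + 1) → ℝ := fun i => pd i (u · β) y with hη
  have hnn : ∀ γ, 0 ≤ gradSq G (u · γ) y := fun γ => sum_gradSq_nonneg hG hlam hy _
  have hsym : ∑ i, ∑ j, (G y)⁻¹ i j * (η i * ξ j) = ∑ i, ∑ j, (G y)⁻¹ i j * (ξ i * η j) := by
    rw [sum_comm]
    refine sum_ext fun i => sum_ext fun j => ?_
    rw [hG.inv_symm hy j i]; ring
  have hexp : ∀ s : ℝ, ∑ i, ∑ j, (G y)⁻¹ i j * ((ξ i + s * η i) * (ξ j + s * η j)) =
      gradSq G (u · α) y + 2 * s * crossEnergy G u y α β + s ^ 2 * gradSq G (u · β) y := by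
    intro s
    have e : ∑ i, ∑ j, (G y)⁻¹ i j * ((ξ i + s * η i) * (ξ j + s * η j)) =
        ∑ i, ∑ j, (G y)⁻¹ i j * (ξ i * ξ j) + s * ∑ i, ∑ j, (G y)⁻¹ i j * (η i * ξ j) +
        s * ∑ i, ∑ j, (G y)⁻¹ i j * (ξ i * η j) +
        s ^ 2 * ∑ i, ∑ j, (G y)⁻¹ i j * (η i * η j) := by
      simp only [mul_sum, ← sum_add_distrib]
      exact sum_ext fun _ => sum_ext fun _ => by ring
    rw [e, hsym]
    simp only [gradSq, crossEnergy, hξ, hη]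
    ring
  have h1 := hG.inv_nonneg hlam hy fun i => ξ i + 1 * η i
  have h2 := hG.inv_nonneg hlam hy fun i => ξ i + (-1) * η i
  rw [hexp] at h1 h2
  have hα := single_le_sum (f := fun γ => gradSq G (u · γ) y)
    (fun γ _ => hnn γ) (Finset.mem_univ α)
  have hβ := single_le_sum (f := fun γ => gradSq G (u · γ) y)
    (fun γ _ => hnn γ) (Finset.mem_univ β)
  simp only at hα hβ
  rw [abs_le]
  constructor <;> linarith

lemma sum_sum_inv_mul_sum {d : ℕ} (G : 𝔼 d → 𝕄 d) (u : 𝔼 d → 𝔼 m) (y : 𝔼 d)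
    (S : Fin m → Fin m → ℝ) :
    ∑ i, ∑ j, (G y)⁻¹ i j * ∑ α, ∑ β, S α β * (pd i (u · α) y * pd j (u · β) y) =
    ∑ α, ∑ β, S α β * crossEnergy G u y α β := by
  simp only [crossEnergy, mul_sum]
  calc _ = ∑ i, ∑ α, ∑ j, ∑ β, (G y)⁻¹ i j * (S α β * (pd i (u · α) y * pd j (u · β) y)) :=
        sum_ext fun i => sum_comm
    _ = ∑ α, ∑ i, ∑ j, ∑ β, (G y)⁻¹ i j * (S α β * (pd i (u · α) y * pd j (u · β) y)) := sum_comm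
    _ = ∑ α, ∑ i, ∑ β, ∑ j, (G y)⁻¹ i j * (S α β * (pd i (u · α) y * pd j (u · β) y)) :=
        sum_ext fun α => sum_ext fun i => sum_comm
    _ = ∑ α, ∑ β, ∑ i, ∑ j, (G y)⁻¹ i j * (S α β * (pd i (u · α) y * pd j (u · β) y)) :=
        sum_ext fun α => sum_comm
    _ = _ := sum_ext fun α => sum_ext fun β => sum_ext fun i => sum_ext fun j => by ring

lemma laplacian_of_tension_eq_zero {d : ℕ} {G : 𝔼 d → 𝕄 d} {u : 𝔼 d → 𝔼 m} {y : 𝔼 d} {γ : Fin m}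
    (h : tension G H u γ y = 0) :
    laplacian G (u · γ) y = -∑ α, ∑ β, christoffel H γ α β (u y) * crossEnergy G u y α β := by
  rw [← sum_sum_inv_mul_sum, eq_neg_iff_add_eq_zero, ← h, laplacian, tension, ← sum_add_distrib]
  refine sum_ext fun i => ?_
  rw [← sum_add_distrib]
  refine sum_ext fun j => ?_
  simp only [mul_assoc]
  ring

lemma exists_local_bound {k : ℕ} {F : Fin k → Fin k → Fin k → 𝔼 m → ℝ}
    (hF : ∀ a b c, ContinuousAt (F a b c) P) :
    ∃ C : ℝ, 0 < C ∧ ∀ᶠ q in 𝓝 P, ∀ a b c, |F a b c q| ≤ C := by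
  refine ⟨∑ a, ∑ b, ∑ c, |F a b c P| + 1, by positivity, ?_⟩
  refine eventually_all.2 fun a => eventually_all.2 fun b => eventually_all.2 fun c => ?_
  have h1 : |F a b c P| < ∑ a, ∑ b, ∑ c, |F a b c P| + 1 := by
    have h2 := single_le_sum (f := fun c => |F a b c P|) (fun _ _ => abs_nonneg _)
      (Finset.mem_univ c)
    have h3 := single_le_sum (f := fun b => ∑ c, |F a b c P|) (fun _ _ => by positivity)
      (Finset.mem_univ b)
    have h4 := single_le_sum (f := fun a => ∑ b, ∑ c, |F a b c P|)
      (fun _ _ => by positivity) (Finset.mem_univ a)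
    linarith
  exact ((hF a b c).abs.eventually (gt_mem_nhds h1)).mono fun q hq => le_of_lt hq

/-- Local decay of the energy density of a harmonic map which converges to a point. -/
theorem AHMetric.exists_energy_decay (hG : AHMetric G c r lam Lam) (hn : 2 ≤ n) (hlam : 0 < lam)
    (hLam : 0 < Lam) (hc : c 0 = 0) (hr : 0 < r) (hr1 : r ≤ 1) {v : 𝕍 → ℝ}
    (hv : ContDiffOn ℝ 2 v (halfBall c r)) (hv0 : ∀ x ∈ halfBall c r, 0 ≤ v x)
    (hlap : ∀ x ∈ halfBall c r, -(2 * n * v x) ≤ laplacian G v x)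
    (hu : ContDiffOn ℝ 2 u (halfBall c r))
    (hlim : ∀ ε > 0, ∃ δ > 0, ∀ x ∈ halfBall c r, x 0 < δ → ‖u x - P‖ ≤ ε)
    (hH : ∀ α β, ContDiffAt ℝ ∞ (H · α β) P) (hdet : (H P).det ≠ 0)
    (htens : ∀ x ∈ halfBall c r, ∀ γ, tension G H u γ x = 0)
    (hve : ∀ x ∈ halfBall c r, v x = coordEnergy G H u x) :
    ∃ r' : ℝ, 0 < r' ∧ r' ≤ r ∧ ∃ C : ℝ, ∀ x ∈ halfBall c r',
    v x * √(G x).det ≤ C * x 0 ^ (n - 1) := by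
  obtain ⟨r₁, hr₁, hbar⟩ := exists_boundary_decay hn hlam hLam
  -- a neighbourhood of `P` with bounds for the metric and for its Christoffel symbols
  obtain ⟨CH, hCH, hbH⟩ := exists_local_bound (P := P) (F := fun α β (_ : Fin m) q => H q α β)
    fun α β _ => (hH α β).continuousAt
  obtain ⟨CΓ, hCΓ, hbΓ⟩ := exists_local_bound (P := P) (F := fun γ α β => christoffel H γ α β)
    fun γ α β => (contDiffAt_christoffel (k := 0) hH (by simp) hdet γ α β).continuousAt
  obtain ⟨η, hη, hball⟩ := Metric.eventually_nhds_iff_ball.1 (hbH.and hbΓ)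
  set C₁ : ℝ := m ^ 2 * CΓ with hC₁
  have hC₁0 : 0 ≤ C₁ := by positivity
  set η₁ : ℝ := min (min (η / 2) 1) (1 / (2 * (m * C₁ + 1))) with hη₁
  have hη₁0 : 0 < η₁ := by positivity
  have hη₁1 : η₁ ≤ 1 := (min_le_left _ _).trans (min_le_right _ _)
  have hη₁η : η₁ < η := by
    have : η₁ ≤ η / 2 := (min_le_left _ _).trans (min_le_left _ _)
    linarith
  have hη₁C : 2 * (m * (η₁ * C₁)) ≤ 1 := by
    have h1 : η₁ ≤ 1 / (2 * (m * C₁ + 1)) := min_le_right _ _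
    have h0 : 0 ≤ m * C₁ := by positivity
    rw [le_div_iff₀ (by positivity)] at h1
    nlinarith
  obtain ⟨δ, hδ, hδu⟩ := hlim η₁ hη₁0
  set ρ : ℝ := min r (min r₁ δ) with hρ
  have hρ0 : 0 < ρ := by positivity
  have hρr : ρ ≤ r := min_le_left _ _
  have hρU : halfBall c ρ ⊆ halfBall c r := halfBall_mono hρr
  have hGρ := hG.mono hρr
  have hU := isOpen_halfBall c ρ
  have huP : ∀ x ∈ halfBall c ρ, ‖u x - P‖ ≤ η₁ := fun x hx =>
    hδu x (hρU hx) ((height_lt hc hx).trans_le ((min_le_right _ _).trans (min_le_right _ _)))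
  have hub : ∀ x ∈ halfBall c ρ, ∀ β, |u x β - P β| ≤ η₁ := fun x hx β =>
    (abs_coord_le (u x - P) β).trans (huP x hx)
  have hbd : ∀ x ∈ halfBall c ρ, (∀ a b (_ : Fin m), |H (u x) a b| ≤ CH) ∧
      ∀ a b e, |christoffel H a b e (u x)| ≤ CΓ := fun x hx =>
    hball (u x) (by rw [Metric.mem_ball, dist_eq_norm]; exact (huP x hx).trans_lt hη₁η)
  have huat : ∀ x ∈ halfBall c ρ, ContDiffAt ℝ 2 u x := fun x hx =>
    (hu.mono hρU).contDiffAt (hU.mem_nhds hx)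
  set Eg : 𝕍 → ℝ := fun x => ∑ γ, gradSq G (u · γ) x with hEg
  have hEg0 : ∀ x ∈ halfBall c ρ, 0 ≤ Eg x := fun x hx =>
    sum_nonneg fun γ _ => sum_gradSq_nonneg hGρ hlam hx _
  have hcross : ∀ x ∈ halfBall c ρ, ∀ α β, |crossEnergy G u x α β| ≤ Eg x := fun x hx α β =>
    hGρ.abs_crossEnergy_le hlam hx α β
  have hlapu : ∀ x ∈ halfBall c ρ, ∀ γ, |laplacian G (u · γ) x| ≤ C₁ * Eg x := by
    intro x hx γ
    rw [laplacian_of_tension_eq_zero (htens x (hρU hx) γ), abs_neg]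
    refine (abs_sum_sum_mul_le (fun α β => (hbd x hx).2 γ α β) (hcross x hx)).trans
      (le_of_eq ?_)
    rw [hC₁]; ring
  have hvEg : ∀ x ∈ halfBall c ρ, v x ≤ m ^ 2 * CH * Eg x := by
    intro x hx
    have e : coordEnergy G H u x = ∑ α, ∑ β, H (u x) α β * crossEnergy G u x α β :=
      sum_sum_inv_mul_sum G u x (H (u x))
    rw [hve x (hρU hx), e]
    refine (le_abs_self _).trans ((abs_sum_sum_mul_le
      (fun α β => (hbd x hx).1 α β α) (hcross x hx)).trans (le_of_eq (by ring)))
  -- the sum of the gradients is controlled by the Laplacian of the squared distance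
  have hsq : ∀ x ∈ halfBall c ρ, Eg x ≤ ∑ β, 2 * (gradSq G (u · β) x +
      (u x β - P β) * laplacian G (u · β) x) := by
    intro x hx
    have h1 : |∑ β, (u x β - P β) * laplacian G (u · β) x| ≤ m * (η₁ * (C₁ * Eg x)) :=
      abs_sum_mul_le (hub x hx) (hlapu x hx)
    have h2 : ∑ β, 2 * (gradSq G (u · β) x + (u x β - P β) * laplacian G (u · β) x) =
        2 * (Eg x + ∑ β, (u x β - P β) * laplacian G (u · β) x) := by
      rw [← mul_sum, sum_add_distrib]
    rw [h2]
    have h3 := neg_le_of_abs_le h1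
    have h4 := mul_le_mul_of_nonneg_right hη₁C (hEg0 x hx)
    nlinarith
  set A : 𝕍 → 𝕄 (n + 1) := fun y => (y 0) ^ (n - 1) • volInv G y with hA
  have hcd : ∀ (σ κ : ℝ) (γ : Fin m), ContDiffOn ℝ 2 (comparisonFun u P σ κ γ) (halfBall c ρ) :=
    fun σ κ γ x hx => (contDiffAt_comparisonFun (huat x hx) σ κ γ).contDiffWithinAt
  have hdivw : ∀ x ∈ halfBall c ρ, ∀ γ, √(G x).det * Eg x ≤
      divOp (singularField A) (comparisonFun u P 0 1 γ) x := by
    intro x hx γ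
    rw [hGρ.divOp_eq hx (hcd _ _ _), laplacian_comparisonFun (huat x hx), zero_mul, zero_add,
      one_mul]
    exact mul_le_mul_of_nonneg_left (hsq x hx) (sqrt_nonneg _)
  -- decay of the components
  have hcomp : ∀ (σ : ℝ) (γ : Fin m), |σ| = 1 → ∀ x ∈ halfBall c (ρ / 2),
      σ * (u x γ - P γ) ≤ 2 ^ (n + 1) * (2 / ρ ^ 4) ^ n * (1 + C₁ * m) * x 0 ^ n := by
    intro σ γ hσ x hx
    have hS : 0 < 1 + C₁ * m := by positivity
    have hbound : ∀ ε, 0 ≤ ε → ε ≤ 1 → ∀ x, ‖u x - P‖ ≤ ε →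
        comparisonFun u P σ C₁ γ x ≤ ε * (1 + C₁ * m) := by
      intro ε hε hε1 x hx
      have h0 : ∀ β, |u x β - P β| ≤ ε := fun β => (abs_coord_le (u x - P) β).trans hx
      have h1 : σ * (u x γ - P γ) ≤ ε := by
        refine (le_abs_self _).trans ?_
        rw [abs_mul, hσ, one_mul]; exact h0 γ
      have h2 : ∑ β, (u x β - P β) ^ 2 ≤ ∑ _β : Fin m, ε := by
        refine sum_le_sum fun β _ => ?_
        rw [← sq_abs]
        have := h0 β
        have := abs_nonneg (u x β - P β)
        nlinarith
      rw [Finset.sum_const, Finset.card_univ, Fintype.card_fin, nsmul_eq_mul] at h2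
      have h3 := mul_le_mul_of_nonneg_left h2 hC₁0
      rw [comparisonFun]
      nlinarith
    have h := hbar A c ρ (1 + C₁ * m) (comparisonFun u P σ C₁ γ) hρ0
      ((min_le_right _ _).trans (min_le_left _ _)) hS hGρ.field (hcd _ _ _) (fun z hz => by
        rw [hGρ.divOp_eq hz (hcd _ _ _), laplacian_comparisonFun (huat z hz)]
        refine mul_nonneg (sqrt_nonneg _) ?_
        have h1 : |σ * laplacian G (u · γ) z| ≤ C₁ * Eg z := by
          rw [abs_mul, hσ, one_mul]; exact hlapu z hz γ
        have h2 := mul_le_mul_of_nonneg_left (hsq z hz) hC₁0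
        have h3 := neg_le_of_abs_le h1
        linarith) (fun z hz => (hbound η₁ hη₁0.le hη₁1 z (huP z hz)).trans
          (mul_le_of_le_one_left hS.le hη₁1)) (fun ε hε => by
        obtain ⟨δ', hδ', h'⟩ := hlim (min 1 (ε / (1 + C₁ * m))) (by positivity)
        refine ⟨δ', hδ', fun z hz hzδ => ?_⟩
        have h1 := hbound _ (by positivity) (min_le_left _ _) z (h' z (hρU hz) hzδ)
        refine h1.trans ?_
        calc _ ≤ ε / (1 + C₁ * m) * (1 + C₁ * m) := by gcongr; exact min_le_right _ _
          _ = ε := by field_simp) x hx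
    refine le_trans ?_ h
    rw [comparisonFun]
    have : 0 ≤ C₁ * ∑ β, (u x β - P β) ^ 2 := by positivity
    linarith
  set C₂ : ℝ := 2 ^ (n + 1) * (2 / ρ ^ 4) ^ n * (1 + C₁ * m) with hC₂
  have hC₂0 : 0 ≤ C₂ := by positivity
  have habs : ∀ x ∈ halfBall c (ρ / 2), ∀ γ, |u x γ - P γ| ≤ C₂ * x 0 ^ n := by
    intro x hx γ
    rw [abs_le]
    have h1 := hcomp 1 γ (by simp) x hx
    have h2 := hcomp (-1) γ (by simp) x hx
    constructor <;> linarith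
  -- decay of the energy density
  set ρ' : ℝ := ρ / 2 with hρ'
  have hρ'0 : 0 < ρ' := by positivity
  have hρ'ρ : halfBall c ρ' ⊆ halfBall c ρ := halfBall_mono (by linarith)
  have hρ'1 : ρ' ≤ 1 := by linarith
  have hGρ' := hG.mono (show ρ' ≤ r by linarith)
  obtain ⟨C₃, hC₃, hpt⟩ := hGρ'.exists_pointwise_le hlam hLam hc hρ'1
    (hv.mono (hρ'ρ.trans hρU)) (fun x hx => hv0 x (hρU (hρ'ρ hx)))
    (fun x hx => hlap x (hρU (hρ'ρ hx)))
  obtain ⟨C₄, hC₄, hint⟩ := exists_whitney_integral_le hn hlam hLam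
  refine ⟨ρ' / 2, by positivity, by linarith, ?_⟩
  -- `comparisonFun` with `σ = 0` and `κ = 1` is the squared distance, but needs an index `γ`
  rcases Nat.eq_zero_or_pos m with hm | hm
  · refine ⟨0, fun x hx => ?_⟩
    subst hm
    rw [hve x (halfBall_mono (by linarith) hx), coordEnergy]
    simp
  refine ⟨C₃ * (m ^ 2 * CH * (C₄ * (m * (C₂ * 2 ^ n) ^ 2))) * Lam, fun x hx => ?_⟩
  have hx0 := hx.1
  set γ₀ : Fin m := ⟨0, hm⟩
  have hBU : closedBall x (x 0 / 4) ⊆ halfBall c ρ' := closedBall_subset_halfBall hc hx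
  have hw : ∀ z ∈ closedBall x (x 0 / 2), |comparisonFun u P 0 1 γ₀ z| ≤
      m * (C₂ * 2 ^ n) ^ 2 * x 0 ^ (2 * n) := by
    intro z hz
    have hzs := closedBall_subset_slab hc hx hz
    have h1 : ∑ β, (u z β - P β) ^ 2 ≤ ∑ _β : Fin m, (C₂ * (2 * x 0) ^ n) ^ 2 := by
      refine sum_le_sum fun β _ => ?_
      rw [← sq_abs]
      have h2 := habs z hzs.1 β
      have h3 : C₂ * z 0 ^ n ≤ C₂ * (2 * x 0) ^ n := by
        have := hzs.1.1
        have := hzs.2.2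
        gcongr
      exact pow_le_pow_left₀ (abs_nonneg _) (h2.trans h3) 2
    rw [Finset.sum_const, Finset.card_univ, Fintype.card_fin, nsmul_eq_mul] at h1
    have h4 : comparisonFun u P 0 1 γ₀ z = ∑ β, (u z β - P β) ^ 2 := by rw [comparisonFun]; ring
    rw [h4, abs_of_nonneg (by positivity)]
    refine h1.trans (le_of_eq ?_)
    rw [mul_pow 2 (x 0) n]; ring
  have h1 := hint A c x ρ' _ (comparisonFun u P 0 1 γ₀) hc hρ'1 hGρ'.field
    ((hcd _ _ _).mono hρ'ρ) (fun z hz => (mul_nonneg (sqrt_nonneg _)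
      (hEg0 z (hρ'ρ hz))).trans (hdivw z (hρ'ρ hz) γ₀)) hx hw
  have hdetc : ContinuousOn (fun x => √(G x).det) (halfBall c r) := fun x hx =>
    (contDiffAt_det (k := 0) fun i j => ((hG.contDiffOn i j).contDiffAt
      ((isOpen_halfBall c r).mem_nhds hx)).of_le (natCast_le_infty 0)).continuousAt.sqrt
      |>.continuousWithinAt
  have hdivc : ContinuousOn (divOp (singularField A) (comparisonFun u P 0 1 γ₀))
      (halfBall c ρ) := by
    have hsf : ∀ i j, ContDiffOn ℝ 1 (fun z => singularField A z i j) (halfBall c ρ) := by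
      intro i j z hz
      have hzA := (hGρ.field.contDiffOn i j).contDiffAt (hU.mem_nhds hz)
      simp only [singularField, Matrix.smul_apply, smul_eq_mul]
      have hwz : ContDiffAt ℝ 1 (fun z : 𝕍 => ((z 0) ^ (n - 1))⁻¹) z :=
        ContDiffAt.inv (by fun_prop) (pow_ne_zero _ hz.1.ne')
      exact (hwz.mul hzA).contDiffWithinAt
    have h1 : ∀ i, ContDiffOn ℝ 1 (fun z => ∑ j, singularField A z i j *
        pd j (comparisonFun u P 0 1 γ₀) z) (halfBall c ρ) := fun i =>
      ContDiffOn.sum fun j _ => (hsf i j).mul (contDiffOn_pd hU (hcd 0 1 γ₀) j (by norm_num))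
    unfold divOp
    exact continuousOn_finsetSum _ fun i _ => continuousOn_pd hU (h1 i) i
  have hBρ : closedBall x (x 0 / 4) ⊆ halfBall c ρ := hBU.trans hρ'ρ
  have h2 : ∫ z in closedBall x (x 0 / 4), v z * √(G z).det ≤
      m ^ 2 * CH * ∫ z in closedBall x (x 0 / 4),
        divOp (singularField A) (comparisonFun u P 0 1 γ₀) z := by
    rw [← integral_const_mul]
    refine setIntegral_mono_on (((hv.continuousOn.mul hdetc).mono
      (hBρ.trans hρU)).integrableOn_compact (isCompact_closedBall _ _))
      (((hdivc.mono hBρ).integrableOn_compact (isCompact_closedBall _ _)).const_mul _)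
      Metric.isClosed_closedBall.measurableSet fun z hz => ?_
    have h3 := hdivw z (hBρ hz) γ₀
    have h4 := hvEg z (hBρ hz)
    calc v z * √(G z).det ≤ m ^ 2 * CH * Eg z * √(G z).det := by gcongr
      _ = m ^ 2 * CH * (√(G z).det * Eg z) := by ring
      _ ≤ _ := by gcongr
  have hvx : v x ≤ C₃ * (m ^ 2 * CH * (C₄ * (m * (C₂ * 2 ^ n) ^ 2))) * x 0 ^ (2 * n) := by
    calc v x ≤ C₃ * ∫ z in closedBall x (x 0 / 4), v z * √(G z).det := hpt x hx
      _ ≤ C₃ * (m ^ 2 * CH * (C₄ * (m * (C₂ * 2 ^ n) ^ 2 * x 0 ^ (2 * n)))) := by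
        gcongr
        exact h2.trans (by gcongr)
      _ = _ := by ring
  have hdx := hG.det_le x (hρU (hρ'ρ (halfBall_mono (by linarith) hx)))
  calc v x * √(G x).det ≤ C₃ * (m ^ 2 * CH * (C₄ * (m * (C₂ * 2 ^ n) ^ 2))) * x 0 ^ (2 * n) *
        (Lam * ((x 0) ^ (n + 1))⁻¹) := by
        gcongr
    _ = C₃ * (m ^ 2 * CH * (C₄ * (m * (C₂ * 2 ^ n) ^ 2))) * Lam *
        (x 0 ^ (2 * n) * ((x 0) ^ (n + 1))⁻¹) := by ring
    _ = _ := by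
        congr 1
        have : x 0 ^ (2 * n) = x 0 ^ (n - 1) * x 0 ^ (n + 1) := by rw [← pow_add]; congr 1; omega
        rw [this, mul_assoc, mul_inv_cancel₀ (by positivity), mul_one]

end LocalDecay

/-! ### Normal coordinates -/

section NormalCoordinates

variable {G : 𝔼 d → 𝕄 d} {y : 𝔼 d}

/-- The Christoffel symbols with lowered index. -/
lemma sum_mul_christoffel (h0 : (G y).det ≠ 0) (b i j : Fin d) :
    ∑ e, G y b e * christoffel G e i j y = (1 / 2 : ℝ) *
    (pd i (G · j b) y + pd j (G · i b) y - pd b (G · i j) y) := by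
  have hone : ∀ l, ∑ e, G y b e * (G y)⁻¹ e l = (1 : 𝕄 d) b l := fun l => by
    rw [← mul_nonsing_inv (G y) (isUnit_iff_ne_zero.2 h0), Matrix.mul_apply]
  set X : Fin d → ℝ := fun l => pd i (G · j l) y + pd j (G · i l) y - pd l (G · i j) y
  calc ∑ e, G y b e * christoffel G e i j y = 1 / 2 * ∑ e, ∑ l, G y b e * (G y)⁻¹ e l * X l := by
        simp only [christoffel, mul_sum]
        exact sum_ext fun _ => sum_ext fun _ => by ring
    _ = 1 / 2 * ∑ l, (1 : 𝕄 d) b l * X l := by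
        rw [sum_comm]
        simp only [← hone, sum_mul]
    _ = _ := by simp [Matrix.one_apply, X]

/-- The Levi-Civita connection is compatible with the metric. -/
lemma metric_compatible (hGs : ∀ᶠ z in 𝓝 y, ∀ i j, G z i j = G z j i) (h0 : (G y).det ≠ 0)
    (a b c : Fin d) : pd c (G · a b) y =
    ∑ e, christoffel G e c a y * G y e b + ∑ e, christoffel G e c b y * G y a e := by
  have hs : ∀ i j k, pd k (G · i j) y = pd k (G · j i) y := fun i j k =>
    pd_congr k (hGs.mono fun z hz => hz i j)
  have hsy := hGs.self_of_nhds
  have e1 : ∑ e, christoffel G e c a y * G y e b = ∑ e, G y b e * christoffel G e c a y :=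
    sum_ext fun e => by rw [hsy e b, mul_comm]
  have e2 : ∑ e, christoffel G e c b y * G y a e = ∑ e, G y a e * christoffel G e c b y :=
    sum_ext fun e => mul_comm _ _
  rw [e1, e2, sum_mul_christoffel h0, sum_mul_christoffel h0, hs b a c, hs c b a, hs c a b]
  ring

/-- The quadratic map with value `y`, differential `B` and second derivatives `-S` at `y`. -/
def quadMap (y : 𝔼 d) (B : 𝕄 d) (S : Fin d → Fin d → Fin d → ℝ) (z : 𝔼 d) : 𝔼 d :=
  toLp 2 fun a => y a + ∑ i, B a i * (z i - y i) -
    1 / 2 * ∑ i, ∑ j, S a i j * ((z i - y i) * (z j - y j))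

variable {B : 𝕄 d} {S : Fin d → Fin d → Fin d → ℝ}

lemma contDiff_quadMap {k : ℕ∞ω} : ContDiff ℝ k (quadMap y B S) := by
  rw [contDiff_euclidean]
  intro a
  simp only [quadMap]
  fun_prop

lemma quadMap_self : quadMap y B S y = y := by
  ext a
  simp [quadMap]

lemma pd_quadMap (hS : ∀ a i j, S a i j = S a j i) (a i : Fin d) (z : 𝔼 d) :
    pd i (fun z => quadMap y B S z a) z = B a i - ∑ j, S a i j * (z j - y j) := by
  have hd : ∀ i, DifferentiableAt ℝ (fun z : 𝔼 d => z i - y i) z := fun i => by fun_prop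
  have h1 : ∀ j, pd i (fun z : 𝔼 d => z j - y j) z = if j = i then 1 else 0 := fun j => by
      rw [pd_sub (g := fun _ => y j) i (by fun_prop) (by fun_prop), pd_coord, pd_const, sub_zero]
  have hin : ∀ j, pd i (fun z => ∑ k, S a j k * ((z j - y j) * (z k - y k))) z =
      ∑ k, S a j k * ((if j = i then 1 else 0) * (z k - y k) +
        (z j - y j) * (if k = i then 1 else 0)) := fun j => by
    rw [pd_sum _ _ fun k _ => ((hd j).fun_mul (hd k)).const_mul _]
    simp only [pd_const_mul i _ ((hd _).fun_mul (hd _)), pd_mul i (hd _) (hd _), h1]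
  simp only [quadMap]
  rw [pd_sub i (DifferentiableAt.fun_add (by fun_prop) (by fun_prop)) (by fun_prop),
    pd_add (f := fun _ => y a) i (by fun_prop) (by fun_prop), pd_const,
    pd_sum _ _ fun j _ => (hd j).const_mul _, pd_const_mul i _ (by fun_prop),
    pd_sum _ _ fun j _ => by fun_prop]
  simp only [hin, pd_const_mul i _ (hd _), h1]
  have e1 : ∑ j, ∑ k, S a j k * ((if j = i then 1 else 0) * (z k - y k) +
      (z j - y j) * (if k = i then 1 else 0)) = 2 * ∑ j, S a i j * (z j - y j) := by
    simp only [mul_add, sum_add_distrib, ite_mul, mul_ite, one_mul, zero_mul, mul_one,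
      mul_zero, sum_ite_eq', Finset.mem_univ, if_true]
    rw [sum_comm]
    simp only [sum_ite_eq', Finset.mem_univ, if_true]
    rw [two_mul]
    congr 1
    exact sum_ext fun j => by rw [hS a j i]
  rw [e1]
  simp

lemma pd_pd_quadMap (hS : ∀ a i j, S a i j = S a j i) (a i k : Fin d) (z : 𝔼 d) :
    pd k (pd i fun z => quadMap y B S z a) z = -S a i k := by
  have h : pd i (fun z => quadMap y B S z a) = fun z => B a i - ∑ j, S a i j * (z j - y j) :=
    funext fun z => pd_quadMap hS a i z
  have hd : ∀ i, DifferentiableAt ℝ (fun z : 𝔼 d => z i - y i) z := fun i => by fun_prop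
  rw [h, pd_sub (f := fun _ => B a i) k (by fun_prop) (by fun_prop), pd_const,
    pd_sum _ _ fun j _ => (hd j).const_mul _]
  simp only [pd_const_mul k _ (hd _)]
  have h1 : ∀ j, pd k (fun z : 𝔼 d => z j - y j) z = if j = k then 1 else 0 := fun j => by
      rw [pd_sub (g := fun _ => y j) k (by fun_prop) (by fun_prop), pd_coord, pd_const, sub_zero]
  simp [h1]

/-- The metric in new coordinates. -/
def pullbackMetric (Q : 𝔼 d → 𝔼 d) (G : 𝔼 d → 𝕄 d) (z : 𝔼 d) : 𝕄 d :=
  Matrix.of fun i j => ∑ a, ∑ b, pd i (Q · a) z * pd j (Q · b) z * G (Q z) a b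

/-- The second derivatives that make the coordinates normal. -/
def normalHessian (G : 𝔼 d → 𝕄 d) (y : 𝔼 d) (B : 𝕄 d) (a i j : Fin d) : ℝ :=
  ∑ b, ∑ c, christoffel G a b c y * (B b i * B c j)

lemma christoffel_symm (hGs : ∀ᶠ z in 𝓝 y, ∀ i j, G z i j = G z j i) (k i j : Fin d) :
    christoffel G k i j y = christoffel G k j i y := by
  unfold christoffel
  congr 1
  refine sum_ext fun l => ?_
  rw [pd_congr l (hGs.mono fun z hz => hz i j)]
  ring

lemma normalHessian_symm (hGs : ∀ᶠ z in 𝓝 y, ∀ i j, G z i j = G z j i) (a i j : Fin d) :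
    normalHessian G y B a i j = normalHessian G y B a j i := by
  unfold normalHessian
  rw [sum_comm]
  refine sum_ext fun b => sum_ext fun c => ?_
  rw [christoffel_symm hGs a c b]; ring

lemma pullbackMetric_self (hB : B.transpose * G y * B = 1)
    (hS : ∀ a i j, S a i j = S a j i) : pullbackMetric (quadMap y B S) G y = 1 := by
  rw [← hB]
  ext i j
  simp only [pullbackMetric, of_apply, quadMap_self, pd_quadMap hS, sub_self, mul_zero,
    sum_const_zero, sub_zero, Matrix.mul_apply, transpose_apply, sum_mul]
  rw [sum_comm]
  exact sum_ext fun _ => sum_ext fun _ => by ring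

lemma pd_pullbackMetric (hG : ∀ i j, ContDiffAt ℝ 1 (G · i j) y)
    (hGs : ∀ᶠ z in 𝓝 y, ∀ i j, G z i j = G z j i) (h0 : (G y).det ≠ 0) (i j k : Fin d) :
    pd k (fun z => pullbackMetric (quadMap y B (normalHessian G y B)) G z i j) y = 0 := by
  set Q := quadMap y B (normalHessian G y B) with hQ
  have hS := normalHessian_symm (B := B) hGs
  have hQd : DifferentiableAt ℝ Q y := (contDiff_quadMap (k := 1)).differentiable (by simp) y
  have hQy : Q y = y := quadMap_self
  have hJ : ∀ a i, DifferentiableAt ℝ (pd i fun z => Q z a) y := fun a i =>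
    (contDiffAt_pd (k := 1) (l := 2) i
      (contDiffAt_coord (contDiff_quadMap (k := 2)).contDiffAt a) (by norm_num)).differentiableAt
      (by simp)
  have hGd : ∀ a b, DifferentiableAt ℝ (G · a b) (Q y) := fun a b => by
    rw [hQy]; exact (hG a b).differentiableAt (by simp)
  have hGQ : ∀ a b, DifferentiableAt ℝ (fun z => G (Q z) a b) y := fun a b =>
    DifferentiableAt.comp (g := fun z => G z a b) y (hGd a b) hQd
  have hJy : ∀ a i, pd i (Q · a) y = B a i := fun a i => by rw [pd_quadMap hS]; simp
  have hterm : ∀ a b, pd k (fun z => pd i (Q · a) z * pd j (Q · b) z *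
      G (Q z) a b) y = (-normalHessian G y B a i k * B b j - B a i * normalHessian G y B b j k) *
        G y a b + B a i * B b j * ∑ c, pd c (G · a b) y * B c k := by
    intro a b
    rw [pd_mul k ((hJ a i).fun_mul (hJ b j)) (hGQ a b), pd_mul k (hJ a i) (hJ b j),
      pd_pd_quadMap hS, pd_pd_quadMap hS, pd_comp (F := fun z => G z a b) k (hGd a b) hQd, hQy]
    simp only [hJy]
    ring
  have hd2 : ∀ a b, DifferentiableAt ℝ (fun z => pd i (Q · a) z *
      pd j (Q · b) z * G (Q z) a b) y := fun a b =>
    ((hJ a i).fun_mul (hJ b j)).fun_mul (hGQ a b)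
  simp only [pullbackMetric, of_apply]
  rw [pd_sum _ _ fun a _ => DifferentiableAt.fun_sum fun b _ => hd2 a b]
  simp only [fun a => pd_sum Finset.univ k fun b _ => hd2 a b, hterm, metric_compatible hGs h0]
  have hsy := hGs.self_of_nhds
  -- both sides of the cancellation are sums over five indices
  have e1 : ∑ a, ∑ b, B a i * B b j * ∑ c, (∑ e, christoffel G e c a y * G y e b +
      ∑ e, christoffel G e c b y * G y a e) * B c k =
      ∑ a, ∑ b, normalHessian G y B a i k * B b j * G y a b +
      ∑ a, ∑ b, B a i * normalHessian G y B b j k * G y a b := by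
    have f1 : ∑ a, ∑ b, B a i * B b j * ∑ c, (∑ e, christoffel G e c a y * G y e b) * B c k =
        ∑ a, ∑ b, normalHessian G y B a i k * B b j * G y a b := by
      have g1 : ∀ b, ∑ a, B a i * B b j * ∑ c, (∑ e, christoffel G e c a y * G y e b) * B c k =
          ∑ e, normalHessian G y B e i k * B b j * G y e b := by
        intro b
        simp only [normalHessian, mul_sum, sum_mul]
        calc _ = ∑ a, ∑ e, ∑ c, B a i * B b j * (christoffel G e c a y * G y e b * B c k) :=
              sum_ext fun _ => sum_comm
          _ = ∑ e, ∑ a, ∑ c, B a i * B b j * (christoffel G e c a y * G y e b * B c k) := sum_comm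
          _ = _ := sum_ext fun e => sum_ext fun a =>
              sum_ext fun c => by rw [christoffel_symm hGs e c a]; ring
      rw [sum_comm, sum_ext fun b => g1 b, sum_comm]
    have f2 : ∑ a, ∑ b, B a i * B b j * ∑ c, (∑ e, christoffel G e c b y * G y a e) * B c k =
        ∑ a, ∑ b, B a i * normalHessian G y B b j k * G y a b := by
      refine sum_ext fun a => ?_
      simp only [normalHessian, mul_sum, sum_mul]
      calc _ = ∑ b, ∑ e, ∑ c, B a i * B b j * (christoffel G e c b y * G y a e * B c k) :=
            sum_ext fun _ => sum_comm
        _ = ∑ e, ∑ b, ∑ c, B a i * B b j * (christoffel G e c b y * G y a e * B c k) := sum_comm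
        _ = _ := sum_ext fun e => sum_ext fun b =>
            sum_ext fun c => by rw [christoffel_symm hGs e c b]; ring
    rw [← f1, ← f2, ← sum_add_distrib]
    refine sum_ext fun a => ?_
    rw [← sum_add_distrib]
    refine sum_ext fun b => ?_
    simp only [add_mul, sum_add_distrib, mul_add]
  simp only [sum_add_distrib]
  rw [e1, ← sum_add_distrib, ← sum_add_distrib]
  refine sum_eq_zero fun a _ => ?_
  rw [← sum_add_distrib, ← sum_add_distrib]
  exact sum_eq_zero fun b _ => by ring

/-- In normal coordinates the Laplacian is the Euclidean one. -/
lemma sum_pd_pd_comp_quadMap (hGs : ∀ᶠ z in 𝓝 y, ∀ i j, G z i j = G z j i)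
    (hB : B * B.transpose = (G y)⁻¹) {v : 𝔼 d → ℝ} (hv : ContDiffAt ℝ 2 v y) :
    ∑ k, pd k (pd k fun z => v (quadMap y B (normalHessian G y B) z)) y = laplacian G v y := by
  set Q := quadMap y B (normalHessian G y B) with hQ
  have hS := normalHessian_symm (B := B) hGs
  have hQd : ∀ z, DifferentiableAt ℝ Q z := (contDiff_quadMap (k := 1)).differentiable (by simp)
  have hQy : Q y = y := quadMap_self
  have hJ : ∀ a i, DifferentiableAt ℝ (pd i fun z => Q z a) y := fun a i =>
    (contDiffAt_pd (k := 1) (l := 2) i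
      (contDiffAt_coord (contDiff_quadMap (k := 2)).contDiffAt a) (by norm_num)).differentiableAt
      (by simp)
  have hJy : ∀ a i, pd i (Q · a) y = B a i := fun a i => by rw [pd_quadMap hS]; simp
  have hpv : ∀ a, DifferentiableAt ℝ (pd a v) (Q y) := fun a => by
    rw [hQy]
    exact differentiableAt_pd a hv
  have hcomp : ∀ a, DifferentiableAt ℝ (fun z => pd a v (Q z)) y := fun a =>
    DifferentiableAt.comp y (hpv a) (hQd y)
  have hev : ∀ k, pd k (fun z => v (Q z)) =ᶠ[𝓝 y]
      fun z => ∑ a, pd a v (Q z) * pd k (Q · a) z := fun k => by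
    have h1 : ∀ᶠ z in 𝓝 y, ContDiffAt ℝ 2 v (Q z) := by
      have h2 : Tendsto Q (𝓝 y) (𝓝 y) := by simpa only [hQy] using (hQd y).continuousAt.tendsto
      exact h2.eventually (hv.eventually (by simp))
    filter_upwards [h1] with z hz
    exact pd_comp k (hz.differentiableAt (by simp)) (hQd z)
  have hterm : ∀ k, pd k (pd k fun z => v (Q z)) y =
      ∑ a, (∑ b, pd b (pd a v) y * B b k) * B a k - ∑ a, pd a v y * normalHessian G y B a k k := by
    intro k
    rw [pd_congr k (hev k), pd_sum _ _ fun a _ => (hcomp a).fun_mul (hJ a k), ← sum_sub_distrib]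
    refine sum_ext fun a => ?_
    rw [pd_mul k (hcomp a) (hJ a k), pd_comp k (hpv a) (hQd y), pd_pd_quadMap hS, hJy, hQy]
    simp only [hJy]
    ring
  have hinv : ∀ b c, ∑ k, B b k * B c k = (G y)⁻¹ b c := fun b c => by
    rw [← hB, Matrix.mul_apply]; rfl
  simp only [hterm, sum_sub_distrib]
  have e1 : ∑ k, ∑ a, (∑ b, pd b (pd a v) y * B b k) * B a k =
      ∑ b, ∑ a, (G y)⁻¹ b a * pd b (pd a v) y := by
    simp only [sum_mul, ← hinv]
    rw [sum_comm]
    refine Eq.trans ?_ sum_comm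
    refine sum_ext fun a => ?_
    rw [sum_comm]
    exact sum_ext fun _ => sum_ext fun _ => by ring
  have e2 : ∑ k, ∑ a, pd a v y * normalHessian G y B a k k =
      ∑ b, ∑ c, (G y)⁻¹ b c * ∑ a, christoffel G a b c y * pd a v y := by
    simp only [normalHessian, mul_sum, ← hinv, sum_mul]
    calc _ = ∑ k, ∑ b, ∑ a, ∑ c, pd a v y * (christoffel G a b c y * (B b k * B c k)) :=
          sum_ext fun _ => sum_comm
      _ = ∑ b, ∑ k, ∑ a, ∑ c, pd a v y * (christoffel G a b c y * (B b k * B c k)) := sum_comm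
      _ = ∑ b, ∑ k, ∑ c, ∑ a, pd a v y * (christoffel G a b c y * (B b k * B c k)) :=
          sum_ext fun _ => sum_ext fun _ => sum_comm
      _ = ∑ b, ∑ c, ∑ k, ∑ a, pd a v y * (christoffel G a b c y * (B b k * B c k)) :=
          sum_ext fun _ => sum_comm
      _ = ∑ b, ∑ c, ∑ a, ∑ k, pd a v y * (christoffel G a b c y * (B b k * B c k)) :=
          sum_ext fun _ => sum_ext fun _ => sum_comm
      _ = _ := sum_ext fun _ => sum_ext fun _ => sum_ext fun _ => sum_ext fun _ => by ring
  rw [e1, e2, laplacian, ← sum_sub_distrib]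
  refine sum_ext fun b => ?_
  rw [← sum_sub_distrib]
  exact sum_ext fun c => by ring

lemma exists_orthonormal_frame {g : 𝕄 d} (hs : ∀ i j, g i j = g j i)
    (hpos : ∀ ξ : Fin d → ℝ, ξ ≠ 0 → 0 < ∑ i, ∑ j, g i j * ξ i * ξ j) :
    0 < g.det ∧ ∃ B : 𝕄 d, IsUnit B.det ∧ B.transpose * g * B = 1 ∧ B * B.transpose = g⁻¹ := by
  have hform : ∀ x : Fin d → ℝ, star x ⬝ᵥ g.mulVec x = ∑ i, ∑ j, g i j * x i * x j := by
    intro x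
    simp only [dotProduct, mulVec, Pi.star_apply, star_trivial, mul_sum]
    exact sum_ext fun _ => sum_ext fun _ => by ring
  have hpd : g.PosDef := by
    refine Matrix.PosDef.of_dotProduct_mulVec_pos ?_ fun x hx => ?_
    · ext i j; simp [hs i j]
    · rw [hform]; exact hpos x hx
  have hdet := hpd.det_pos
  refine ⟨hdet, ?_⟩
  have hell : IsEllipticMatrix g 0 (∑ i, ∑ j, |g i j|) := by
    refine ⟨hs, fun ξ => ?_, fun i j => ?_⟩
    · rw [zero_mul]
      rcases eq_or_ne ξ 0 with rfl | h
      · simp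
      · exact (hpos ξ h).le
    · have h2 := single_le_sum (f := fun j => |g i j|) (fun _ _ => abs_nonneg _)
        (Finset.mem_univ j)
      have h3 := single_le_sum (f := fun i => ∑ j, |g i j|) (fun _ _ => by positivity)
        (Finset.mem_univ i)
      exact h2.trans h3
  obtain ⟨L, hL⟩ := hell.exists_eq_sum le_rfl
  have hgL : g = L.transpose * L := by ext i j; rw [hL, Matrix.mul_apply]; rfl
  have hLu : IsUnit L.det := by
    rw [isUnit_iff_ne_zero]
    intro h
    rw [hgL, det_mul, h, mul_zero] at hdet
    exact lt_irrefl _ hdet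
  refine ⟨L⁻¹, ?_, ?_, ?_⟩
  · rw [Matrix.det_nonsing_inv]; exact hLu.ringInverse
  · rw [hgL, ← Matrix.mul_assoc, Matrix.mul_assoc _ L, mul_nonsing_inv _ hLu,
      Matrix.mul_one, ← Matrix.transpose_mul, mul_nonsing_inv _ hLu, Matrix.transpose_one]
  · rw [hgL, Matrix.mul_inv_rev, transpose_nonsing_inv]

end NormalCoordinates

/-! ### Traces -/

section Trace

variable {g K : 𝕄 d}

lemma form_eq_sum {m : ℕ} (b : 𝔼 m →L[ℝ] 𝔼 m →L[ℝ] ℝ) (L : 𝔼 d →L[ℝ] 𝔼 m) (v w : 𝔼 d) :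
    b (L v) (L w) = ∑ i, ∑ j, b (L (single i 1)) (L (single j 1)) * v i * w j := by
  conv_lhs => rw [euclidean_eq_sum v, euclidean_eq_sum w]
  simp only [map_sum, map_smul, sum_apply, smul_apply, mul_sum, smul_eq_mul]
  refine sum_comm.trans ?_
  exact sum_ext fun _ => sum_ext fun _ => by ring

lemma sum_sum_eq_dotProduct (K : 𝕄 d) (x : Fin d → ℝ) :
    ∑ i, ∑ j, K i j * x i * x j = x ⬝ᵥ K.mulVec x := by
  simp only [dotProduct, mulVec, mul_sum]
  exact sum_ext fun _ => sum_ext fun _ => by ring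

/-- A nonnegative form is bounded by its trace. -/
lemma form_le_trace (hK : ∀ x : Fin d → ℝ, 0 ≤ x ⬝ᵥ K.mulVec x) (x : Fin d → ℝ) :
    0 ≤ K.trace ∧ x ⬝ᵥ K.mulVec x ≤ K.trace * ∑ i, x i ^ 2 := by
  have hdiag : ∀ i, 0 ≤ K i i := fun i => by simpa using hK (Pi.single i 1)
  refine ⟨sum_nonneg fun i _ => hdiag i, ?_⟩
  have h1 : ∀ k l, 0 ≤ x k ^ 2 * K l l + x l ^ 2 * K k k - x k * x l * K k l -
      x k * x l * K l k := fun k l => by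
    have h := hK (Pi.single l (x k) - Pi.single k (x l))
    simp only [Matrix.mulVec_sub, dotProduct_sub, sub_dotProduct, Matrix.mulVec_single,
      single_dotProduct, Pi.smul_apply, MulOpposite.smul_eq_mul_unop, MulOpposite.unop_op,
      Matrix.col_apply] at h
    linarith
  have h2 : 0 ≤ ∑ k, ∑ l, (x k ^ 2 * K l l + x l ^ 2 * K k k - x k * x l * K k l -
      x k * x l * K l k) := sum_nonneg fun k _ => sum_nonneg fun l _ => h1 k l
  simp only [sum_add_distrib, sum_sub_distrib] at h2
  have e1 : ∑ k, ∑ l, x k ^ 2 * K l l = K.trace * ∑ i, x i ^ 2 := by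
    simp only [Matrix.trace, Matrix.diag_apply, ← mul_sum, ← sum_mul, mul_comm]
  have e2 : ∑ k, ∑ l, x l ^ 2 * K k k = K.trace * ∑ i, x i ^ 2 := by rw [sum_comm]; exact e1
  have e3 : ∑ k, ∑ l, x k * x l * K k l = x ⬝ᵥ K.mulVec x := by
    rw [← sum_sum_eq_dotProduct]
    exact sum_ext fun _ => sum_ext fun _ => by ring
  have e4 : ∑ k, ∑ l, x k * x l * K l k = x ⬝ᵥ K.mulVec x := by
    rw [sum_comm, ← sum_sum_eq_dotProduct]
    exact sum_ext fun _ => sum_ext fun _ => by ring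
  rw [e1, e2, e3, e4] at h2
  linarith

lemma sum_inv_mul_eq_trace (hs : ∀ i j, g i j = g j i) :
    ∑ i, ∑ j, g⁻¹ i j * K i j = (g⁻¹ * K).trace := by
  have ht : g.transpose = g := by ext i j; exact hs j i
  simp only [Matrix.trace, Matrix.diag_apply, Matrix.mul_apply]
  rw [sum_comm]
  refine sum_ext fun i => sum_ext fun j => ?_
  rw [← transpose_apply g⁻¹, transpose_nonsing_inv, ht]

/-- A nonnegative form is bounded by the metric times its trace with respect to the metric. -/
lemma form_le_trace_mul (hs : ∀ i j, g i j = g j i)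
    (hpos : ∀ ξ : Fin d → ℝ, ξ ≠ 0 → 0 < ∑ i, ∑ j, g i j * ξ i * ξ j)
    (hK : ∀ x : Fin d → ℝ, 0 ≤ ∑ i, ∑ j, K i j * x i * x j) (x : Fin d → ℝ) :
    0 ≤ ∑ i, ∑ j, g⁻¹ i j * K i j ∧ ∑ i, ∑ j, K i j * x i * x j ≤
    (∑ i, ∑ j, g⁻¹ i j * K i j) * ∑ i, ∑ j, g i j * x i * x j := by
  obtain ⟨-, B, hBu, hB1, hB2⟩ := exists_orthonormal_frame hs hpos
  have hq : ∀ (L : 𝕄 d) (ξ : Fin d → ℝ),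
      ξ ⬝ᵥ (B.transpose * L * B).mulVec ξ = B.mulVec ξ ⬝ᵥ L.mulVec (B.mulVec ξ) := fun L ξ => by
    rw [← mulVec_mulVec, ← mulVec_mulVec, Matrix.dotProduct_mulVec, Matrix.vecMul_transpose]
  have htr : ∑ i, ∑ j, g⁻¹ i j * K i j = (B.transpose * K * B).trace := by
    rw [sum_inv_mul_eq_trace hs, ← hB2, Matrix.trace_mul_comm, ← Matrix.mul_assoc,
      Matrix.trace_mul_comm, ← Matrix.mul_assoc]
  have hx : B.mulVec (B⁻¹.mulVec x) = x := by rw [mulVec_mulVec, mul_nonsing_inv _ hBu, one_mulVec]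
  have h := form_le_trace (K := B.transpose * K * B)
    (fun ξ => by rw [hq, ← sum_sum_eq_dotProduct]; exact hK _) (B⁻¹.mulVec x)
  have hn : ∑ i, (B⁻¹.mulVec x) i ^ 2 = ∑ i, ∑ j, g i j * x i * x j := by
    have h1 := hq g (B⁻¹.mulVec x)
    rw [hB1, one_mulVec, hx] at h1
    rw [sum_sum_eq_dotProduct, ← h1, dotProduct]
    exact sum_ext fun _ => by ring
  rw [hq, hx, hn, ← htr, ← sum_sum_eq_dotProduct] at h
  exact h

/-- The trace of a form with respect to a metric does not depend on the basis. -/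
lemma trace_comp (g K : 𝔼 d →L[ℝ] 𝔼 d →L[ℝ] ℝ) (hs : ∀ v w, g v w = g w v) {L : 𝔼 d →L[ℝ] 𝔼 d}
    (hL : Function.Injective L) : ∑ i, ∑ j, (Matrix.of fun i j => g (L (single i 1))
    (L (single j 1)))⁻¹ i j * K (L (single i 1)) (L (single j 1)) =
    ∑ i, ∑ j, (Matrix.of fun i j => g (single i 1)
    (single j 1))⁻¹ i j * K (single i 1) (single j 1) := by
  set P : 𝕄 d := Matrix.of fun a i => L (single i 1) a with hP
  have hdet : IsUnit P.det := by
    rw [isUnit_iff_ne_zero]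
    intro h
    obtain ⟨v, hv, hv0⟩ := Matrix.exists_mulVec_eq_zero_iff.2 h
    refine hv (?_ : v = 0)
    have h1 : L (toLp 2 v) = 0 := by
      rw [euclidean_eq_sum (toLp 2 v), map_sum]
      ext a
      have := congrFun hv0 a
      simp only [mulVec, dotProduct, hP, of_apply, Pi.zero_apply] at this
      simp only [map_smul, WithLp.ofLp_sum, Finset.sum_apply, PiLp.smul_apply, smul_eq_mul,
        PiLp.zero_apply]
      rw [← this]
      exact sum_ext fun _ => mul_comm _ _
    have h2 := hL (h1.trans (map_zero L).symm)
    exact congrArg ofLp h2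
  have hgram : ∀ b : 𝔼 d →L[ℝ] 𝔼 d →L[ℝ] ℝ,
      (Matrix.of fun i j => b (L (single i 1)) (L (single j 1))) =
      P.transpose * (Matrix.of fun i j => b (single i 1)
        (single j 1)) * P := by
    intro b
    ext i j
    simp only [Matrix.mul_apply, of_apply, transpose_apply, sum_mul, hP]
    have h := form_eq_sum b (ContinuousLinearMap.id ℝ _) (L (single i 1))
      (L (single j 1))
    simp only [ContinuousLinearMap.id_apply] at h
    rw [h, sum_comm]
    exact sum_ext fun _ => sum_ext fun _ => by ring
  have e1 := sum_inv_mul_eq_trace (g := Matrix.of fun i j => g (L (single i 1))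
    (L (single j 1))) (K := Matrix.of fun i j => K (L (single i 1))
    (L (single j 1))) fun i j => hs _ _
  have e2 := sum_inv_mul_eq_trace (g := Matrix.of fun i j => g (single i 1)
    (single j 1)) (K := Matrix.of fun i j => K (single i 1)
    (single j 1)) fun i j => hs _ _
  refine e1.trans (Eq.trans ?_ e2.symm)
  rw [hgram, hgram, Matrix.mul_inv_rev, Matrix.mul_inv_rev]
  set A := (Matrix.of fun i j => g (single i 1) (single j 1))⁻¹
  set C := Matrix.of fun i j => K (single i 1) (single j 1)
  have hPt : P.transpose⁻¹ * P.transpose = 1 :=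
    Matrix.nonsing_inv_mul _ (by rwa [Matrix.det_transpose])
  calc (P⁻¹ * (A * P.transpose⁻¹) * (P.transpose * C * P)).trace
      = (P⁻¹ * (A * (P.transpose⁻¹ * P.transpose) * C) * P).trace := by simp only [Matrix.mul_assoc]
    _ = (A * C).trace := by
        rw [hPt, Matrix.mul_one, Matrix.trace_mul_comm, ← Matrix.mul_assoc,
          mul_nonsing_inv _ hdet, Matrix.one_mul]

end Trace

/-! ### Metrics in charts -/

section Charts

variable {X Y : Type*} [TopologicalSpace X] [TopologicalSpace Y] {I : ModelWithCorners ℝ (𝔼 d) X}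
  {J : ModelWithCorners ℝ (𝔼 m) Y} {M : Type*} [TopologicalSpace M] [ChartedSpace X M]
  [IsManifold I ∞ M] {N : Type*} [TopologicalSpace N] [ChartedSpace Y N] [IsManifold J ∞ N]
  {φ φ' : OpenPartialHomeomorph M X} {ψ : OpenPartialHomeomorph N Y} {y : 𝔼 d} {A : Set (𝔼 d)}

/-- Being an interior point can be tested in any chart of the maximal atlas. -/
lemma mem_interior_iff (hφ : φ ∈ 𝒜 I M) {x : M} (hx : x ∈ φ.source) :
    x ∈ I.interior M ↔ φ.extend I x ∈ interior (range I) := by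
  have hd : IsLocalDiffeomorphAt I I (⊤ : ℕ∞) φ x :=
    PartialDiffeomorph.isLocalDiffeomorphAt I I (⊤ : ℕ∞)
      ⟨φ.toPartialEquiv, φ.open_source, φ.open_target,
        contMDiffOn_of_mem_maximalAtlas hφ, contMDiffOn_symm_of_mem_maximalAtlas hφ⟩ hx
  have h := hd.isInteriorPoint_iff (by simp)
  exact h

lemma mem_interiorCoords_iff (hφ : φ ∈ 𝒜 I M) :
    y ∈ interiorCoords I φ ↔ y ∈ interior (range I) ∧ I.symm y ∈ φ.target := by
  constructor
  · rintro ⟨h1, h2⟩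
    rw [mem_interior_iff hφ (by rw [← φ.extend_source (I := I)]; exact (φ.extend I).map_target h1),
      (φ.extend I).right_inv h1] at h2
    rw [φ.extend_target] at h1
    exact ⟨h2, h1.1⟩
  · rintro ⟨h1, h2⟩
    have ht : y ∈ (φ.extend I).target := by rw [φ.extend_target]; exact ⟨h2, interior_subset h1⟩
    refine ⟨ht, ?_⟩
    rw [mem_interior_iff hφ (by rw [← φ.extend_source (I := I)]; exact (φ.extend I).map_target ht),
      (φ.extend I).right_inv ht]
    exact h1

lemma isOpen_interiorCoords (hφ : φ ∈ 𝒜 I M) : IsOpen (interiorCoords I φ) := by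
  have : interiorCoords I φ = interior (range I) ∩ I.symm ⁻¹' φ.target :=
    Set.ext fun y => mem_interiorCoords_iff hφ
  rw [this]
  exact isOpen_interior.inter (φ.open_target.preimage I.continuous_symm)

lemma range_mem_nhds (hφ : φ ∈ 𝒜 I M) (hy : y ∈ interiorCoords I φ) : range I ∈ 𝓝 y :=
  mem_interior_iff_mem_nhds.1 ((mem_interiorCoords_iff hφ).1 hy).1

lemma contMDiffOn_extend_symm_target (hφ : φ ∈ 𝒜 I M) :
    ContMDiffOn 𝓘(ℝ, 𝔼 d) I ∞ φ⁻[I] (φ.extend I).target := by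
  rw [φ.extend_target']
  exact contMDiffOn_extend_symm hφ

lemma contMDiffAt_extend_symm (hφ : φ ∈ 𝒜 I M) (hy : y ∈ interiorCoords I φ) :
    ContMDiffAt 𝓘(ℝ, 𝔼 d) I ∞ φ⁻[I] y :=
  ((contMDiffOn_extend_symm_target hφ) y hy.1).contMDiffAt
    (mem_of_superset ((isOpen_interiorCoords hφ).mem_nhds hy) fun _ h => h.1)

/-- The differential of the inverse of a chart, as a linear map of `ℝ^d`, which is the model of
all tangent spaces. -/
def chartDeriv (I : ModelWithCorners ℝ (𝔼 d) X) (φ : OpenPartialHomeomorph M X) (y : 𝔼 d) :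
    𝔼 d →L[ℝ] 𝔼 d :=
  mfderivWithin 𝓘(ℝ, 𝔼 d) I φ⁻[I] (range I) y

lemma chartDeriv_eq (hφ : φ ∈ 𝒜 I M) (hy : y ∈ interiorCoords I φ) :
    chartDeriv I φ y = mfderiv 𝓘(ℝ, 𝔼 d) I φ⁻[I] y :=
  mfderivWithin_of_mem_nhds (range_mem_nhds hφ hy)

lemma hasMFDerivAt_extend_symm (hφ : φ ∈ 𝒜 I M) (hy : y ∈ interiorCoords I φ) :
    HasMFDerivAt 𝓘(ℝ, 𝔼 d) I φ⁻[I] y (chartDeriv I φ y) := by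
  rw [chartDeriv_eq hφ hy]
  exact ((contMDiffAt_extend_symm hφ hy).mdifferentiableAt (by simp)).hasMFDerivAt

lemma chartDeriv_injective (hφ : φ ∈ 𝒜 I M)
    (hy : y ∈ interiorCoords I φ) : Function.Injective (chartDeriv I φ y) := by
  have hx : φ⁻[I] y ∈ φ.source := by
    rw [← φ.extend_source (I := I)]; exact (φ.extend I).map_target hy.1
  have h1 : MDifferentiableAt I 𝓘(ℝ, 𝔼 d) (φ.extend I)
      (φ⁻[I] y) :=
    (φ.contMDiffAt_extend hφ hx).mdifferentiableAt (by simp)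
  have h2 := h1.hasMFDerivAt.comp y (hasMFDerivAt_extend_symm hφ hy)
  have h3 : HasMFDerivAt 𝓘(ℝ, 𝔼 d) 𝓘(ℝ, 𝔼 d)
      (φ.extend I ∘ φ⁻[I]) y (ContinuousLinearMap.id ℝ _) :=
    (hasMFDerivAt_id y).congr_of_eventuallyEq
      (mem_of_superset ((isOpen_interiorCoords hφ).mem_nhds hy) fun z hz =>
        (φ.extend I).right_inv hz.1)
  have h4 := hasMFDerivAt_unique h2 h3
  intro v w hvw
  have h5 := fun v => DFunLike.congr_fun h4 v
  exact (h5 v).symm.trans (Eq.trans (congrArg (mfderiv I 𝓘(ℝ, 𝔼 d)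
    (φ.extend I) (φ⁻[I] y)) hvw) (h5 w))

/-- A form on the tangent spaces, as a form on `ℝ^d`. -/
def modelForm (g : Forms I M) (x : M) : 𝔼 d →L[ℝ] 𝔼 d →L[ℝ] ℝ := g x

variable {g : Forms I M} {h : Forms J N} {f : M → N} {U : Set M}

lemma metricCoeff_apply (i j : Fin d) : metricCoeff I ↟g φ y i j =
    modelForm g (φ⁻[I] y) (chartDeriv I φ y (single i 1)) (chartDeriv I φ y (single j 1)) :=
  rfl

lemma sum_metricCoeff (v w : 𝔼 d) : ∑ i, ∑ j, metricCoeff I ↟g φ y i j * v i * w j =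
    modelForm g (φ⁻[I] y) (chartDeriv I φ y v) (chartDeriv I φ y w) :=
  (form_eq_sum _ _ v w).symm

/-- The components of a metric of class `C^k` are of class `C^k`, up to the boundary. -/
lemma contDiffOn_metricCoeff (hφ : φ ∈ 𝒜 I M) {k : ℕ∞ω}
    (hk : k + 1 ≤ (⊤ : ℕ∞)) {U : Set M}
    (hg : ContMDiffOn I (I.prod 𝓘(ℝ, 𝔼 d →L[ℝ]
      𝔼 d →L[ℝ] ℝ)) k
      (fun x => Bundle.TotalSpace.mk' (𝔼 d →L[ℝ]
        𝔼 d →L[ℝ] ℝ) x (g x)) U) (i j : Fin d) :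
    ContDiffOn ℝ k (fun y => metricCoeff I ↟g φ y i j)
      ((φ.extend I).target ∩ φ⁻[I] ⁻¹' U) := by
  set σ := φ⁻[I] with hσ
  set T := (φ.extend I).target with hT
  have hσs : ContMDiffOn 𝓘(ℝ, 𝔼 d) I ∞ σ T := contMDiffOn_extend_symm_target hφ
  have hTu : UniqueDiffOn ℝ T := by
    rw [hT, φ.extend_target]
    exact I.uniqueDiffOn_preimage φ.open_target
  have htan := hσs.contMDiffOn_tangentMapWithin hk hTu.uniqueMDiffOn
  have hsec : ∀ i : Fin d, ContMDiffOn 𝓘(ℝ, 𝔼 d) I.tangent k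
      (fun y => (⟨σ y, coordVec I φ i y⟩ : TangentBundle I M)) T := by
    intro i
    have hc : ContMDiffOn 𝓘(ℝ, 𝔼 d)
        𝓘(ℝ, 𝔼 d).tangent k (fun y =>
        (⟨y, single i (1 : ℝ)⟩ : TangentBundle 𝓘(ℝ, 𝔼 d) (𝔼 d))) T :=
      contMDiffOn_vectorSpace_iff_contDiffOn.2 contDiffOn_const
    refine (htan.comp hc fun y hy => hy).congr fun y hy => ?_
    have hm : T =ᶠ[𝓝 y] range I := by
      have : y ∈ (φ.extend I).target := hy
      rw [← (φ.extend I).right_inv this]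
      exact φ.extend_target_eventuallyEq
        (by rw [← φ.extend_source (I := I)]; exact (φ.extend I).map_target this)
    simp only [Function.comp, tangentMapWithin, coordVec]
    rw [mfderivWithin_congr_set hm]
  intro y hy
  have hσk : ContMDiffWithinAt 𝓘(ℝ, 𝔼 d) I k σ (T ∩ σ ⁻¹' U) y :=
    ((hσs y hy.1).of_le (le_self_add.trans hk)).mono inter_subset_left
  have h1 := (hg (σ y) hy.2).comp y hσk fun z hz => hz.2
  have h2 : ContMDiffWithinAt 𝓘(ℝ, 𝔼 d) (I.prod 𝓘(ℝ)) k
      (fun y => Bundle.TotalSpace.mk' ℝ (E := Bundle.Trivial M ℝ) (σ y)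
        (g (σ y) (coordVec I φ i y) (coordVec I φ j y))) (T ∩ σ ⁻¹' U) y :=
    ContMDiffWithinAt.clm_bundle_apply₂ (F₁ := 𝔼 d)
    (F₂ := 𝔼 d) (F₃ := ℝ) (E₁ := fun x : M => TangentSpace I x)
    (E₂ := fun x : M => TangentSpace I x) (E₃ := Bundle.Trivial M ℝ) (b := σ)
    (ψ := fun y => g (σ y)) h1 ((hsec i y hy.1).mono inter_subset_left)
    ((hsec j y hy.1).mono inter_subset_left)
  simp only [Bundle.contMDiffWithinAt_totalSpace] at h2
  exact h2.2.contDiffWithinAt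

/-- A change of coordinates near an interior point, as a map of the model space with corners. -/
def modelChange (I : ModelWithCorners ℝ (𝔼 d) X) (Θ : OpenPartialHomeomorph (𝔼 d) (𝔼 d))
    (hs : Θ.source ⊆ range I) (ht : Θ.target ⊆ range I) : OpenPartialHomeomorph X X where
  toFun x := I.symm (Θ (I x))
  invFun x := I.symm (Θ.symm (I x))
  source := I ⁻¹' Θ.source
  target := I ⁻¹' Θ.target
  map_source' x hx := by
    rw [mem_preimage, I.right_inv (ht (Θ.map_source hx))]
    exact Θ.map_source hx
  map_target' x hx := by
    rw [mem_preimage, I.right_inv (hs (Θ.map_target hx))]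
    exact Θ.map_target hx
  left_inv' x hx := by rw [I.right_inv (ht (Θ.map_source hx)), Θ.left_inv hx, I.left_inv]
  right_inv' x hx := by rw [I.right_inv (hs (Θ.map_target hx)), Θ.right_inv hx, I.left_inv]
  open_source := Θ.open_source.preimage I.continuous
  open_target := Θ.open_target.preimage I.continuous
  continuousOn_toFun := I.continuous_symm.comp_continuousOn
    (Θ.continuousOn.comp I.continuous.continuousOn fun _ h => h)
  continuousOn_invFun := I.continuous_symm.comp_continuousOn
    (Θ.symm.continuousOn.comp I.continuous.continuousOn fun _ h => h)

/-- Charts can be changed, near an interior point, by any local diffeomorphism. -/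
lemma exists_chart_comp (hφ : φ ∈ 𝒜 I M) (hy : y ∈ interiorCoords I φ)
    {Q : 𝔼 d → 𝔼 d} (hQ : ContDiff ℝ ∞ Q)
    (hQy : Q y = y) (hQ' : ∃ f' : 𝔼 d ≃L[ℝ] 𝔼 d, (f' : 𝔼 d →L[ℝ] 𝔼 d) = fderiv ℝ Q y) :
    ∃ φ' ∈ 𝒜 I M, y ∈ interiorCoords I φ' ∧ ∀ᶠ z in 𝓝 y, φ'⁻[I] z = φ⁻[I] (Q z) := by
  have hdiff : Differentiable ℝ Q := hQ.differentiable (by simp)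
  set W : Set (𝔼 d) := (interior (range I) ∩ Q ⁻¹' interior (range I)) ∩
    fderiv ℝ Q ⁻¹' range ((↑) : (𝔼 d ≃L[ℝ] 𝔼 d) → 𝔼 d →L[ℝ] 𝔼 d) with hW
  have hWo : IsOpen W := (isOpen_interior.inter (isOpen_interior.preimage hQ.continuous)).inter
    (ContinuousLinearEquiv.isOpen.preimage (hQ.continuous_fderiv (by simp)))
  obtain ⟨hyi, hyt⟩ := (mem_interiorCoords_iff hφ).1 hy
  have hyW : y ∈ W := ⟨⟨hyi, by rw [mem_preimage, hQy]; exact hyi⟩, hQ'⟩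
  obtain ⟨f', hf'⟩ := hQ'
  have hfd : HasFDerivAt Q (f' : 𝔼 d →L[ℝ] 𝔼 d) y := by rw [hf']; exact (hdiff y).hasFDerivAt
  set Θ := (hQ.contDiffAt.toOpenPartialHomeomorph Q hfd (by simp)).restrOpen W hWo with hΘ
  have hΘc : ∀ z, Θ z = Q z := fun z => rfl
  have hΘs : Θ.source ⊆ W := inter_subset_right
  have hyΘ : y ∈ Θ.source := ⟨hQ.contDiffAt.mem_toOpenPartialHomeomorph_source hfd (by simp), hyW⟩
  have hs : Θ.source ⊆ range I := fun z hz => interior_subset (hΘs hz).1.1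
  have ht : Θ.target ⊆ range I := fun z hz => by
    have h1 := (hΘs (Θ.map_target hz)).1.2
    rw [mem_preimage, ← hΘc, Θ.right_inv hz] at h1
    exact interior_subset h1
  have hΘsymm : ContDiffOn ℝ ∞ Θ.symm Θ.target := fun z hz => by
    obtain ⟨e, he⟩ := (hΘs (Θ.map_target hz)).2
    refine (Θ.contDiffAt_symm (f₀' := e) hz ?_ hQ.contDiffAt).contDiffWithinAt
    rw [he]; exact (hdiff _).hasFDerivAt
  set e := modelChange I Θ hs ht with he
  have he1 : ContMDiffOn I I ∞ e e.source :=
    I.contMDiffOn_symm.comp (hQ.contMDiff.comp I.contMDiff).contMDiffOn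
      fun x hx => ht (Θ.map_source hx)
  have he2 : ContMDiffOn I I ∞ e.symm e.target :=
    I.contMDiffOn_symm.comp (hΘsymm.contMDiffOn.comp I.contMDiff.contMDiffOn fun _ h => h)
      fun x hx => hs (Θ.map_target hx)
  have hmem : φ ≫ₕ e.symm ∈ 𝒜 I M := by
    refine OpenPartialHomeomorph.mem_maximalAtlas_of_contMDiffOn _ ?_ ?_
    · exact he2.comp ((contMDiffOn_of_mem_maximalAtlas hφ).mono fun x hx => hx.1) fun x hx => hx.2
    · exact (contMDiffOn_symm_of_mem_maximalAtlas hφ).comp (he1.mono fun x hx => hx.1)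
        fun x hx => hx.2
  refine ⟨φ ≫ₕ e.symm, hmem, (mem_interiorCoords_iff hmem).2 ⟨hyi, ?_, ?_⟩, ?_⟩
  · show I (I.symm y) ∈ Θ.source
    rw [I.right_inv (interior_subset hyi)]; exact hyΘ
  · show I.symm (Θ (I (I.symm y))) ∈ φ.target
    rw [I.right_inv (interior_subset hyi), hΘc, hQy]; exact hyt
  · filter_upwards [isOpen_interior.mem_nhds hyi] with z hz
    show φ.symm (I.symm (Θ (I (I.symm z)))) = φ.symm (I.symm (Q z))
    rw [I.right_inv (interior_subset hz), hΘc]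

/-- The transformation rule of a metric under a change of charts. -/
lemma metricCoeff_comp {φ' : OpenPartialHomeomorph M X} (hφ : φ ∈ 𝒜 I M) (hφ' : φ' ∈ 𝒜 I M)
    (hy : y ∈ interiorCoords I φ') {Q : 𝔼 d → 𝔼 d} (hQ : DifferentiableAt ℝ Q y)
    (hQy : Q y ∈ interiorCoords I φ) (hQφ : ∀ᶠ z in 𝓝 y, φ'⁻[I] z = φ⁻[I] (Q z)) :
    chartDeriv I φ' y = (chartDeriv I φ (Q y)).comp (fderiv ℝ Q y) ∧
    metricCoeff I ↟g φ' y = pullbackMetric Q (metricCoeff I ↟g φ) y := by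
  have h1 := (hasMFDerivAt_extend_symm hφ hQy).comp y hQ.hasFDerivAt.hasMFDerivAt
  have h2 := h1.congr_of_eventuallyEq hQφ
  have h3 : chartDeriv I φ' y = (chartDeriv I φ (Q y)).comp (fderiv ℝ Q y) :=
    hasMFDerivAt_unique (hasMFDerivAt_extend_symm hφ' hy) h2
  refine ⟨h3, ?_⟩
  ext i j
  rw [metricCoeff_apply, h3, hQφ.self_of_nhds]
  simp only [ContinuousLinearMap.comp_apply]
  rw [← sum_metricCoeff]
  simp only [pullbackMetric, of_apply]
  have hc : ∀ a i, (fderiv ℝ Q y (single i 1)) a = pd i (Q · a) y := fun a i => by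
      rw [pd]
      have := ((proj a : 𝔼 d →L[ℝ] ℝ).hasFDerivAt.comp y
        hQ.hasFDerivAt).fderiv
      have h5 : (Q · a) = (proj a : 𝔼 d →L[ℝ] ℝ) ∘ Q := rfl
      rw [h5, this]; rfl
  simp only [hc]
  exact sum_ext fun _ => sum_ext fun _ => by ring

/-! ### The energy density in charts -/

/-- The differential of a map, as a linear map between the models of the tangent spaces. -/
def modelDeriv (I : ModelWithCorners ℝ (𝔼 d) X) (J : ModelWithCorners ℝ (𝔼 m) Y) (f : M → N)
    (x : M) :
    𝔼 d →L[ℝ] 𝔼 m :=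
  mfderiv I J f x

lemma energyDensity_eq (hφ : φ ∈ 𝒜 I M) (hy : y ∈ interiorCoords I φ)
    (hs : ∀ v w, g (φ⁻[I] y) v w = g (φ⁻[I] y) w v) :
    energyDensity I J ↟g ↟h f (φ⁻[I] y) = ∑ i, ∑ j, (metricCoeff I ↟g φ y)⁻¹ i j *
    modelForm h (f (φ⁻[I] y)) (modelDeriv I J f (φ⁻[I] y) (chartDeriv I φ y (single i 1)))
    (modelDeriv I J f (φ⁻[I] y) (chartDeriv I φ y (single j 1))) := by
  set D := modelDeriv I J f (φ⁻[I] y)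
  set K : 𝔼 d →L[ℝ] 𝔼 d →L[ℝ] ℝ := (modelForm h (f (φ⁻[I] y))).bilinearComp D D with hK
  exact (trace_comp (modelForm g (φ⁻[I] y)) K hs (chartDeriv_injective hφ hy)).symm

lemma contDiffAt_coordMap (hφ : φ ∈ 𝒜 I M) (hψ : ψ ∈ maximalAtlas J ∞ N)
    (hy : y ∈ interiorCoords I φ) (hf : ContMDiffAt I J ∞ f (φ⁻[I] y))
    (hfy : f (φ⁻[I] y) ∈ ψ.source) : ContDiffAt ℝ ∞ (fun z => ψ.extend J (f (φ⁻[I] z))) y := by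
  have h1 : ContMDiffAt 𝓘(ℝ, 𝔼 d) 𝓘(ℝ, 𝔼 m) ∞
      (fun z => ψ.extend J (f (φ⁻[I] z))) y :=
    ContMDiffAt.comp y (ψ.contMDiffAt_extend hψ hfy)
      (ContMDiffAt.comp y hf (contMDiffAt_extend_symm hφ hy))
  exact h1.contDiffAt

lemma mem_interiorCoords_extend [BoundarylessManifold J N] {q : N} (hq : q ∈ ψ.source) :
    ψ.extend J q ∈ interiorCoords J ψ := by
  refine ⟨(ψ.extend J).map_source (by rwa [ψ.extend_source]), ?_⟩
  rw [ModelWithCorners.interior_eq_univ]; trivial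

lemma modelDeriv_chartDeriv [BoundarylessManifold J N] (hφ : φ ∈ 𝒜 I M)
    (hψ : ψ ∈ maximalAtlas J ∞ N) (hy : y ∈ interiorCoords I φ) (hf : ContMDiffAt I J ∞ f (φ⁻[I] y))
    (hfy : f (φ⁻[I] y) ∈ ψ.source) (v : 𝔼 d) :
    modelDeriv I J f (φ⁻[I] y) (chartDeriv I φ y v) = chartDeriv J ψ (ψ.extend J (f (φ⁻[I] y)))
    (fderiv ℝ (fun z => ψ.extend J (f (φ⁻[I] z))) y v) := by
  set u := fun z => ψ.extend J (f (φ⁻[I] z)) with hu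
  have hud : DifferentiableAt ℝ u y :=
    (contDiffAt_coordMap hφ hψ hy hf hfy).differentiableAt (by simp)
  have hcσ := (contMDiffAt_extend_symm hφ hy).continuousAt
  have h1 := (hf.mdifferentiableAt (by simp)).hasMFDerivAt.comp y (hasMFDerivAt_extend_symm hφ hy)
  have h2 := (hasMFDerivAt_extend_symm hψ (mem_interiorCoords_extend (J := J) hfy)).comp y
    (f := u) hud.hasFDerivAt.hasMFDerivAt
  have h3 : f ∘ φ⁻[I] =ᶠ[𝓝 y] (ψ.extend J).symm ∘ u := by
    have hc : ContinuousAt (fun z => f (φ⁻[I] z)) y :=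
      ContinuousAt.comp (f := φ⁻[I]) hf.continuousAt hcσ
    filter_upwards [hc.preimage_mem_nhds (ψ.open_source.mem_nhds hfy)] with z hz
    exact ((ψ.extend J).left_inv (by rw [ψ.extend_source]; exact hz)).symm
  have h4 := hasMFDerivAt_unique h1 (h2.congr_of_eventuallyEq h3)
  exact DFunLike.congr_fun h4 v

lemma fderiv_apply_coord {u : 𝔼 d → 𝔼 m} (hu : DifferentiableAt ℝ u y) (i : Fin d) (α : Fin m) :
    (fderiv ℝ u y (single i 1)) α = pd i (u · α) y := by
  have h := ((proj α : 𝔼 m →L[ℝ] ℝ).hasFDerivAt.comp y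
    hu.hasFDerivAt).fderiv
  have h5 : (u · α) = (proj α : 𝔼 m →L[ℝ] ℝ) ∘ u := rfl
  rw [pd, h5, h]; rfl

lemma energyDensity_eq_coordEnergy [BoundarylessManifold J N] (hφ : φ ∈ 𝒜 I M)
    (hψ : ψ ∈ maximalAtlas J ∞ N) (hy : y ∈ interiorCoords I φ)
    (hs : ∀ v w, g (φ⁻[I] y) v w = g (φ⁻[I] y) w v) (hf : ContMDiffAt I J ∞ f (φ⁻[I] y))
    (hfy : f (φ⁻[I] y) ∈ ψ.source) :
    energyDensity I J ↟g ↟h f (φ⁻[I] y) = coordEnergy (metricCoeff I ↟g φ) (metricCoeff J ↟h ψ)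
    (fun z => ψ.extend J (f (φ⁻[I] z))) y := by
  have hud : DifferentiableAt ℝ (fun z => ψ.extend J (f (φ⁻[I] z))) y :=
    (contDiffAt_coordMap hφ hψ hy hf hfy).differentiableAt (by simp)
  rw [energyDensity_eq hφ hy hs, coordEnergy]
  refine sum_ext fun i => sum_ext fun j => ?_
  congr 1
  rw [modelDeriv_chartDeriv hφ hψ hy hf hfy, modelDeriv_chartDeriv hφ hψ hy hf hfy]
  have hp : f (φ⁻[I] y) = (ψ.extend J).symm (ψ.extend J (f (φ⁻[I] y))) :=
    ((ψ.extend J).left_inv (by rwa [ψ.extend_source])).symm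
  conv_lhs => enter [1, 1]; rw [hp]
  rw [← sum_metricCoeff]
  refine sum_ext fun α => sum_ext fun β => ?_
  rw [fderiv_apply_coord hud, fderiv_apply_coord hud, mul_assoc]

lemma contDiffAt_coordEnergy {G : 𝔼 d → 𝕄 d} {H : 𝔼 m → 𝕄 m} {u : 𝔼 d → 𝔼 m} {k : ℕ∞ω}
    (hG : ∀ i j, ContDiffAt ℝ k (G · i j) y) (h0 : (G y).det ≠ 0)
    (hH : ∀ i j, ContDiffAt ℝ k (H · i j) (u y)) (hu : ContDiffAt ℝ (k + 1) u y) :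
    ContDiffAt ℝ k (coordEnergy G H u) y := by
  unfold coordEnergy
  have huk := hu.of_le (le_self_add : k ≤ k + 1)
  have hp : ∀ α i, ContDiffAt ℝ k (pd i fun w => u w α) y := fun α i =>
    contDiffAt_pd i (contDiffAt_coord hu α) le_rfl
  exact ContDiffAt.sum fun i _ => ContDiffAt.sum fun j _ =>
    (contDiffAt_inv_apply hG h0 i j).mul <| ContDiffAt.sum fun α _ => ContDiffAt.sum fun β _ =>
      ((hH α β).comp y huk).mul ((hp α i).mul (hp β j))

lemma IsSmoothMetricOn.metricCoeff_symm (hg : IsSmoothMetricOn I g (I.interior M))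
    (hy : y ∈ interiorCoords I φ) (i j : Fin d) :
    metricCoeff I ↟g φ y i j = metricCoeff I ↟g φ y j i :=
  hg.symm _ hy.2 _ _

lemma IsSmoothMetricOn.metricCoeff_pos (hg : IsSmoothMetricOn I g (I.interior M)) (hφ : φ ∈ 𝒜 I M)
    (hy : y ∈ interiorCoords I φ) {ξ : Fin d → ℝ} (hξ : ξ ≠ 0) :
    0 < ∑ i, ∑ j, metricCoeff I ↟g φ y i j * ξ i * ξ j := by
  have h := sum_metricCoeff (g := g) (φ := φ) (y := y) (toLp 2 ξ) (toLp 2 ξ)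
  refine lt_of_lt_of_eq (hg.pos _ hy.2 (chartDeriv I φ y (toLp 2 ξ)) fun h0 => hξ ?_) h.symm
  have h1 := chartDeriv_injective hφ hy (h0.trans (map_zero (chartDeriv I φ y)).symm)
  exact congrArg ofLp h1

lemma IsSmoothMetricOn.det_metricCoeff_pos (hg : IsSmoothMetricOn I g (I.interior M))
    (hφ : φ ∈ 𝒜 I M) (hy : y ∈ interiorCoords I φ) : 0 < (metricCoeff I ↟g φ y).det :=
  (exists_orthonormal_frame (hg.metricCoeff_symm hy) fun _ hξ => hg.metricCoeff_pos hφ hy hξ).1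

lemma IsSmoothMetricOn.contDiffAt_metricCoeff (hg : IsSmoothMetricOn I g (I.interior M))
    (hφ : φ ∈ 𝒜 I M) (hy : y ∈ interiorCoords I φ) (i j : Fin d) :
    ContDiffAt ℝ ∞ (fun z => metricCoeff I ↟g φ z i j) y :=
  ((contDiffOn_metricCoeff hφ (by simp) hg.smooth i j) y hy).contDiffAt
    (mem_of_superset ((isOpen_interiorCoords hφ).mem_nhds hy) fun _ h => h)

/-- Around every interior point there is a chart which is normal there. -/
lemma exists_normal_chart (hg : IsSmoothMetricOn I g (I.interior M)) (hφ : φ ∈ 𝒜 I M)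
    (hy : y ∈ interiorCoords I φ) : ∃ φ' ∈ 𝒜 I M, ∃ Q : 𝔼 d → 𝔼 d, Continuous Q ∧ Q y = y ∧
    y ∈ interiorCoords I φ' ∧ (∀ᶠ z in 𝓝 y, φ'⁻[I] z = φ⁻[I] (Q z)) ∧ metricCoeff I ↟g φ' y = 1 ∧
    (∀ i j k, pd k (fun z => metricCoeff I ↟g φ' z i j) y = 0) ∧
    ∀ v : 𝔼 d → ℝ, ContDiffAt ℝ 2 v y → ∑ k, pd k (pd k fun z => v (Q z)) y =
    laplacian (metricCoeff I ↟g φ) v y := by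
  set G := metricCoeff I ↟g φ with hG
  have hGs : ∀ᶠ z in 𝓝 y, ∀ i j, G z i j = G z j i := by
    filter_upwards [(isOpen_interiorCoords hφ).mem_nhds hy] with z hz i j
    exact hg.metricCoeff_symm hz i j
  have hGd : ∀ i j, ContDiffAt ℝ 1 (G · i j) y := fun i j =>
    (hg.contDiffAt_metricCoeff hφ hy i j).of_le (natCast_le_infty 1)
  obtain ⟨hdet, B, hBu, hB1, hB2⟩ := exists_orthonormal_frame hGs.self_of_nhds
    fun _ hξ => hg.metricCoeff_pos hφ hy hξ
  set Q := quadMap y B (normalHessian G y B) with hQ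
  have hS := normalHessian_symm (B := B) hGs
  have hQc : ContDiff ℝ ∞ Q := contDiff_quadMap
  have hQd : Differentiable ℝ Q := hQc.differentiable (by simp)
  have hQy : Q y = y := quadMap_self
  have hJ : ∀ a i, (fderiv ℝ Q y (single i 1)) a = B a i := fun a i => by
    rw [fderiv_apply_coord (hQd y), pd_quadMap hS]; simp
  have hmul : ∀ v, fderiv ℝ Q y v = toLp 2 (B.mulVec v) := fun v => by
    conv_lhs => rw [euclidean_eq_sum v, map_sum]
    ext a
    simp only [map_smul, WithLp.ofLp_sum, Finset.sum_apply, PiLp.smul_apply, smul_eq_mul, hJ,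
      mulVec, dotProduct]
    exact sum_ext fun _ => mul_comm _ _
  have hinj : Function.Injective (fderiv ℝ Q y).toLinearMap := fun v w hvw => by
    have h1 : B.mulVec v = B.mulVec w := by
      have h2 : fderiv ℝ Q y v = fderiv ℝ Q y w := hvw
      rw [hmul, hmul] at h2
      exact congrArg ofLp h2
    have h3 := congrArg (B⁻¹.mulVec) h1
    rw [mulVec_mulVec, mulVec_mulVec, Matrix.nonsing_inv_mul _ hBu, one_mulVec, one_mulVec] at h3
    exact WithLp.ofLp_injective 2 h3
  obtain ⟨φ', hφ', hy', hev⟩ := exists_chart_comp hφ hy hQc hQy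
    ⟨(LinearEquiv.ofInjectiveEndo _ hinj).toContinuousLinearEquiv, by ext v; rfl⟩
  have hpull : (metricCoeff I ↟g φ') =ᶠ[𝓝 y] pullbackMetric Q G := by
    have hQt : Tendsto Q (𝓝 y) (𝓝 y) := by
      have := hQc.continuous.tendsto y
      rwa [hQy] at this
    filter_upwards [(isOpen_interiorCoords hφ').mem_nhds hy',
      hQt.eventually ((isOpen_interiorCoords hφ).mem_nhds hy),
      eventually_eventually_nhds.2 hev] with z hz hz' hz''
    exact (metricCoeff_comp hφ hφ' hz (hQd z) hz' hz'').2
  refine ⟨φ', hφ', Q, hQc.continuous, hQy, hy', hev, ?_, fun i j k => ?_, fun v hv =>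
    sum_pd_pd_comp_quadMap hGs hB2 hv⟩
  · rw [hpull.self_of_nhds, pullbackMetric_self hB1 hS]
  · have h1 : (fun z => metricCoeff I ↟g φ' z i j) =ᶠ[𝓝 y]
        fun z => pullbackMetric Q G z i j := 
        hpull.mono fun z hz => congrFun (congrFun hz i) j
    rw [pd_congr k h1]
    exact pd_pullbackMetric hGd hGs hdet.ne' i j k

/-- The energy density is nonnegative, and bounds the differential of a map. -/
lemma modelForm_modelDeriv_le (hg : IsSmoothMetricOn I g (I.interior M)) (hh : ∀ q v, 0 ≤ h q v v)
    (hφ : φ ∈ 𝒜 I M) (hy : y ∈ interiorCoords I φ) (w : 𝔼 d) :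
    0 ≤ energyDensity I J ↟g ↟h f (φ⁻[I] y) ∧ modelForm h (f (φ⁻[I] y))
    (modelDeriv I J f (φ⁻[I] y) (chartDeriv I φ y w))
    (modelDeriv I J f (φ⁻[I] y) (chartDeriv I φ y w)) ≤
    energyDensity I J ↟g ↟h f (φ⁻[I] y) * ∑ i, ∑ j, metricCoeff I ↟g φ y i j * w i * w j := by
  rw [energyDensity_eq hφ hy (hg.symm _ hy.2)]
  set b := modelForm h (f (φ⁻[I] y)) with hb
  set L := (modelDeriv I J f (φ⁻[I] y)).comp (chartDeriv I φ y) with hL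
  have hb0 : ∀ v, 0 ≤ b v v := fun v => hh _ v
  have hK : ∀ x : 𝔼 d, b (L x) (L x) = ∑ i, ∑ j,
      b (L (single i 1)) (L (single j 1)) * x i * x j := fun x =>
    form_eq_sum b L x x
  have key := form_le_trace_mul (K := Matrix.of fun i j => b (L (single i 1)) (L (single j 1)))
    (hg.metricCoeff_symm hy) (fun _ hξ => hg.metricCoeff_pos hφ hy hξ)
    (fun x => (hb0 _).trans_eq (hK (toLp 2 x))) w
  exact ⟨key.1, (hK w).trans_le key.2⟩

/-! ### The Riemannian volume in charts -/

lemma continuousOn_extend_symm_interiorCoords : ContinuousOn φ⁻[I] (interiorCoords I φ) :=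
  (φ.continuousOn_extend_symm).mono fun _ h => h.1

lemma image_extend_symm_eq (hA : A ⊆ interiorCoords I φ) :
    φ⁻[I] '' A = (φ.extend I).source ∩ φ.extend I ⁻¹' A := by
  ext x
  constructor
  · rintro ⟨y, hy, rfl⟩
    have hT := (hA hy).1
    refine ⟨(φ.extend I).map_target hT, ?_⟩
    rwa [mem_preimage, (φ.extend I).right_inv hT]
  · exact fun hx => ⟨_, hx.2, (φ.extend I).left_inv hx.1⟩

lemma isOpen_image_extend_symm (hAo : IsOpen A) (hA : A ⊆ interiorCoords I φ) :
    IsOpen (φ⁻[I] '' A) := by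
  rw [image_extend_symm_eq hA]
  exact (φ.continuousOn_extend).isOpen_inter_preimage
    (φ.isOpen_extend_source) hAo

lemma continuousOn_image_extend_symm {F : M → ℝ≥0∞} (hA : A ⊆ interiorCoords I φ)
    (hF : ContinuousOn (fun y => F (φ⁻[I] y)) A) : ContinuousOn F (φ⁻[I] '' A) := by
  rw [image_extend_symm_eq hA]
  exact (hF.comp ((φ.continuousOn_extend (I := I)).mono inter_subset_left)
    fun x hx => hx.2).congr fun x hx => congrArg F ((φ.extend I).left_inv hx.1).symm

/-- The density of the Riemannian measure in a chart. -/
def volumeDensity (g : Forms I M) (φ : OpenPartialHomeomorph M X) (y : 𝔼 d) : ℝ≥0∞ :=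
  ofReal √(metricCoeff I ↟g φ y).det

lemma continuousOn_volumeDensity (hg : IsSmoothMetricOn I g (I.interior M)) (hφ : φ ∈ 𝒜 I M) :
    ContinuousOn (volumeDensity g φ) (interiorCoords I φ) := by
  refine ENNReal.continuous_ofReal.comp_continuousOn (ContinuousOn.sqrt ?_)
  exact continuous_id.matrix_det.comp_continuousOn (continuousOn_pi.2 fun i =>
    continuousOn_pi.2 fun j => fun y hy =>
      (hg.contDiffAt_metricCoeff hφ hy i j).continuousAt.continuousWithinAt)

/-- The transformation rule of the density. -/
lemma volumeDensity_comp (hφ : φ ∈ 𝒜 I M) (hφ' : φ' ∈ 𝒜 I M) {y : 𝔼 d}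
    (hy : y ∈ interiorCoords I φ') {Q : 𝔼 d → 𝔼 d} (hQ : DifferentiableAt ℝ Q y)
    (hQy : Q y ∈ interiorCoords I φ) (hQφ : ∀ᶠ z in 𝓝 y, φ'⁻[I] z = φ⁻[I] (Q z)) :
    volumeDensity g φ' y = ofReal |(fderiv ℝ Q y).det| * volumeDensity g φ (Q y) := by
  set G := metricCoeff I ↟g φ (Q y) with hG
  set B : 𝕄 d := LinearMap.toMatrix (basisFun (Fin d) ℝ).toBasis
    (basisFun (Fin d) ℝ).toBasis (fderiv ℝ Q y) with hB
  have hBa : ∀ a i, B a i = pd i (Q · a) y := fun a i => by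
    rw [← fderiv_apply_coord hQ, hB, LinearMap.toMatrix_apply]
    simp
  have h1 : metricCoeff I ↟g φ' y = B.transpose * G * B := by
    rw [(metricCoeff_comp hφ hφ' hy hQ hQy hQφ).2]
    ext i j
    simp only [pullbackMetric, of_apply, Matrix.mul_apply, transpose_apply, hBa, sum_mul]
    rw [sum_comm]
    exact sum_ext fun _ => sum_ext fun _ => by ring
  have h2 : B.det = (fderiv ℝ Q y).det := LinearMap.det_toMatrix _ _
  rw [volumeDensity, h1, det_mul, det_mul, Matrix.det_transpose,
    show B.det * G.det * B.det = B.det ^ 2 * G.det by ring, Real.sqrt_mul (sq_nonneg _),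
    Real.sqrt_sq_eq_abs, ofReal_mul (abs_nonneg _), h2]
  rfl

section

variable [MeasurableSpace M] [BorelSpace M]

lemma aemeasurable_extend_symm (hφ : φ ∈ 𝒜 I M) :
    AEMeasurable φ⁻[I] ((volume.restrict (interiorCoords I φ)).withDensity (volumeDensity g φ)) :=
  (continuousOn_extend_symm_interiorCoords.aemeasurable
    (isOpen_interiorCoords hφ).measurableSet).mono_ac (withDensity_absolutelyContinuous _ _)

lemma restrict_chartVolume (hφ : φ ∈ 𝒜 I M) {B : Set M} (hB : MeasurableSet B) :
    (chartVolume I ↟g φ).restrict B =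
    ((volume.restrict (interiorCoords I φ ∩ φ⁻[I] ⁻¹' B)).withDensity
    (volumeDensity g φ)).map φ⁻[I] := by
  have h1 := Measure.restrict_map_of_aemeasurable (aemeasurable_extend_symm (g := g) hφ) hB
  refine h1.trans ?_
  rw [restrict_withDensity', Measure.restrict_restrict' (isOpen_interiorCoords hφ).measurableSet,
    inter_comm]

lemma chartVolume_apply (hφ : φ ∈ 𝒜 I M) {B : Set M} (hB : MeasurableSet B) : chartVolume I ↟g φ B =
    ∫⁻ y in interiorCoords I φ ∩ φ⁻[I] ⁻¹' B, volumeDensity g φ y := by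
  refine (Measure.map_apply_of_aemeasurable (aemeasurable_extend_symm (g := g) hφ) hB).trans ?_
  rw [withDensity_apply', Measure.restrict_restrict' (isOpen_interiorCoords hφ).measurableSet,
    inter_comm]

/-- Two charts define the same measure on the intersection of their domains. -/
lemma chartVolume_le (hφ : φ ∈ 𝒜 I M) (hφ' : φ' ∈ 𝒜 I M) {B : Set M} (hB : MeasurableSet B)
    (hBφ : B ⊆ φ.source) : chartVolume I ↟g φ' B ≤ chartVolume I ↟g φ B := by
  rw [chartVolume_apply hφ hB, chartVolume_apply hφ' hB]
  set Q : 𝔼 d → 𝔼 d := fun y => φ.extend I (φ'⁻[I] y) with hQ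
  set D := interiorCoords I φ' ∩ φ'⁻[I] ⁻¹' B with hD
  have hDm : MeasurableSet D := by
    have h1 := (isOpen_interiorCoords hφ').measurableSet.subtype_image
      ((continuousOn_extend_symm_interiorCoords (φ := φ') (I := I)).domRestrict.measurable hB)
    convert h1 using 1
    ext y
    simp [hD, and_comm]
  have hσQ : ∀ y, φ'⁻[I] y ∈ φ.source → φ⁻[I] (Q y) = φ'⁻[I] y := fun y hy =>
    (φ.extend I).left_inv (by rwa [φ.extend_source])
  have hQd : ∀ y ∈ D, DifferentiableAt ℝ Q y := fun y hy => by
    have h1 := ContMDiffAt.comp y (φ.contMDiffAt_extend hφ (hBφ hy.2))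
      (contMDiffAt_extend_symm hφ' hy.1)
    exact h1.contDiffAt.differentiableAt (by simp)
  have hQi : ∀ y ∈ D, Q y ∈ interiorCoords I φ := fun y hy =>
    ⟨(φ.extend I).map_source (by rw [φ.extend_source]; exact hBφ hy.2), by
      rw [hσQ y (hBφ hy.2)]; exact hy.1.2⟩
  have hinj : InjOn Q D := fun y hy z hz hyz => by
    have h1 := congrArg φ⁻[I] hyz
    rw [hσQ y (hBφ hy.2), hσQ z (hBφ hz.2)] at h1
    exact φ'⁻[I].injOn hy.1.1 hz.1.1 h1
  calc ∫⁻ y in D, volumeDensity g φ' y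
      = ∫⁻ y in D, ofReal |(fderiv ℝ Q y).det| * volumeDensity g φ (Q y) := by
        refine setLIntegral_congr_fun hDm fun y hy => volumeDensity_comp hφ hφ' hy.1 (hQd y hy)
          (hQi y hy) ?_
        filter_upwards [(contMDiffAt_extend_symm hφ' hy.1).continuousAt.preimage_mem_nhds
          (φ.open_source.mem_nhds (hBφ hy.2))] with z hz using (hσQ z hz).symm
    _ = ∫⁻ y in Q '' D, volumeDensity g φ y :=
        (lintegral_image_eq_lintegral_abs_det_fderiv_mul _ hDm
          (fun y hy => (hQd y hy).hasFDerivAt.hasFDerivWithinAt) hinj _).symm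
    _ ≤ _ := by
        refine lintegral_mono_set ?_
        rintro _ ⟨y, hy, rfl⟩
        refine ⟨hQi y hy, ?_⟩
        rw [mem_preimage, hσQ y (hBφ hy.2)]
        exact hy.2

/-- On a chart domain, the Riemannian measure is the measure of the chart. -/
lemma riemannianVolume_restrict (hφ : φ ∈ 𝒜 I M) {B : Set M}
    (hB : MeasurableSet B) (hBφ : B ⊆ φ.source) :
    (riemannianVolume I ↟g).restrict B = (chartVolume I ↟g φ).restrict B := by
  set μ := riemannianVolume I ↟g with hμ
  have hle : ∀ φ' ∈ 𝒜 I M, chartVolume I ↟g φ' ≤ μ :=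
    fun φ' h => le_iSup₂ (f := fun φ (_ : φ ∈ 𝒜 I M) => chartVolume I ↟g φ) φ' h
  refine le_antisymm ?_ (Measure.restrict_mono_measure (hle φ hφ) B)
  have key : μ ≤ (chartVolume I ↟g φ).restrict B + μ.restrict Bᶜ := by
    refine iSup₂_le fun φ' hφ' => ?_
    rw [← Measure.restrict_add_restrict_compl (μ := chartVolume I ↟g φ') hB]
    refine add_le_add (Measure.le_iff.2 fun S hS => ?_)
      (Measure.restrict_mono_measure (hle φ' hφ') _)
    rw [Measure.restrict_apply hS, Measure.restrict_apply hS]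
    exact chartVolume_le hφ hφ' (hS.inter hB) (inter_subset_right.trans hBφ)
  refine (Measure.restrict_mono_measure key B).trans_eq ?_
  rw [Measure.restrict_add, Measure.restrict_restrict hB, Measure.restrict_restrict hB, inter_self,
    inter_compl_self, Measure.restrict_empty, add_zero]

/-- Integrals with respect to the Riemannian measure, in a chart. -/
lemma setLIntegral_riemannianVolume (hg : IsSmoothMetricOn I g (I.interior M)) (hφ : φ ∈ 𝒜 I M)
    (hAo : IsOpen A) (hA : A ⊆ interiorCoords I φ) {F : M → ℝ≥0∞}
    (hF : ContinuousOn (fun y => F (φ⁻[I] y)) A) :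
    ∫⁻ x in φ⁻[I] '' A, F x ∂(riemannianVolume I ↟g) =
    ∫⁻ y in A, volumeDensity g φ y * F (φ⁻[I] y) := by
  have hV := (isOpen_image_extend_symm hAo hA).measurableSet
  have hVA : interiorCoords I φ ∩ φ⁻[I] ⁻¹' (φ⁻[I] '' A) = A := by
    refine Subset.antisymm ?_ fun y hy => ⟨hA hy, mem_image_of_mem _ hy⟩
    rintro y ⟨hy, z, hz, hzy⟩
    rwa [← φ⁻[I].injOn (hA hz).1 hy.1 hzy]
  rw [riemannianVolume_restrict hφ hV (by
      rw [image_extend_symm_eq hA, φ.extend_source]; exact inter_subset_left),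
    restrict_chartVolume hφ hV, hVA]
  have hρ : AEMeasurable (volumeDensity g φ) (volume.restrict A) :=
    ((continuousOn_volumeDensity hg hφ).mono hA).aemeasurable hAo.measurableSet
  have hσ : AEMeasurable φ⁻[I] ((volume.restrict A).withDensity (volumeDensity g φ)) :=
    ((continuousOn_extend_symm_interiorCoords.mono hA).aemeasurable hAo.measurableSet).mono_ac
      (withDensity_absolutelyContinuous _ _)
  have hFm := (continuousOn_image_extend_symm hA hF).aemeasurable hV
    (μ := chartVolume I ↟g φ)
  rw [restrict_chartVolume hφ hV, hVA] at hFm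
  rw [lintegral_map' hFm hσ, lintegral_withDensity_eq_lintegral_mul_non_measurable₀ _ hρ
    (Eventually.of_forall fun _ => ENNReal.ofReal_lt_top)]
  rfl

end

/-! ### The Bochner inequality for harmonic maps -/

variable [BoundarylessManifold J N]

/-- Near a point the energy density is given by the coordinate expression. -/
lemma energyDensity_eventuallyEq (hg : IsSmoothMetricOn I g (I.interior M)) (hφ : φ ∈ 𝒜 I M)
    (hψ : ψ ∈ maximalAtlas J ∞ N) (hy : y ∈ interiorCoords I φ) (hU : U ∈ 𝓝 (φ⁻[I] y))
    (hf : ContMDiffOn I J ∞ f U) (hfy : f (φ⁻[I] y) ∈ ψ.source) :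
    (fun z => energyDensity I J ↟g ↟h f (φ⁻[I] z)) =ᶠ[𝓝 y] coordEnergy (metricCoeff I ↟g φ)
    (metricCoeff J ↟h ψ) (fun z => ψ.extend J (f (φ⁻[I] z))) := by
  have hcσ := (contMDiffAt_extend_symm hφ hy).continuousAt
  have hfc : ContinuousAt (fun z => f (φ⁻[I] z)) y := ContinuousAt.comp (f := φ⁻[I])
      (hf.contMDiffAt hU).continuousAt hcσ
  filter_upwards [(isOpen_interiorCoords hφ).mem_nhds hy,
    hcσ.eventually (eventually_mem_nhds_iff.2 hU),
    hfc.preimage_mem_nhds (ψ.open_source.mem_nhds hfy)] with z hz hzU hzψ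
  exact energyDensity_eq_coordEnergy hφ hψ hz (hg.symm _ hz.2) (hf.contMDiffAt hzU) hzψ

lemma contDiffAt_energyDensity (hg : IsSmoothMetricOn I g (I.interior M))
    (hh : IsSmoothMetricOn J h (J.interior N)) (hφ : φ ∈ 𝒜 I M) (hy : y ∈ interiorCoords I φ)
    (hU : U ∈ 𝓝 (φ⁻[I] y)) (hf : ContMDiffOn I J ∞ f U) :
    ContDiffAt ℝ ∞ (fun z => energyDensity I J ↟g ↟h f (φ⁻[I] z)) y := by
  have hψ := chart_mem_maximalAtlas (I := J) (n := ∞) (f (φ⁻[I] y))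
  have hfy := mem_chart_source Y (f (φ⁻[I] y))
  refine ContDiffAt.congr_of_eventuallyEq ?_ (energyDensity_eventuallyEq hg hφ hψ hy hU hf hfy)
  refine contDiffAt_coordEnergy (hg.contDiffAt_metricCoeff hφ hy)
    (hg.det_metricCoeff_pos hφ hy).ne'
    (hh.contDiffAt_metricCoeff hψ (mem_interiorCoords_extend hfy)) ?_
  simpa using contDiffAt_coordMap hφ hψ hy (hf.contMDiffAt hU) hfy

/-- The differential inequality which follows from Bochner's formula. -/
theorem laplacian_energyDensity_ge (hg : IsSmoothMetricOn I g (I.interior M))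
    (hh : IsSmoothMetricOn J h (J.interior N)) {c : ℝ} (hRic : RicciBoundedBelow I ↟g c)
    (hN : NonpositivelyCurved J ↟h) (hf : IsHarmonicOn I J ↟g ↟h f U) (hφ : φ ∈ 𝒜 I M)
    (hy : y ∈ interiorCoords I φ) (hU : U ∈ 𝓝 (φ⁻[I] y)) : 2 * c * energyDensity I J ↟g ↟h f
    (φ⁻[I] y) ≤ laplacian (metricCoeff I ↟g φ) (fun z => energyDensity I J
    ↟g ↟h f (φ⁻[I] z)) y := by
  set p := φ⁻[I] y with hp
  set v : 𝔼 d → ℝ := fun z => energyDensity I J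
    ↟g ↟h f (φ⁻[I] z) with hv
  obtain ⟨φ', hφ', Q, hQc, hQy, hy', hσ, hG1, hG', hlap⟩ := exists_normal_chart hg hφ hy
  have hψ₀ := chart_mem_maximalAtlas (I := J) (n := ∞) (f p)
  have hfp := mem_chart_source Y (f p)
  set q := (chartAt Y (f p)).extend J (f p) with hq
  have hqi := mem_interiorCoords_extend (J := J) hfp
  obtain ⟨ψ, hψ, R, hRc, hRq, hqψ, hσψ, hH1, hH', -⟩ := exists_normal_chart hh hψ₀ hqi
  -- the base point of the normal chart of the target is `f p`
  have hqp : (ψ.extend J).symm q = f p := by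
    rw [hσψ.self_of_nhds, hRq]
    exact ((chartAt Y (f p)).extend J).left_inv (by rwa [OpenPartialHomeomorph.extend_source])
  have hσy : φ'⁻[I] y = p := by rw [hσ.self_of_nhds, hQy]
  have hfψ : f (φ'⁻[I] y) ∈ ψ.source := by
    rw [hσy, ← hqp, ← ψ.extend_source (I := J)]
    exact (ψ.extend J).map_target hqψ.1
  have hU' : U ∈ 𝓝 (φ'⁻[I] y) := by rwa [hσy]
  set u : 𝔼 d → 𝔼 m := fun z => ψ.extend J (f (φ'⁻[I] z)) with hu
  have huy : u y = q := by
    rw [hu]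
    simp only
    rw [hσy, ← hqp]
    exact (ψ.extend J).right_inv hqψ.1
  have hev := energyDensity_eventuallyEq (h := h) hg hφ' hψ hy' hU' hf.smooth hfψ
  have hvQ : (fun z => v (Q z)) =ᶠ[𝓝 y] coordEnergy (metricCoeff I ↟g φ')
      (metricCoeff J ↟h ψ) u := by
    filter_upwards [hev, hσ] with z hz hz'
    rw [← hz, hv]
    simp only
    rw [hz']
  have hvy : v y = coordEnergy (metricCoeff I ↟g φ')
      (metricCoeff J ↟h ψ) u y := by
    rw [← hvQ.self_of_nhds]
    exact congrArg v hQy.symm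
  have hcσ := (contMDiffAt_extend_symm hφ' hy').continuousAt
  have hfc : ContinuousAt (fun z => f (φ'⁻[I] z)) y := ContinuousAt.comp (f := φ'⁻[I])
      (hf.smooth.contMDiffAt hU').continuousAt hcσ
  have hbo := bochner_of_normal (G := metricCoeff I ↟g φ')
    (H := metricCoeff J ↟h ψ) (u := u) (y := y) (c := c)
    (hg.contDiffAt_metricCoeff hφ' hy')
    (by rw [huy]; exact hh.contDiffAt_metricCoeff hψ hqψ)
    (contDiffAt_coordMap hφ' hψ hy' (hf.smooth.contMDiffAt hU') hfψ)
    (by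
      filter_upwards [(isOpen_interiorCoords hφ').mem_nhds hy'] with z hz i j
      exact hg.metricCoeff_symm hz i j)
    (by
      rw [huy]
      filter_upwards [(isOpen_interiorCoords hψ).mem_nhds hqψ] with z hz i j
      exact hh.metricCoeff_symm hz i j)
    hG1 hG' (by rw [huy]; exact hH1) (by rw [huy]; exact hH')
    (fun γ => by
      filter_upwards [(isOpen_interiorCoords hφ').mem_nhds hy',
        hcσ.eventually hU', hfc.preimage_mem_nhds (ψ.open_source.mem_nhds hfψ)] with z hz hzU hzψ
      exact hf.tension_eq_zero φ' hφ' ψ hψ z hz.1 hzU hzψ γ)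
    (hRic φ' hφ' y hy') (by rw [huy]; exact hN ψ hψ q hqψ)
  rw [← hlap v ((contDiffAt_energyDensity hg hh hφ hy hU hf.smooth).of_le (natCast_le_infty 2)),
    show energyDensity I J ↟g ↟h f p = v y from rfl, hvy]
  refine hbo.trans (le_of_eq (sum_ext fun k => ?_))
  exact (pd_congr k (pd_eventuallyEq k hvQ)).symm

end Charts

/-! ### Conformally compact metrics near a boundary point -/

section BoundaryRegularity

variable {c : 𝔼 (n + 1)}

/-- The closed half space. -/
def halfSpace (n : ℕ) : Set (𝔼 (n + 1)) := {y | 0 ≤ y 0}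

/-- Interior points of the half space near the boundary point `c`. -/
def insideNhds (c : 𝕍) : Filter 𝕍 := 𝓝[{y | 0 < y 0}] c

lemma range_eq_halfSpace : range 𝓗 = halfSpace n := range_modelWithCornersEuclideanHalfSpace (n + 1)

lemma uniqueDiffOn_halfSpace : UniqueDiffOn ℝ (halfSpace n) :=
  range_eq_halfSpace (n := n) ▸ (𝓗).uniqueDiffOn

lemma convex_halfSpace : Convex ℝ (halfSpace n) := convex_halfSpace_ge (f := fun y : 𝕍 => y 0)
    ⟨fun _ _ => rfl, fun _ _ => rfl⟩ 0

lemma halfSpace_mem_nhds {y : 𝕍} (hy : 0 < y 0) : halfSpace n ∈ 𝓝 y :=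
  mem_of_superset ((isOpen_lt continuous_const (by fun_prop :
    Continuous fun y : 𝕍 => y 0)).mem_nhds hy) fun z hz => le_of_lt (show 0 < z 0 from hz)

lemma insideNhds_le : insideNhds c ≤ 𝓝[halfSpace n] c :=
  nhdsWithin_mono _ fun y hy => le_of_lt (show 0 < y 0 from hy)

lemma eventually_pos : ∀ᶠ y in insideNhds c, 0 < y 0 := eventually_mem_nhdsWithin

lemma eventually_insideNhds_iff {p : 𝕍 → Prop} :
    (∀ᶠ y in insideNhds c, p y) ↔ ∃ r > 0, ∀ y ∈ halfBall c r, p y := by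
  rw [insideNhds, Metric.nhdsWithin_basis_ball.eventually_iff]
  refine exists_congr fun r => and_congr_right fun _ => ?_
  exact ⟨fun h y hy => h ⟨hy.2, hy.1⟩, fun h y hy => h y ⟨hy.2, hy.1⟩⟩

/-- Functions of class `C¹` up to the boundary have bounded derivatives. -/
lemma exists_pd_bound {F : 𝕍 → ℝ} (hc : c 0 = 0) (hF : ContDiffWithinAt ℝ 1 F (halfSpace n) c) :
    ∃ L : ℝ, ∀ᶠ y in insideNhds c, DifferentiableAt ℝ F y ∧ ∀ i, |pd i F y| ≤ L := by
  obtain ⟨K, t, ht, hK⟩ := hF.exists_lipschitzOnWith convex_halfSpace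
  refine ⟨K, ?_⟩
  have h1 : ∀ᶠ y in 𝓝[halfSpace n] c, t ∈ 𝓝[halfSpace n] y := eventually_eventually_nhdsWithin.2 ht
  have h2 : ∀ᶠ y in 𝓝[halfSpace n] c, ContDiffWithinAt ℝ 1 F (halfSpace n) y := by
    have := hF.eventually (by simp)
    rwa [insert_eq_of_mem (show c ∈ halfSpace n from hc.ge)] at this
  filter_upwards [insideNhds_le h1, insideNhds_le h2, eventually_pos] with y h1 h2 h3
  have hn := halfSpace_mem_nhds h3
  rw [nhdsWithin_eq_nhds.2 hn] at h1
  refine ⟨(h2.contDiffAt hn).differentiableAt (by simp), fun i => ?_⟩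
  refine ((fderiv ℝ F y).le_opNorm _).trans ?_
  rw [norm_single, norm_one, mul_one]
  exact norm_fderiv_le_of_lipschitzOn ℝ h1 hK

/-- A function of class `C²` up to the boundary which vanishes to first order there, divided by
the height. -/
lemma exists_quotient_bound {τ : 𝕍 → ℝ} (hc : c 0 = 0) (hτ : ContDiffWithinAt ℝ 2 τ (halfSpace n) c)
    (hpos : ∀ᶠ y in insideNhds c, 0 < τ y) (hzero : ∀ᶠ y in 𝓝 c, y 0 = 0 → τ y = 0)
    (hτ' : fderivWithin ℝ τ (halfSpace n) c ≠ 0) :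
    ∃ a b : ℝ, 0 < a ∧ ∀ᶠ y in insideNhds c, a ≤ τ y / y 0 ∧ τ y / y 0 ≤ b ∧
    DifferentiableAt ℝ (fun z => τ z / z 0) y ∧ ∀ i, |pd i (fun z => τ z / z 0) y| ≤ b := by
  set T := fderivWithin ℝ τ (halfSpace n) with hT
  have hcH : c ∈ halfSpace n := hc.ge
  obtain ⟨L, t, ht, hL⟩ := (hτ.fderivWithin_right (m := 1) uniqueDiffOn_halfSpace
    (by norm_num) hcH).exists_lipschitzOnWith convex_halfSpace
  have h2 : ∀ᶠ y in 𝓝[halfSpace n] c, ContDiffWithinAt ℝ 2 τ (halfSpace n) y := by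
    have := hτ.eventually (by simp)
    rwa [insert_eq_of_mem hcH] at this
  obtain ⟨ρ, hρ, hball⟩ := (Metric.nhdsWithin_basis_ball (x := c) (s := halfSpace n)).eventually_iff.1
    (((show ∀ᶠ y in 𝓝[halfSpace n] c, y ∈ t from ht).and h2).and
      (hzero.filter_mono nhdsWithin_le_nhds))
  set e : Fin (n + 1) → 𝕍 := fun i => single i 1
    with he
  have hen : ∀ i, ‖e i‖ = 1 := fun i => by rw [he]; simp
  have he0 : e 0 0 = 1 := by simp [he]
  have hLip : ∀ y ∈ ball c ρ ∩ halfSpace n, ∀ z ∈ ball c ρ ∩ halfSpace n, ∀ i,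
      |T y (e i) - T z (e i)| ≤ L * dist y z := fun y hy z hz i => by
    have h := hL.dist_le_mul y (hball hy).1.1 z (hball hz).1.1
    rw [dist_eq_norm] at h
    refine le_trans ?_ h
    have := (T y - T z).le_opNorm (e i)
    rwa [hen, mul_one] at this
  have hder : ∀ y ∈ ball c ρ ∩ halfSpace n, HasFDerivWithinAt τ (T y) (halfSpace n) y :=
    fun y hy => ((hball hy).1.2.differentiableWithinAt (by simp)).hasFDerivWithinAt
  -- the tangential derivatives vanish on the boundary
  have htan : ∀ y ∈ ball c ρ, y 0 = 0 → ∀ i ≠ 0, T y (e i) = 0 := by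
    intro y hy hy0 i hi
    have hline : HasDerivAt (fun s : ℝ => y + s • e i) (e i) 0 := by
      simpa using ((hasDerivAt_id (0 : ℝ)).smul_const (e i)).const_add y
    have hcoord : ∀ s : ℝ, (y + s • e i) 0 = 0 := fun s => by simp [he, hy0, hi.symm]
    have h1 : HasDerivAt (fun s : ℝ => τ (y + s • e i)) (T y (e i)) 0 := by
      have h3 := hder y ⟨hy, hy0.ge⟩
      have h4 : HasFDerivWithinAt τ (T y) (halfSpace n) (y + (0 : ℝ) • e i) := by simpa using h3
      rw [← hasDerivWithinAt_univ]
      exact h4.comp_hasDerivWithinAt (0 : ℝ) hline.hasDerivWithinAt fun s _ => (hcoord s).ge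
    have h5 : (fun s : ℝ => τ (y + s • e i)) =ᶠ[𝓝 0] fun _ => 0 := by
      have hc' : ContinuousAt (fun s : ℝ => y + s • e i) 0 := hline.continuousAt
      have : ∀ᶠ s in 𝓝 (0 : ℝ), y + s • e i ∈ ball c ρ :=
        hc'.preimage_mem_nhds (Metric.isOpen_ball.mem_nhds (by simpa using hy))
      filter_upwards [this] with s hs
      exact (hball ⟨hs, (hcoord s).ge⟩).2 (hcoord s)
    exact h1.unique ((hasDerivAt_const (0 : ℝ) (0 : ℝ)).congr_of_eventuallyEq h5)
  -- the mean value theorem on the vertical segment below `y`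
  have key : ∀ r ≤ ρ, ∀ y ∈ halfBall c (r / 2), y ∈ ball c ρ ∩ halfSpace n ∧
      y - y 0 • e 0 ∈ ball c ρ ∧ (y - y 0 • e 0) 0 = 0 ∧
      ∃ z ∈ ball c ρ ∩ halfSpace n, τ y / y 0 = T z (e 0) ∧ dist y z ≤ y 0 ∧ dist z c < r := by
    intro r hr y hy
    have hy0 := hy.1
    have hyc : dist y c < r / 2 := hy.2
    have hlt := height_lt hc hy
    have hpt : ∀ s : ℝ, 0 ≤ s → s ≤ y 0 → dist y (y - s • e 0) ≤ y 0 ∧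
        dist (y - s • e 0) c < r ∧ (y - s • e 0) 0 = y 0 - s := fun s hs hs' => by
      have h1 : dist y (y - s • e 0) = s := by
        rw [dist_eq_norm, sub_sub_cancel, norm_smul, hen, mul_one, norm_of_nonneg hs]
      refine ⟨h1.le.trans hs', ?_, by simp [he0]⟩
      have := dist_triangle_left (y - s • e 0) c y
      linarith
    have hmem : ∀ s : ℝ, 0 ≤ s → s ≤ y 0 → y - s • e 0 ∈ ball c ρ ∩ halfSpace n :=
      fun s hs hs' => ⟨(hpt s hs hs').2.1.trans_le hr, by
        show 0 ≤ (y - s • e 0) 0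
        rw [(hpt s hs hs').2.2]; linarith⟩
    have hline : ∀ s : ℝ, HasDerivAt (fun s : ℝ => y - s • e 0) (-e 0) s := fun s => by
      simpa using ((hasDerivAt_id s).smul_const (e 0)).const_sub y
    have hd : ∀ s ∈ Icc 0 (y 0), HasDerivWithinAt (fun s : ℝ => τ (y - s • e 0))
        (-T (y - s • e 0) (e 0)) (Icc 0 (y 0)) s := fun s hs => by
      have h1 := (hder _ (hmem s hs.1 hs.2)).comp_hasDerivWithinAt s
        ((hline s).hasDerivWithinAt (s := Icc 0 (y 0))) fun s hs => (hmem s hs.1 hs.2).2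
      rw [map_neg] at h1
      exact h1
    obtain ⟨s, hs, hs'⟩ := exists_hasDerivAt_eq_slope (fun s : ℝ => τ (y - s • e 0))
      (fun s => -T (y - s • e 0) (e 0)) hy0 (fun s hs => (hd s hs).continuousWithinAt)
      fun s hs => (hd s ⟨hs.1.le, hs.2.le⟩).hasDerivAt (Icc_mem_nhds hs.1 hs.2)
    have hb := hmem (y 0) hy0.le le_rfl
    have hb0 : (y - y 0 • e 0) 0 = 0 := by rw [(hpt (y 0) hy0.le le_rfl).2.2, sub_self]
    refine ⟨by simpa using hmem 0 le_rfl hy0.le, hb.1, hb0, _, hmem s hs.1.le hs.2.le, ?_,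
      (hpt s hs.1.le hs.2.le).1, (hpt s hs.1.le hs.2.le).2.1⟩
    rw [(hball hb).2 hb0, zero_smul, sub_zero, sub_zero, zero_sub, neg_div] at hs'
    exact (neg_injective hs').symm
  set W := T c (e 0) with hW
  have hcb : c ∈ ball c ρ ∩ halfSpace n := ⟨Metric.mem_ball_self hρ, hcH⟩
  have hquot : ∀ r ≤ ρ, ∀ y ∈ halfBall c (r / 2), |τ y / y 0 - W| ≤ L * r := fun r hr y hy => by
    obtain ⟨-, -, -, z, hz, h1, -, h2⟩ := key r hr y hy
    rw [h1]
    exact (hLip z hz c hcb 0).trans (mul_le_mul_of_nonneg_left h2.le L.2)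
  have hWne : W ≠ 0 := by
    intro h0
    refine hτ' (ContinuousLinearMap.ext fun v => ?_)
    rw [euclidean_eq_sum v, map_sum]
    refine sum_eq_zero fun i _ => ?_
    rw [map_smul]
    rcases eq_or_ne i 0 with rfl | hi
    · exact (congrArg (v 0 • ·) h0).trans (smul_zero _)
    · exact (congrArg (v i • ·) (htan c hcb.1 hc i hi)).trans (smul_zero _)
  have hWpos : 0 < W := by
    refine lt_of_le_of_ne (le_of_forall_pos_le_add fun ε hε => ?_) hWne.symm
    obtain ⟨r₁, hr₁, hr₁'⟩ := eventually_insideNhds_iff.1 hpos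
    set r := min (min ρ (2 * r₁)) (ε / (L + 1)) with hr
    have hL1 : (0 : ℝ) < L + 1 := by positivity
    have hr0 : 0 < r := by positivity
    set y := c + (r / 4) • e 0 with hy
    have hyb : y ∈ halfBall c (r / 2) := by
      refine ⟨by simp [hy, hc, he0]; positivity, ?_⟩
      rw [hy, dist_self_add_left, norm_smul, hen, norm_of_nonneg (by positivity)]
      linarith
    have h1 := hquot r ((min_le_left _ _).trans (min_le_left _ _)) y hyb
    have h3 : r ≤ 2 * r₁ := (min_le_left _ _).trans (min_le_right _ _)
    have h2 : 0 < τ y / y 0 := div_pos (hr₁' y (halfBall_mono (by linarith) hyb)) hyb.1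
    have h4 : L * r ≤ ε := by
      calc L * r ≤ (L + 1) * (ε / (L + 1)) := by
            gcongr
            · linarith
            · exact min_le_right _ _
        _ = ε := by field_simp
    linarith [(abs_le.1 h1).2]
  refine ⟨W / 2, max (2 * W) L, by positivity, eventually_insideNhds_iff.2 ?_⟩
  set r := min ρ (W / (2 * (L + 1))) with hr
  have hL1 : (0 : ℝ) < L + 1 := by positivity
  have hrW : L * r ≤ W / 2 := by
    calc L * r ≤ (L + 1) * (W / (2 * (L + 1))) := by
          gcongr
          · linarith
          · exact min_le_right _ _
      _ = W / 2 := by field_simp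
  refine ⟨r / 2, by positivity, fun y hy => ?_⟩
  obtain ⟨hyb, hbb, hb0, z, hz, hzeq, hzd, -⟩ := key r (min_le_left _ _) y hy
  have hq := abs_le.1 (hquot r (min_le_left _ _) y hy)
  have hy0 := hy.1
  have hn := halfSpace_mem_nhds hy0
  have hyd : HasFDerivAt τ (T y) y := (hder y hyb).hasFDerivAt hn
  have hh : DifferentiableAt ℝ (fun z : 𝕍 => (z 0)⁻¹) y :=
    DifferentiableAt.fun_inv (by fun_prop) hy0.ne'
  have hquo : (fun z => τ z / z 0) = fun z : 𝕍 => τ z * (z 0)⁻¹ :=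
    funext fun z => div_eq_mul_inv _ _
  refine ⟨by linarith, by linarith [le_max_left (2 * W) L],
    hquo ▸ hyd.differentiableAt.fun_mul hh, fun i => le_trans ?_ (le_max_right _ _)⟩
  have hpd : pd i (fun z => τ z / z 0) y =
      (T y (e i) - (if i = 0 then τ y / y 0 else 0)) / y 0 := by
    have h1 := pd_comp_real (φ := fun s => s⁻¹) (u := fun z : 𝕍 => z 0)
      i (hasDerivAt_inv hy0.ne') (by fun_prop)
    rw [hquo, pd_mul i hyd.differentiableAt hh, h1, pd_coord, pd, hyd.fderiv]
    split_ifs with h2 h3 h3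
    · field_simp
      simp only [he]
      ring
    · exact absurd h2.symm h3
    · exact absurd h3.symm h2
    · field_simp
      ring
  rw [hpd, abs_div, abs_of_pos hy0, div_le_iff₀ hy0]
  split_ifs with hi
  · rw [hi, hzeq]
    exact (hLip y hyb z hz 0).trans (mul_le_mul_of_nonneg_left hzd L.2)
  · rw [sub_zero, ← sub_zero (T y (e i)), ← htan _ hbb hb0 i hi]
    refine (hLip y hyb _ ⟨hbb, hb0.ge⟩ i).trans (mul_le_mul_of_nonneg_left ?_ L.2)
    rw [dist_eq_norm, sub_sub_cancel, norm_smul, hen, mul_one, norm_of_nonneg hy0.le]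

end BoundaryRegularity

/-! ### Uniform bounds for a conformally compact metric -/

section ConformallyCompact

variable {c : 𝔼 (n + 1)}

lemma exists_lower_bound {d : ℕ} {g : 𝕄 d} (hs : ∀ i j, g i j = g j i)
    (hpos : ∀ ξ : Fin d → ℝ, ξ ≠ 0 → 0 < ∑ i, ∑ j, g i j * ξ i * ξ j) :
    ∃ lam Lam : ℝ, 0 < lam ∧ IsEllipticMatrix g lam Lam := by
  obtain ⟨-, B, hBu, hB1, -⟩ := exists_orthonormal_frame hs hpos
  have hle : ∀ A : 𝕄 d, ∀ i j, |A i j| ≤ ∑ i, ∑ j, |A i j| := fun A i j =>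
    (single_le_sum (f := fun j => |A i j|) (fun _ _ => abs_nonneg _)
      (Finset.mem_univ j)).trans (single_le_sum (f := fun i => ∑ j, |A i j|)
        (fun _ _ => by positivity) (Finset.mem_univ i))
  set K : ℝ := (d * ∑ i, ∑ j, |B i j|) ^ 2 with hK
  refine ⟨(K + 1)⁻¹, _, by positivity, hs, fun ξ => ?_, hle g⟩
  have h1 := sum_sq_mulVec_le (hle B) (B⁻¹.mulVec ξ)
  have hx : B.mulVec (B⁻¹.mulVec ξ) = ξ := by rw [mulVec_mulVec, mul_nonsing_inv _ hBu, one_mulVec]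
  have h2 : ∑ i, (B⁻¹.mulVec ξ) i ^ 2 = ∑ i, ∑ j, g i j * ξ i * ξ j := by
    have h3 : (B⁻¹.mulVec ξ) ⬝ᵥ (B.transpose * g * B).mulVec (B⁻¹.mulVec ξ) = ξ ⬝ᵥ g.mulVec ξ := by
      rw [← mulVec_mulVec, ← mulVec_mulVec, Matrix.dotProduct_mulVec, Matrix.vecMul_transpose, hx]
    rw [hB1, one_mulVec] at h3
    rw [sum_sum_eq_dotProduct, ← h3, dotProduct]
    exact sum_ext fun _ => by ring
  rw [hx, h2, ← hK] at h1
  have h4 : 0 ≤ ∑ i, ∑ j, g i j * ξ i * ξ j := h2 ▸ sum_nonneg fun _ _ => sq_nonneg _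
  rw [inv_mul_le_iff₀ (by positivity)]
  linarith

lemma abs_form_le {d : ℕ} {A : 𝕄 d} {ε : ℝ} (hA : ∀ i j, |A i j| ≤ ε)
    (ξ : Fin d → ℝ) : |∑ i, ∑ j, A i j * ξ i * ξ j| ≤ ε * d * ∑ i, ξ i ^ 2 := by
  rcases isEmpty_or_nonempty (Fin d) with h | ⟨⟨i₀⟩⟩
  · simp
  have hε : 0 ≤ ε := (abs_nonneg _).trans (hA i₀ i₀)
  calc |∑ i, ∑ j, A i j * ξ i * ξ j| ≤ ∑ i, ∑ j, ε * (|ξ i| * |ξ j|) := by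
        refine (Finset.abs_sum_le_sum_abs _ _).trans (sum_le_sum fun i _ =>
          (Finset.abs_sum_le_sum_abs _ _).trans (sum_le_sum fun j _ => ?_))
        rw [abs_mul, abs_mul, mul_assoc]
        exact mul_le_mul_of_nonneg_right (hA i j) (by positivity)
    _ = ε * (∑ i, |ξ i|) ^ 2 := by
        rw [sq, Finset.sum_mul_sum, mul_sum]
        exact sum_ext fun _ => (mul_sum _ _ _).symm
    _ ≤ ε * (d * ∑ i, |ξ i| ^ 2) := by
        gcongr
        simpa using sq_sum_le_card_mul_sum_sq (s := Finset.univ) (f := fun i => |ξ i|)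
    _ = _ := by simp only [sq_abs, mul_assoc]

/-- The bounds of `AHMetric` for `G = τ⁻² Gb`: with `q = τ / y 0`, the regular part of `√(det G) G⁻¹`
is `q^(1 - n) √(det Gb) Gb⁻¹`. -/
lemma ahMetric_of_bounds {G Gb : 𝕍 → 𝕄 (n + 1)} {τ : 𝕍 → ℝ}
    (hn : 2 ≤ n) {r a b lamV ΛV LV D₁ D₂ : ℝ} (ha : 0 < a) (hb0 : 0 < b) (hlamV0 : 0 < lamV)
    (hΛ0 : 0 < ΛV) (hLV0 : 0 ≤ LV) (hD₁ : 0 < D₁) (hD₂ : 0 < D₂)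
    (hq : ∀ y ∈ halfBall c r, a ≤ τ y / y 0 ∧ τ y / y 0 ≤ b ∧
      DifferentiableAt ℝ (fun z => τ z / z 0) y ∧ ∀ i, |pd i (fun z => τ z / z 0) y| ≤ b)
    (hV : ∀ y ∈ halfBall c r, ∀ i j, DifferentiableAt ℝ (fun z => volInv Gb z i j) y ∧
      ∀ k, |pd k (fun z => volInv Gb z i j) y| ≤ LV)
    (hVe : ∀ y ∈ halfBall c r, IsEllipticMatrix (volInv Gb y) lamV ΛV)
    (hGbΛ : ∀ y ∈ halfBall c r, ∀ i j, |Gb y i j| ≤ ΛV)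
    (hD : ∀ y ∈ halfBall c r, D₁ ≤ √(Gb y).det ∧ √(Gb y).det ≤ D₂)
    (hG : ∀ i j, ContDiffOn ℝ ∞ (G · i j) (halfBall c r))
    (hGs : ∀ y ∈ halfBall c r, ∀ i j, G y i j = G y j i)
    (hdet : ∀ y ∈ halfBall c r, 0 < (G y).det)
    (hGG : ∀ y ∈ halfBall c r, Gb y = τ y ^ 2 • G y) :
    ∃ lam Lam : ℝ, 0 < lam ∧ 0 < Lam ∧ AHMetric G c r lam Lam ∧
      ∀ y ∈ halfBall c r, lam * y 0 ≤ τ y := by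
  -- the ratio of the regular parts of the coefficient fields of `G` and `Gb`
  set s : 𝕍 → ℝ := fun z => ((τ z / z 0) ^ (n - 1))⁻¹ with hsdef
  have hfac : ∀ y ∈ halfBall c r, 0 < τ y ∧ √(Gb y).det = τ y ^ (n + 1) * √(G y).det ∧
      (y 0) ^ (n - 1) • volInv G y = s y • volInv Gb y := by
    intro y hy
    have hy0 := hy.1
    have hτy : 0 < τ y := by
      have h1 := ha.trans_le (hq y hy).1
      rwa [div_pos_iff_of_pos_right hy0] at h1
    have hd : √(Gb y).det = τ y ^ (n + 1) * √(G y).det := by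
      rw [hGG y hy, Matrix.det_smul, Fintype.card_fin, Real.sqrt_mul (by positivity),
        ← pow_mul, mul_comm 2, pow_mul, Real.sqrt_sq (by positivity)]
    refine ⟨hτy, hd, ?_⟩
    have hi : (Gb y)⁻¹ = (τ y ^ 2)⁻¹ • (G y)⁻¹ := by
      have hu : (τ y ^ 2) • G y = (Units.mk0 (τ y ^ 2) (by positivity) : ℝˣ) • G y := rfl
      rw [hGG y hy, hu, Matrix.inv_smul' _ _ (isUnit_iff_ne_zero.2 (hdet y hy).ne')]
      rfl
    rw [volInv, volInv, hd, hi, smul_smul, smul_smul, smul_smul, hsdef]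
    congr 1
    obtain ⟨k, rfl⟩ : ∃ k, n = k + 1 := ⟨n - 1, by omega⟩
    simp only [Nat.add_sub_cancel, div_pow, inv_div]
    field_simp
    ring
  have hpow : ∀ (k : ℕ) (q : ℝ), a ≤ q → q ≤ b → (b ^ k)⁻¹ ≤ (q ^ k)⁻¹ ∧ (q ^ k)⁻¹ ≤ (a ^ k)⁻¹ :=
    fun k q h1 h2 => ⟨inv_anti₀ (pow_pos (ha.trans_le h1) k) (pow_le_pow_left₀ (ha.le.trans h1) h2 k),
      inv_anti₀ (pow_pos ha k) (pow_le_pow_left₀ ha.le h1 k)⟩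
  set K₁ : ℝ := (n - 1 : ℕ) * b ^ (n - 1 - 1) / (a ^ (n - 1)) ^ 2 with hK₁
  set Lam : ℝ := (a ^ (n - 1))⁻¹ * ΛV + (K₁ * b * ΛV + (a ^ (n - 1))⁻¹ * LV) +
    (a ^ (n + 1))⁻¹ * D₂ + (a ^ 2)⁻¹ * (ΛV * (n + 1 : ℕ)) with hLam
  have hK₁0 : 0 ≤ K₁ := by positivity
  have p1 : 0 < (a ^ (n - 1))⁻¹ * ΛV := by positivity
  have p2 : 0 ≤ K₁ * b * ΛV + (a ^ (n - 1))⁻¹ * LV := by positivity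
  have p3 : 0 ≤ (a ^ (n + 1))⁻¹ * D₂ := by positivity
  have p4 : 0 ≤ (a ^ 2)⁻¹ * (ΛV * (n + 1 : ℕ)) := by positivity
  set lam : ℝ := min (min ((b ^ (n - 1))⁻¹ * lamV) ((b ^ (n + 1))⁻¹ * D₁)) a with hlam
  refine ⟨lam, Lam, by positivity, by positivity, ⟨hG, hGs, hdet, ⟨?_, ?_, ?_⟩, ?_, ?_, ?_⟩, ?_⟩
  · intro i j y hy
    have hU := (isOpen_halfBall c r).mem_nhds hy
    have hGy : ∀ i j, ContDiffAt ℝ 1 (G · i j) y := fun i j =>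
      ((hG i j).contDiffAt hU).of_le (natCast_le_infty 1)
    have hd := hdet y hy
    have h0 : ContDiffAt ℝ 1 (fun z : 𝕍 => z 0 ^ (n - 1)) y := by fun_prop
    exact (h0.mul (((contDiffAt_det hGy).sqrt hd.ne').mul
      (contDiffAt_inv_apply hGy hd.ne' i j))).contDiffWithinAt
  · intro y hy
    have hqy := hq y hy
    have hsy := hpow (n - 1) _ hqy.1 hqy.2.1
    have hs0 : 0 < s y := lt_of_lt_of_le (by positivity) hsy.1
    have he := (hVe y hy).smul hs0.le
    simp only
    rw [(hfac y hy).2.2]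
    refine ⟨he.symm, fun ξ => le_trans ?_ (he.lower ξ), fun i j => (he.upper i j).trans ?_⟩
    · refine mul_le_mul_of_nonneg_right ?_ (sum_nonneg fun _ _ => sq_nonneg _)
      calc lam ≤ (b ^ (n - 1))⁻¹ * lamV := (min_le_left _ _).trans (min_le_left _ _)
        _ ≤ s y * lamV := mul_le_mul_of_nonneg_right hsy.1 hlamV0.le
    · calc s y * ΛV ≤ (a ^ (n - 1))⁻¹ * ΛV := mul_le_mul_of_nonneg_right hsy.2 hΛ0.le
        _ ≤ Lam := by linarith
  · intro y hy i j k
    have hqy := hq y hy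
    have hLy := hV y hy
    have hsy := hpow (n - 1) _ hqy.1 hqy.2.1
    have hq0 : 0 < τ y / y 0 := ha.trans_le hqy.1
    have hs0 : 0 < s y := lt_of_lt_of_le (by positivity) hsy.1
    have hev : (fun z => ((z 0) ^ (n - 1) • volInv G z) i j) =ᶠ[𝓝 y]
        fun z => s z * volInv Gb z i j := by
      filter_upwards [(isOpen_halfBall c r).mem_nhds hy] with z hz
      rw [(hfac z hz).2.2]; rfl
    have hφ := (hasDerivAt_pow (n - 1) (τ y / y 0)).fun_inv (pow_ne_zero _ hq0.ne')
    have hs1 : DifferentiableAt ℝ s y :=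
      DifferentiableAt.fun_inv (hqy.2.2.1.fun_pow _) (pow_ne_zero _ hq0.ne')
    rw [pd_congr k hev, pd_mul k hs1 (hLy i j).1,
      pd_comp_real (φ := fun x => (x ^ (n - 1))⁻¹) (u := fun z => τ z / z 0) k hφ hqy.2.2.1]
    have hφle : |-((n - 1 : ℕ) * (τ y / y 0) ^ (n - 1 - 1)) / ((τ y / y 0) ^ (n - 1)) ^ 2| ≤ K₁ := by
      rw [abs_div, abs_neg, abs_of_nonneg (by positivity), abs_of_nonneg (by positivity), hK₁]
      gcongr
      · exact hqy.2.1
      · exact hqy.1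
    refine (abs_add_le _ _).trans ?_
    rw [abs_mul, abs_mul, abs_mul, abs_of_pos hs0]
    calc _ ≤ K₁ * b * ΛV + (a ^ (n - 1))⁻¹ * LV := by
          refine add_le_add (mul_le_mul (mul_le_mul hφle (hqy.2.2.2 k) (abs_nonneg _) hK₁0)
            ((hVe y hy).upper i j)
            (abs_nonneg _) (by positivity)) (mul_le_mul hsy.2 ((hLy i j).2 k)
              (abs_nonneg _) (by positivity))
      _ ≤ Lam := by linarith
  all_goals
    intro y hy
    have hqy := hq y hy
    have hDy := hD y hy
    obtain ⟨hτy, hd, -⟩ := hfac y hy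
    have hy0 := hy.1
    have hτq : τ y = (τ y / y 0) * y 0 := by field_simp
    have hqp := hpow (n + 1) _ hqy.1 hqy.2.1
    have hdG : √(G y).det = ((τ y / y 0) ^ (n + 1))⁻¹ * √(Gb y).det * ((y 0) ^ (n + 1))⁻¹ := by
      rw [hd, div_pow]; field_simp
  · rw [hdG]
    gcongr
    calc lam ≤ (b ^ (n + 1))⁻¹ * D₁ := (min_le_left _ _).trans (min_le_right _ _)
      _ ≤ _ := mul_le_mul hqp.1 hDy.1 hD₁.le (le_trans (by positivity) hqp.1)
  · rw [hdG]
    gcongr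
    calc _ ≤ (a ^ (n + 1))⁻¹ * D₂ := mul_le_mul hqp.2 hDy.2 (sqrt_nonneg _) (by positivity)
      _ ≤ Lam := by linarith
  · intro ξ
    have h1 : ∑ i, ∑ j, G y i j * ξ i * ξ j = (τ y ^ 2)⁻¹ * ∑ i, ∑ j, Gb y i j * ξ i * ξ j := by
      simp only [hGG y hy, Matrix.smul_apply, smul_eq_mul, mul_sum]
      refine sum_ext fun i => sum_ext fun j => ?_
      field_simp
    have h2 := (le_abs_self _).trans (abs_form_le (A := Gb y) (ε := ΛV) (hGbΛ y hy) ξ)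
    have h3 : (τ y ^ 2)⁻¹ ≤ (a ^ 2)⁻¹ * ((y 0) ^ 2)⁻¹ := by
      rw [← mul_inv, ← mul_pow]
      refine inv_anti₀ (by positivity) (pow_le_pow_left₀ (by positivity) ?_ 2)
      rw [hτq]
      gcongr
      exact hqy.1
    rw [h1]
    calc _ ≤ ((a ^ 2)⁻¹ * ((y 0) ^ 2)⁻¹) * (ΛV * (n + 1 : ℕ) * ∑ i, ξ i ^ 2) := by
          refine (mul_le_mul_of_nonneg_left h2 (by positivity)).trans
            (mul_le_mul_of_nonneg_right h3 (by positivity))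
      _ = (a ^ 2)⁻¹ * (ΛV * (n + 1 : ℕ)) * ((y 0) ^ 2)⁻¹ * ∑ i, ξ i ^ 2 := by ring
      _ ≤ _ := by
          gcongr
          linarith
  · rw [hτq]
    gcongr
    exact (min_le_right _ _).trans hqy.1

/-- The metric `τ⁻² Gb` satisfies uniform bounds near a boundary point when `Gb` is of class `C¹`
up to the boundary and `τ` vanishes to first order there. -/
theorem exists_ahMetric {G Gb : 𝕍 → 𝕄 (n + 1)} {τ : 𝕍 → ℝ} (hn : 2 ≤ n) (hc : c 0 = 0)
    (hGb : ∀ i j, ContDiffWithinAt ℝ 1 (Gb · i j) (halfSpace n) c) (hs : ∀ i j, Gb c i j = Gb c j i)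
    (hpos : ∀ ξ : Fin (n + 1) → ℝ, ξ ≠ 0 → 0 < ∑ i, ∑ j, Gb c i j * ξ i * ξ j)
    (hτ : ContDiffWithinAt ℝ 2 τ (halfSpace n) c) (hτpos : ∀ᶠ y in insideNhds c, 0 < τ y)
    (hzero : ∀ᶠ y in 𝓝 c, y 0 = 0 → τ y = 0) (hτ' : fderivWithin ℝ τ (halfSpace n) c ≠ 0) {R : ℝ}
    (hR : 0 < R) (hG : ∀ i j, ContDiffOn ℝ ∞ (G · i j) (halfBall c R))
    (hGs : ∀ y ∈ halfBall c R, ∀ i j, G y i j = G y j i) (hdet : ∀ y ∈ halfBall c R, 0 < (G y).det)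
    (hGG : ∀ y ∈ halfBall c R, Gb y = τ y ^ 2 • G y) :
    ∃ r lam Lam : ℝ, 0 < r ∧ r ≤ R ∧ r ≤ 1 ∧ 0 < lam ∧ 0 < Lam ∧ AHMetric G c r lam Lam ∧
    ∀ y ∈ halfBall c r, lam * y 0 ≤ τ y := by
  obtain ⟨a, b, ha, hq⟩ := exists_quotient_bound hc hτ hτpos hzero hτ'
  obtain ⟨lam₀, Lam₀, hlam₀, hell⟩ := exists_lower_bound hs hpos
  have hdc : 0 < (Gb c).det := (exists_orthonormal_frame hs hpos).1
  set D := √(Gb c).det with hD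
  have hD0 : 0 < D := Real.sqrt_pos.2 hdc
  have hsq : ContDiffWithinAt ℝ 1 (fun z => √(Gb z).det) (halfSpace n) c :=
    (contDiffWithinAt_det hGb).sqrt hdc.ne'
  have hV : ∀ i j, ContDiffWithinAt ℝ 1 (fun z => volInv Gb z i j) (halfSpace n) c := fun i j =>
    hsq.mul (contDiffWithinAt_inv_apply hGb hdc.ne' i j)
  choose L hL using fun i j => exists_pd_bound hc (hV i j)
  set LV := ∑ i, ∑ j, |L i j| with hLV
  have hLle : ∀ i j, L i j ≤ LV := fun i j => (le_abs_self _).trans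
    ((single_le_sum (f := fun j => |L i j|) (fun _ _ => abs_nonneg _)
      (Finset.mem_univ j)).trans (single_le_sum (f := fun i => ∑ j, |L i j|)
        (fun _ _ => by positivity) (Finset.mem_univ i)))
  -- ellipticity at the boundary point itself, and nearby by continuity
  set K₀ : ℝ := ((n + 1 : ℕ) * Lam₀) ^ 2 + 1 with hK₀
  set lamV := D * (lam₀ / K₀) with hlamV
  have hK₀0 : 0 < K₀ := by positivity
  have hlamV0 : 0 < lamV := by positivity
  have hVc : ∀ ξ : Fin (n + 1) → ℝ,
      lamV * ∑ i, ξ i ^ 2 ≤ ∑ i, ∑ j, volInv Gb c i j * ξ i * ξ j := fun ξ => by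
    have h1 := hell.inv_lower hlam₀ ξ
    have h0 : 0 ≤ ∑ i, ∑ j, (Gb c)⁻¹ i j * ξ i * ξ j := by
      obtain ⟨w, -, -, h2, h3⟩ := hell.sum_inv hlam₀ ξ
      rw [h2]
      exact le_trans (mul_nonneg hlam₀.le (sum_nonneg fun _ _ => sq_nonneg _)) h3
    have h2 : ∑ i, ∑ j, volInv Gb c i j * ξ i * ξ j = D * ∑ i, ∑ j, (Gb c)⁻¹ i j * ξ i * ξ j := by
      simp only [volInv, Matrix.smul_apply, smul_eq_mul, mul_sum, mul_assoc, hD]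
    rw [h2, hlamV, mul_assoc]
    refine mul_le_mul_of_nonneg_left ?_ hD0.le
    rw [div_mul_eq_mul_div, div_le_iff₀ hK₀0]
    nlinarith
  set ε := lamV / (2 * (n + 1)) with hε
  have hε0 : 0 < ε := by positivity
  have hnear : ∀ F : 𝕍 → ℝ, ContDiffWithinAt ℝ 1 F (halfSpace n) c →
      ∀ ε > 0, ∀ᶠ y in insideNhds c, |F y - F c| < ε := fun F hF ε hε =>
    insideNhds_le ((hF.continuousWithinAt.sub_const (F c)).abs.eventually_lt_const (by simpa))
  set ΛV := ∑ i, ∑ j, (|volInv Gb c i j| + |Gb c i j| + (ε + 1)) with hΛV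
  have hΛ : ∀ i j, |volInv Gb c i j| + |Gb c i j| + (ε + 1) ≤ ΛV := fun i j =>
    (single_le_sum (f := fun j => |volInv Gb c i j| + |Gb c i j| + (ε + 1))
      (fun _ _ => by positivity) (Finset.mem_univ j)).trans
      (single_le_sum (f := fun i => ∑ j, (|volInv Gb c i j| + |Gb c i j| + (ε + 1)))
        (fun _ _ => by positivity) (Finset.mem_univ i))
  have hΛ0 : 0 < ΛV := lt_of_lt_of_le (by positivity) (hΛ 0 0)
  obtain ⟨r, hr, hall⟩ := eventually_insideNhds_iff.1
    ((hq.and ((eventually_all.2 fun i => eventually_all.2 fun j => hL i j).and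
      (eventually_all.2 fun i => eventually_all.2 fun j => hnear _ (hV i j) ε hε0))).and
    ((eventually_all.2 fun i => eventually_all.2 fun j => hnear _ (hGb i j) 1 one_pos).and
      (hnear _ hsq (D / 2) (by positivity))))
  have hb0 : 0 < b := by
    obtain ⟨y, hy⟩ : (halfBall c r).Nonempty := by
      refine ⟨c + single 0 (r / 2), by simp [hc]; positivity, ?_⟩
      rw [dist_self_add_left, norm_single, norm_of_nonneg (by positivity)]
      linarith
    exact ha.trans_le ((hall y hy).1.1.1.trans (hall y hy).1.1.2.1)
  have hsub : halfBall c (min (min r R) 1) ⊆ halfBall c r ∩ halfBall c R :=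
    subset_inter (halfBall_mono ((min_le_left _ _).trans (min_le_left _ _)))
      (halfBall_mono ((min_le_left _ _).trans (min_le_right _ _)))
  have hle : ∀ y ∈ halfBall c r, ∀ i j, |volInv Gb y i j| ≤ ΛV ∧ |Gb y i j| ≤ ΛV := by
    intro y hy i j
    obtain ⟨⟨-, -, hVy⟩, hGy, -⟩ := hall y hy
    have h1 := abs_sub_abs_le_abs_sub (volInv Gb y i j) (volInv Gb c i j)
    have h2 := abs_sub_abs_le_abs_sub (Gb y i j) (Gb c i j)
    have h3 := hΛ i j
    constructor
    · linarith [hVy i j, abs_nonneg (Gb c i j)]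
    · linarith [hGy i j, abs_nonneg (volInv Gb c i j)]
  have hVe : ∀ y ∈ halfBall c (min (min r R) 1), IsEllipticMatrix (volInv Gb y) (lamV / 2) ΛV := by
    refine fun y hy => ⟨fun i j => ?_, fun ξ => ?_, fun i j => (hle y (hsub hy).1 i j).1⟩
    · have ht : (Gb y).transpose = Gb y := by
        ext i j
        rw [hGG y (hsub hy).2]
        simp only [transpose_apply, Matrix.smul_apply, hGs y (hsub hy).2 j i]
      simp only [volInv, Matrix.smul_apply]
      rw [← transpose_apply (Gb y)⁻¹, transpose_nonsing_inv, ht]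
    · have hVy := (hall y (hsub hy).1).1.2.2
      have h1 := (abs_le.1 (abs_form_le (A := volInv Gb y - volInv Gb c)
        (fun i j => (hVy i j).le) ξ)).1
      have h2 := hVc ξ
      have h3 : ∑ i, ∑ j, (volInv Gb y - volInv Gb c) i j * ξ i * ξ j =
          ∑ i, ∑ j, volInv Gb y i j * ξ i * ξ j - ∑ i, ∑ j, volInv Gb c i j * ξ i * ξ j := by
        simp only [Matrix.sub_apply, sub_mul, sum_sub_distrib]
      have h4 : ε * (n + 1 : ℕ) = lamV / 2 := by rw [hε]; push_cast; field_simp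
      rw [h3, h4] at h1
      linarith
  obtain ⟨lam, Lam, h1, h2, h3, h4⟩ := ahMetric_of_bounds (c := c) (G := G) (Gb := Gb) (τ := τ)
    (r := min (min r R) 1) (a := a) (b := b) (lamV := lamV / 2) (ΛV := ΛV) (LV := LV)
    (D₁ := D / 2) (D₂ := 2 * D) hn ha hb0 (by positivity) hΛ0 (by positivity) (by positivity)
    (by positivity) (fun y hy => (hall y (hsub hy).1).1.1)
    (fun y hy i j => ⟨((hall y (hsub hy).1).1.2.1 i j).1, fun k =>
      (((hall y (hsub hy).1).1.2.1 i j).2 k).trans (hLle i j)⟩)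
    hVe
    (fun y hy i j => (hle y (hsub hy).1 i j).2)
    (fun y hy => by
      have h := abs_lt.1 (hall y (hsub hy).1).2.2
      constructor <;> linarith)
    (fun i j => (hG i j).mono fun y hy => (hsub hy).2) (fun y hy => hGs y (hsub hy).2)
    (fun y hy => hdet y (hsub hy).2) (fun y hy => hGG y (hsub hy).2)
  exact ⟨_, lam, Lam, by positivity, (min_le_left _ _).trans (min_le_right _ _), min_le_right _ _,
    h1, h2, h3, h4⟩

end ConformallyCompact

/-! ### Small gradient from finite energy -/

section SmallGradient

variable {N : Type*} [PseudoEMetricSpace N] {G : 𝔼 (n + 1) → 𝕄 (n + 1)} {c : 𝔼 (n + 1)}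
  {r lam Lam : ℝ} {v : 𝔼 (n + 1) → ℝ}

/-- The bound for the Euclidean norm of the differential of a map with energy density `v`. -/
def gradientBound (Lam : ℝ) (v : 𝕍 → ℝ) (c : 𝕍) (r : ℝ) : 𝕍 → ℝ≥0∞ :=
  (halfBall c r).indicator fun x => ofReal √(v x * (Lam * ((x 0) ^ 2)⁻¹))

lemma weightedSq_gradientBound (hn : 2 ≤ n) (hLam : 0 < Lam) (hv0 : ∀ x ∈ halfBall c r, 0 ≤ v x)
    {x : 𝕍} (hx : x ∈ halfBall c r) :
    weightedSq (gradientBound Lam v c r) x = ofReal (Lam * (v x * ((x 0) ^ (n + 1))⁻¹)) := by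
  have h0 := hx.1
  have hv := hv0 x hx
  have h1 : 0 ≤ v x * (Lam * ((x 0) ^ 2)⁻¹) := by positivity
  have h2 : (x 0) ^ (n + 1) = (x 0) ^ 2 * (x 0) ^ (n - 1) := by rw [← pow_add]; congr 1; omega
  rw [weightedSq, gradientBound, indicator_of_mem hx, ← ofReal_pow (sqrt_nonneg _),
    ← ofReal_mul (sq_nonneg _), Real.sq_sqrt h1]
  congr 1
  rw [h2, mul_inv]
  ring

/-- A map of finite energy with a differential inequality for the energy density has small
gradient near the boundary. -/
lemma AHMetric.hasSmallGradient (hG : AHMetric G c r lam Lam) (hn : 2 ≤ n) (hlam : 0 < lam)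
    (hLam : 0 < Lam) (hc : c 0 = 0) (hr1 : r ≤ 1)
    (hv : ContDiffOn ℝ 2 v (halfBall c r)) (hv0 : ∀ x ∈ halfBall c r, 0 ≤ v x)
    (hlap : ∀ x ∈ halfBall c r, -(2 * n * v x) ≤ laplacian G v x)
    (hfin : ∫⁻ x in halfBall c r, ofReal (v x * √(G x).det) ≠ ⊤)
    {F : 𝕍 → N}
    (hF : ∀ a ∈ halfBall c r, ∀ b ∈ halfBall c r, edist (F a) (F b) ≤
      ∫⁻ τ in Icc (0 : ℝ) 1, ofReal ‖b - a‖ * gradientBound Lam v c r (a + τ • (b - a))) :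
    HasSmallGradient F (gradientBound Lam v c r) c (r / 2) := by
  have hsub : ∀ r', r' ≤ r / 2 → halfBall c r' ⊆ halfBall c r := fun r' h x hx =>
    ⟨hx.1, hx.2.trans_le (h.trans (by linarith [dist_nonneg.trans_lt hx.2]))⟩
  have hmeas : Measurable (gradientBound Lam v c r) := by
    classical
    rw [gradientBound, ← piecewise_eq_indicator]
    refine ContinuousOn.measurable_piecewise (ENNReal.continuous_ofReal.comp_continuousOn
      (hv.continuousOn.mul (continuousOn_const.mul (ContinuousOn.inv₀ (by fun_prop)
        fun x hx => (pow_pos hx.1 2).ne'))).sqrt) continuousOn_const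
      (isOpen_halfBall c r).measurableSet
  have hfin' : ∫⁻ x in halfBall c r, weightedSq (gradientBound Lam v c r) x ≠ ⊤ := by
    refine ne_top_of_le_ne_top (ENNReal.mul_ne_top (ENNReal.ofReal_ne_top (r := Lam / lam)) hfin) ?_
    rw [← lintegral_const_mul' _ _ ENNReal.ofReal_ne_top]
    refine setLIntegral_mono' (isOpen_halfBall c r).measurableSet fun x hx => ?_
    rw [weightedSq_gradientBound hn hLam hv0 hx, ← ofReal_mul (by positivity)]
    refine ofReal_le_ofReal ?_
    have h1 := mul_le_mul_of_nonneg_left (hG.le_det x hx) (hv0 x hx)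
    calc Lam * (v x * ((x 0) ^ (n + 1))⁻¹) = Lam / lam * (v x * (lam * ((x 0) ^ (n + 1))⁻¹)) := by
          field_simp
      _ ≤ _ := by gcongr
  obtain ⟨C, hC, hpt⟩ := hG.exists_pointwise_le hlam hLam hc hr1 hv hv0 hlap
  refine ⟨hmeas, fun a ha b hb => hF a (hsub _ le_rfl ha) b (hsub _ le_rfl hb),
    ne_top_of_le_ne_top hfin' (lintegral_mono_set (hsub _ le_rfl)), fun ε hε => ?_⟩
  obtain ⟨δ, hδ, hlow⟩ := exists_lowEnergy_le hfin'
    (ε := ofReal (ε ^ 2 / (C * Lam))) (by simp only [ENNReal.ofReal_pos]; positivity)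
  refine ⟨δ / 2, by positivity, fun y hy hyδ => ?_⟩
  have hyr := hsub _ le_rfl hy
  have hy0 := hy.1
  have hball := closedBall_subset_halfBall hc hy
  have hint : ∫ x in closedBall y (y 0 / 4), v x * √(G x).det ≤ ε ^ 2 / (C * Lam) := by
    rw [integral_eq_lintegral_of_nonneg_ae]
    rotate_left
    · exact (ae_restrict_iff' Metric.isClosed_closedBall.measurableSet).2
        (Eventually.of_forall fun x hx => mul_nonneg (hv0 x (hball hx)) (sqrt_nonneg _))
    · refine (ContinuousOn.mul (hv.continuousOn.mono hball) (ContinuousOn.sqrt ?_))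
        |>.aestronglyMeasurable Metric.isClosed_closedBall.measurableSet
      exact (continuous_id.matrix_det.comp_continuousOn (continuousOn_pi.2 fun i =>
        continuousOn_pi.2 fun j => (hG.contDiffOn i j).continuousOn)).mono hball
    refine ENNReal.toReal_le_of_le_ofReal (by positivity) (le_trans ?_ hlow)
    refine (setLIntegral_mono' Metric.isClosed_closedBall.measurableSet fun x hx => ?_).trans
      (lintegral_mono_set fun x hx => ⟨hball hx, ?_⟩)
    · rw [weightedSq_gradientBound hn hLam hv0 (hball hx)]
      refine ofReal_le_ofReal ?_
      have h1 := mul_le_mul_of_nonneg_left (hG.det_le x (hball hx)) (hv0 x (hball hx))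
      linarith
    · have := (height_of_mem_closedBall hx).2
      show x 0 < δ
      linarith
  have hvy : v y * Lam ≤ ε ^ 2 := by
    have h1 := mul_le_mul_of_nonneg_right ((hpt y hy).trans
      (mul_le_mul_of_nonneg_left hint hC.le)) hLam.le
    rwa [show C * (ε ^ 2 / (C * Lam)) * Lam = ε ^ 2 by field_simp] at h1
  rw [gradientBound, indicator_of_mem hyr, ← ofReal_mul hy0.le]
  refine ofReal_le_ofReal ?_
  refine abs_le_of_sq_le_sq' ?_ hε.le |>.2
  have hv := hv0 y hyr
  rw [mul_pow, Real.sq_sqrt (by positivity)]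
  field_simp
  linarith

end SmallGradient

/-! ### Charts at a boundary point -/

section BoundaryChart

variable {M : Type*} [TopologicalSpace M] [ChartedSpace (EuclideanHalfSpace (n + 1)) M]
  [IsManifold (𝓡∂ (n + 1)) ∞ M] {φ : OpenPartialHomeomorph M (EuclideanHalfSpace (n + 1))}
  {c y : 𝔼 (n + 1)} {r lam Lam : ℝ} {N : Type*} [EMetricSpace N] [CompleteSpace N]
  [ChartedSpace (𝔼 m) N] [IsManifold (𝓡 m) ∞ N]
  [Bundle.RiemannianBundle (fun y : N => TangentSpace (𝓡 m) y)] {g : Forms (𝓡∂ (n + 1)) M}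
  {h : Forms (𝓡 m) N} {f : M → N} {t : M → ℝ}

lemma mem_interiorCoords_iff_pos (hφ : φ ∈ 𝒜 𝓗 M) (hy : y ∈ (φ.extend 𝓗).target) :
    y ∈ interiorCoords 𝓗 φ ↔ 0 < y 0 := by
  rw [mem_interiorCoords_iff hφ, interior_range_modelWithCornersEuclideanHalfSpace]
  rw [φ.extend_target] at hy
  exact and_iff_left hy.1

/-- A conformally compact metric in a chart at a boundary point. -/
theorem exists_ahMetric_chart (hn : 2 ≤ n) {g : Forms 𝓗 M}
    (hg : IsSmoothMetricOn 𝓗 g ((𝓗).interior M)) {t : M → ℝ} (ht : IsDefiningFunction 𝓗 t)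
    (hcc : HasConformalExtension 𝓗 1 g t) {x₁ : M} (hx₁ : x₁ ∈ (𝓗).boundary M) {R : ℝ}
    (hR : 0 < R) :
    extChartAt 𝓗 x₁ x₁ 0 = 0 ∧ ∃ r lam Lam : ℝ, 0 < r ∧ r ≤ R ∧ r ≤ 1 ∧ 0 < lam ∧
    0 < Lam ∧ AHMetric (metricCoeff 𝓗 ↟g (chartAt _ x₁)) (extChartAt 𝓗 x₁ x₁) r lam Lam ∧
    halfBall (extChartAt 𝓗 x₁ x₁) r ⊆ interiorCoords 𝓗 (chartAt _ x₁) ∧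
    ∀ y ∈ halfBall (extChartAt 𝓗 x₁ x₁) r, lam * y 0 ≤ t ((extChartAt 𝓗 x₁).symm y) := by
  set φ := chartAt (EuclideanHalfSpace (n + 1)) x₁ with hφ'
  have hφ : φ ∈ 𝒜 𝓗 M := chart_mem_maximalAtlas x₁
  set c := extChartAt 𝓗 x₁ x₁ with hcdef
  set σ := φ⁻[𝓗] with hσ
  have hx₁s : x₁ ∈ φ.source := mem_chart_source _ x₁
  have hσc : σ c = x₁ := extChartAt_to_inv x₁
  have hc : c 0 = 0 := by
    have h1 : c ∈ frontier (range 𝓗) := hx₁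
    rw [frontier_range_modelWithCornersEuclideanHalfSpace] at h1
    exact (show 0 = c 0 from h1).symm
  have hcT : c ∈ (φ.extend 𝓗).target := mem_extChartAt_target x₁
  have hT : (φ.extend 𝓗).target ∈ 𝓝[halfSpace n] c := by
    rw [← range_eq_halfSpace]; exact extChartAt_target_mem_nhdsWithin x₁
  refine ⟨hc, ?_⟩
  obtain ⟨gb, hgb⟩ := hcc
  have hsm : ContMDiffOn 𝓘(ℝ, 𝕍) 𝓘(ℝ, ℝ) ∞ (fun y => t (σ y))
      (φ.extend 𝓗).target :=
    ht.smooth.comp_contMDiffOn (contMDiffOn_extend_symm_target hφ)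
  have hτ : ContDiffWithinAt ℝ ∞ (fun y => t (σ y)) (halfSpace n) c :=
    ((hsm c hcT).contDiffWithinAt).mono_of_mem_nhdsWithin hT
  obtain ⟨ρ, hρ, hball⟩ := Metric.mem_nhdsWithin_iff.1 hT
  have hin : ∀ y ∈ halfBall c (min R ρ), y ∈ interiorCoords 𝓗 φ := fun y hy =>
    (mem_interiorCoords_iff_pos hφ (hball ⟨hy.2.trans_le (min_le_right _ _), hy.1.le⟩)).2 hy.1
  have hτ' : fderivWithin ℝ (fun y => t (σ y)) (halfSpace n) c ≠ 0 := by
    have h1 := ht.mfderiv_ne_zero x₁ hx₁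
    have h2 : MDifferentiableAt 𝓗 𝓘(ℝ, ℝ) t x₁ := ht.smooth.mdifferentiable (by simp) x₁
    rw [h2.mfderiv, range_eq_halfSpace] at h1
    exact h1
  have hmc := fun i j => (contDiffOn_metricCoeff (g := gb.inner) hφ (k := 1) (U := univ)
    (by exact_mod_cast natCast_le_infty 2) gb.contMDiff.contMDiffOn i j)
  have key := exists_ahMetric (G := metricCoeff 𝓗 ↟g φ)
    (Gb := metricCoeff 𝓗 (fun x v w => gb.inner x v w) φ)
    (τ := fun y => t (σ y)) (c := c) hn hc
    (fun i j => ((hmc i j) c ⟨hcT, trivial⟩).mono_of_mem_nhdsWithin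
      (by rw [preimage_univ, inter_univ]; exact hT))
    (fun i j => gb.symm _ _ _) (fun ξ hξ => by
      have h1 := sum_metricCoeff (g := gb.inner) (φ := φ) (y := c) (toLp 2 ξ)
        (toLp 2 ξ)
      refine lt_of_lt_of_eq (gb.pos _ (chartDeriv 𝓗 φ c (toLp 2 ξ))
        fun h0 => hξ ?_) h1.symm
      obtain ⟨e, he⟩ := isInvertible_mfderivWithin_extChartAt_symm
        (mem_extChartAt_target (I := 𝓗) x₁)
      have h2 : e (toLp 2 ξ) = 0 := (DFunLike.congr_fun he _).trans h0
      exact congrArg ofLp (e.map_eq_zero_iff.1 h2))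
    (hτ.of_le (natCast_le_infty 2))
    (eventually_insideNhds_iff.2 ⟨min R ρ, by positivity, fun y hy => ht.pos _ (hin y hy).2⟩)
    (by
      filter_upwards [eventually_nhdsWithin_iff.1 hT] with y hy hy0
      have hyT := hy hy0.ge
      refine ht.zero _ ?_
      rw [← ModelWithCorners.compl_interior]
      intro hi
      have := (mem_interiorCoords_iff_pos hφ hyT).1 ⟨hyT, hi⟩
      linarith) hτ' (R := min R ρ) (by positivity)
    (fun i j y hy => (hg.contDiffAt_metricCoeff hφ (hin y hy) i j).contDiffWithinAt)
    (fun y hy i j => hg.metricCoeff_symm (hin y hy) i j)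
    (fun y hy => hg.det_metricCoeff_pos hφ (hin y hy))
    (fun y hy => by
      ext i j
      exact hgb _ (hin y hy).2 _ _)
  obtain ⟨r, lam, Lam, h1, h2, h3, h4, h5, h6, h7⟩ := key
  exact ⟨r, lam, Lam, h1, h2.trans (min_le_left _ _), h3, h4, h5, h6,
    fun y hy => hin y (halfBall_mono h2 hy), h7⟩

/-- The distance in the target is at most the length of the image of a segment, and the energy
density bounds the speed. -/
lemma edist_le_lintegral_gradientBound [IsRiemannianManifold (𝓡 m) N]
    (hg : IsSmoothMetricOn 𝓗 g ((𝓗).interior M))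
    (hh : ∀ (y : N) (v w : TangentSpace (𝓡 m) y), inner ℝ v w = h y v w) (hφ : φ ∈ 𝒜 𝓗 M)
    (hLam : 0 ≤ Lam) (hG : AHMetric (metricCoeff 𝓗 ↟g φ) c r lam Lam)
    (hin : halfBall c r ⊆ interiorCoords 𝓗 φ)
    (hf : ∀ y ∈ halfBall c r, ContMDiffAt 𝓗 (𝓡 m) ∞ f (φ⁻[𝓗] y)) {a b : 𝕍} (ha : a ∈ halfBall c r)
    (hb : b ∈ halfBall c r) :
    edist (f (φ⁻[𝓗] a)) (f (φ⁻[𝓗] b)) ≤ ∫⁻ τ in Icc (0 : ℝ) 1, ofReal ‖b - a‖ *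
    gradientBound Lam (fun y => energyDensity 𝓗 (𝓡 m) ↟g ↟h f (φ⁻[𝓗] y)) c r (a + τ • (b - a)) := by
  set σ := φ⁻[𝓗] with hσ
  set γ : ℝ → N := fun τ => f (σ (a + τ • (b - a))) with hγ
  have hmem : ∀ τ ∈ Icc (0 : ℝ) 1, a + τ • (b - a) ∈ halfBall c r := fun τ hτ =>
    (convex_halfBall c r).add_smul_sub_mem ha hb hτ
  have hsm : ContMDiffOn 𝓘(ℝ, ℝ) (𝓡 m) 1 γ (Icc 0 1) := fun τ hτ => by
    have hl : ContMDiffAt 𝓘(ℝ, ℝ) 𝓘(ℝ, 𝕍) ∞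
        (fun τ : ℝ => a + τ • (b - a)) τ := ContDiffAt.contMDiffAt (by fun_prop)
    have h1 : ContMDiffAt 𝓘(ℝ, ℝ) (𝓡 m) ∞ γ τ := ContMDiffAt.comp τ (hf _ (hmem τ hτ))
        (ContMDiffAt.comp τ (contMDiffAt_extend_symm hφ (hin (hmem τ hτ))) hl)
    exact (h1.of_le (natCast_le_infty 1)).contMDiffWithinAt
  rw [IsRiemannianManifold.out (I := 𝓡 m)]
  refine (Manifold.riemannianEDist_le_pathELength hsm (by simp [hγ]) (by simp [hγ])
    zero_le_one).trans ?_
  rw [Manifold.pathELength_eq_lintegral_mfderiv_Icc]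
  refine setLIntegral_mono' measurableSet_Icc fun τ hτ => ?_
  have hy := hmem τ hτ
  rw [gradientBound, indicator_of_mem hy]
  set y := a + τ • (b - a) with hydef
  have hl : HasMFDerivAt 𝓘(ℝ, ℝ) 𝓘(ℝ, 𝕍)
      (fun τ : ℝ => a + τ • (b - a)) τ
      ((ContinuousLinearMap.id ℝ ℝ).smulRight (b - a)) := by
    refine HasFDerivAt.hasMFDerivAt ?_
    exact ((hasFDerivAt_id τ).smul_const (b - a)).const_add a
  have hfd := ((hf y hy).mdifferentiableAt (by simp)).hasMFDerivAt
  have hd := (HasMFDerivAt.comp τ (HasMFDerivAt.comp (f := σ) y hfd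
    (hasMFDerivAt_extend_symm hφ (hin hy))) hl).mfderiv
  have hd1 : mfderiv 𝓘(ℝ, ℝ) (𝓡 m) γ τ (1 : ℝ) = modelDeriv 𝓗 (𝓡 m) f (σ y)
      (chartDeriv 𝓗 φ y (b - a)) := by
    refine (DFunLike.congr_fun hd (1 : ℝ)).trans ?_
    show modelDeriv 𝓗 (𝓡 m) f (σ y)
      (chartDeriv 𝓗 φ y ((1 : ℝ) • (b - a))) = _
    rw [one_smul]
  have hh0 : ∀ (q : N) (v : TangentSpace (𝓡 m) q), 0 ≤ h q v v := fun q v => by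
    rw [← hh]; exact real_inner_self_nonneg
  obtain ⟨hv0, hv1⟩ := modelForm_modelDeriv_le hg hh0 (f := f) hφ (hin hy) (b - a)
  have hm := hG.metric_le y hy fun i => (b - a) i
  rw [← ofReal_norm, ← ofReal_mul (norm_nonneg _)]
  refine ofReal_le_ofReal (abs_le_of_sq_le_sq' ?_ (by positivity)).2
  rw [mul_pow, Real.sq_sqrt, ← real_inner_self_eq_norm_sq, hh]
  · refine (congrArg (fun w => modelForm h (f (σ y)) w w) hd1).trans_le (hv1.trans ?_)
    refine (mul_le_mul_of_nonneg_left hm hv0).trans_eq ?_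
    rw [EuclideanSpace.real_norm_sq_eq]
    exact (by intros; ring : ∀ A L S : ℝ, A * (L * S) = S * (A * L)) _ _ _
  · exact mul_nonneg hv0 (by positivity)

variable [MeasurableSpace M] [BorelSpace M]

/-- The decay of the energy density near a boundary point, in a chart. -/
theorem exists_chart_decay [IsRiemannianManifold (𝓡 m) N] (hn : 2 ≤ n)
    (hg : IsSmoothMetricOn 𝓗 g ((𝓗).interior M))
    (ht : IsDefiningFunction 𝓗 t)
    (hcc : HasConformalExtension 𝓗 1 g t)
    (hRic : RicciBoundedBelow 𝓗 ↟g (-(n : ℝ)))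
    (hh : IsSmoothMetricOn (𝓡 m) h ((𝓡 m).interior N))
    (hin : ∀ (y : N) (v w : TangentSpace (𝓡 m) y), inner ℝ v w = h y v w)
    (hN : NonpositivelyCurved (𝓡 m) ↟h) {U : Set M}
    (hf : IsHarmonicOn 𝓗 (𝓡 m) ↟g ↟h f U)
    (hfin : energy 𝓗 (𝓡 m) ↟g ↟h f U ≠ ⊤)
    {x₁ : M} (hx₁ : x₁ ∈ (𝓗).boundary M) {R : ℝ} (hR : 0 < R)
    (hU : ∀ y ∈ halfBall (extChartAt 𝓗 x₁ x₁) R, y ∈ interiorCoords 𝓗 (chartAt _ x₁) →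
      (extChartAt 𝓗 x₁).symm y ∈ U) :
    ∃ r lam C : ℝ, 0 < r ∧ r ≤ R ∧ 0 < lam ∧ 0 ≤ C ∧ halfBall (extChartAt 𝓗 x₁ x₁) r ⊆
        interiorCoords 𝓗 (chartAt _ x₁) ∧
      (∀ y ∈ halfBall (extChartAt 𝓗 x₁ x₁) r, lam * y 0 ≤ t ((extChartAt 𝓗 x₁).symm y)) ∧
      (ContinuousOn (fun y => energyDensity 𝓗 (𝓡 m) ↟g
        ↟h f ((extChartAt 𝓗 x₁).symm y))
        (halfBall (extChartAt 𝓗 x₁ x₁) r)) ∧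
      ∀ y ∈ halfBall (extChartAt 𝓗 x₁ x₁) r, volumeDensity g (chartAt _ x₁) y *
          ofReal (energyDensity 𝓗 (𝓡 m) ↟g
            ↟h f ((extChartAt 𝓗 x₁).symm y)) ≤
          ofReal (C * y 0 ^ (n - 1)) := by
  obtain ⟨hc, r, lam, Lam, hr, hrR, hr1, hlam, hLam, hG, hsub, htlam⟩ :=
    exists_ahMetric_chart hn hg ht hcc hx₁ hR
  set φ := chartAt (EuclideanHalfSpace (n + 1)) x₁ with hφdef
  have hφ : φ ∈ 𝒜 𝓗 M := chart_mem_maximalAtlas x₁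
  set c := extChartAt 𝓗 x₁ x₁ with hcdef
  set σ := (extChartAt 𝓗 x₁).symm with hσ
  set v : 𝕍 → ℝ := fun y => energyDensity 𝓗 (𝓡 m)
    ↟g ↟h f (σ y) with hv
  set G := metricCoeff 𝓗 ↟g φ with hGdef
  have hVo : IsOpen (σ '' halfBall c r) := isOpen_image_extend_symm (isOpen_halfBall c r) hsub
  have hVU : σ '' halfBall c r ⊆ U := image_subset_iff.2 fun y hy =>
    hU y (halfBall_mono hrR hy) (hsub hy)
  have hnhds : ∀ y ∈ halfBall c r, σ '' halfBall c r ∈ 𝓝 (σ y) := fun y hy =>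
    hVo.mem_nhds (mem_image_of_mem _ hy)
  have hfV : IsHarmonicOn 𝓗 (𝓡 m) ↟g ↟h f
      (σ '' halfBall c r) :=
    ⟨hf.smooth.mono hVU, fun φ hφ ψ hψ y hy hyV => hf.tension_eq_zero φ hφ ψ hψ y hy (hVU hyV)⟩
  have hfat : ∀ y ∈ halfBall c r, ContMDiffAt 𝓗 (𝓡 m) ∞ f (σ y) := fun y hy =>
    hfV.smooth.contMDiffAt (hnhds y hy)
  have hh0 : ∀ (q : N) (v : TangentSpace (𝓡 m) q), 0 ≤ h q v v := fun q v => by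
    rw [← hin]; exact real_inner_self_nonneg
  have hv2 : ContDiffOn ℝ 2 v (halfBall c r) := fun y hy =>
    ((contDiffAt_energyDensity hg hh hφ (hsub hy) (hnhds y hy) hfV.smooth).of_le
      (natCast_le_infty 2)).contDiffWithinAt
  have hv0 : ∀ y ∈ halfBall c r, 0 ≤ v y := fun y hy =>
    (modelForm_modelDeriv_le hg hh0 (f := f) hφ (hsub hy) 0).1
  have hlap : ∀ y ∈ halfBall c r, -(2 * n * v y) ≤ laplacian G v y := fun y hy => by
    have h1 := laplacian_energyDensity_ge hg hh hRic hN hfV hφ (hsub hy) (hnhds y hy)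
    refine le_trans (le_of_eq ?_) h1
    show _ = 2 * -(n : ℝ) * v y
    ring
  have hint : ∫⁻ y in halfBall c r, ofReal (v y * √(G y).det) ≠ ⊤ := by
    refine ne_top_of_le_ne_top hfin (le_trans (le_of_eq ?_) (lintegral_mono_set hVU))
    refine Eq.trans ?_ (setLIntegral_riemannianVolume hg hφ (isOpen_halfBall c r) hsub
      (F := fun x => ofReal (energyDensity 𝓗 (𝓡 m) ↟g
        ↟h f x))
      (ENNReal.continuous_ofReal.comp_continuousOn hv2.continuousOn)).symm
    refine setLIntegral_congr_fun (isOpen_halfBall c r).measurableSet fun y hy => ?_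
    rw [ofReal_mul (hv0 y hy), mul_comm]
    rfl
  have hgrad := hG.hasSmallGradient hn hlam hLam hc hr1 hv2 hv0 hlap hint (F := fun y => f (σ y))
    fun a ha b hb => edist_le_lintegral_gradientBound hg hin hφ hLam.le hG hsub hfat ha hb
  obtain ⟨P, hP⟩ := hgrad.exists_limit hn hc (by positivity)
  -- the map in a chart of the target at the limit
  set ψ := chartAt (𝔼 m) P with hψdef
  have hψ : ψ ∈ maximalAtlas (𝓡 m) ∞ N := chart_mem_maximalAtlas P
  have hPs : P ∈ ψ.source := mem_chart_source _ P
  have hnear : ∀ S ∈ 𝓝 P, ∃ δ > 0, ∀ y ∈ halfBall c (r / 2 / 4), y 0 < δ → f (σ y) ∈ S := by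
    intro S hS
    obtain ⟨ε, hε, hS⟩ := Metric.nhds_basis_closedEBall.mem_iff.1 hS
    have hε1 : min ε 1 ≠ ⊤ := ne_top_of_le_ne_top ENNReal.one_ne_top (min_le_right _ _)
    obtain ⟨δ, hδ, h1⟩ := hP (min ε 1).toReal
      (toReal_pos (lt_min hε zero_lt_one).ne' hε1)
    refine ⟨δ, hδ, fun y hy hyδ => hS ((h1 y hy hyδ).trans ?_)⟩
    rw [ENNReal.ofReal_toReal hε1]
    exact min_le_left _ _
  obtain ⟨δ, hδ, hsrc⟩ := hnear _ (ψ.open_source.mem_nhds hPs)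
  set r₂ := min (r / 2 / 4) δ with hr₂
  have hr₂0 : 0 < r₂ := by positivity
  have hr₂r : r₂ ≤ r := (min_le_left _ _).trans (by linarith)
  have hsub₂ := halfBall_mono (c := c) hr₂r
  have hfs : ∀ y ∈ halfBall c r₂, f (σ y) ∈ ψ.source := fun y hy =>
    hsrc y (halfBall_mono (min_le_left _ _) hy) ((height_lt hc hy).trans_le (min_le_right _ _))
  have hPi := mem_interiorCoords_extend (J := 𝓡 m) hPs
  obtain ⟨r', hr', hr'r, C, hC⟩ := (hG.mono hr₂r).exists_energy_decay hn hlam hLam hc hr₂0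
    (hr₂r.trans hr1) (u := fun y => ψ.extend (𝓡 m) (f (σ y))) (P := ψ.extend (𝓡 m) P)
    (H := metricCoeff (𝓡 m) ↟h ψ) (hv2.mono hsub₂)
    (fun y hy => hv0 y (hsub₂ hy)) (fun y hy => hlap y (hsub₂ hy))
    (fun y hy => ((contDiffAt_coordMap hφ hψ (hsub (hsub₂ hy)) (hfat y (hsub₂ hy))
      (hfs y hy)).of_le (natCast_le_infty 2)).contDiffWithinAt)
    (fun ε hε => by
      obtain ⟨δ', hδ', h1⟩ := hnear _ ((ψ.contMDiffAt_extend hψ hPs).continuousAt.preimage_mem_nhds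
        (Metric.closedBall_mem_nhds _ hε))
      refine ⟨δ', hδ', fun y hy hyδ => ?_⟩
      rw [← dist_eq_norm]
      exact h1 y (halfBall_mono (min_le_left _ _) hy) hyδ)
    (hh.contDiffAt_metricCoeff hψ hPi) (hh.det_metricCoeff_pos hψ hPi).ne'
    (fun y hy γ => hfV.tension_eq_zero φ hφ ψ hψ y (hsub (hsub₂ hy)).1
      (mem_image_of_mem _ (hsub₂ hy)) (hfs y hy) γ)
    (fun y hy => energyDensity_eq_coordEnergy hφ hψ (hsub (hsub₂ hy))
      (hg.symm _ (hsub (hsub₂ hy)).2) (hfat y (hsub₂ hy)) (hfs y hy))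
  have hsub' := (halfBall_mono (c := c) hr'r).trans hsub₂
  refine ⟨r', lam, max C 0, hr', (hr'r.trans hr₂r).trans hrR, hlam, le_max_right _ _,
    hsub'.trans hsub, fun y hy => htlam y (hsub' hy), hv2.continuousOn.mono hsub', fun y hy => ?_⟩
  rw [volumeDensity, ← ofReal_mul (sqrt_nonneg _), mul_comm]
  refine ofReal_le_ofReal ((hC y hy).trans ?_)
  have := hy.1
  gcongr
  exact le_max_left _ _

lemma volume_low_le (c : 𝕍) {r : ℝ} (hr : 0 < r) (s : ℝ) :
    volume (halfBall c r ∩ {y | y 0 < s}) ≤ ofReal (s * (2 * r) ^ n) := by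
  set a : Fin (n + 1) → ℝ := Fin.cons 0 fun i => c i.succ - r with ha
  set b : Fin (n + 1) → ℝ := Fin.cons s fun i => c i.succ + r with hb
  have hsub : halfBall c r ∩ {y | y 0 < s} ⊆ ofLp ⁻¹' Icc a b := fun y hy => by
    have h1 : ∀ i, |y i - c i| ≤ r := fun i => by
      have := abs_coord_le (y - c) i
      rw [← dist_eq_norm] at this
      exact this.trans hy.1.2.le
    refine ⟨fun i => ?_, fun i => ?_⟩ <;> refine Fin.cases ?_ (fun j => ?_) i
    · exact hy.1.1.le
    · have := abs_le.1 (h1 j.succ)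
      simp only [ha, Fin.cons_succ]; linarith
    · exact le_of_lt hy.2
    · have := abs_le.1 (h1 j.succ)
      simp only [hb, Fin.cons_succ]; linarith
  refine (measure_mono hsub).trans_eq ?_
  rw [(PiLp.volume_preserving_ofLp (Fin (n + 1))).measure_preimage
    measurableSet_Icc.nullMeasurableSet, Real.volume_Icc_pi, Fin.prod_univ_succ,
    ENNReal.ofReal_mul' (by positivity), ofReal_pow (by positivity)]
  simp only [ha, hb, Fin.cons_zero, Fin.cons_succ, sub_zero, add_sub_sub_cancel, two_mul,
    Finset.prod_const, Finset.card_univ, Fintype.card_fin]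

/-- The decay of the energy near a boundary point. -/
theorem exists_nhds_energy_le [IsRiemannianManifold (𝓡 m) N] (hn : 2 ≤ n)
    (hg : IsSmoothMetricOn 𝓗 g ((𝓗).interior M)) (ht : IsDefiningFunction 𝓗 t)
    (hcc : HasConformalExtension 𝓗 1 g t) (hRic : RicciBoundedBelow 𝓗 ↟g (-(n : ℝ)))
    (hh : IsSmoothMetricOn (𝓡 m) h ((𝓡 m).interior N))
    (hin : ∀ (y : N) (v w : TangentSpace (𝓡 m) y), inner ℝ v w = h y v w)
    (hN : NonpositivelyCurved (𝓡 m) ↟h) {x₀ : M} {t₀ : ℝ} (ht₀ : 0 < t₀)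
    (hf : IsHarmonicOn 𝓗 (𝓡 m) ↟g ↟h f (endRegion t t₀ x₀ t₀))
    (hfin : energy 𝓗 (𝓡 m) ↟g ↟h f (endRegion t t₀ x₀ t₀) ≠ ⊤) {x₁ : M}
    (hx₁ : x₁ ∈ (𝓗).boundary M) :
    ∃ O ∈ 𝓝 x₁, ∃ C : ℝ, 0 ≤ C ∧ ∀ s > 0, energy 𝓗 (𝓡 m) ↟g ↟h f
    (O ∩ endRegion t t₀ x₀ s) ≤ ofReal (C * s ^ n) := by
  set φ := chartAt (EuclideanHalfSpace (n + 1)) x₁ with hφdef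
  have hφ : φ ∈ 𝒜 𝓗 M := chart_mem_maximalAtlas x₁
  set c := extChartAt 𝓗 x₁ x₁ with hcdef
  set σ := (extChartAt 𝓗 x₁).symm with hσ
  -- the points of the region near the boundary point lie in the half ball
  have hO : ∀ ρ, 0 < ρ → ∃ O ∈ 𝓝 x₁, ∀ x ∈ O, 0 < t x →
      ∃ y ∈ halfBall c ρ, y ∈ interiorCoords 𝓗 φ ∧ σ y = x := fun ρ hρ => by
    refine ⟨_, inter_mem (extChartAt_source_mem_nhds (I := 𝓗) x₁)
      ((continuousAt_extChartAt (I := 𝓗) x₁).preimage_mem_nhds (Metric.ball_mem_nhds _ hρ)),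
      fun x hx htx => ?_⟩
    have hσx : σ (extChartAt 𝓗 x₁ x) = x := (extChartAt 𝓗 x₁).left_inv hx.1
    have hxT := (extChartAt 𝓗 x₁).map_source hx.1
    have hxi : extChartAt 𝓗 x₁ x ∈ interiorCoords 𝓗 φ := by
      refine ⟨hxT, ?_⟩
      rw [show φ⁻[𝓗] (extChartAt 𝓗 x₁ x) = x from hσx]
      by_contra hxi
      rw [← mem_compl_iff, ModelWithCorners.compl_interior] at hxi
      exact htx.ne' (ht.zero x hxi)
    exact ⟨_, ⟨(mem_interiorCoords_iff_pos hφ hxT).1 hxi, hx.2⟩, hxi, hσx⟩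
  have hcont : ContinuousAt (fun y => t (σ y)) c :=
    (ht.smooth.continuous.continuousAt).comp (continuousAt_extChartAt_symm x₁)
  have hlt : ∀ᶠ y in 𝓝 c, t (σ y) < t₀ := hcont.eventually_lt continuousAt_const (by
    rw [show σ c = x₁ from extChartAt_to_inv x₁, ht.zero x₁ hx₁]; exact ht₀)
  obtain ⟨R, hR, hlt⟩ := Metric.eventually_nhds_iff_ball.1 hlt
  obtain ⟨-, r₀, -, -, hr₀, hr₀R, -, -, -, -, hsub₀, -⟩ := exists_ahMetric_chart hn hg ht hcc hx₁ hR
  by_cases hp : ∃ p ∈ σ '' halfBall c r₀, p ∈ connectedComponentIn {q | t q < t₀} x₀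
  · obtain ⟨p, hpK, hp⟩ := hp
    have hK : IsPreconnected (σ '' halfBall c r₀) := (convex_halfBall c r₀).isPreconnected.image _
      (continuousOn_extend_symm_interiorCoords.mono hsub₀)
    have hKc : σ '' halfBall c r₀ ⊆ connectedComponentIn {q | t q < t₀} x₀ := by
      rw [connectedComponentIn_eq hp]
      exact hK.subset_connectedComponentIn hpK (image_subset_iff.2 fun y hy =>
        hlt y (hy.2.trans_le hr₀R))
    obtain ⟨r, lam, C, hr, hrr, hlam, hC, hsub, htl, hcon, hdec⟩ :=
      exists_chart_decay hn hg ht hcc hRic hh hin hN hf hfin hx₁ hr₀ fun y hy hyi =>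
        ⟨hKc (mem_image_of_mem _ hy), ht.pos _ hyi.2, hlt y (hy.2.trans_le hr₀R)⟩
    obtain ⟨O, hOn, hO⟩ := hO r hr
    refine ⟨O, hOn, C * (1 / lam) ^ n * (2 * r) ^ n, by positivity, fun s hs => ?_⟩
    set A := halfBall c r ∩ {y | y 0 < s / lam} with hA
    have hAo : IsOpen A := (isOpen_halfBall c r).inter (isOpen_lt (by fun_prop) continuous_const)
    have hOA : O ∩ endRegion t t₀ x₀ s ⊆ σ '' A := by
      rintro x ⟨hxO, hx⟩
      obtain ⟨y, hy, -, rfl⟩ := hO x hxO hx.2.1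
      refine mem_image_of_mem _ ⟨hy, ?_⟩
      rw [Set.mem_ofPred_eq, lt_div_iff₀' hlam]
      exact (htl y hy).trans_lt hx.2.2
    calc _ ≤ ∫⁻ x in σ '' A, ofReal (energyDensity 𝓗 (𝓡 m)
          ↟g ↟h f x)
            ∂(riemannianVolume 𝓗 ↟g) := lintegral_mono_set hOA
      _ = ∫⁻ y in A, volumeDensity g φ y * ofReal (energyDensity 𝓗 (𝓡 m)
          ↟g ↟h f (σ y)) :=
        setLIntegral_riemannianVolume hg hφ hAo (inter_subset_left.trans hsub)
          (F := fun x => ofReal (energyDensity 𝓗 (𝓡 m)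
          ↟g ↟h f x))
          (ENNReal.continuous_ofReal.comp_continuousOn (hcon.mono inter_subset_left))
      _ ≤ ∫⁻ _ in A, ofReal (C * (s / lam) ^ (n - 1)) :=
        setLIntegral_mono' hAo.measurableSet fun y hy => (hdec y hy.1).trans
          (ofReal_le_ofReal (by
            have := hy.1.1
            have h2 : y 0 ≤ s / lam := le_of_lt hy.2
            gcongr))
      _ ≤ ofReal (C * (s / lam) ^ (n - 1)) * ofReal (s / lam * (2 * r) ^ n) := by
        rw [setLIntegral_const]
        gcongr
        exact volume_low_le c hr _
      _ = _ := by
        rw [← ofReal_mul (by positivity)]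
        congr 1
        obtain ⟨k, hk⟩ := Nat.exists_eq_add_of_le' (one_le_two.trans hn)
        have h1 : (s / lam) ^ n = (s / lam) ^ (n - 1) * (s / lam) := by
          rw [← pow_succ]; congr 1; omega
        have h2 : (s / lam) ^ n = (1 / lam) ^ n * s ^ n := by rw [← mul_pow]; congr 1; ring
        calc _ = C * ((s / lam) ^ (n - 1) * (s / lam)) * (2 * r) ^ n := by ring
          _ = _ := by rw [← h1, h2]; ring
  · obtain ⟨O, hOn, hO⟩ := hO r₀ hr₀
    refine ⟨O, hOn, 0, le_rfl, fun s _ => ?_⟩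
    have hempty : O ∩ endRegion t t₀ x₀ s = ∅ := eq_empty_iff_forall_notMem.2 fun x hx => by
      obtain ⟨y, hy, -, rfl⟩ := hO x hx.1 hx.2.2.1
      exact hp ⟨_, mem_image_of_mem _ hy, hx.2.1⟩
    rw [hempty, energy, Measure.restrict_empty, lintegral_zero_measure]
    exact bot_le

end BoundaryChart

end EnergyDecay

end

theorem lemma1p1 (n : ℕ) (hn : 2 ≤ n)
    -- the compact manifold with boundary, of dimension `n + 1`, whose interior is the manifold
    {M : Type*} [TopologicalSpace M] [T2Space M] [CompactSpace M]
    [ChartedSpace (EuclideanHalfSpace (n + 1)) M] [IsManifold (𝓡∂ (n + 1)) ∞ M]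
    [MeasurableSpace M] [BorelSpace M]
    -- the smooth metric on the interior, conformally compact of order `C^1`
    (g : ∀ x : M, TangentSpace (𝓡∂ (n + 1)) x →L[ℝ] TangentSpace (𝓡∂ (n + 1)) x →L[ℝ] ℝ)
    (hg : EnergyDecay.IsSmoothMetricOn (𝓡∂ (n + 1)) g ((𝓡∂ (n + 1)).interior M))
    (t : M → ℝ) (ht : EnergyDecay.IsDefiningFunction (𝓡∂ (n + 1)) t)
    (hcc : EnergyDecay.HasConformalExtension (𝓡∂ (n + 1)) 1 g t)
    (hRic : EnergyDecay.RicciBoundedBelow (𝓡∂ (n + 1)) (fun x v w => g x v w) (-(n : ℝ)))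
    -- the complete nonpositively curved target
    {m : ℕ} {N : Type*} [EMetricSpace N] [CompleteSpace N]
    [ChartedSpace (EuclideanSpace ℝ (Fin m)) N] [IsManifold (𝓡 m) ∞ N]
    [Bundle.RiemannianBundle (fun y : N => TangentSpace (𝓡 m) y)]
    [IsContMDiffRiemannianBundle (𝓡 m) ∞ (EuclideanSpace ℝ (Fin m))
      (fun y : N => TangentSpace (𝓡 m) y)]
    [IsRiemannianManifold (𝓡 m) N]
    (hN : EnergyDecay.NonpositivelyCurved (𝓡 m)
      (fun (y : N) (v w : TangentSpace (𝓡 m) y) => inner ℝ v w))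
    -- the end of a boundary component, and the harmonic map of finite energy on it
    (x₀ : M) (hx₀ : x₀ ∈ (𝓡∂ (n + 1)).boundary M) (t₀ : ℝ) (ht₀ : 0 < t₀)
    (f : M → N)
    (hf : EnergyDecay.IsHarmonicOn (𝓡∂ (n + 1)) (𝓡 m) (fun x v w => g x v w)
      (fun (y : N) (v w : TangentSpace (𝓡 m) y) => inner ℝ v w) f
      (EnergyDecay.endRegion t t₀ x₀ t₀))
    (hfin : EnergyDecay.energy (𝓡∂ (n + 1)) (𝓡 m) (fun x v w => g x v w)
      (fun (y : N) (v w : TangentSpace (𝓡 m) y) => inner ℝ v w) f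
      (EnergyDecay.endRegion t t₀ x₀ t₀) ≠ ⊤) :
    ∃ C : ℝ, ∀ᶠ s in 𝓝[>] (0 : ℝ), EnergyDecay.energy (𝓡∂ (n + 1)) (𝓡 m) (fun x v w => g x v w)
        (fun (y : N) (v w : TangentSpace (𝓡 m) y) => inner ℝ v w) f
        (EnergyDecay.endRegion t t₀ x₀ s) ≤ ENNReal.ofReal (C * s ^ n) := by
  obtain ⟨h, hh, hin⟩ := IsContMDiffRiemannianBundle.exists_contMDiff (IB := 𝓡 m) (n := ∞)
    (F := EuclideanSpace ℝ (Fin m)) (E := fun y : N => TangentSpace (𝓡 m) y)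
  have heq : (fun (y : N) (v w : TangentSpace (𝓡 m) y) => inner ℝ v w) = fun y v w => h y v w := by
    funext y v w; exact hin y v w
  rw [heq] at hN hf hfin ⊢
  have hhm : EnergyDecay.IsSmoothMetricOn (𝓡 m) h ((𝓡 m).interior N) :=
    ⟨fun x _ v w => by rw [← hin, ← hin, real_inner_comm],
      fun x _ v hv => by rw [← hin]; exact real_inner_self_pos.2 hv, hh.contMDiffOn⟩
  -- the estimate holds near the boundary, which is compact
  have key : ∃ W : Set M, IsOpen W ∧ (𝓡∂ (n + 1)).boundary M ⊆ W ∧ ∃ C : ℝ, 0 ≤ C ∧ ∀ s > 0,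
      EnergyDecay.energy (𝓡∂ (n + 1)) (𝓡 m) (fun x v w => g x v w) (fun y v w => h y v w) f
        (W ∩ EnergyDecay.endRegion t t₀ x₀ s) ≤ ENNReal.ofReal (C * s ^ n) := by
    refine IsCompact.induction_on (p := fun S => ∃ W : Set M, IsOpen W ∧ S ⊆ W ∧ ∃ C : ℝ, 0 ≤ C ∧
      ∀ s > 0, EnergyDecay.energy (𝓡∂ (n + 1)) (𝓡 m) (fun x v w => g x v w) (fun y v w => h y v w) f
        (W ∩ EnergyDecay.endRegion t t₀ x₀ s) ≤ ENNReal.ofReal (C * s ^ n))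
      (ModelWithCorners.isClosed_boundary (n := ∞) (by simp)).isCompact
      ⟨∅, isOpen_empty, Subset.rfl, 0, le_rfl, fun s _ => by simp [EnergyDecay.energy]⟩
      (fun _ _ hST ⟨W, hW, hTW, hC⟩ => ⟨W, hW, hST.trans hTW, hC⟩) ?_ fun x hx => ?_
    · rintro S T ⟨W, hW, hSW, C, hC, hWC⟩ ⟨W', hW', hTW, C', hC', hWC'⟩
      refine ⟨W ∪ W', hW.union hW', union_subset_union hSW hTW, C + C', by positivity,
        fun s hs => ?_⟩
      rw [union_inter_distrib_right, add_mul, ENNReal.ofReal_add (by positivity) (by positivity)]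
      exact (lintegral_union_le _ _ _).trans (add_le_add (hWC s hs) (hWC' s hs))
    · obtain ⟨O, hO, C, hC, hOC⟩ :=
        EnergyDecay.exists_nhds_energy_le hn hg ht hcc hRic hhm hin hN ht₀ hf hfin hx
      exact ⟨_, mem_nhdsWithin_of_mem_nhds (interior_mem_nhds.2 hO), interior O, isOpen_interior,
        Subset.rfl, C, hC, fun s hs => (lintegral_mono_set
          (inter_subset_inter_left _ interior_subset)).trans (hOC s hs)⟩
  obtain ⟨W, hW, hbW, C, -, hC⟩ := key
  -- away from the boundary, the defining function is bounded below
  have hlow : ∃ s₀ > 0, ∀ x, t x < s₀ → x ∈ W := by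
    rcases Wᶜ.eq_empty_or_nonempty with hWe | hWn
    · exact ⟨1, one_pos, fun x _ => compl_empty_iff.1 hWe ▸ mem_univ x⟩
    · obtain ⟨x, hx, hmin⟩ := hW.isClosed_compl.isCompact.exists_isMinOn hWn
        ht.smooth.continuous.continuousOn
      refine ⟨t x, ht.pos x ?_, fun z hz => by_contra fun hzW => (hmin hzW).not_gt hz⟩
      rw [← ModelWithCorners.compl_boundary]
      exact fun hxb => hx (hbW hxb)
  obtain ⟨s₀, hs₀, hlow⟩ := hlow
  refine ⟨C, ?_⟩
  filter_upwards [Ioo_mem_nhdsGT hs₀] with s hs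
  refine le_trans (lintegral_mono_set fun x hx => ?_) (hC s hs.1)
  exact ⟨hlow x (hx.2.2.trans hs.2), hx⟩
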